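/- Let $n\ge 3$. Let $\mathcal D=\{[j2^k,(j+1)2^k): j,k\in\mathbb Z\}$ be the dyadic intervals of $\mathbb R$; write $|I|$ for the length and $c(I)$ for the center of $I\in\mathcal D$. Given $K\ge0$ and $N\in\mathbb N$, a differentiable function $\varphi:\mathbb R\to\mathbb C$ is called $(K,N)$-adapted to $I$ if $\|\varphi\|_2\le1$ and $$|D^i\varphi(x)|\le K\,|I|^{-i-\frac12}\Bigl(1+\tfrac{|x-c(I)|}{|I|}\Bigr)^{-N},\qquad x\in\mathbb R,\ i=0,1 .$$ Let $\varphi_{j,I}$ ($1\le j\le n$, $I\in\mathcal D$) be $(K,N)$-adapted to $I$, and suppose that for at least two of the indices $j\in\{1,\dots,n\}$ one has $\int\varphi_{j,I}\,dx=0$ for all $I\in\mathcal D$. The associated $(n-1)$-linear paraproduct is $$\mathrm B(f_1,\dots,f_{n-1})=\sum_{I\in\mathcal D}|I|^{-\frac{n-2}2}\,\varphi_{n,I}\prod_{j=1}^{n-1}\langle f_j,\varphi_{j,I}\rangle,\qquad \langle f,\varphi\rangle=\int f\,\overline{\varphi}\,dx ,$$ the sum being understood as an unconditional limit in measure of its finite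 partial sums. Write $\|g\|_{q,\infty}=\sup_{t>0}t\,|\{|g|>t\}|^{1/q}$, and let $BMO$ be the space of locally integrable $f$ with $\|f\|_{BMO}=\sup_J|J|^{-1}\int_J|f-f_J|\,dx<\infty$, where $J$ ranges over all bounded intervals of positive length and $f_J$ is the mean of $f$ over $J$. 1. Let $1<p_j\le\infty$ for $1\le j\le n-1$, not all equal to $\infty$, and let $\frac1r=\sum_{j=1}^{n-1}\frac1{p_j}$ (so $r<1$ is allowed). There is an $N$, depending only on $n$ and the $p_j$, such that for every $K$ there is a constant $C$, depending only on $n$, the $p_j$ and $K$, such that for all families $\varphi_{j,I}$ as above and all $f_j\in L^{p_j}(\mathbb R)$ the sum $\mathrm B(f_1,\dots,f_{n-1})$ converges and $$\|\mathrm B(f_1,\dots,f_{n-1})\|_r\le C\prod_{j=1}^{n-1}\|f_j\|_{p_j}.$$ 2. There is an $N$, depending only on $n$, such that for every $K$ there is a constant $C$, depending only on $n$ and $K$, such that for all families as above and all $f_j\in L^1(\mathbb R)$ the sum converges and $$\|\mathrm B(f_1,\dots,f_{n-1})\|_{\frac1{n-1},\infty}\le C\prod_{j=1}^{n-1}\|f_j\|_1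 .$$ 3. Let $S\subset\{1,\dots,n-1\}$ be nonempty, with $s$ elements. There is an $N$, depending only on $n$ and $S$, such that for every $K$ there is a constant $C$, depending only on $n$, $S$ and $K$, such that for all families as above for which moreover $\int\varphi_{j,I}\,dx=0$ for all $I\in\mathcal D$ and all $j\le n-1$ with $j\notin S$, and for all $f_j\in L^1(\mathbb R)$ ($j\in S$) and $f_j\in BMO$ ($j\notin S$), the sum converges and $$\|\mathrm B(f_1,\dots,f_{n-1})\|_{\frac1s,\infty}\le C\prod_{j\in S}\|f_j\|_1\prod_{j\notin S}\|f_j\|_{BMO}.$$ -/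

import Mathlib

open MeasureTheory Filter Topology
open scoped ENNReal NNReal ComplexConjugate

namespace Paraproduct

/-! ### Dyadic intervals -/

/-- The dyadic intervals of the real line, indexed by pairs `(j, k)` of integers: the pair
`(j, k)` stands for the interval `[j 2^k, (j+1) 2^k)`. -/
abbrev DyadicInterval : Type := ℤ × ℤ

/-- The interval `[j 2^k, (j+1) 2^k)`. -/
def DyadicInterval.toSet (I : DyadicInterval) : Set ℝ :=
  Set.Ico ((I.1 : ℝ) * (2 : ℝ) ^ I.2) (((I.1 : ℝ) + 1) * (2 : ℝ) ^ I.2)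

/-- The length `|I| = 2^k`. -/
noncomputable def DyadicInterval.length (I : DyadicInterval) : ℝ := (2 : ℝ) ^ I.2

/-- The center `c(I) = (j + 1/2) 2^k`. -/
noncomputable def DyadicInterval.center (I : DyadicInterval) : ℝ := ((I.1 : ℝ) + 1 / 2) * (2 : ℝ) ^ I.2

theorem DyadicInterval.volume_toSet (I : DyadicInterval) : volume I.toSet = ENNReal.ofReal I.length := by
  unfold DyadicInterval.toSet DyadicInterval.length
  rw [Real.volume_Ico]
  congr 1
  ring

/-- Different indices stand for different intervals. -/
theorem DyadicInterval.toSet_injective : Function.Injective DyadicInterval.toSet := by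
  intro I J h
  have hl : I.length = J.length := by
    have h1 := I.volume_toSet
    rw [h, J.volume_toSet] at h1
    have pI : 0 ≤ I.length := by unfold DyadicInterval.length; positivity
    have pJ : 0 ≤ J.length := by unfold DyadicInterval.length; positivity
    exact ((ENNReal.ofReal_eq_ofReal_iff pJ pI).1 h1).symm
  have hk : I.2 = J.2 := zpow_right_injective₀ (by norm_num : (0 : ℝ) < 2) (by norm_num) hl
  have key : ∀ L : DyadicInterval, sInf L.toSet = (L.1 : ℝ) * (2 : ℝ) ^ L.2 := by
    intro L
    have hp : (0 : ℝ) < (2 : ℝ) ^ L.2 := by positivity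
    exact csInf_Ico (by nlinarith)
  have h2 : (I.1 : ℝ) * (2 : ℝ) ^ I.2 = (J.1 : ℝ) * (2 : ℝ) ^ J.2 := by
    rw [← key I, ← key J, h]
  rw [hk] at h2
  have hp : (2 : ℝ) ^ J.2 ≠ 0 := by positivity
  have h3 : I.1 = J.1 := by exact_mod_cast mul_right_cancel₀ hp h2
  exact Prod.ext h3 hk

/-! ### Adapted functions -/

/-- `φ` is adapted to the dyadic interval `I`, with decay exponent `N` and implied constant `K`:
its `L²` norm is at most one, and
`|D^i φ(x)| ≤ K |I|^(-i-1/2) (1 + |x - c(I)| / |I|)^(-N)` for `i = 0, 1`. -/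
structure IsAdapted (K : ℝ) (N : ℕ) (I : DyadicInterval) (φ : ℝ → ℂ) : Prop where
  differentiable : Differentiable ℝ φ
  norm_le_one : eLpNorm φ 2 volume ≤ 1
  bound : ∀ x, ‖φ x‖ ≤
    K * I.length ^ (-(1 / 2) : ℝ) * ((1 + |x - I.center| / I.length) ^ N)⁻¹
  deriv_bound : ∀ x, ‖deriv φ x‖ ≤
    K * I.length ^ (-(3 / 2) : ℝ) * ((1 + |x - I.center| / I.length) ^ N)⁻¹

/-- All functions of the family `φ_I`, `I` dyadic, have integral zero. -/
def HasMeanZero (φ : DyadicInterval → ℝ → ℂ) : Prop := ∀ I, ∫ x, φ I x = 0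

/-- The families of functions that an `m`-linear paraproduct is built from:
`φ_{j,I}` is adapted to `I` for each of the `m + 1` positions `j` and each dyadic `I`, and
in (at least) two of the positions all functions have integral zero. -/
structure IsParaproductFamily {m : ℕ} (K : ℝ) (N : ℕ) (φ : Fin (m + 1) → DyadicInterval → ℝ → ℂ) :
    Prop where
  adapted : ∀ j I, IsAdapted K N I (φ j I)
  two_mean_zero : ∃ a b : Fin (m + 1), a ≠ b ∧ HasMeanZero (φ a) ∧ HasMeanZero (φ b)

/-! ### The paraproduct -/

/-- The pairing `⟨f, φ⟩ = ∫ f(x) conj (φ(x)) dx`. -/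
noncomputable def pairing (f φ : ℝ → ℂ) : ℂ := ∫ x, f x * conj (φ x)

/-- The summand `|I|^(-(m-1)/2) φ_{m+1,I} ∏_{j ≤ m} ⟨f_j, φ_{j,I}⟩` of the `m`-linear
paraproduct.  The last of the `m + 1` positions is the output position. -/
noncomputable def summand {m : ℕ} (φ : Fin (m + 1) → DyadicInterval → ℝ → ℂ) (f : Fin m → ℝ → ℂ)
    (I : DyadicInterval) (x : ℝ) : ℂ :=
  ((I.length ^ (-((m : ℝ) - 1) / 2) : ℝ) : ℂ) * φ (Fin.last m) I x *
    ∏ j : Fin m, pairing (f j) (φ j.castSucc I)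

/-- `g` is (a version of) `B(f_1, …, f_m)`, the sum of the summands over all dyadic intervals:
the finite partial sums converge to `g` in measure, unconditionally, that is along the directed
set of all finite sets of dyadic intervals.  This determines `g` almost everywhere. -/
structure IsParaproduct {m : ℕ} (φ : Fin (m + 1) → DyadicInterval → ℝ → ℂ) (f : Fin m → ℝ → ℂ)
    (g : ℝ → ℂ) : Prop where
  aestronglyMeasurable : AEStronglyMeasurable g volume
  tendsto : TendstoInMeasure volume
    (fun (F : Finset DyadicInterval) (x : ℝ) => ∑ I ∈ F, summand φ f I x) atTop g

/-! ### Weak `L^q` and `BMO` -/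

/-- The quasi-norm of weak `L^q`: the supremum over `t ≥ 0` of `t |{x : |g(x)| > t}|^(1/q)`. -/
noncomputable def weakNorm (g : ℝ → ℂ) (q : ℝ) : ℝ≥0∞ :=
  ⨆ t : ℝ≥0, (t : ℝ≥0∞) * volume {x | (t : ℝ≥0∞) < ‖g x‖ₑ} ^ q⁻¹

/-- The `BMO` seminorm: the supremum over all bounded intervals of the mean oscillation. -/
noncomputable def bmoNorm (f : ℝ → ℂ) : ℝ≥0∞ :=
  ⨆ (a : ℝ) (b : ℝ) (_ : a < b),
    (∫⁻ x in Set.Ioc a b, ‖f x - ⨍ y in Set.Ioc a b, f y‖ₑ) / ENNReal.ofReal (b - a)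

/-- Functions of bounded mean oscillation on the real line. -/
structure MemBMO (f : ℝ → ℂ) : Prop where
  locallyIntegrable : LocallyIntegrable f volume
  bmoNorm_lt_top : bmoNorm f < ∞

end Paraproduct

namespace Paraproduct

/-! ### Geometry of dyadic intervals and of their weights. -/

namespace DyadicInterval

/-! After renormalizing the adapted functions in `L^∞`, the paraproduct is the sum over `I` of the
product of the coefficients `|I|⁻¹⟨f_j, ψ_{j,I}⟩` times the output bump `ψ_{n,I}`. Let `L` be the
set of input positions that contribute to `1/r`; the other positions carry bounded or `BMO`
functions. A coefficient in a position of `L` is at most a constant times the maximal function of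
`f_j` at every point of `I`, and a coefficient outside `L` is bounded. In a position of mean zero
there is more: the square function, the sum of the squared coefficients over `I ∋ x`, is controlled
by the square of the maximal function, and for `BMO` data the squared coefficients form a Carleson
measure.

Two positions of mean zero can be distributed in three ways. If both lie in `L`, Cauchy–Schwarz
bounds the sum of absolute values pointwise by two square functions times maximal functions
(`exists_sum_of_pair`). If one is the output, the sum is read as `∑ β_I ψ_I` with `β_I` the product
of all coefficients; it is controlled by the square function of `β`, which in turn is controlled
through the other position of mean zero (`exists_sum_of_last`). If one is an input outside `L`, its
bounded coefficient is absorbed into the output bump, and the Carleson property takes the place of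
the cancellation of the output (`exists_sum_of_notMem`).

The control of `∑ β_I ψ_I` by the square function of `β` has two ingredients. For exponents `P ≥ 2`
it is dual to the square function bound for the conjugate exponent
(`lintegral_sum_rpow_le_of_dual`). For small exponents, in particular `r ≤ 1`, a stopping time
selects the intervals on which the square function of `β` exceeds `t`; away from their triples the
decay of the bumps suffices, provided that the decay exponent is large compared with `1/r`
(`exists_dom_sum`).

No interpolation is used. The nonlinear estimates compare distribution functions: `|{Y > t}| ≤ ∑ c_i
|{X > s_i t}|`. Such a comparison yields a weak and a strong `L^q` bound at once, for every `q` with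
`∑ c_i s_i^(-q) < ∞` (`gauge_le_of_dom`). Applied to finite sets of intervals far out, it also gives
unconditional convergence in measure (`exists_sum_of_dom`). The comparison of square functions with
maximal functions is a good-λ inequality, whose input is a localized weak type `(1,1)` bound. That
bound follows from almost orthogonality in `L²` and the Calderón–Zygmund decomposition. -/

theorem length_pos (I : DyadicInterval) : 0 < I.length := by
  unfold DyadicInterval.length; positivity

theorem mem_toSet_iff {I : DyadicInterval} {x : ℝ} :
    x ∈ I.toSet ↔ ⌊x / I.length⌋ = I.1 := by
  have h := I.length_pos
  rw [Int.floor_eq_iff, le_div_iff₀ h, div_lt_iff₀ h]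
  rfl

theorem length_mono {I J : DyadicInterval} (h : I.2 ≤ J.2) : I.length ≤ J.length :=
  zpow_le_zpow_right₀ (by norm_num) h

theorem length_eq_mul (I J : DyadicInterval) : J.length = (2 : ℝ) ^ (J.2 - I.2) * I.length := by
  unfold DyadicInterval.length
  rw [← zpow_add₀ (by norm_num)]
  congr 1; ring

theorem measurableSet_toSet (I : DyadicInterval) : MeasurableSet I.toSet := measurableSet_Ico

theorem center_mem (I : DyadicInterval) : I.center ∈ I.toSet := by
  have h := I.length_pos
  unfold DyadicInterval.length at h
  constructor <;> unfold DyadicInterval.center <;> nlinarith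

/-- The dyadic interval of scale `k` that contains `x`. -/
noncomputable def around (x : ℝ) (k : ℤ) : DyadicInterval := (⌊x / (2 : ℝ) ^ k⌋, k)

theorem mem_around (x : ℝ) (k : ℤ) : x ∈ (around x k).toSet := mem_toSet_iff.2 rfl

theorem eq_around {I : DyadicInterval} {x : ℝ} (h : x ∈ I.toSet) : I = around x I.2 :=
  Prod.ext (mem_toSet_iff.1 h).symm rfl

theorem eq_of_mem {I J : DyadicInterval} {x : ℝ} (hI : x ∈ I.toSet) (hJ : x ∈ J.toSet)
    (h : I.2 = J.2) : I = J := by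
  rw [eq_around hI, eq_around hJ, h]

/-- If `|J| = 2^d |I|`, the index of the interval of scale `J.2` around a point is the integer
quotient by `2^d` of its index at scale `I.2`. Hence it is the same for all points of `I`. -/
theorem toSet_subset_of_mem {I J : DyadicInterval} {x : ℝ} (hI : x ∈ I.toSet) (hJ : x ∈ J.toSet)
    (h : I.2 ≤ J.2) : I.toSet ⊆ J.toSet := by
  intro y hy
  obtain ⟨d, hd⟩ : ∃ d : ℕ, J.2 = I.2 + d := ⟨(J.2 - I.2).toNat, by omega⟩
  have hl : J.length = I.length * ((2 ^ d : ℕ) : ℝ) := by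
    unfold DyadicInterval.length
    rw [hd, zpow_add₀ (by norm_num)]; simp
  rw [mem_toSet_iff] at hI hJ hy ⊢
  rw [← hJ, hl, ← div_div, ← div_div, Int.floor_div_natCast, Int.floor_div_natCast, hI, hy]

theorem abs_sub_center_le {I : DyadicInterval} {x : ℝ} (h : x ∈ I.toSet) :
    |x - I.center| ≤ I.length / 2 := by
  obtain ⟨h1, h2⟩ := h
  unfold DyadicInterval.center DyadicInterval.length
  rw [abs_le]; constructor <;> nlinarith

/-- The interval of the same length, `n` steps to the right. -/
def shift (I : DyadicInterval) (n : ℤ) : DyadicInterval := (I.1 + n, I.2)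

@[simp] theorem length_shift (I : DyadicInterval) (n : ℤ) : (I.shift n).length = I.length := rfl

theorem center_shift (I : DyadicInterval) (n : ℤ) :
    (I.shift n).center = I.center + n * I.length := by
  unfold DyadicInterval.shift DyadicInterval.center DyadicInterval.length
  push_cast; ring

@[simp] theorem shift_zero (I : DyadicInterval) : I.shift 0 = I := by simp [shift]

@[simp] theorem shift_shift (I : DyadicInterval) (n k : ℤ) :
    (I.shift n).shift k = I.shift (n + k) := by simp [shift, add_assoc]

theorem exists_mem_shift (I : DyadicInterval) (x : ℝ) : ∃ n : ℤ, x ∈ (I.shift n).toSet :=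
  ⟨⌊x / I.length⌋ - I.1, mem_toSet_iff.2 (by simp [shift, DyadicInterval.length])⟩

/-- The weight `1 + |y - c(I)| / |I|`. -/
noncomputable def weight (I : DyadicInterval) (y : ℝ) : ℝ := 1 + |y - I.center| / I.length

theorem one_le_weight (I : DyadicInterval) (y : ℝ) : 1 ≤ I.weight y := by
  have := I.length_pos
  unfold weight
  have : 0 ≤ |y - I.center| / I.length := by positivity
  linarith

theorem weight_pos (I : DyadicInterval) (y : ℝ) : 0 < I.weight y :=
  one_pos.trans_le (I.one_le_weight y)

theorem continuous_weight (I : DyadicInterval) : Continuous I.weight := by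
  unfold weight; fun_prop

/-- Triangle inequality and `1 + a + b ≤ (1 + a)(1 + b)`. The displacement may be measured in units
of any interval not longer than `J`, which allows bumps at two scales to be compared. -/
theorem weight_le_mul {I J : DyadicInterval} (h : I.2 ≤ J.2) (x y : ℝ) :
    J.weight x ≤ J.weight y * (1 + |x - y| / I.length) := by
  have hI := I.length_pos
  have hJ := J.length_pos
  have hl := length_mono h
  have h1 : |x - J.center| ≤ |x - y| + |y - J.center| := abs_sub_le _ _ _
  have h2 : |x - J.center| / J.length ≤ |x - y| / J.length + |y - J.center| / J.length := by
    rw [← add_div]; gcongr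
  have h3 : |x - y| / J.length ≤ |x - y| / I.length := by gcongr
  have h4 : 0 ≤ |y - J.center| / J.length := by positivity
  have h5 : 0 ≤ |x - y| / I.length := by positivity
  unfold weight
  nlinarith

theorem weight_le_two_mul {I J : DyadicInterval} (h : I.2 ≤ J.2) {x y : ℝ} (hx : x ∈ I.toSet)
    (hy : y ∈ I.toSet) : J.weight x ≤ 2 * J.weight y := by
  have hI := I.length_pos
  have h1 := weight_le_mul h x y
  have h2 : |x - y| ≤ I.length := by
    obtain ⟨h1, h2⟩ := hx
    obtain ⟨h3, h4⟩ := hy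
    unfold DyadicInterval.length
    rw [abs_le]; constructor <;> nlinarith
  have h3 : |x - y| / I.length ≤ 1 := by rw [div_le_one hI]; exact h2
  have := J.weight_pos y
  nlinarith

/-- Translates are comparable up to a factor that is polynomial in the number of steps. This loss is
what the decay exponent `N` pays for later. -/
theorem weight_shift_le (I : DyadicInterval) (n : ℤ) (y : ℝ) :
    I.weight y ≤ (1 + |(n : ℝ)|) * (I.shift n).weight y := by
  have hI := I.length_pos
  have h1 : |y - I.center| ≤ |y - (I.shift n).center| + |(n : ℝ)| * I.length := by
    rw [center_shift]
    calc |y - I.center| = |(y - (I.center + n * I.length)) + n * I.length| := by congr 1; ring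
      _ ≤ _ := (abs_add_le _ _).trans (by rw [abs_mul, abs_of_pos hI])
  have h2 : |y - I.center| / I.length ≤ |y - (I.shift n).center| / I.length + |(n : ℝ)| := by
    rw [div_add' _ _ _ hI.ne']; gcongr
  have h3 : 0 ≤ |y - (I.shift n).center| / I.length := by positivity
  have h4 := abs_nonneg (n : ℝ)
  unfold weight
  rw [length_shift]
  nlinarith

theorem le_weight_of_mem_shift {I : DyadicInterval} {n : ℤ} {x : ℝ}
    (h : x ∈ (I.shift n).toSet) : (1 + |(n : ℝ)|) / 2 ≤ I.weight x := by
  have hI := I.length_pos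
  have h1 := abs_sub_center_le h
  rw [center_shift, length_shift] at h1
  have h2 : |(n : ℝ)| * I.length ≤ |x - I.center| + I.length / 2 := by
    calc |(n : ℝ)| * I.length = |(x - I.center) - (x - (I.center + n * I.length))| := by
          rw [← abs_of_pos hI, ← abs_mul]; congr 1; rw [abs_of_pos hI]; ring
      _ ≤ _ := (abs_sub _ _).trans (by linarith)
  have h3 : |(n : ℝ)| ≤ |x - I.center| / I.length + 1 / 2 := by
    rw [div_add' _ _ _ hI.ne', le_div_iff₀ hI]; linarith
  have h4 : 0 ≤ |x - I.center| / I.length := by positivity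
  unfold weight; linarith

/-- The union of `I` and its two neighbours. -/
def triple (I : DyadicInterval) : Set ℝ :=
  (I.shift (-1)).toSet ∪ I.toSet ∪ (I.shift 1).toSet

theorem measurableSet_triple (I : DyadicInterval) : MeasurableSet I.triple :=
  ((measurableSet_toSet _).union (measurableSet_toSet _)).union (measurableSet_toSet _)

theorem volume_triple_le (I : DyadicInterval) : volume I.triple ≤ 3 * volume I.toSet := by
  refine (measure_union_le _ _).trans ((add_le_add_left (measure_union_le _ _) _).trans ?_)
  simp only [volume_toSet, length_shift]
  refine le_of_eq ?_
  ring

theorem two_le_of_notMem_triple {I : DyadicInterval} {n : ℤ} {x : ℝ} (hx : x ∉ I.triple)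
    (hn : x ∈ (I.shift n).toSet) : 2 ≤ |n| := by
  by_contra h
  have : n = -1 ∨ n = 0 ∨ n = 1 := by rw [not_le, abs_lt] at h; omega
  apply hx
  rcases this with rfl | rfl | rfl
  · exact Or.inl (Or.inl hn)
  · exact Or.inl (Or.inr (by simpa using hn))
  · exact Or.inr hn

/-- The triple is the half-open interval that extends `I` by `|I|` on both sides. The index `n` of
the translate containing a point of it satisfies `|n| < 2`. -/
theorem length_le_of_notMem_triple {I : DyadicInterval} {x y : ℝ} (hx : x ∉ I.triple)
    (hy : y ∈ I.toSet) : I.length ≤ |x - y| := by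
  have hI := I.length_pos
  have h1 : ¬ (x ∈ Set.Ico (((I.1 : ℝ) - 1) * I.length) (((I.1 : ℝ) + 2) * I.length)) := by
    intro h
    obtain ⟨n, hn⟩ := I.exists_mem_shift x
    have h2 := two_le_of_notMem_triple hx hn
    obtain ⟨h3, h4⟩ := hn
    have h5 : (I.shift n).1 = I.1 + n := rfl
    have h6 : (2 : ℝ) ^ (I.shift n).2 = I.length := rfl
    rw [h5, h6] at h3 h4
    push_cast at h3 h4
    obtain ⟨h7, h8⟩ := h
    have h9 : (n : ℝ) < 2 := by
      by_contra hc; rw [not_lt] at hc; nlinarith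
    have h10 : (-2 : ℝ) < n := by
      by_contra hc; rw [not_lt] at hc; nlinarith
    have h11 : n < 2 := by exact_mod_cast h9
    have h12 : -2 < n := by exact_mod_cast h10
    rw [le_abs] at h2; omega
  obtain ⟨h3, h4⟩ := hy
  change (I.1 : ℝ) * I.length ≤ y at h3
  change y < ((I.1 : ℝ) + 1) * I.length at h4
  by_contra h
  rw [not_le, abs_lt] at h
  exact h1 ⟨by nlinarith, by nlinarith⟩

/-- The triple is a union of three dyadic intervals of the scale of `J`, each of which contains or
misses the shorter interval `I`. -/
theorem toSet_subset_triple_or_disjoint {I J : DyadicInterval} (h : I.2 ≤ J.2) :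
    I.toSet ⊆ J.triple ∨ Disjoint I.toSet J.triple := by
  by_cases hd : Disjoint I.toSet J.triple
  · exact Or.inr hd
  obtain ⟨x, hxI, hx⟩ := Set.not_disjoint_iff.1 hd
  left
  rcases hx with (hx | hx) | hx
  · exact (toSet_subset_of_mem hxI hx h).trans fun _ h => Or.inl (Or.inl h)
  · exact (toSet_subset_of_mem hxI hx h).trans fun _ h => Or.inl (Or.inr h)
  · exact (toSet_subset_of_mem hxI hx h).trans fun _ h => Or.inr h

theorem snd_le_of_subset {I J : DyadicInterval} (h : I.toSet ⊆ J.toSet) : I.2 ≤ J.2 := by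
  have h1 := measure_mono (μ := volume) h
  rw [volume_toSet, volume_toSet, ENNReal.ofReal_le_ofReal_iff J.length_pos.le] at h1
  exact (zpow_le_zpow_iff_right₀ (by norm_num : (1 : ℝ) < 2)).1 h1

/-- Outside `3J`, the weight of a subinterval `I ⊆ J` is large. -/
theorem mul_weight_le_of_notMem_triple {I J : DyadicInterval} (h : I.toSet ⊆ J.toSet) {x : ℝ}
    (hx : x ∉ J.triple) : J.length / I.length * J.weight x ≤ 3 * I.weight x := by
  have hI := I.length_pos
  have hJ := J.length_pos
  have h1 := length_le_of_notMem_triple hx (h I.center_mem)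
  have h2 := abs_sub_center_le (h I.center_mem)
  have h3 : |x - J.center| ≤ |x - I.center| + |I.center - J.center| := abs_sub_le _ _ _
  unfold weight
  rw [div_mul_eq_mul_div, div_le_iff₀ hI]
  have e1 : J.length * (1 + |x - J.center| / J.length) = J.length + |x - J.center| := by
    field_simp
  have e2 : 3 * (1 + |x - I.center| / I.length) * I.length = 3 * I.length + 3 * |x - I.center| := by
    field_simp
  rw [e1, e2]
  linarith

theorem iUnion_scale (k : ℤ) : ⋃ j : ℤ, toSet ((j, k) : DyadicInterval) = Set.univ := by
  ext x
  simp only [Set.mem_iUnion, Set.mem_univ, iff_true]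
  exact ⟨_, mem_around x k⟩

theorem pairwise_disjoint_scale (k : ℤ) :
    Pairwise (Function.onFun Disjoint fun j : ℤ => toSet ((j, k) : DyadicInterval)) := by
  intro i j hij
  refine Set.disjoint_left.2 fun x hi hj => hij ?_
  exact congrArg Prod.fst (eq_of_mem hi hj rfl)

theorem lintegral_eq_tsum_scale (k : ℤ) (h : ℝ → ℝ≥0∞) :
    ∫⁻ x, h x = ∑' j : ℤ, ∫⁻ x in toSet ((j, k) : DyadicInterval), h x := by
  rw [← lintegral_iUnion (fun j => measurableSet_toSet _) (pairwise_disjoint_scale k),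
    iUnion_scale, Measure.restrict_univ]

end DyadicInterval

/-! ### Sums and integrals of the weights. -/

open DyadicInterval

/-- The constant `∑ₙ (1 + |n|)⁻²`. -/
noncomputable def shiftSum : ℝ≥0∞ := ∑' n : ℤ, ENNReal.ofReal (((1 + |(n : ℝ)|) ^ 2)⁻¹)

theorem summable_one_add_abs : Summable fun n : ℤ => ((1 + |(n : ℝ)|) ^ 2)⁻¹ := by
  have h : Summable fun n : ℕ => ((1 + (n : ℝ)) ^ 2)⁻¹ := by
    have := (summable_nat_add_iff 1).2 (Real.summable_nat_pow_inv.2 (by norm_num : 1 < 2))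
    refine this.congr fun n => ?_
    push_cast; rw [add_comm]
  refine Summable.of_nat_of_neg ?_ ?_
  · refine h.congr fun n => by simp
  · refine h.congr fun n => by simp

theorem shiftSum_ne_top : shiftSum ≠ ∞ := by
  unfold shiftSum
  rw [← ENNReal.ofReal_tsum_of_nonneg (fun n => by positivity) summable_one_add_abs]
  exact ENNReal.ofReal_ne_top

theorem inv_weight_sq_le {I : DyadicInterval} {n : ℤ} {x : ℝ} (h : x ∈ (I.shift n).toSet) :
    (I.weight x ^ 2)⁻¹ ≤ 4 * ((1 + |(n : ℝ)|) ^ 2)⁻¹ := by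
  have h1 := le_weight_of_mem_shift h
  have h2 : ((1 + |(n : ℝ)|) / 2) ^ 2 ≤ I.weight x ^ 2 := by gcongr
  calc (I.weight x ^ 2)⁻¹ ≤ (((1 + |(n : ℝ)|) / 2) ^ 2)⁻¹ := by gcongr
    _ = _ := by field_simp; norm_num

/-- At a fixed scale, the sum of the weights `w_I(y)⁻²` is bounded. -/
theorem tsum_inv_weight_sq_le (k : ℤ) (y : ℝ) :
    ∑' j : ℤ, ENNReal.ofReal ((weight ((j, k) : DyadicInterval) y ^ 2)⁻¹) ≤ 4 * shiftSum := by
  set i : ℤ := ⌊y / (2 : ℝ) ^ k⌋ with hi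
  unfold shiftSum
  rw [← (Equiv.subLeft i).tsum_eq (fun n : ℤ => ENNReal.ofReal (((1 + |(n : ℝ)|) ^ 2)⁻¹)),
    ← ENNReal.tsum_mul_left]
  refine ENNReal.tsum_le_tsum fun j => ?_
  have hm : y ∈ (DyadicInterval.shift (j, k) (i - j)).toSet := by
    have := mem_around y k
    convert this using 2
    simp [DyadicInterval.shift, around, hi]
  have h := ENNReal.ofReal_le_ofReal (inv_weight_sq_le hm)
  rw [ENNReal.ofReal_mul (by norm_num), ENNReal.ofReal_ofNat] at h
  exact h

/-- The line is cut into the translates of `I`. On the `n`-th one the weight is at least `(1 +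
|n|)/2`. -/
theorem lintegral_inv_weight_sq_le (I : DyadicInterval) :
    ∫⁻ x, ENNReal.ofReal ((I.weight x ^ 2)⁻¹) ≤ 4 * shiftSum * ENNReal.ofReal I.length := by
  rw [lintegral_eq_tsum_scale I.2, ← (Equiv.addLeft I.1).tsum_eq]
  unfold shiftSum
  rw [← ENNReal.tsum_mul_left, ← ENNReal.tsum_mul_right]
  refine ENNReal.tsum_le_tsum fun n => ?_
  have hv : volume (I.shift n).toSet = ENNReal.ofReal I.length := by rw [volume_toSet, length_shift]
  calc ∫⁻ x in (I.shift n).toSet, ENNReal.ofReal ((I.weight x ^ 2)⁻¹)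
      ≤ ∫⁻ x in (I.shift n).toSet, 4 * ENNReal.ofReal (((1 + |(n : ℝ)|) ^ 2)⁻¹) := by
        refine setLIntegral_mono measurable_const fun x hx => ?_
        have h := ENNReal.ofReal_le_ofReal (inv_weight_sq_le hx)
        rwa [ENNReal.ofReal_mul (by norm_num), ENNReal.ofReal_ofNat] at h
    _ = _ := by rw [setLIntegral_const, hv]

end Paraproduct

namespace Paraproduct

/-! ### Distributional domination -/

/-- The distribution function of `Y` is dominated by a superposition of dilates of that of `X`. -/
def Dom {ι : Type} (c s : ι → ℝ≥0) (X Y : ℝ → ℝ≥0∞) : Prop :=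
  ∀ t : ℝ≥0, 0 < t → volume {x | (t : ℝ≥0∞) < Y x} ≤
    ∑' i, (c i : ℝ≥0∞) * volume {x | ((s i * t : ℝ≥0) : ℝ≥0∞) < X x}

/-- The `q`-th power of the weak (`w = true`) or strong (`w = false`) `L^q` quasi-norm. -/
noncomputable def gauge (w : Bool) (q : ℝ) (X : ℝ → ℝ≥0∞) : ℝ≥0∞ :=
  if w then ⨆ t : ℝ≥0, (t : ℝ≥0∞) ^ q * volume {x | (t : ℝ≥0∞) < X x} else ∫⁻ x, X x ^ q

theorem gauge_true (q : ℝ) (X : ℝ → ℝ≥0∞) :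
    gauge true q X = ⨆ t : ℝ≥0, (t : ℝ≥0∞) ^ q * volume {x | (t : ℝ≥0∞) < X x} := rfl

theorem gauge_false (q : ℝ) (X : ℝ → ℝ≥0∞) : gauge false q X = ∫⁻ x, X x ^ q := rfl

theorem gauge_mono {w : Bool} {q : ℝ} (hq : 0 < q) {X Y : ℝ → ℝ≥0∞} (h : ∀ x, X x ≤ Y x) :
    gauge w q X ≤ gauge w q Y := by
  cases w
  · exact lintegral_mono fun x => ENNReal.rpow_le_rpow (h x) hq.le
  · refine iSup_mono fun t => ?_
    gcongr with x
    exact h x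

/-- Chebyshev's inequality in the strong case, the definition in the weak case. -/
theorem mul_meas_le_gauge (w : Bool) {q : ℝ} (hq : 0 < q) {X : ℝ → ℝ≥0∞} (hX : Measurable X)
    (t : ℝ≥0) : (t : ℝ≥0∞) ^ q * volume {x | (t : ℝ≥0∞) < X x} ≤ gauge w q X := by
  cases w
  · refine le_trans ?_ (mul_meas_ge_le_lintegral (hX.pow_const q) ((t : ℝ≥0∞) ^ q))
    gcongr with x
    intro h
    exact ENNReal.rpow_le_rpow (le_of_lt h) hq.le
  · exact le_iSup (fun t : ℝ≥0 => (t : ℝ≥0∞) ^ q * volume {x | (t : ℝ≥0∞) < X x}) t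

theorem meas_le_gauge (w : Bool) {q : ℝ} (hq : 0 < q) {X : ℝ → ℝ≥0∞} (hX : Measurable X)
    {t : ℝ≥0} (ht : 0 < t) :
    volume {x | (t : ℝ≥0∞) < X x} ≤ ((t ^ (-q) : ℝ≥0) : ℝ≥0∞) * gauge w q X := by
  have h := mul_meas_le_gauge w hq hX t
  have h0 : (t : ℝ≥0∞) ^ q ≠ 0 := by
    rw [← ENNReal.coe_rpow_of_nonneg _ hq.le]
    exact_mod_cast (NNReal.rpow_pos ht).ne'
  have h1 : (t : ℝ≥0∞) ^ q ≠ ∞ := ENNReal.rpow_ne_top_of_nonneg hq.le ENNReal.coe_ne_top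
  rw [ENNReal.coe_rpow_of_ne_zero ht.ne', ENNReal.rpow_neg, ← ENNReal.div_eq_inv_mul]
  rw [ENNReal.le_div_iff_mul_le (Or.inl h0) (Or.inl h1), mul_comm]
  exact h

/-- The set where `X = ∞` lies in `{X > n + 1}`, whose measure is `O((n + 1)^(-q))`. -/
theorem ae_lt_top_of_gauge {w : Bool} {q : ℝ} (hq : 0 < q) {X : ℝ → ℝ≥0∞} (hX : Measurable X)
    (h : gauge w q X ≠ ∞) : ∀ᵐ x, X x < ∞ := by
  have key : ∀ n : ℕ, volume {x | X x = ∞} ≤ (((n + 1 : ℝ≥0) ^ (-q) : ℝ≥0) : ℝ≥0∞) * gauge w q X := by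
    intro n
    refine le_trans (measure_mono fun x hx => ?_) (meas_le_gauge w hq hX (by positivity))
    simp only [Set.mem_ofPred_eq] at hx ⊢
    rw [hx]; exact ENNReal.coe_lt_top
  have hlim : Tendsto (fun n : ℕ => (((n + 1 : ℝ≥0) ^ (-q) : ℝ≥0) : ℝ≥0∞) * gauge w q X) atTop
      (𝓝 (0 * gauge w q X)) := by
    refine ENNReal.Tendsto.mul_const ?_ (Or.inr h)
    rw [← ENNReal.coe_zero, ENNReal.tendsto_coe, ← NNReal.tendsto_coe]
    have h1 : Tendsto (fun n : ℕ => (n : ℝ) + 1) atTop atTop :=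
      tendsto_natCast_atTop_atTop.atTop_add tendsto_const_nhds
    have h2 := (tendsto_rpow_neg_atTop hq).comp h1
    refine h2.congr fun n => ?_
    simp
  rw [zero_mul] at hlim
  have h0 : volume {x | X x = ∞} = 0 :=
    le_antisymm (ge_of_tendsto' hlim key) zero_le
  rw [ae_iff]
  simpa using h0

/-- The layer cake formula for a single value. It includes the value `∞`, so that Tonelli's theorem
applies directly to functions with values in `[0, ∞]`. -/
theorem rpow_eq_lintegral (a : ℝ≥0∞) {q : ℝ} (hq : 0 < q) :
    a ^ q = ∫⁻ t in Set.Ioi (0 : ℝ),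
      {t : ℝ | ENNReal.ofReal t < a}.indicator (fun t => ENNReal.ofReal (q * t ^ (q - 1))) t := by
  have fin : ∀ b : ℝ, 0 ≤ b → ENNReal.ofReal b ^ q = ∫⁻ t in Set.Ioi (0 : ℝ),
      {t : ℝ | t < b}.indicator (fun t => ENNReal.ofReal (q * t ^ (q - 1))) t := by
    intro b hb
    -- For finite `b` this is the layer cake formula for the constant function `b` on a point mass.
    have h := lintegral_rpow_eq_lintegral_meas_lt_mul (Measure.dirac (0 : ℝ))
      (f := fun _ => b) (ae_of_all _ fun _ => hb) aemeasurable_const hq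
    simp only [lintegral_const, measure_univ, mul_one] at h
    rw [ENNReal.ofReal_rpow_of_nonneg hb hq.le, h, ← lintegral_const_mul']
    · refine setLIntegral_congr_fun measurableSet_Ioi fun t ht => ?_
      by_cases hlt : t < b
      · simp [hlt, ENNReal.ofReal_mul hq.le]
      · simp [hlt]
    · exact ENNReal.ofReal_ne_top
  induction a with
  | top =>
    rw [ENNReal.top_rpow_of_pos hq]
    symm
    refine ENNReal.eq_top_of_forall_nnreal_le fun r => ?_
    have h := fin ((r : ℝ) ^ q⁻¹) (by positivity)
    rw [ENNReal.ofReal_rpow_of_nonneg (by positivity) hq.le, ← Real.rpow_mul (by positivity),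
      inv_mul_cancel₀ hq.ne', Real.rpow_one, ENNReal.ofReal_coe_nnreal] at h
    rw [h]
    refine lintegral_mono fun t => ?_
    refine Set.indicator_le_indicator_of_subset (fun t _ => ?_) (fun _ => zero_le) t
    simp
  | coe r =>
    have h := fin r r.2
    rw [ENNReal.ofReal_coe_nnreal] at h
    rw [h]
    refine setLIntegral_congr_fun measurableSet_Ioi fun t ht => ?_
    have : {t : ℝ | ENNReal.ofReal t < (r : ℝ≥0∞)} ∩ Set.Ioi 0 = {t : ℝ | t < r} ∩ Set.Ioi 0 := by
      ext t
      simp only [Set.mem_inter_iff, Set.mem_ofPred_eq, Set.mem_Ioi]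
      refine and_congr_left fun ht => ?_
      rw [ENNReal.ofReal_lt_coe_iff ht.le]
    have h2 : ENNReal.ofReal t < (r : ℝ≥0∞) ↔ t < r := ENNReal.ofReal_lt_coe_iff (le_of_lt ht)
    simp only [Set.indicator, Set.mem_ofPred_eq, h2]

theorem lintegral_rpow_layer {X : ℝ → ℝ≥0∞} (hX : Measurable X) {q : ℝ} (hq : 0 < q) :
    ∫⁻ x, X x ^ q = ∫⁻ t in Set.Ioi (0 : ℝ),
      volume {x | ENNReal.ofReal t < X x} * ENNReal.ofReal (q * t ^ (q - 1)) := by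
  simp_rw [fun x => rpow_eq_lintegral (X x) hq]
  have hm : MeasurableSet {z : ℝ × ℝ | ENNReal.ofReal z.2 < X z.1} :=
    measurableSet_lt (ENNReal.measurable_ofReal.comp measurable_snd) (hX.comp measurable_fst)
  have hf : Measurable fun z : ℝ × ℝ => {z : ℝ × ℝ | ENNReal.ofReal z.2 < X z.1}.indicator
      (fun z => ENNReal.ofReal (q * z.2 ^ (q - 1))) z := by
    refine Measurable.indicator ?_ hm
    exact ENNReal.measurable_ofReal.comp ((measurable_snd.pow_const _).const_mul _)
  have hswap := lintegral_lintegral_swap (μ := (volume : Measure ℝ))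
    (ν := volume.restrict (Set.Ioi (0 : ℝ)))
    (f := fun x t => {z : ℝ × ℝ | ENNReal.ofReal z.2 < X z.1}.indicator
      (fun z => ENNReal.ofReal (q * z.2 ^ (q - 1))) (x, t)) hf.aemeasurable
  refine hswap.trans ?_
  refine lintegral_congr fun t => ?_
  have e : ∀ x, {z : ℝ × ℝ | ENNReal.ofReal z.2 < X z.1}.indicator
      (fun z => ENNReal.ofReal (q * z.2 ^ (q - 1))) (x, t) =
      {x | ENNReal.ofReal t < X x}.indicator (fun _ => ENNReal.ofReal (q * t ^ (q - 1))) x := by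
    intro x; simp [Set.indicator]
  simp_rw [e]
  rw [lintegral_indicator (measurableSet_lt measurable_const hX), setLIntegral_const, mul_comm]

/-- Replacing `X` by `X / s` multiplies the `q`-th power of either quasi-norm by `s^(-q)`. In the
strong case the domination is integrated against `q t^(q-1) dt`; in the weak case the levels `s_i t`
are inserted into the supremum. This lemma takes the place of interpolation. -/
theorem gauge_le_of_dom {ι : Type} [Countable ι] {c s : ι → ℝ≥0} (hs : ∀ i, 0 < s i)
    {X Y : ℝ → ℝ≥0∞} (hX : Measurable X) (hY : Measurable Y) (h : Dom c s X Y) (w : Bool) {q : ℝ}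
    (hq : 0 < q) :
    gauge w q Y ≤ (∑' i, ((c i * s i ^ (-q) : ℝ≥0) : ℝ≥0∞)) * gauge w q X := by
  cases w
  · have hscale : ∀ i, ∫⁻ t in Set.Ioi (0 : ℝ),
        volume {x | ((s i : ℝ≥0∞) * ENNReal.ofReal t) < X x} * ENNReal.ofReal (q * t ^ (q - 1)) =
        ((s i ^ (-q) : ℝ≥0) : ℝ≥0∞) * ∫⁻ x, X x ^ q := by
      intro i
      have hs0 : (s i : ℝ≥0∞) ≠ 0 := by exact_mod_cast (hs i).ne'
      have hl := lintegral_rpow_layer (X := fun x => (s i : ℝ≥0∞)⁻¹ * X x)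
        (hX.const_mul _) hq
      have e : ∀ t x, ENNReal.ofReal t < (s i : ℝ≥0∞)⁻¹ * X x ↔
          (s i : ℝ≥0∞) * ENNReal.ofReal t < X x := by
        intro t x
        rw [mul_comm _ (X x), ← div_eq_mul_inv, ENNReal.lt_div_iff_mul_lt (Or.inl hs0)
          (Or.inl ENNReal.coe_ne_top), mul_comm]
      simp_rw [e] at hl
      rw [← hl]
      simp_rw [ENNReal.mul_rpow_of_nonneg _ _ hq.le]
      rw [lintegral_const_mul _ (hX.pow_const q), ENNReal.inv_rpow, ← ENNReal.rpow_neg,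
        ENNReal.coe_rpow_of_ne_zero (hs i).ne']
    rw [gauge_false, gauge_false, lintegral_rpow_layer hY hq, ← ENNReal.tsum_mul_right]
    calc ∫⁻ t in Set.Ioi (0 : ℝ),
          volume {x | ENNReal.ofReal t < Y x} * ENNReal.ofReal (q * t ^ (q - 1))
        ≤ ∫⁻ t in Set.Ioi (0 : ℝ), ∑' i, (c i : ℝ≥0∞) *
          (volume {x | ((s i : ℝ≥0∞) * ENNReal.ofReal t) < X x} *
            ENNReal.ofReal (q * t ^ (q - 1))) := by
          refine setLIntegral_mono' measurableSet_Ioi fun t ht => ?_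
          have h1 := h (Real.toNNReal t) (Real.toNNReal_pos.2 ht)
          simp_rw [← mul_assoc]
          rw [ENNReal.tsum_mul_right]
          gcongr
          simpa [ENNReal.ofReal] using h1
      _ = ∑' i, (c i : ℝ≥0∞) * ∫⁻ t in Set.Ioi (0 : ℝ),
          volume {x | ((s i : ℝ≥0∞) * ENNReal.ofReal t) < X x} *
            ENNReal.ofReal (q * t ^ (q - 1)) := by
          have hm : ∀ i, Measurable fun t : ℝ =>
              volume {x | ((s i : ℝ≥0∞) * ENNReal.ofReal t) < X x} *
                ENNReal.ofReal (q * t ^ (q - 1)) := by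
            intro i
            refine Measurable.mul (Antitone.measurable fun t t' htt => ?_)
              (ENNReal.measurable_ofReal.comp ((measurable_id.pow_const _).const_mul _))
            refine measure_mono fun x hx => lt_of_le_of_lt (b := (s i : ℝ≥0∞) * ENNReal.ofReal t') ?_ hx
            gcongr
          rw [lintegral_tsum fun i => ((hm i).const_mul _).aemeasurable]
          exact tsum_congr fun i => lintegral_const_mul _ (hm i)
      _ ≤ _ := by
          refine ENNReal.tsum_le_tsum fun i => ?_
          rw [hscale, ENNReal.coe_mul, mul_assoc]
  · rw [gauge_true]
    refine iSup_le fun t => ?_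
    rcases eq_or_lt_of_le (zero_le : 0 ≤ t) with rfl | ht
    · simp [ENNReal.zero_rpow_of_pos hq]
    calc (t : ℝ≥0∞) ^ q * volume {x | (t : ℝ≥0∞) < Y x}
        ≤ (t : ℝ≥0∞) ^ q * ∑' i, (c i : ℝ≥0∞) *
            volume {x | ((s i * t : ℝ≥0) : ℝ≥0∞) < X x} := by gcongr; exact h t ht
      _ ≤ _ := by
          rw [← ENNReal.tsum_mul_left, ← ENNReal.tsum_mul_right]
          refine ENNReal.tsum_le_tsum fun i => ?_
          have h1 := meas_le_gauge true hq hX (mul_pos (hs i) ht)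
          calc (t : ℝ≥0∞) ^ q * (c i * volume {x | ((s i * t : ℝ≥0) : ℝ≥0∞) < X x})
              ≤ (t : ℝ≥0∞) ^ q * (c i * ((((s i * t) ^ (-q) : ℝ≥0) : ℝ≥0∞) * gauge true q X)) := by
                gcongr
            _ = ((t ^ q * (c i * (s i * t) ^ (-q)) : ℝ≥0) : ℝ≥0∞) * gauge true q X := by
                rw [ENNReal.coe_mul, ENNReal.coe_mul, ENNReal.coe_rpow_of_nonneg _ hq.le]; ring
            _ = _ := by
                congr 2
                rw [NNReal.mul_rpow, NNReal.rpow_neg t]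
                have : t ^ q ≠ 0 := (NNReal.rpow_pos ht).ne'
                field_simp

/-- For the weak quasi-norm, `t ↦ t^a` is a bijection of the thresholds. -/
theorem gauge_rpow (w : Bool) (q : ℝ) {a : ℝ} (ha : 0 < a) (X : ℝ → ℝ≥0∞) :
    gauge w q (fun x => X x ^ a) = gauge w (a * q) X := by
  cases w
  · rw [gauge_false, gauge_false]
    simp_rw [ENNReal.rpow_mul]
  · rw [gauge_true, gauge_true]
    let e : ℝ≥0 ≃ ℝ≥0 :=
      { toFun := fun t => t ^ a
        invFun := fun t => t ^ a⁻¹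
        left_inv := fun t => by simp [← NNReal.rpow_mul, ha.ne']
        right_inv := fun t => by simp [← NNReal.rpow_mul, ha.ne'] }
    rw [← e.iSup_comp]
    refine iSup_congr fun t => ?_
    change (((t ^ a : ℝ≥0) : ℝ≥0∞)) ^ q * volume {x | ((t ^ a : ℝ≥0) : ℝ≥0∞) < X x ^ a} = _
    rw [ENNReal.coe_rpow_of_nonneg _ ha.le, ← ENNReal.rpow_mul]
    simp_rw [ENNReal.rpow_lt_rpow_iff ha]

theorem gauge_const_mul (w : Bool) {q : ℝ} (hq : 0 < q) {X : ℝ → ℝ≥0∞} (hX : Measurable X)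
    {C : ℝ≥0} (hC : 0 < C) :
    gauge w q (fun x => C * X x) ≤ ((C ^ q : ℝ≥0) : ℝ≥0∞) * gauge w q X := by
  -- Multiplication by a constant is a domination with a single dilate.
  have hd : Dom (ι := Unit) (fun _ => 1) (fun _ => C⁻¹) X (fun x => C * X x) := by
    intro t ht
    simp only [ENNReal.coe_one, one_mul, tsum_fintype, Finset.univ_unique, Finset.sum_const,
      Finset.card_singleton, one_smul]
    refine measure_mono fun x hx => ?_
    simp only [Set.mem_ofPred_eq] at hx ⊢
    rw [ENNReal.coe_mul, ENNReal.coe_inv hC.ne', mul_comm, ← div_eq_mul_inv]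
    refine ENNReal.div_lt_of_lt_mul' hx
  have h := gauge_le_of_dom (fun _ => inv_pos.2 hC) hX (hX.const_mul _) hd w hq
  simpa [NNReal.rpow_neg, NNReal.inv_rpow] using h

/-! ### Unconditional convergence in measure -/

/-- The set of values exceeding `t` is open, so the indicator at the limit is at most the lower
limit of the indicators. Fatou's lemma does the rest. -/
theorem meas_lt_le_of_tendsto_ae {E : Type*} [NormedAddCommGroup E] {u : ℕ → ℝ → E} {g : ℝ → E}
    (hu : ∀ n, Measurable fun x => ‖u n x‖ₑ) (hg : Measurable fun x => ‖g x‖ₑ)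
    (h : ∀ᵐ x, Tendsto (fun n => u n x) atTop (𝓝 (g x))) {t : ℝ≥0} {M : ℝ≥0∞}
    (hM : ∀ᶠ n in atTop, volume {x | (t : ℝ≥0∞) < ‖u n x‖ₑ} ≤ M) :
    volume {x | (t : ℝ≥0∞) < ‖g x‖ₑ} ≤ M := by
  have hms : ∀ n, MeasurableSet {x | (t : ℝ≥0∞) < ‖u n x‖ₑ} := fun n =>
    measurableSet_lt measurable_const (hu n)
  have hmg : MeasurableSet {x | (t : ℝ≥0∞) < ‖g x‖ₑ} := measurableSet_lt measurable_const hg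
  calc volume {x | (t : ℝ≥0∞) < ‖g x‖ₑ}
      = ∫⁻ x, {x | (t : ℝ≥0∞) < ‖g x‖ₑ}.indicator 1 x := (lintegral_indicator_one hmg).symm
    _ ≤ ∫⁻ x, liminf (fun n => {x | (t : ℝ≥0∞) < ‖u n x‖ₑ}.indicator 1 x) atTop := by
        refine lintegral_mono_ae (h.mono fun x hx => ?_)
        by_cases hxt : (t : ℝ≥0∞) < ‖g x‖ₑ
        · refine le_liminf_of_le (by isBoundedDefault) ?_
          have h1 := (hx.enorm).eventually (lt_mem_nhds hxt)
          filter_upwards [h1] with n hn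
          rw [Set.indicator_of_mem (s := {x | (t : ℝ≥0∞) < ‖u n x‖ₑ}) hn,
            Set.indicator_of_mem (s := {x | (t : ℝ≥0∞) < ‖g x‖ₑ}) hxt]
        · rw [Set.indicator_of_notMem (s := {x | (t : ℝ≥0∞) < ‖g x‖ₑ}) hxt]
          exact zero_le
    _ ≤ liminf (fun n => ∫⁻ x, {x | (t : ℝ≥0∞) < ‖u n x‖ₑ}.indicator 1 x) atTop :=
        lintegral_liminf_le fun n => measurable_one.indicator (hms n)
    _ ≤ M := by
        refine liminf_le_of_frequently_le' (Eventually.frequently ?_)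
        filter_upwards [hM] with n hn
        rwa [lintegral_indicator_one (hms n)]

/-- A Cauchy criterion: small finite sums far out force unconditional convergence in measure. The
limit is built along an increasing cofinal sequence of finite sets whose increments are at most
`2^(-n)` off sets of measure `2^(-n)`, so that Borel–Cantelli gives convergence almost everywhere.
-/
theorem exists_tendstoInMeasure_sum {κ : Type} [Countable κ] {s : κ → ℝ → ℂ}
    (hs : ∀ I, Measurable (s I))
    (htail : ∀ t : ℝ≥0, 0 < t → ∀ ε : ℝ≥0∞, 0 < ε → ∃ F₀ : Finset κ, ∀ F : Finset κ,
      Disjoint F F₀ → volume {x | (t : ℝ≥0∞) < ‖∑ I ∈ F, s I x‖ₑ} ≤ ε) :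
    ∃ g : ℝ → ℂ, Measurable g ∧
      TendstoInMeasure volume (fun (F : Finset κ) x => ∑ I ∈ F, s I x) atTop g ∧
      ∃ G : ℕ → Finset κ, ∀ᵐ x, Tendsto (fun n => ∑ I ∈ G n, s I x) atTop (𝓝 (g x)) := by
  classical
  have hmeas : ∀ F : Finset κ, Measurable fun x => ∑ I ∈ F, s I x := fun F =>
    Finset.measurable_fun_sum _ fun I _ => hs I
  choose F₀ hF₀ using fun n : ℕ => htail ((1 / 2) ^ n) (by positivity) ((1 / 2 : ℝ≥0∞) ^ n)
    (ENNReal.pow_pos (by simp) n)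
  obtain ⟨H, hH⟩ := exists_seq_tendsto (atTop : Filter (Finset κ))
  -- The union with `F₀ k` makes the increments small; the union with the cofinal sequence `H k`
  -- makes every finite set eventually contained in `G n`.
  let G : ℕ → Finset κ := fun n => (Finset.range (n + 1)).biUnion (fun k => F₀ k ∪ H k)
  have hGmono : Monotone G := fun a b hab =>
    Finset.biUnion_subset_biUnion_of_subset_left _ (Finset.range_mono (by omega))
  have hGF : ∀ n, F₀ n ⊆ G n := fun n => Finset.subset_union_left.trans
    (Finset.subset_biUnion_of_mem (fun k => F₀ k ∪ H k) (Finset.self_mem_range_succ n))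
  have hGH : ∀ n, H n ⊆ G n := fun n => Finset.subset_union_right.trans
    (Finset.subset_biUnion_of_mem (fun k => F₀ k ∪ H k) (Finset.self_mem_range_succ n))
  have hGtop : ∀ F : Finset κ, ∀ᶠ n in atTop, F ⊆ G n := by
    intro F
    obtain ⟨n, hn⟩ := ((tendsto_atTop.1 hH F)).exists
    filter_upwards [eventually_ge_atTop n] with k hk
    exact hn.trans ((hGH n).trans (hGmono hk))
  have hstep : ∀ n, volume {x | (((1 / 2) ^ n : ℝ≥0) : ℝ≥0∞) <
      ‖∑ I ∈ G (n + 1) \ G n, s I x‖ₑ} ≤ (1 / 2 : ℝ≥0∞) ^ n := by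
    intro n
    refine hF₀ n _ ?_
    exact Disjoint.mono_right (hGF n) Finset.sdiff_disjoint
  have hBC : ∀ᵐ x, ∀ᶠ n in atTop, ¬ ((((1 / 2) ^ n : ℝ≥0) : ℝ≥0∞) <
      ‖∑ I ∈ G (n + 1) \ G n, s I x‖ₑ) := by
    refine ae_eventually_notMem (s := fun n => {x | (((1 / 2) ^ n : ℝ≥0) : ℝ≥0∞) <
      ‖∑ I ∈ G (n + 1) \ G n, s I x‖ₑ}) ?_
    refine ne_top_of_le_ne_top ?_ (ENNReal.tsum_le_tsum hstep)
    rw [ENNReal.tsum_geometric]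
    simp
  have hconv : ∀ᵐ x, ∃ l, Tendsto (fun n => ∑ I ∈ G n, s I x) atTop (𝓝 l) := by
    filter_upwards [hBC] with x hx
    obtain ⟨N, hN⟩ := eventually_atTop.1 hx
    have hc : CauchySeq fun n => ∑ I ∈ G (n + N), s I x := by
      refine cauchySeq_of_le_geometric_two (C := 2) fun n => ?_
      have h1 := hN (n + N) (by omega)
      rw [not_lt] at h1
      have h2 : ∑ I ∈ G (n + 1 + N), s I x - ∑ I ∈ G (n + N), s I x =
          ∑ I ∈ G (n + N + 1) \ G (n + N), s I x := by
        rw [show n + 1 + N = n + N + 1 by ring, Finset.sum_sdiff_eq_sub (hGmono (by omega))]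
      rw [dist_comm, dist_eq_norm, h2]
      have h3 : ‖∑ I ∈ G (n + N + 1) \ G (n + N), s I x‖ ≤ (1 / 2) ^ (n + N) := by
        rw [← ofReal_norm, ENNReal.ofReal_le_iff_le_toReal ENNReal.coe_ne_top] at h1
        simpa using h1
      calc _ ≤ (1 / 2 : ℝ) ^ (n + N) := h3
        _ ≤ (1 / 2 : ℝ) ^ n := pow_le_pow_of_le_one (by norm_num) (by norm_num) (by omega)
        _ = _ := by simp [div_eq_mul_inv]
    obtain ⟨l, hl⟩ := cauchySeq_tendsto_of_complete hc
    exact ⟨l, (tendsto_add_atTop_iff_nat N).1 hl⟩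
  obtain ⟨g, hgm, hg⟩ := measurable_limit_of_tendsto_metrizable_ae (fun n => (hmeas (G n)).aemeasurable)
    hconv
  refine ⟨g, hgm, ?_, G, hg⟩
  -- For `F` and `G n` both containing `F₁`, the difference of the two sums is a difference of sums
  -- over `F \ G n` and `G n \ F`, and both of these avoid `F₁`. Then `n → ∞`.
  have hclose : ∀ t : ℝ≥0, 0 < t → ∀ ε : ℝ≥0∞, 0 < ε → ∃ F₁ : Finset κ, ∀ F : Finset κ, F₁ ≤ F →
      volume {x | (t : ℝ≥0∞) < ‖(∑ I ∈ F, s I x) - g x‖ₑ} ≤ ε := by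
    intro t ht ε hε
    obtain ⟨F₁, hF₁⟩ := htail (t / 2) (by positivity) (ε / 2) (ENNReal.half_pos hε.ne')
    refine ⟨F₁, fun F hF => ?_⟩
    refine meas_lt_le_of_tendsto_ae (u := fun n x => (∑ I ∈ F, s I x) - ∑ I ∈ G n, s I x)
      (fun n => ((hmeas F).sub (hmeas (G n))).enorm) ((hmeas F).sub hgm).enorm ?_ ?_
    · filter_upwards [hg] with x hx
      exact tendsto_const_nhds.sub hx
    · filter_upwards [hGtop F₁] with n hn
      have h1 := hF₁ (F \ G n) (Disjoint.mono_right hn Finset.sdiff_disjoint)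
      have h2 := hF₁ (G n \ F) (Disjoint.mono_right hF Finset.sdiff_disjoint)
      calc volume {x | (t : ℝ≥0∞) < ‖(∑ I ∈ F, s I x) - ∑ I ∈ G n, s I x‖ₑ}
          ≤ volume ({x | ((t / 2 : ℝ≥0) : ℝ≥0∞) < ‖∑ I ∈ F \ G n, s I x‖ₑ} ∪
            {x | ((t / 2 : ℝ≥0) : ℝ≥0∞) < ‖∑ I ∈ G n \ F, s I x‖ₑ}) := by
            refine measure_mono fun x hx => ?_
            by_contra hcon
            simp only [Set.mem_union, Set.mem_ofPred_eq, not_or, not_lt] at hcon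
            simp only [Set.mem_ofPred_eq] at hx
            refine absurd hx (not_lt.2 ?_)
            rw [← Finset.sum_sdiff_sub_sum_sdiff]
            refine (enorm_sub_le).trans ((add_le_add hcon.1 hcon.2).trans ?_)
            rw [← ENNReal.coe_add, add_halves]
        _ ≤ ε / 2 + ε / 2 := (measure_union_le _ _).trans (add_le_add h1 h2)
        _ = ε := ENNReal.add_halves ε
  rw [tendstoInMeasure_iff_enorm]
  intro ε hε hεt
  rw [ENNReal.tendsto_nhds_zero]
  intro δ hδ
  obtain ⟨t, ht0, htε⟩ := ENNReal.lt_iff_exists_nnreal_btwn.1 hε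
  obtain ⟨F₁, hF₁⟩ := hclose t (by exact_mod_cast ht0) δ hδ
  filter_upwards [eventually_ge_atTop F₁] with F hF
  exact (measure_mono fun x hx => htε.trans_le hx).trans (hF₁ F hF)

/-- Dominated convergence twice: for each level on the line, with the indicator of `{X > s_i t}` as
majorant, and then for the sum over `i`, where finiteness of `∑ c_i s_i^(-q)` provides the majorant.
-/
theorem tendsto_tsum_meas {ι : Type} {c s : ι → ℝ≥0} (hs : ∀ i, 0 < s i) (w : Bool) {q : ℝ}
    (hq : 0 < q) (hsum : ∑' i, ((c i * s i ^ (-q) : ℝ≥0) : ℝ≥0∞) ≠ ∞)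
    {X : ℝ → ℝ≥0∞} (hX : Measurable X) (hg : gauge w q X ≠ ∞) {Xn : ℕ → ℝ → ℝ≥0∞}
    (hXn : ∀ n, Measurable (Xn n)) (hle : ∀ n x, Xn n x ≤ X x)
    (hlim : ∀ᵐ x, Tendsto (fun n => Xn n x) atTop (𝓝 0)) {t : ℝ≥0} (ht : 0 < t) :
    Tendsto (fun n => ∑' i, (c i : ℝ≥0∞) * volume {x | ((s i * t : ℝ≥0) : ℝ≥0∞) < Xn n x}) atTop
      (𝓝 0) := by
  let _ : MeasurableSpace ι := ⊤
  have hbound : ∀ i, (c i : ℝ≥0∞) * volume {x | ((s i * t : ℝ≥0) : ℝ≥0∞) < X x} ≤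
      ((c i * s i ^ (-q) : ℝ≥0) : ℝ≥0∞) * (((t ^ (-q) : ℝ≥0) : ℝ≥0∞) * gauge w q X) := by
    intro i
    have h := meas_le_gauge w hq hX (mul_pos (hs i) ht)
    rw [NNReal.mul_rpow] at h
    calc (c i : ℝ≥0∞) * volume {x | ((s i * t : ℝ≥0) : ℝ≥0∞) < X x} ≤
          c i * (((s i ^ (-q) * t ^ (-q) : ℝ≥0) : ℝ≥0∞) * gauge w q X) := by gcongr
      _ = _ := by push_cast; ring
  have hfin : ∀ i, volume {x | ((s i * t : ℝ≥0) : ℝ≥0∞) < X x} ≠ ∞ := fun i =>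
    ne_top_of_le_ne_top (ENNReal.mul_ne_top ENNReal.coe_ne_top hg)
      (meas_le_gauge w hq hX (mul_pos (hs i) ht))
  have hpt : ∀ i, Tendsto (fun n => volume {x | ((s i * t : ℝ≥0) : ℝ≥0∞) < Xn n x}) atTop
      (𝓝 0) := by
    intro i
    have hpos : (0 : ℝ≥0∞) < ((s i * t : ℝ≥0) : ℝ≥0∞) := by
      exact_mod_cast mul_pos (hs i) ht
    have hmX : MeasurableSet {x | ((s i * t : ℝ≥0) : ℝ≥0∞) < X x} :=
      measurableSet_lt measurable_const hX
    have hm : ∀ n, MeasurableSet {x | ((s i * t : ℝ≥0) : ℝ≥0∞) < Xn n x} := fun n =>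
      measurableSet_lt measurable_const (hXn n)
    have h := tendsto_lintegral_of_dominated_convergence (μ := volume)
      (F := fun n => {x | ((s i * t : ℝ≥0) : ℝ≥0∞) < Xn n x}.indicator (1 : ℝ → ℝ≥0∞))
      (f := fun _ => 0)
      ({x | ((s i * t : ℝ≥0) : ℝ≥0∞) < X x}.indicator (1 : ℝ → ℝ≥0∞))
      (fun n => measurable_one.indicator (hm n))
      (fun n => ae_of_all _ fun x => Set.indicator_le_indicator_of_subset
        (fun y hy => lt_of_lt_of_le hy (hle n y)) (fun _ => zero_le) x)
      (by rw [lintegral_indicator_one hmX]; exact hfin i)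
      (by
        filter_upwards [hlim] with x hx
        refine tendsto_const_nhds.congr' ?_
        filter_upwards [hx.eventually (gt_mem_nhds hpos)] with n hn
        exact (Set.indicator_of_notMem (s := {x | ((s i * t : ℝ≥0) : ℝ≥0∞) < Xn n x}) (not_lt.2 hn.le) _).symm)
    simp_rw [lintegral_zero] at h
    refine h.congr fun n => lintegral_indicator_one (hm n)
  have h := tendsto_lintegral_of_dominated_convergence (μ := (Measure.count : Measure ι))
    (F := fun n i => (c i : ℝ≥0∞) * volume {x | ((s i * t : ℝ≥0) : ℝ≥0∞) < Xn n x})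
    (f := fun _ => 0)
    (fun i => (c i : ℝ≥0∞) * volume {x | ((s i * t : ℝ≥0) : ℝ≥0∞) < X x})
    (fun n => measurable_from_top)
    (fun n => ae_of_all _ fun i => mul_le_mul_right
      (measure_mono fun x (hx : _ < Xn n x) => hx.trans_le (hle n x)) _)
    (by
      rw [lintegral_count]
      refine ne_top_of_le_ne_top ?_ (ENNReal.tsum_le_tsum hbound)
      rw [ENNReal.tsum_mul_right]
      exact ENNReal.mul_ne_top hsum (ENNReal.mul_ne_top ENNReal.coe_ne_top hg))
    (ae_of_all _ fun i => by
      have := ENNReal.Tendsto.const_mul (hpt i) (Or.inr (ENNReal.coe_ne_top (r := c i)))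
      simpa using this)
  simpa [lintegral_count] using h

/-- Summands whose finite sums are dominated, in distribution, by square functions of the same
finite sets, converge unconditionally in measure, with the corresponding bound. -/
theorem exists_sum_of_dom {κ ι : Type} [Countable κ] [Countable ι] {c s : ι → ℝ≥0}
    {θ : ℝ} (hθ : 0 < θ) (hs : ∀ i, 0 < s i) (w : Bool) {q : ℝ} (hq : 0 < q)
    (hsum : ∑' i, ((c i * s i ^ (-q) : ℝ≥0) : ℝ≥0∞) ≠ ∞)
    {u : κ → ℝ → ℂ} (hu : ∀ I, Measurable (u I)) {b : κ → ℝ → ℝ≥0∞} (hb : ∀ I, Measurable (b I))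
    (hdom : ∀ F : Finset κ, Dom c s (fun x => (∑ I ∈ F, b I x) ^ θ)
      (fun x => ‖∑ I ∈ F, u I x‖ₑ))
    (hg : gauge w q (fun x => (∑' I, b I x) ^ θ) ≠ ∞) :
    ∃ g : ℝ → ℂ, Measurable g ∧
      TendstoInMeasure volume (fun (F : Finset κ) x => ∑ I ∈ F, u I x) atTop g ∧
      gauge w q (fun x => ‖g x‖ₑ) ≤ (∑' i, ((c i * s i ^ (-q) : ℝ≥0) : ℝ≥0∞)) *
        gauge w q (fun x => (∑' I, b I x) ^ θ) := by
  classical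
  have hX : Measurable fun x => (∑' I, b I x) ^ θ :=
    (Measurable.tsum hb).pow_const _
  have hmono : ∀ F : Finset κ, ∀ x, (∑ I ∈ F, b I x) ^ θ ≤
      (∑' I, b I x) ^ θ := fun F x =>
    ENNReal.rpow_le_rpow (ENNReal.sum_le_tsum F) hθ.le
  obtain ⟨H, hH⟩ := exists_seq_tendsto (atTop : Filter (Finset κ))
  have hfin : ∀ᵐ x, ∑' I, b I x ≠ ∞ := by
    filter_upwards [ae_lt_top_of_gauge hq hX hg] with x hx htop
    rw [htop, ENNReal.top_rpow_of_pos hθ] at hx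
    exact lt_irrefl _ hx
  have htail : ∀ t : ℝ≥0, 0 < t → ∀ ε : ℝ≥0∞, 0 < ε → ∃ F₀ : Finset κ, ∀ F : Finset κ,
      Disjoint F F₀ → volume {x | (t : ℝ≥0∞) < ‖∑ I ∈ F, u I x‖ₑ} ≤ ε := by
    intro t ht ε hε
    -- The dominating function for a finite set disjoint from `H n` is at most the tail of the full
    -- series outside `H n`, which tends to zero wherever the series is finite.
    have h := tendsto_tsum_meas hs w hq hsum hX hg
      (Xn := fun n x => (∑' I : {I // I ∉ H n}, b I x) ^ θ)
      (fun n => (Measurable.tsum fun I : {I // I ∉ H n} => hb I).pow_const _)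
      (fun n x => ENNReal.rpow_le_rpow
        (ENNReal.tsum_comp_le_tsum_of_injective Subtype.val_injective (fun I => b I x))
          hθ.le)
      (by
        filter_upwards [hfin] with x hx
        have h1 := (ENNReal.tendsto_tsum_compl_atTop_zero hx).comp hH
        have h2 := (ENNReal.continuous_rpow_const (y := θ)).tendsto 0
        rw [ENNReal.zero_rpow_of_pos hθ] at h2
        exact h2.comp h1) ht
    obtain ⟨n, hn⟩ := (h.eventually (gt_mem_nhds hε)).exists
    refine ⟨H n, fun F hF => ((hdom F t ht).trans ?_).trans hn.le⟩
    refine ENNReal.tsum_le_tsum fun i => ?_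
    gcongr with x
    have e : ∑ I ∈ F, b I x = ∑ I ∈ F.subtype (fun I => I ∉ H n), b I x := by
      rw [Finset.sum_subtype_of_mem (f := fun I => b I x)]
      intro I hI
      exact Finset.disjoint_left.1 hF hI
    refine ENNReal.rpow_le_rpow (e.trans_le ?_) hθ.le
    exact ENNReal.sum_le_tsum (f := fun I : {I // I ∉ H n} => b I x) _
  obtain ⟨g, hgm, hgt, G, hG⟩ := exists_tendstoInMeasure_sum hu htail
  refine ⟨g, hgm, hgt, gauge_le_of_dom hs hX hgm.enorm ?_ w hq⟩
  intro t ht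
  refine meas_lt_le_of_tendsto_ae
    (fun n => (Finset.measurable_fun_sum (G n) fun I _ => hu I).enorm) hgm.enorm hG
    (Eventually.of_forall fun n => (hdom (G n) t ht).trans ?_)
  refine ENNReal.tsum_le_tsum fun i => ?_
  gcongr with x
  exact hmono _ _

end Paraproduct

namespace Paraproduct

open DyadicInterval

/-! ### Weighted averages and the maximal function -/

/-- The average of `h` over `I` with tails, `|I|⁻¹ ∫ h w_I⁻²`. -/
noncomputable def avg (I : DyadicInterval) (h : ℝ → ℝ≥0∞) : ℝ≥0∞ :=
  (ENNReal.ofReal I.length)⁻¹ * ∫⁻ y, h y * ENNReal.ofReal ((I.weight y ^ 2)⁻¹)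

/-- The maximal function that belongs to the averages `avg`. -/
noncomputable def maxFun (h : ℝ → ℝ≥0∞) (x : ℝ) : ℝ≥0∞ :=
  ⨆ I : DyadicInterval, I.toSet.indicator (fun _ => avg I h) x

theorem ofReal_length_ne_zero (I : DyadicInterval) : ENNReal.ofReal I.length ≠ 0 := by
  simpa using I.length_pos

theorem measurable_inv_weight (I : DyadicInterval) :
    Measurable fun y => ENNReal.ofReal ((I.weight y ^ 2)⁻¹) :=
  ENNReal.measurable_ofReal.comp (I.continuous_weight.measurable.pow_const 2).inv

theorem ofReal_mul_avg (I : DyadicInterval) (h : ℝ → ℝ≥0∞) :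
    ENNReal.ofReal I.length * avg I h = ∫⁻ y, h y * ENNReal.ofReal ((I.weight y ^ 2)⁻¹) := by
  unfold avg
  rw [← mul_assoc, ENNReal.mul_inv_cancel (ofReal_length_ne_zero I) ENNReal.ofReal_ne_top, one_mul]

theorem avg_mono (I : DyadicInterval) {h₁ h₂ : ℝ → ℝ≥0∞} (h : ∀ x, h₁ x ≤ h₂ x) :
    avg I h₁ ≤ avg I h₂ := by
  unfold avg
  gcongr with x
  exact h x

theorem avg_add (I : DyadicInterval) {h₁ : ℝ → ℝ≥0∞} (h₂ : ℝ → ℝ≥0∞) (hm : Measurable h₁) :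
    avg I (fun x => h₁ x + h₂ x) = avg I h₁ + avg I h₂ := by
  unfold avg
  simp_rw [add_mul]
  rw [← mul_add]
  congr 1
  exact lintegral_add_left (hm.mul (measurable_inv_weight I)) _

theorem avg_const_le (I : DyadicInterval) (c : ℝ≥0∞) :
    avg I (fun _ => c) ≤ 4 * shiftSum * c := by
  unfold avg
  rw [lintegral_const_mul _ (measurable_inv_weight I)]
  calc (ENNReal.ofReal I.length)⁻¹ * (c * ∫⁻ y, ENNReal.ofReal ((I.weight y ^ 2)⁻¹))
      ≤ (ENNReal.ofReal I.length)⁻¹ * (c * (4 * shiftSum * ENNReal.ofReal I.length)) := by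
        gcongr; exact lintegral_inv_weight_sq_le I
    _ = ((ENNReal.ofReal I.length)⁻¹ * ENNReal.ofReal I.length) * (4 * shiftSum * c) := by ring
    _ = _ := by
        rw [ENNReal.inv_mul_cancel (ofReal_length_ne_zero I) ENNReal.ofReal_ne_top, one_mul]

theorem avg_le_shift (I : DyadicInterval) (n : ℤ) (h : ℝ → ℝ≥0∞) :
    avg I h ≤ ENNReal.ofReal ((1 + |(n : ℝ)|) ^ 2) * avg (I.shift n) h := by
  unfold avg
  rw [length_shift, mul_left_comm]
  gcongr
  rw [← lintegral_const_mul' _ _ ENNReal.ofReal_ne_top]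
  refine lintegral_mono fun y => ?_
  change h y * _ ≤ _ * (h y * _)
  rw [mul_left_comm]
  gcongr
  rw [← ENNReal.ofReal_mul (by positivity)]
  refine ENNReal.ofReal_le_ofReal ?_
  have h1 := weight_shift_le (I.shift n) (-n) y
  rw [shift_shift, add_neg_cancel, shift_zero] at h1
  push_cast at h1
  rw [abs_neg] at h1
  have h2 := I.weight_pos y
  have h3 := (I.shift n).weight_pos y
  rw [← div_eq_mul_inv, inv_eq_one_div, div_le_div_iff₀ (by positivity) (by positivity), one_mul,
    ← mul_pow]
  gcongr

theorem avg_le_maxFun {I : DyadicInterval} {x : ℝ} (hx : x ∈ I.toSet) (h : ℝ → ℝ≥0∞) :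
    avg I h ≤ maxFun h x := by
  refine le_trans ?_ (le_iSup _ I)
  rw [Set.indicator_of_mem hx]

theorem measurable_maxFun (h : ℝ → ℝ≥0∞) : Measurable (maxFun h) :=
  Measurable.iSup fun I => measurable_const.indicator (measurableSet_toSet I)

theorem lt_maxFun_iff {h : ℝ → ℝ≥0∞} {x : ℝ} {t : ℝ≥0∞} :
    t < maxFun h x ↔ ∃ I : DyadicInterval, x ∈ I.toSet ∧ t < avg I h := by
  unfold maxFun
  rw [lt_iSup_iff]
  refine exists_congr fun I => ?_
  by_cases hx : x ∈ I.toSet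
  · simp [hx]
  · simp [hx]

/-- If `n ≥ 1` is least with `y` in the ball of radius `2^n |I|`, the weight at `y` is at least
`2^(n-1)`, so its inverse square is at most `4 · 4^(-n)`. -/
theorem inv_weight_le_tsum (I : DyadicInterval) (y : ℝ) :
    ENNReal.ofReal ((I.weight y ^ 2)⁻¹) ≤ ∑' n : ℕ, 4 * (1 / 4 : ℝ≥0∞) ^ n *
      (Metric.closedBall I.center (2 ^ n * I.length)).indicator 1 y := by
  have hI := I.length_pos
  have hex : ∃ n : ℕ, |y - I.center| ≤ 2 ^ n * I.length := by
    obtain ⟨n, hn⟩ := pow_unbounded_of_one_lt (|y - I.center| / I.length) (one_lt_two)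
    exact ⟨n, by rw [div_lt_iff₀ hI] at hn; exact hn.le⟩
  classical
  set n := Nat.find hex with hn
  have hmem : y ∈ Metric.closedBall I.center (2 ^ n * I.length) := by
    rw [Metric.mem_closedBall, Real.dist_eq]; exact Nat.find_spec hex
  refine le_trans ?_ (ENNReal.le_tsum n)
  rw [Set.indicator_of_mem hmem, Pi.one_apply, mul_one]
  have e : 4 * (1 / 4 : ℝ≥0∞) ^ n = ENNReal.ofReal (4 * (1 / 4) ^ n) := by
    rw [ENNReal.ofReal_mul (by norm_num), ENNReal.ofReal_pow (by norm_num),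
      ENNReal.ofReal_div_of_pos (by norm_num)]
    simp
  rw [e]
  refine ENNReal.ofReal_le_ofReal ?_
  have h1 := I.one_le_weight y
  rcases Nat.eq_zero_or_pos n with h0 | hpos
  · rw [h0]
    have : (I.weight y ^ 2)⁻¹ ≤ 1 := inv_le_one_of_one_le₀ (by nlinarith)
    linarith
  · obtain ⟨k, hk⟩ : ∃ k, n = k + 1 := ⟨n - 1, by omega⟩
    have h2 := Nat.find_min hex (m := k) (by omega)
    rw [not_le, ← lt_div_iff₀ hI] at h2
    have h3 : (2 : ℝ) ^ k ≤ I.weight y := by unfold weight; linarith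
    calc (I.weight y ^ 2)⁻¹ ≤ (((2 : ℝ) ^ k) ^ 2)⁻¹ := by gcongr
      _ = 4 * (1 / 4) ^ n := by
        rw [hk, pow_succ (1 / 4 : ℝ) k, ← pow_mul, mul_comm k 2, pow_mul, one_div, inv_pow]; norm_num; ring_nf

theorem avg_le_tsum_closedBall (I : DyadicInterval) {h : ℝ → ℝ≥0∞} (hm : AEMeasurable h) :
    avg I h ≤ (ENNReal.ofReal I.length)⁻¹ * ∑' n : ℕ, 4 * (1 / 4 : ℝ≥0∞) ^ n *
      ∫⁻ y in Metric.closedBall I.center (2 ^ n * I.length), h y := by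
  unfold avg
  gcongr
  have hb : ∀ n : ℕ, MeasurableSet (Metric.closedBall I.center (2 ^ n * I.length)) := fun n =>
    Metric.isClosed_closedBall.measurableSet
  calc ∫⁻ y, h y * ENNReal.ofReal ((I.weight y ^ 2)⁻¹)
      ≤ ∫⁻ y, ∑' n : ℕ, 4 * (1 / 4 : ℝ≥0∞) ^ n *
        (Metric.closedBall I.center (2 ^ n * I.length)).indicator h y := by
        refine lintegral_mono fun y => ?_
        refine (mul_le_mul_right (inv_weight_le_tsum I y) _).trans ?_
        rw [← ENNReal.tsum_mul_left]
        refine ENNReal.tsum_le_tsum fun n => ?_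
        rw [mul_left_comm]
        refine le_of_eq (congrArg _ ?_)
        by_cases hy : y ∈ Metric.closedBall I.center (2 ^ n * I.length)
        · rw [Set.indicator_of_mem hy, Set.indicator_of_mem hy, Pi.one_apply, mul_one]
        · rw [Set.indicator_of_notMem hy, Set.indicator_of_notMem hy, mul_zero]
    _ = _ := by
        rw [lintegral_tsum fun n => (hm.indicator (hb n)).const_mul _]
        refine tsum_congr fun n => ?_
        rw [lintegral_const_mul'' _ (hm.indicator (hb n)), lintegral_indicator (hb n)]

/-- The weak type `(1,1)` bound for the maximal function. -/
theorem mul_meas_lt_maxFun_le {h : ℝ → ℝ≥0∞} (hm : Measurable h) (t : ℝ≥0) :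
    (t : ℝ≥0∞) * volume {x | (t : ℝ≥0∞) < maxFun h x} ≤ 80 * ∫⁻ x, h x := by
  rcases eq_or_ne (∫⁻ x, h x) ∞ with htop | hfin
  · rw [htop]; simp
  rcases eq_or_lt_of_le (zero_le : 0 ≤ t) with rfl | ht
  · simp
  let T : Set DyadicInterval := {I | (t : ℝ≥0∞) < avg I h}
  -- If all these balls had small averages, the tails would sum to at most `∑ 4 · 4^(-n) · 2^n · t /
  -- 8 = t`, contradicting `t < avg I h`.
  have hex : ∀ I : DyadicInterval, I ∈ T → ∃ n : ℕ, (t : ℝ≥0∞) * ENNReal.ofReal (2 ^ n * I.length) ≤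
      8 * ∫⁻ y in Metric.closedBall I.center (2 ^ n * I.length), h y := by
    intro I hI
    by_contra! hcon
    refine absurd hI (not_lt.2 ((avg_le_tsum_closedBall I hm.aemeasurable).trans ?_))
    rw [mul_comm, ← div_eq_mul_inv]
    refine ENNReal.div_le_of_le_mul ?_
    calc ∑' n : ℕ, 4 * (1 / 4 : ℝ≥0∞) ^ n *
          ∫⁻ y in Metric.closedBall I.center (2 ^ n * I.length), h y
        ≤ ∑' n : ℕ, (1 / 2 : ℝ≥0∞) ^ n * (2⁻¹ * (t * ENNReal.ofReal I.length)) := by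
          refine ENNReal.tsum_le_tsum fun n => ?_
          have h1 := (hcon n).le
          rw [ENNReal.ofReal_mul (by positivity), ENNReal.ofReal_pow (by norm_num)] at h1
          have h8 : ∫⁻ y in Metric.closedBall I.center (2 ^ n * I.length), h y ≤
              8⁻¹ * (t * (ENNReal.ofReal 2 ^ n * ENNReal.ofReal I.length)) := by
            rw [← ENNReal.div_eq_inv_mul, ENNReal.le_div_iff_mul_le (by simp) (by simp), mul_comm]
            exact h1
          refine (mul_le_mul_right h8 _).trans (le_of_eq ?_)
          rw [show (1 / 4 : ℝ≥0∞) = (1 / 2) * (1 / 2) by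
            rw [one_div, one_div, ← ENNReal.mul_inv (by simp) (by simp)]; norm_num,
            mul_pow]
          have e2 : (1 / 2 : ℝ≥0∞) ^ n * ENNReal.ofReal 2 ^ n = 1 := by
            rw [← mul_pow]; simp [ENNReal.inv_mul_cancel]
          have e3 : (4 : ℝ≥0∞) * 8⁻¹ = 2⁻¹ := by
            rw [show (8 : ℝ≥0∞) = 4 * 2 by norm_num, ENNReal.mul_inv (by simp) (by simp),
              ← mul_assoc, ENNReal.mul_inv_cancel (by simp) (by simp), one_mul]
          calc _ = (1 / 2 : ℝ≥0∞) ^ n * ((1 / 2 : ℝ≥0∞) ^ n * ENNReal.ofReal 2 ^ n) *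
                ((4 * 8⁻¹) * (t * ENNReal.ofReal I.length)) := by ring
            _ = _ := by rw [e2, e3, mul_one]
      _ = t * ENNReal.ofReal I.length := by
          rw [ENNReal.tsum_mul_right, ENNReal.tsum_geometric, one_div, ENNReal.one_sub_inv_two,
            inv_inv, ← mul_assoc, ENNReal.mul_inv_cancel (by simp) (by simp), one_mul]
      _ ≤ _ := le_rfl
  choose! n hn using hex
  -- The Vitali covering lemma needs bounded radii; the finite integral of `h` provides the bound.
  have hR : ∀ I ∈ T, 2 ^ n I * I.length ≤ ((t : ℝ≥0∞)⁻¹ * (8 * ∫⁻ x, h x)).toReal := by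
    intro I hI
    have ht0 : (t : ℝ≥0∞) ≠ 0 := by exact_mod_cast ht.ne'
    rw [← ENNReal.ofReal_le_iff_le_toReal (ENNReal.mul_ne_top (by simpa using ht.ne')
      (ENNReal.mul_ne_top (by simp) hfin)), ← ENNReal.div_eq_inv_mul,
      ENNReal.le_div_iff_mul_le (Or.inl ht0) (Or.inl ENNReal.coe_ne_top), mul_comm]
    exact (hn I hI).trans (mul_le_mul_right (setLIntegral_le_lintegral _ _) _)
  obtain ⟨u, huT, hdisj, hcov⟩ := Vitali.exists_disjoint_subfamily_covering_enlargement_closedBall T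
    (fun I => I.center) (fun I => 2 ^ n I * I.length) _ hR 5 (by norm_num)
  have hsub : {x | (t : ℝ≥0∞) < maxFun h x} ⊆
      ⋃ I ∈ u, Metric.closedBall I.center (5 * (2 ^ n I * I.length)) := by
    intro x hx
    obtain ⟨I, hxI, hI⟩ := lt_maxFun_iff.1 hx
    obtain ⟨J, hJu, hJ⟩ := hcov I hI
    refine Set.mem_biUnion hJu (hJ ?_)
    rw [Metric.mem_closedBall, Real.dist_eq]
    have h1 := abs_sub_center_le hxI
    have h2 := I.length_pos
    have h3 : (1 : ℝ) ≤ 2 ^ n I := one_le_pow₀ (by norm_num)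
    nlinarith
  have hcount : u.Countable := Set.to_countable u
  calc (t : ℝ≥0∞) * volume {x | (t : ℝ≥0∞) < maxFun h x}
      ≤ t * ∑' I : u, volume (Metric.closedBall (I : DyadicInterval).center
          (5 * (2 ^ n (I : DyadicInterval) * (I : DyadicInterval).length))) := by
        gcongr
        exact (measure_mono hsub).trans (measure_biUnion_le _ hcount _)
    _ ≤ ∑' I : u, 80 * ∫⁻ y in Metric.closedBall (I : DyadicInterval).center
          (2 ^ n (I : DyadicInterval) * (I : DyadicInterval).length), h y := by
        rw [← ENNReal.tsum_mul_left]
        refine ENNReal.tsum_le_tsum fun I => ?_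
        have h1 := hn I (huT I.2)
        -- The constant 80 is 10, from the length of the fivefold ball relative to the radius, times
        -- the 8 of the selection of the radii.
        rw [Real.volume_closedBall, show 2 * (5 * (2 ^ n (I : DyadicInterval) *
          (I : DyadicInterval).length)) = 10 * (2 ^ n (I : DyadicInterval) *
          (I : DyadicInterval).length) by ring, ENNReal.ofReal_mul (by norm_num),
          ENNReal.ofReal_ofNat, mul_left_comm]
        refine (mul_le_mul_right h1 _).trans (le_of_eq ?_)
        rw [← mul_assoc]; norm_num
    _ = 80 * ∫⁻ y in ⋃ I ∈ u, Metric.closedBall I.center (2 ^ n I * I.length), h y := by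
        rw [ENNReal.tsum_mul_left, lintegral_biUnion hcount
          (fun I _ => Metric.isClosed_closedBall.measurableSet) hdisj]
    _ ≤ _ := mul_le_mul_right (setLIntegral_le_lintegral _ _) _

theorem gauge_maxFun_weak {h : ℝ → ℝ≥0∞} (hm : Measurable h) :
    gauge true 1 (maxFun h) ≤ 80 * ∫⁻ x, h x := by
  rw [gauge_true]
  refine iSup_le fun t => ?_
  rw [ENNReal.rpow_one]
  exact mul_meas_lt_maxFun_le hm t

/-- Cutting `h` at height `s`, the low part contributes at most `4 * shiftSum * s` to every average.
-/
theorem lt_add_of_lt_maxFun {h : ℝ → ℝ≥0∞} (hm : Measurable h) (s t : ℝ≥0) {x : ℝ}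
    (hx : (t : ℝ≥0∞) + 4 * shiftSum * s < maxFun h x) :
    (t : ℝ≥0∞) < maxFun ({x | (s : ℝ≥0∞) < h x}.indicator h) x := by
  obtain ⟨I, hxI, hI⟩ := lt_maxFun_iff.1 hx
  refine lt_maxFun_iff.2 ⟨I, hxI, ?_⟩
  have hms : MeasurableSet {x | (s : ℝ≥0∞) < h x} := measurableSet_lt measurable_const hm
  by_contra hcon
  rw [not_lt] at hcon
  refine absurd hI (not_lt.2 ?_)
  calc avg I h ≤ avg I (fun x => {x | (s : ℝ≥0∞) < h x}.indicator h x + s) := by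
        refine avg_mono I fun y => ?_
        by_cases hy : y ∈ {x | (s : ℝ≥0∞) < h x}
        · rw [Set.indicator_of_mem hy]; exact le_self_add
        · rw [Set.indicator_of_notMem hy, zero_add]; exact not_lt.1 hy
    _ ≤ _ := by
        rw [avg_add I _ (hm.indicator hms)]
        exact add_le_add hcon (avg_const_le I s)

/-- Where `2^n s < h ≤ 2^(n+1) s`, the `n`-th term alone dominates `h`. Where `h = ∞`, all terms are
present and the series diverges. -/
theorem lintegral_indicator_lt_le {h : ℝ → ℝ≥0∞} (hm : Measurable h) {s : ℝ≥0} (hs : 0 < s) :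
    ∫⁻ x, {x | (s : ℝ≥0∞) < h x}.indicator h x ≤
      ∑' n : ℕ, ((2 ^ (n + 1) * s : ℝ≥0) : ℝ≥0∞) * volume {x | ((2 ^ n * s : ℝ≥0) : ℝ≥0∞) < h x} := by
  have hms : ∀ r : ℝ≥0, MeasurableSet {x | (r : ℝ≥0∞) < h x} := fun r =>
    measurableSet_lt measurable_const hm
  calc ∫⁻ x, {x | (s : ℝ≥0∞) < h x}.indicator h x
      ≤ ∫⁻ x, ∑' n : ℕ, ((2 ^ (n + 1) * s : ℝ≥0) : ℝ≥0∞) *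
        {x | ((2 ^ n * s : ℝ≥0) : ℝ≥0∞) < h x}.indicator 1 x := by
        refine lintegral_mono fun x => ?_
        by_cases hx : (s : ℝ≥0∞) < h x
        · rw [Set.indicator_of_mem (s := {x | (s : ℝ≥0∞) < h x}) hx]
          by_cases hex : ∃ n : ℕ, h x ≤ ((2 ^ n * s : ℝ≥0) : ℝ≥0∞)
          · classical
            set n := Nat.find hex with hn
            have h1 : h x ≤ ((2 ^ n * s : ℝ≥0) : ℝ≥0∞) := Nat.find_spec hex
            obtain ⟨k, hk⟩ : ∃ k, n = k + 1 := by
              refine ⟨n - 1, ?_⟩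
              rcases Nat.eq_zero_or_pos n with h0 | hpos
              · rw [h0] at h1
                simp only [pow_zero, one_mul] at h1
                exact absurd hx (not_lt.2 h1)
              · omega
            have h2 := Nat.find_min hex (m := k) (by omega)
            rw [not_le] at h2
            refine le_trans ?_ (ENNReal.le_tsum k)
            rw [Set.indicator_of_mem (s := {x | ((2 ^ k * s : ℝ≥0) : ℝ≥0∞) < h x}) h2,
              Pi.one_apply, mul_one, ← hk]
            exact h1
          · push Not at hex
            have : ∀ n : ℕ, (n : ℝ≥0∞) * s ≤ ∑' n : ℕ, ((2 ^ (n + 1) * s : ℝ≥0) : ℝ≥0∞) *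
                {x | ((2 ^ n * s : ℝ≥0) : ℝ≥0∞) < h x}.indicator 1 x := by
              intro n
              refine le_trans ?_ (ENNReal.le_tsum n)
              rw [Set.indicator_of_mem (s := {x | ((2 ^ n * s : ℝ≥0) : ℝ≥0∞) < h x}) (hex n),
                Pi.one_apply, mul_one, ENNReal.coe_mul]
              gcongr
              have : n ≤ 2 ^ (n + 1) := (Nat.lt_two_pow_self.le).trans
                (Nat.pow_le_pow_right (by norm_num) (by omega))
              exact_mod_cast this
            have htop : ∑' n : ℕ, ((2 ^ (n + 1) * s : ℝ≥0) : ℝ≥0∞) *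
                {x | ((2 ^ n * s : ℝ≥0) : ℝ≥0∞) < h x}.indicator 1 x = ∞ := by
              refine ENNReal.eq_top_of_forall_nnreal_le fun r => ?_
              obtain ⟨n, hn⟩ := exists_nat_ge (r / s)
              refine le_trans ?_ (this n)
              rw [div_le_iff₀ hs] at hn
              exact_mod_cast hn
            rw [htop]; exact le_top
        · rw [Set.indicator_of_notMem (s := {x | (s : ℝ≥0∞) < h x}) hx]; exact zero_le
    _ = _ := by
        rw [lintegral_tsum fun n => ((measurable_one.indicator (hms _)).const_mul _).aemeasurable]
        refine tsum_congr fun n => ?_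
        rw [lintegral_const_mul _ (measurable_one.indicator (hms _)),
          lintegral_indicator_one (hms _)]

/-- A positive constant that bounds the averages of the function `1`. -/
noncomputable def maxConst : ℝ≥0 := (4 * shiftSum).toNNReal + 1

theorem four_mul_shiftSum_le : 4 * shiftSum ≤ (maxConst : ℝ≥0∞) := by
  unfold maxConst
  rw [ENNReal.coe_add, ENNReal.coe_toNNReal (ENNReal.mul_ne_top (by simp) shiftSum_ne_top)]
  exact le_self_add

theorem maxConst_pos : 0 < maxConst := by unfold maxConst; positivity

/-- At level `t` the function is cut at `s = t / (2 * maxConst)`. The low part accounts for at most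
`t / 2`, and the weak type bound at level `t / 2` is applied to the high part, decomposed into
dyadic layers. -/
theorem dom_maxFun {h : ℝ → ℝ≥0∞} (hm : Measurable h) :
    Dom (fun n : ℕ => 160 * (2 ^ (n + 1) * (2 * maxConst)⁻¹)) (fun n => 2 ^ n * (2 * maxConst)⁻¹)
      h (maxFun h) := by
  intro t ht
  have hC := maxConst_pos
  set s : ℝ≥0 := (2 * maxConst)⁻¹ * t with hs
  have hs0 : 0 < s := by positivity
  have hms : MeasurableSet {x | (s : ℝ≥0∞) < h x} := measurableSet_lt measurable_const hm
  have h1 := mul_meas_lt_maxFun_le (hm.indicator hms) (t / 2)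
  have hsub : volume {x | (t : ℝ≥0∞) < maxFun h x} ≤
      volume {x | ((t / 2 : ℝ≥0) : ℝ≥0∞) < maxFun ({x | (s : ℝ≥0∞) < h x}.indicator h) x} := by
    refine measure_mono fun x (hx : _ < _) => lt_add_of_lt_maxFun hm s (t / 2) (lt_of_le_of_lt ?_ hx)
    calc ((t / 2 : ℝ≥0) : ℝ≥0∞) + 4 * shiftSum * s
        ≤ ((t / 2 : ℝ≥0) : ℝ≥0∞) + maxConst * s := by gcongr; exact four_mul_shiftSum_le
      _ = ((t / 2 + maxConst * s : ℝ≥0) : ℝ≥0∞) := by push_cast; rfl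
      _ = t := by
          congr 1
          rw [hs]; field_simp; norm_num
  have h2 : ((t / 2 : ℝ≥0) : ℝ≥0∞) ≠ 0 := by
    exact_mod_cast (by positivity : 0 < t / 2).ne'
  have h3 : volume {x | (t : ℝ≥0∞) < maxFun h x} ≤
      ((t / 2 : ℝ≥0) : ℝ≥0∞)⁻¹ * (80 * ∫⁻ x, {x | (s : ℝ≥0∞) < h x}.indicator h x) := by
    rw [← ENNReal.div_eq_inv_mul, ENNReal.le_div_iff_mul_le (Or.inl h2) (Or.inl ENNReal.coe_ne_top),
      mul_comm]
    exact (mul_le_mul_right hsub _).trans h1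
  refine h3.trans ?_
  calc ((t / 2 : ℝ≥0) : ℝ≥0∞)⁻¹ * (80 * ∫⁻ x, {x | (s : ℝ≥0∞) < h x}.indicator h x)
      ≤ ((t / 2 : ℝ≥0) : ℝ≥0∞)⁻¹ * (80 * ∑' n : ℕ, ((2 ^ (n + 1) * s : ℝ≥0) : ℝ≥0∞) *
          volume {x | ((2 ^ n * s : ℝ≥0) : ℝ≥0∞) < h x}) := by
        gcongr
        exact lintegral_indicator_lt_le hm hs0
    _ ≤ _ := by
        rw [← mul_assoc, ← ENNReal.tsum_mul_left]
        refine ENNReal.tsum_le_tsum fun n => ?_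
        rw [← mul_assoc, ← ENNReal.coe_inv (by positivity)]
        refine mul_le_mul' (le_of_eq ?_) (le_of_eq ?_)
        · rw [show (80 : ℝ≥0∞) = ((80 : ℝ≥0) : ℝ≥0∞) by simp, ← ENNReal.coe_mul, ← ENNReal.coe_mul]
          congr 1
          rw [hs]
          field_simp
          norm_num
        · congr 4; rw [hs, mul_assoc]

/-- The strong type bound for the maximal function. -/
theorem exists_gauge_maxFun_le {q : ℝ} (hq : 1 < q) : ∃ C : ℝ≥0, ∀ h : ℝ → ℝ≥0∞, Measurable h →
    gauge false q (maxFun h) ≤ C * gauge false q h := by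
  have hC := maxConst_pos
  have hsum : ∑' n : ℕ, ((160 * (2 ^ (n + 1) * (2 * maxConst)⁻¹) *
      (2 ^ n * (2 * maxConst)⁻¹) ^ (-q) : ℝ≥0) : ℝ≥0∞) ≠ ∞ := by
    rw [ENNReal.tsum_coe_ne_top_iff_summable]
    -- The series is geometric with ratio `2^(1-q)`; here `q > 1` enters.
    have hr : (2 : ℝ≥0) * (2 : ℝ≥0) ^ (-q) < 1 := by
      have : (2 : ℝ≥0) * (2 : ℝ≥0) ^ (-q) = (2 : ℝ≥0) ^ (1 - q) := by
        rw [sub_eq_add_neg, NNReal.rpow_add (by norm_num), NNReal.rpow_one]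
      rw [this]
      exact NNReal.rpow_lt_one_of_one_lt_of_neg (by norm_num) (by linarith)
    have hg := (NNReal.summable_geometric hr).mul_left
      (160 * (2 * (2 * maxConst)⁻¹) * (2 * maxConst)⁻¹ ^ (-q))
    refine hg.congr fun n => ?_
    have e : ((2 : ℝ≥0) ^ n) ^ (-q) = ((2 : ℝ≥0) ^ (-q)) ^ n := by
      rw [← NNReal.rpow_natCast, ← NNReal.rpow_natCast, ← NNReal.rpow_mul, ← NNReal.rpow_mul,
        mul_comm]
    rw [NNReal.mul_rpow, e, mul_pow, pow_succ]
    ring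
  refine ⟨(∑' n : ℕ, ((160 * (2 ^ (n + 1) * (2 * maxConst)⁻¹) *
      (2 ^ n * (2 * maxConst)⁻¹) ^ (-q) : ℝ≥0) : ℝ≥0∞)).toNNReal, fun h hm => ?_⟩
  rw [ENNReal.coe_toNNReal hsum]
  exact gauge_le_of_dom (fun n => by positivity) hm (measurable_maxFun h) (dom_maxFun hm) false
    (by linarith)

end Paraproduct

namespace Paraproduct

open DyadicInterval

/-! ### Bump functions and their coefficients -/

/-- A bump function for `I`, normalized in `L^∞`. -/
structure Bump (K : ℝ) (N : ℕ) (I : DyadicInterval) (ψ : ℝ → ℂ) : Prop where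
  differentiable : Differentiable ℝ ψ
  bound : ∀ x, ‖ψ x‖ ≤ K * (I.weight x ^ N)⁻¹
  deriv_bound : ∀ x, ‖deriv ψ x‖ ≤ K * I.length⁻¹ * (I.weight x ^ N)⁻¹

/-- The normalized coefficient `|I|⁻¹ ⟨f, ψ⟩`. -/
noncomputable def coef (I : DyadicInterval) (ψ f : ℝ → ℂ) : ℂ :=
  ((I.length⁻¹ : ℝ) : ℂ) * pairing f ψ

variable {K : ℝ} {N : ℕ} {I J : DyadicInterval} {ψ χ f : ℝ → ℂ}

theorem Bump.nonneg (h : Bump K N I ψ) : 0 ≤ K := by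
  have h1 := (norm_nonneg _).trans (h.bound 0)
  have h2 := I.weight_pos 0
  exact nonneg_of_mul_nonneg_left h1 (by positivity)

theorem Bump.mono (h : Bump K N I ψ) {K' : ℝ} {N' : ℕ} (hK : K ≤ K') (hN : N' ≤ N) :
    Bump K' N' I ψ := by
  have h0 := h.nonneg
  have h1 := I.length_pos
  have key : ∀ x, (I.weight x ^ N)⁻¹ ≤ (I.weight x ^ N')⁻¹ := fun x => by
    have := I.one_le_weight x
    gcongr
  have key2 : ∀ x, 0 ≤ (I.weight x ^ N)⁻¹ := fun x => by
    have := I.weight_pos x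
    positivity
  refine ⟨h.differentiable, fun x => (h.bound x).trans ?_, fun x => (h.deriv_bound x).trans ?_⟩
  · exact mul_le_mul hK (key x) (key2 x) (h0.trans hK)
  · exact mul_le_mul (by gcongr) (key x) (key2 x) (by have := h0.trans hK; positivity)

theorem Bump.continuous (h : Bump K N I ψ) : Continuous ψ := h.differentiable.continuous

theorem Bump.enorm_le (h : Bump K N I ψ) (x : ℝ) :
    ‖ψ x‖ₑ ≤ ENNReal.ofReal K * ENNReal.ofReal ((I.weight x ^ N)⁻¹) := by
  rw [← ENNReal.ofReal_mul h.nonneg, ← ofReal_norm]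
  exact ENNReal.ofReal_le_ofReal (h.bound x)

theorem Bump.norm_le (h : Bump K N I ψ) (x : ℝ) : ‖ψ x‖ ≤ K := by
  refine (h.bound x).trans (mul_le_of_le_one_right h.nonneg ?_)
  exact inv_le_one_of_one_le₀ (one_le_pow₀ (I.one_le_weight x))

theorem Bump.integrable (h : Bump K N I ψ) (hN : 2 ≤ N) : Integrable ψ := by
  refine ⟨h.continuous.aestronglyMeasurable, ?_⟩
  refine lt_of_le_of_lt (lintegral_mono fun x => (h.mono le_rfl hN).enorm_le x) ?_
  rw [lintegral_const_mul _ (measurable_inv_weight I)]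
  refine ENNReal.mul_lt_top ENNReal.ofReal_lt_top
    ((lintegral_inv_weight_sq_le I).trans_lt ?_)
  exact ENNReal.mul_lt_top (ENNReal.mul_lt_top (by simp) shiftSum_ne_top.lt_top)
    ENNReal.ofReal_lt_top

/-- Mean value inequality on the segment from `y` to `x`. The decay of the derivative at the
intermediate points is transferred to `y` at the cost of the last factor. -/
theorem Bump.norm_sub_le (h : Bump K N J ψ) (hN : 2 ≤ N) (hIJ : I.2 ≤ J.2) (x y : ℝ) :
    ‖ψ x - ψ y‖ ≤ K * J.length⁻¹ * |x - y| * ((J.weight y ^ 2)⁻¹ * (1 + |x - y| / I.length) ^ 2) := by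
  have hI := I.length_pos
  have hJ := J.length_pos
  have hK := h.nonneg
  have hb : ∀ z ∈ Set.uIcc y x, ‖deriv ψ z‖ ≤
      K * J.length⁻¹ * ((J.weight y ^ 2)⁻¹ * (1 + |x - y| / I.length) ^ 2) := by
    intro z hz
    refine ((h.mono le_rfl hN).deriv_bound z).trans ?_
    gcongr
    have h1 := weight_le_mul hIJ y z
    have h2 : |y - z| ≤ |x - y| := by
      rw [abs_sub_comm y z, abs_sub_comm x y]
      exact (Set.abs_sub_left_of_mem_uIcc hz).trans (by rw [abs_sub_comm])
    have h3 : J.weight y ≤ J.weight z * (1 + |x - y| / I.length) := by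
      refine h1.trans ?_
      have := J.weight_pos z
      gcongr
    have h4 := J.weight_pos z
    have h5 := J.weight_pos y
    rw [inv_mul_eq_div, le_div_iff₀ (by positivity), inv_mul_le_iff₀ (by positivity), ← mul_pow]
    gcongr
  have := Convex.norm_image_sub_le_of_norm_deriv_le (fun z _ => h.differentiable z) hb
    (convex_uIcc y x) Set.left_mem_uIcc Set.right_mem_uIcc
  refine this.trans (le_of_eq ?_)
  rw [Real.norm_eq_abs]; ring

theorem enorm_coef (I : DyadicInterval) (ψ f : ℝ → ℂ) :
    ‖coef I ψ f‖ₑ = (ENNReal.ofReal I.length)⁻¹ * ‖pairing f ψ‖ₑ := by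
  have hI := I.length_pos
  unfold coef
  rw [enorm_mul]
  congr 1
  rw [← ofReal_norm, Complex.norm_real, Real.norm_of_nonneg (by positivity),
    ENNReal.ofReal_inv_of_pos hI]

theorem ofReal_length_mul_enorm_coef (I : DyadicInterval) (ψ f : ℝ → ℂ) :
    ENNReal.ofReal I.length * ‖coef I ψ f‖ₑ = ‖pairing f ψ‖ₑ := by
  rw [enorm_coef, ← mul_assoc, ENNReal.mul_inv_cancel (ofReal_length_ne_zero I)
    ENNReal.ofReal_ne_top, one_mul]

theorem enorm_pairing_le (f ψ : ℝ → ℂ) : ‖pairing f ψ‖ₑ ≤ ∫⁻ x, ‖f x‖ₑ * ‖ψ x‖ₑ := by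
  refine (enorm_integral_le_lintegral_enorm _).trans (le_of_eq ?_)
  refine lintegral_congr fun x => ?_
  rw [enorm_mul, RCLike.enorm_conj]

theorem Bump.enorm_coef_le (h : Bump K N I ψ) (hN : 2 ≤ N) (f : ℝ → ℂ) :
    ‖coef I ψ f‖ₑ ≤ ENNReal.ofReal K * avg I (fun x => ‖f x‖ₑ) := by
  rw [enorm_coef]
  unfold avg
  rw [mul_left_comm]
  gcongr
  rw [← lintegral_const_mul' _ _ ENNReal.ofReal_ne_top]
  refine (enorm_pairing_le f ψ).trans (lintegral_mono fun x => ?_)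
  change _ ≤ _ * (_ * _)
  rw [mul_left_comm]
  gcongr
  exact (h.mono le_rfl hN).enorm_le x

/-! ### Almost orthogonality -/

/-- The shorter bump has integral zero, so the value of the longer one at the center of `I` may be
subtracted. Of the five powers of decay of `ψ`, one pays for `|x - c(I)|`, two for the change of the
weight of `J`, and two remain for integrability. -/
theorem enorm_pairing_bump_le (hψ : Bump K 5 I ψ) (hχ : Bump K N J χ) (hN : 2 ≤ N)
    (h0 : ∫ x, ψ x = 0) (hIJ : I.2 ≤ J.2) :
    ‖pairing ψ χ‖ₑ ≤ 4 * shiftSum * ENNReal.ofReal (K ^ 2) *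
      (ENNReal.ofReal (I.length / J.length) * ENNReal.ofReal I.length *
        ENNReal.ofReal ((J.weight I.center ^ 2)⁻¹)) := by
  have hI := I.length_pos
  have hJ := J.length_pos
  have hK := hψ.nonneg
  have hi := hψ.integrable (by norm_num)
  have hi2 : Integrable fun x => ψ x * conj (χ x) :=
    hi.mul_bdd (c := K) (Complex.continuous_conj.comp hχ.continuous).aestronglyMeasurable
      (ae_of_all _ fun x => by simpa using hχ.norm_le x)
  have e : pairing ψ χ = ∫ x, ψ x * (conj (χ x) - conj (χ I.center)) := by
    unfold pairing
    simp_rw [mul_sub]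
    rw [integral_sub hi2 (hi.mul_const _), integral_mul_const, h0, zero_mul, sub_zero]
  rw [e]
  calc ‖∫ x, ψ x * (conj (χ x) - conj (χ I.center))‖ₑ
      ≤ ∫⁻ x, ‖ψ x * (conj (χ x) - conj (χ I.center))‖ₑ := enorm_integral_le_lintegral_enorm _
    _ ≤ ∫⁻ x, ENNReal.ofReal (K ^ 2 * (I.length / J.length) * (J.weight I.center ^ 2)⁻¹) *
        ENNReal.ofReal ((I.weight x ^ 2)⁻¹) := by
        refine lintegral_mono fun x => ?_
        rw [← ENNReal.ofReal_mul (by have := J.weight_pos I.center; positivity), ← ofReal_norm]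
        refine ENNReal.ofReal_le_ofReal ?_
        rw [norm_mul, ← map_sub, RCLike.norm_conj]
        have h1 := hψ.bound x
        have h2 := hχ.norm_sub_le hN hIJ x I.center
        have hw := I.weight_pos x
        have hwJ := J.weight_pos I.center
        have h3 : |x - I.center| ≤ I.length * I.weight x := by
          unfold weight; rw [mul_add, mul_div_cancel₀ _ hI.ne']; linarith
        change _ ≤ _ * ((J.weight I.center ^ 2)⁻¹ * I.weight x ^ 2) at h2
        calc ‖ψ x‖ * ‖χ x - χ I.center‖
            ≤ (K * (I.weight x ^ 5)⁻¹) * (K * J.length⁻¹ * (I.length * I.weight x) *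
              ((J.weight I.center ^ 2)⁻¹ * I.weight x ^ 2)) := by
              refine mul_le_mul h1 (h2.trans ?_) (norm_nonneg _) (by positivity)
              gcongr
          _ = _ := by field_simp
    _ ≤ ENNReal.ofReal (K ^ 2 * (I.length / J.length) * (J.weight I.center ^ 2)⁻¹) *
        (4 * shiftSum * ENNReal.ofReal I.length) := by
        rw [lintegral_const_mul _ (measurable_inv_weight I)]
        gcongr
        exact lintegral_inv_weight_sq_le I
    _ = _ := by
        rw [ENNReal.ofReal_mul (by positivity), ENNReal.ofReal_mul (by positivity)]
        ring

theorem enorm_pairing_comm (ψ χ : ℝ → ℂ) : ‖pairing ψ χ‖ₑ = ‖pairing χ ψ‖ₑ := by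
  have : pairing ψ χ = conj (pairing χ ψ) := by
    unfold pairing
    rw [← integral_conj]
    refine integral_congr_ae (ae_of_all _ fun x => ?_)
    simp [mul_comm]
  rw [this, RCLike.enorm_conj]

/-- The constant `∑ₖ 2^(-|k|)`. -/
noncomputable def scaleSum : ℝ≥0∞ := ∑' k : ℤ, (1 / 2 : ℝ≥0∞) ^ k.natAbs

theorem scaleSum_ne_top : scaleSum ≠ ∞ := by
  unfold scaleSum
  have h : Summable fun k : ℤ => (1 / 2 : ℝ≥0) ^ k.natAbs := by
    rw [← NNReal.summable_coe]
    refine Summable.of_nat_of_neg ?_ ?_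
    · simpa using summable_geometric_two
    · simpa using summable_geometric_two
  have h2 := ENNReal.tsum_coe_ne_top_iff_summable.2 h
  refine ne_of_eq_of_ne (tsum_congr fun k => ?_) h2
  simp [ENNReal.inv_pow]

theorem ofReal_length_div (h : I.2 ≤ J.2) :
    ENNReal.ofReal (I.length / J.length) = (1 / 2 : ℝ≥0∞) ^ (J.2 - I.2).natAbs := by
  have hI := I.length_pos
  obtain ⟨d, hd⟩ : ∃ d : ℕ, J.2 - I.2 = d := ⟨(J.2 - I.2).toNat, by omega⟩
  rw [length_eq_mul I J, hd, Int.natAbs_natCast, zpow_natCast, div_mul_cancel_right₀ hI.ne',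
    ENNReal.ofReal_inv_of_pos (by positivity), ENNReal.ofReal_pow (by norm_num)]
  simp [ENNReal.inv_pow]

theorem tsum_le_of_scale {a : DyadicInterval → ℝ≥0∞} {k₀ : ℤ} {B : ℝ≥0∞}
    (h : ∀ k : ℤ, ∑' j : ℤ, a (j, k) ≤ B * (1 / 2 : ℝ≥0∞) ^ (k - k₀).natAbs) :
    ∑' I, a I ≤ B * scaleSum := by
  have e : ∑' I : DyadicInterval, a I = ∑' k : ℤ, ∑' j : ℤ, a (j, k) := by
    rw [ENNReal.tsum_comm]
    exact ENNReal.tsum_prod (f := fun j k => a (j, k))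
  rw [e]
  refine (ENNReal.tsum_le_tsum h).trans ?_
  rw [ENNReal.tsum_mul_left]
  unfold scaleSum
  rw [← (Equiv.subRight k₀).tsum_eq fun k : ℤ => (1 / 2 : ℝ≥0∞) ^ k.natAbs]
  rfl

/-- The left side is a Riemann sum of the integral of the weight of `I`, which varies by at most a
factor two on intervals of scale at most that of `I`. -/
theorem tsum_length_mul_inv_weight_le (I : DyadicInterval) {k : ℤ} (hk : k ≤ I.2) :
    ∑' j : ℤ, ENNReal.ofReal (length ((j, k) : DyadicInterval)) *
      ENNReal.ofReal ((I.weight (center ((j, k) : DyadicInterval)) ^ 2)⁻¹) ≤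
      16 * shiftSum * ENNReal.ofReal I.length := by
  calc _ ≤ ∑' j : ℤ, 4 * ∫⁻ y in toSet ((j, k) : DyadicInterval),
        ENNReal.ofReal ((I.weight y ^ 2)⁻¹) := by
        refine ENNReal.tsum_le_tsum fun j => ?_
        rw [← lintegral_const_mul _ (measurable_inv_weight I), mul_comm, ← volume_toSet,
          ← setLIntegral_const]
        refine setLIntegral_mono ((measurable_inv_weight I).const_mul _) fun y hy => ?_
        rw [← ENNReal.ofReal_ofNat, ← ENNReal.ofReal_mul (by norm_num)]
        refine ENNReal.ofReal_le_ofReal ?_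
        have h1 := weight_le_two_mul (I := (j, k)) (J := I) hk hy (center_mem _)
        have h2 := I.weight_pos y
        have h3 := I.weight_pos (center ((j, k) : DyadicInterval))
        rw [← div_eq_mul_inv, inv_eq_one_div, div_le_div_iff₀ (by positivity) (by positivity)]
        nlinarith
    _ = 4 * ∫⁻ y, ENNReal.ofReal ((I.weight y ^ 2)⁻¹) := by
        rw [ENNReal.tsum_mul_left, ← lintegral_eq_tsum_scale]
    _ ≤ 4 * (4 * shiftSum * ENNReal.ofReal I.length) := by
        gcongr; exact lintegral_inv_weight_sq_le I
    _ = _ := by rw [← mul_assoc, ← mul_assoc]; norm_num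

/-- The row sums for Schur's test. The cancellation of the shorter bump makes the scales decay
geometrically on both sides of the scale of `I`. Within a scale, the positions are summed directly
for longer intervals and as a Riemann sum for shorter ones. -/
theorem tsum_enorm_pairing_le {Ψ : DyadicInterval → ℝ → ℂ} (hΨ : ∀ I, Bump K 5 I (Ψ I))
    (h0 : HasMeanZero Ψ) (I : DyadicInterval) :
    ∑' J, ‖pairing (Ψ I) (Ψ J)‖ₑ ≤
      64 * shiftSum ^ 2 * scaleSum * ENNReal.ofReal (K ^ 2) * ENNReal.ofReal I.length := by
  have key : ∀ k : ℤ, ∑' j : ℤ, ‖pairing (Ψ I) (Ψ (j, k))‖ₑ ≤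
      (64 * shiftSum ^ 2 * ENNReal.ofReal (K ^ 2) * ENNReal.ofReal I.length) *
        (1 / 2 : ℝ≥0∞) ^ (k - I.2).natAbs := by
    intro k
    rcases le_total I.2 k with hk | hk
    · calc ∑' j : ℤ, ‖pairing (Ψ I) (Ψ (j, k))‖ₑ
          ≤ ∑' j : ℤ, 4 * shiftSum * ENNReal.ofReal (K ^ 2) * ((1 / 2 : ℝ≥0∞) ^ (k - I.2).natAbs *
            ENNReal.ofReal I.length) *
              ENNReal.ofReal ((weight ((j, k) : DyadicInterval) I.center ^ 2)⁻¹) := by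
            refine ENNReal.tsum_le_tsum fun j => ?_
            have h := enorm_pairing_bump_le (hΨ I) (hΨ (j, k)) (by norm_num) (h0 I) hk
            rw [ofReal_length_div (J := (j, k)) hk] at h
            refine h.trans (le_of_eq (by ring))
        _ ≤ 4 * shiftSum * ENNReal.ofReal (K ^ 2) * ((1 / 2 : ℝ≥0∞) ^ (k - I.2).natAbs *
            ENNReal.ofReal I.length) * (4 * shiftSum) := by
            rw [ENNReal.tsum_mul_left]
            gcongr
            exact tsum_inv_weight_sq_le k _
        _ = 16 * (shiftSum ^ 2 * ENNReal.ofReal (K ^ 2) * ENNReal.ofReal I.length *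
            (1 / 2 : ℝ≥0∞) ^ (k - I.2).natAbs) := by ring
        _ ≤ 64 * (shiftSum ^ 2 * ENNReal.ofReal (K ^ 2) * ENNReal.ofReal I.length *
            (1 / 2 : ℝ≥0∞) ^ (k - I.2).natAbs) := by gcongr; norm_num
        _ = _ := by ring
    · calc ∑' j : ℤ, ‖pairing (Ψ I) (Ψ (j, k))‖ₑ
          ≤ ∑' j : ℤ, 4 * shiftSum * ENNReal.ofReal (K ^ 2) * (1 / 2 : ℝ≥0∞) ^ (k - I.2).natAbs *
            (ENNReal.ofReal (length ((j, k) : DyadicInterval)) *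
              ENNReal.ofReal ((I.weight (center ((j, k) : DyadicInterval)) ^ 2)⁻¹)) := by
            refine ENNReal.tsum_le_tsum fun j => ?_
            rw [enorm_pairing_comm]
            have h := enorm_pairing_bump_le (hΨ (j, k)) (hΨ I) (by norm_num) (h0 (j, k)) hk
            rw [ofReal_length_div (I := (j, k)) hk, show (I.2 - k).natAbs = (k - I.2).natAbs by omega] at h
            refine h.trans (le_of_eq (by ring))
        _ ≤ 4 * shiftSum * ENNReal.ofReal (K ^ 2) * (1 / 2 : ℝ≥0∞) ^ (k - I.2).natAbs *
            (16 * shiftSum * ENNReal.ofReal I.length) := by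
            rw [ENNReal.tsum_mul_left]
            gcongr
            exact tsum_length_mul_inv_weight_le I hk
        _ = _ := by ring
  refine (tsum_le_of_scale key).trans (le_of_eq (by ring))

theorem mul_le_sq_add_sq (a b : ℝ≥0∞) : a * b ≤ a ^ 2 + b ^ 2 := by
  rcases le_total a b with h | h
  · calc a * b ≤ b * b := by gcongr
      _ = b ^ 2 := (sq b).symm
      _ ≤ _ := le_add_self
  · calc a * b ≤ a * a := by gcongr
      _ = a ^ 2 := (sq a).symm
      _ ≤ _ := le_self_add

theorem Bump.integrable_mul_conj (hψ : Bump K N I ψ) (hN : 2 ≤ N) {K' : ℝ} {N' : ℕ}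
    (hχ : Bump K' N' J χ) : Integrable fun x => ψ x * conj (χ x) :=
  (hψ.integrable hN).mul_bdd (c := K')
    (Complex.continuous_conj.comp hχ.continuous).aestronglyMeasurable
    (ae_of_all _ fun x => by simpa using hχ.norm_le x)

/-- The constant in the almost orthogonality estimates. -/
noncomputable def besselConst : ℝ≥0∞ := 128 * shiftSum ^ 2 * scaleSum

theorem besselConst_ne_top : besselConst ≠ ∞ :=
  ENNReal.mul_ne_top (ENNReal.mul_ne_top (by simp) (ENNReal.pow_ne_top shiftSum_ne_top))
    scaleSum_ne_top

/-- Schur's test: the square is expanded, `|β_I β_J| ≤ |β_I|² + |β_J|²` is used, and the row sums of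
the Gram matrix are bounded. -/
theorem lintegral_sum_bump_sq_le {Ψ : DyadicInterval → ℝ → ℂ} (hΨ : ∀ I, Bump K 5 I (Ψ I))
    (h0 : HasMeanZero Ψ) (F : Finset DyadicInterval) (β : DyadicInterval → ℂ) :
    ∫⁻ x, ‖∑ I ∈ F, β I * Ψ I x‖ₑ ^ 2 ≤
      besselConst * ENNReal.ofReal (K ^ 2) * ∑ I ∈ F, ENNReal.ofReal I.length * ‖β I‖ₑ ^ 2 := by
  set T : ℝ → ℂ := fun x => ∑ I ∈ F, β I * Ψ I x with hT
  have hint : ∀ I J, Integrable fun x => Ψ I x * conj (Ψ J x) := fun I J =>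
    (hΨ I).integrable_mul_conj (by norm_num) (hΨ J)
  have e1 : ∀ x, T x * conj (T x) =
      ∑ I ∈ F, ∑ J ∈ F, β I * conj (β J) * (Ψ I x * conj (Ψ J x)) := by
    intro x
    rw [hT]
    simp only [map_sum, map_mul]
    rw [Finset.sum_mul_sum]
    refine Finset.sum_congr rfl fun I _ => Finset.sum_congr rfl fun J _ => ?_
    ring
  have hTint : Integrable fun x => T x * conj (T x) := by
    simp_rw [e1]
    exact integrable_finsetSum _ fun I _ => integrable_finsetSum _ fun J _ =>
      (hint I J).const_mul _
  have e2 : ∫ x, T x * conj (T x) =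
      ∑ I ∈ F, ∑ J ∈ F, β I * conj (β J) * pairing (Ψ I) (Ψ J) := by
    simp_rw [e1]
    rw [integral_finsetSum _ fun I _ => integrable_finsetSum _ fun J _ => (hint I J).const_mul _]
    refine Finset.sum_congr rfl fun I _ => ?_
    rw [integral_finsetSum _ fun J _ => (hint I J).const_mul _]
    refine Finset.sum_congr rfl fun J _ => ?_
    rw [integral_const_mul]; rfl
  have e3 : ∫⁻ x, ‖T x‖ₑ ^ 2 = ‖∫ x, T x * conj (T x)‖ₑ := by
    have h1 : ∀ x, T x * conj (T x) = ((‖T x‖ ^ 2 : ℝ) : ℂ) := fun x => by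
      rw [Complex.mul_conj, Complex.normSq_eq_norm_sq]
    simp_rw [h1]
    rw [integral_complex_ofReal, ← ofReal_norm, Complex.norm_real, Real.norm_of_nonneg
      (integral_nonneg fun x => by positivity), ofReal_integral_eq_lintegral_ofReal]
    · refine lintegral_congr fun x => ?_
      rw [ENNReal.ofReal_pow (norm_nonneg _), ofReal_norm]
    · simp_rw [h1] at hTint
      exact hTint.re.congr (ae_of_all _ fun x => Complex.ofReal_re _)
    · exact ae_of_all _ fun x => by positivity
  rw [e3, e2]
  have hS : ∀ I, ∑ J ∈ F, ‖pairing (Ψ I) (Ψ J)‖ₑ ≤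
      64 * shiftSum ^ 2 * scaleSum * ENNReal.ofReal (K ^ 2) * ENNReal.ofReal I.length := fun I =>
    (ENNReal.sum_le_tsum F).trans (tsum_enorm_pairing_le hΨ h0 I)
  calc ‖∑ I ∈ F, ∑ J ∈ F, β I * conj (β J) * pairing (Ψ I) (Ψ J)‖ₑ
      ≤ ∑ I ∈ F, ∑ J ∈ F, (‖β I‖ₑ ^ 2 + ‖β J‖ₑ ^ 2) * ‖pairing (Ψ I) (Ψ J)‖ₑ := by
        refine (enorm_sum_le _ _).trans (Finset.sum_le_sum fun I _ => ?_)
        refine (enorm_sum_le _ _).trans (Finset.sum_le_sum fun J _ => ?_)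
        rw [enorm_mul, enorm_mul, RCLike.enorm_conj]
        gcongr
        exact mul_le_sq_add_sq _ _
    _ = ∑ I ∈ F, ‖β I‖ₑ ^ 2 * ∑ J ∈ F, ‖pairing (Ψ I) (Ψ J)‖ₑ +
        ∑ J ∈ F, ‖β J‖ₑ ^ 2 * ∑ I ∈ F, ‖pairing (Ψ J) (Ψ I)‖ₑ := by
        simp_rw [add_mul, Finset.sum_add_distrib, Finset.mul_sum]
        congr 1
        rw [Finset.sum_comm]
        simp_rw [fun I J => enorm_pairing_comm (Ψ I) (Ψ J)]
    _ = 2 * ∑ I ∈ F, ‖β I‖ₑ ^ 2 * ∑ J ∈ F, ‖pairing (Ψ I) (Ψ J)‖ₑ := by ring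
    _ ≤ 2 * ∑ I ∈ F, ‖β I‖ₑ ^ 2 *
        (64 * shiftSum ^ 2 * scaleSum * ENNReal.ofReal (K ^ 2) * ENNReal.ofReal I.length) := by
        gcongr with I hI
        exact hS I
    _ = _ := by
        unfold besselConst
        rw [Finset.mul_sum, Finset.mul_sum]
        refine Finset.sum_congr rfl fun I _ => ?_
        ring

theorem lintegral_mul_sq_le {g h : ℝ → ℝ≥0∞} (hg : AEMeasurable g) (hh : AEMeasurable h) :
    (∫⁻ x, g x * h x) ^ 2 ≤ (∫⁻ x, g x ^ 2) * ∫⁻ x, h x ^ 2 := by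
  have h1 := ENNReal.lintegral_mul_le_Lp_mul_Lq volume Real.HolderConjugate.two_two hg hh
  simp only [Pi.mul_apply, ENNReal.rpow_two] at h1
  calc (∫⁻ x, g x * h x) ^ 2
      ≤ ((∫⁻ x, g x ^ 2) ^ (1 / 2 : ℝ) * (∫⁻ x, h x ^ 2) ^ (1 / 2 : ℝ)) ^ 2 := by gcongr
    _ = _ := by
      rw [mul_pow, ← ENNReal.rpow_natCast, ← ENNReal.rpow_natCast, ← ENNReal.rpow_mul,
        ← ENNReal.rpow_mul]
      norm_num

/-- The estimate dual to `lintegral_sum_bump_sq_le`. With `a_I` the coefficients, the sum `A` over a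
finite set is the pairing of `f` with `∑ a_I Ψ_I`, so that Cauchy–Schwarz gives `A² ≤ C ‖f‖² A`, and
`A` is finite. -/
theorem tsum_coef_sq_le {Ψ : DyadicInterval → ℝ → ℂ} (hΨ : ∀ I, Bump K 5 I (Ψ I))
    (h0 : HasMeanZero Ψ) {f : ℝ → ℂ} (hf : Measurable f) :
    ∑' I, ENNReal.ofReal I.length * ‖coef I (Ψ I) f‖ₑ ^ 2 ≤
      besselConst * ENNReal.ofReal (K ^ 2) * ∫⁻ x, ‖f x‖ₑ ^ 2 := by
  rcases eq_or_ne (∫⁻ x, ‖f x‖ₑ ^ 2) ∞ with htop | hfin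
  -- If `f` is not square integrable, the right side is infinite unless `K = 0`, and in that case
  -- all bumps vanish.
  · rcases eq_or_ne (besselConst * ENNReal.ofReal (K ^ 2)) 0 with hz | hnz
    · have hK : K = 0 := by
        rcases mul_eq_zero.1 hz with h | h
        · exfalso
          unfold besselConst at h
          have h1 : shiftSum ≠ 0 := by
            unfold shiftSum
            intro h
            have := ENNReal.tsum_eq_zero.1 h 0
            simp at this
          have h2 : scaleSum ≠ 0 := by
            unfold scaleSum
            intro h
            have := ENNReal.tsum_eq_zero.1 h 0
            simp at this
          simp [h1, h2] at h
        · have h1 := (hΨ (0, 0)).nonneg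
          rw [ENNReal.ofReal_eq_zero] at h
          nlinarith
      have hz : ∀ I, coef I (Ψ I) f = 0 := by
        intro I
        have h1 : ∀ x, Ψ I x = 0 := fun x => by
          have := (hΨ I).norm_le x
          rw [hK] at this
          simpa using this
        simp [coef, pairing, h1]
      simp [hz]
    · rw [htop, ENNReal.mul_top hnz]; exact le_top
  rw [ENNReal.tsum_eq_iSup_sum]
  refine iSup_le fun F => ?_
  set a : DyadicInterval → ℂ := fun I => coef I (Ψ I) f with ha
  set A : ℝ≥0∞ := ∑ I ∈ F, ENNReal.ofReal I.length * ‖a I‖ₑ ^ 2 with hA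
  have hAfin : A ≠ ∞ := ENNReal.sum_ne_top.2 fun I _ =>
    ENNReal.mul_ne_top ENNReal.ofReal_ne_top (ENNReal.pow_ne_top enorm_ne_top)
  set T : ℝ → ℂ := fun x => ∑ I ∈ F, a I * Ψ I x with hT
  have hTm : Measurable T := Finset.measurable_fun_sum _ fun I _ =>
    (hΨ I).continuous.measurable.const_mul _
  have hint : ∀ I, Integrable fun x => f x * conj (Ψ I x) := by
    intro I
    refine ⟨(hf.mul (Complex.continuous_conj.comp (hΨ I).continuous).measurable).aestronglyMeasurable,
      ?_⟩
    refine lt_of_le_of_lt (b := ∫⁻ x, ‖f x‖ₑ ^ 2 + ‖Ψ I x‖ₑ ^ 2) (lintegral_mono fun x => ?_) ?_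
    · rw [enorm_mul, RCLike.enorm_conj]
      exact mul_le_sq_add_sq _ _
    · rw [lintegral_add_left (hf.enorm.pow_const 2)]
      refine ENNReal.add_lt_top.2 ⟨hfin.lt_top, ?_⟩
      have h1 := ((hΨ I).integrable_mul_conj (by norm_num) (hΨ I)).2
      refine lt_of_le_of_lt (lintegral_mono fun x => ?_) h1
      rw [enorm_mul, RCLike.enorm_conj, sq]
  have e1 : A = ‖∑ I ∈ F, conj (a I) * pairing f (Ψ I)‖ₑ := by
    have h1 : ∀ I, conj (a I) * pairing f (Ψ I) = ((I.length * ‖a I‖ ^ 2 : ℝ) : ℂ) := by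
      intro I
      have hI := I.length_pos
      have h2 : pairing f (Ψ I) = (I.length : ℂ) * a I := by
        rw [ha]
        simp only [coef]
        rw [← mul_assoc, ← Complex.ofReal_mul, mul_inv_cancel₀ hI.ne']; simp
      rw [h2, mul_left_comm, mul_comm (conj (a I)), Complex.mul_conj, Complex.normSq_eq_norm_sq]
      push_cast; ring
    simp_rw [h1]
    rw [← Complex.ofReal_sum, ← ofReal_norm, Complex.norm_real, Real.norm_of_nonneg
      (Finset.sum_nonneg fun I _ => by have := I.length_pos; positivity),
      ENNReal.ofReal_sum_of_nonneg fun I _ => by have := I.length_pos; positivity]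
    refine Finset.sum_congr rfl fun I _ => ?_
    rw [ENNReal.ofReal_mul I.length_pos.le, ENNReal.ofReal_pow (norm_nonneg _), ofReal_norm]
  have e2 : ∑ I ∈ F, conj (a I) * pairing f (Ψ I) = ∫ x, f x * conj (T x) := by
    have h1 : ∀ x, f x * conj (T x) = ∑ I ∈ F, conj (a I) * (f x * conj (Ψ I x)) := by
      intro x
      rw [hT]
      simp only [map_sum, map_mul]
      rw [Finset.mul_sum]
      exact Finset.sum_congr rfl fun I _ => by ring
    simp_rw [h1]
    rw [integral_finsetSum _ fun I _ => (hint I).const_mul _]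
    refine Finset.sum_congr rfl fun I _ => ?_
    rw [integral_const_mul]; rfl
  have e3 : A ≤ ∫⁻ x, ‖f x‖ₑ * ‖T x‖ₑ := by
    rw [e1, e2]
    exact enorm_pairing_le f T
  have e4 : A ^ 2 ≤ (∫⁻ x, ‖f x‖ₑ ^ 2) * (besselConst * ENNReal.ofReal (K ^ 2) * A) := by
    calc A ^ 2 ≤ (∫⁻ x, ‖f x‖ₑ * ‖T x‖ₑ) ^ 2 := by gcongr
      _ ≤ _ := lintegral_mul_sq_le hf.enorm.aemeasurable hTm.enorm.aemeasurable
      _ ≤ _ := by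
        gcongr
        exact lintegral_sum_bump_sq_le hΨ h0 F a
  rcases eq_or_ne A 0 with h | h
  · rw [h]; exact zero_le
  · rw [sq, ← mul_assoc] at e4
    have := (ENNReal.mul_le_mul_iff_left h hAfin).1 e4
    rwa [mul_comm] at this

end Paraproduct

namespace Paraproduct

open DyadicInterval

/-! ### Sums over the dyadic intervals that contain a point -/

/-- The function `∑_{I ∋ x} u(I)`. -/
noncomputable def tower (u : DyadicInterval → ℝ≥0∞) (x : ℝ) : ℝ≥0∞ :=
  ∑' I : DyadicInterval, I.toSet.indicator (fun _ => u I) x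

theorem measurable_tower (u : DyadicInterval → ℝ≥0∞) : Measurable (tower u) :=
  Measurable.tsum fun I => measurable_const.indicator (measurableSet_toSet I)

theorem lintegral_tower (u : DyadicInterval → ℝ≥0∞) :
    ∫⁻ x, tower u x = ∑' I : DyadicInterval, ENNReal.ofReal I.length * u I := by
  unfold tower
  rw [lintegral_tsum fun I => (measurable_const.indicator (measurableSet_toSet I)).aemeasurable]
  refine tsum_congr fun I => ?_
  rw [lintegral_indicator (measurableSet_toSet I), setLIntegral_const, volume_toSet, mul_comm]

theorem tower_mono {u v : DyadicInterval → ℝ≥0∞} {x : ℝ} (h : ∀ I, x ∈ I.toSet → u I ≤ v I) :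
    tower u x ≤ tower v x := by
  refine ENNReal.tsum_le_tsum fun I => ?_
  by_cases hx : x ∈ I.toSet
  · rw [Set.indicator_of_mem hx, Set.indicator_of_mem hx]; exact h I hx
  · rw [Set.indicator_of_notMem hx]; exact zero_le

theorem tower_add (u v : DyadicInterval → ℝ≥0∞) (x : ℝ) :
    tower (fun I => u I + v I) x = tower u x + tower v x := by
  unfold tower
  rw [← ENNReal.tsum_add]
  refine tsum_congr fun I => ?_
  by_cases hx : x ∈ I.toSet <;> simp [hx]

theorem tower_const_mul (c : ℝ≥0∞) (u : DyadicInterval → ℝ≥0∞) (x : ℝ) :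
    tower (fun I => c * u I) x = c * tower u x := by
  unfold tower
  rw [← ENNReal.tsum_mul_left]
  refine tsum_congr fun I => ?_
  by_cases hx : x ∈ I.toSet <;> simp [hx]

theorem tsum_sq_le_sq_tsum {ι : Type*} (a : ι → ℝ≥0∞) : ∑' i, a i ^ 2 ≤ (∑' i, a i) ^ 2 := by
  rw [sq, ← ENNReal.tsum_mul_right]
  refine ENNReal.tsum_le_tsum fun i => ?_
  rw [sq]
  gcongr
  exact ENNReal.le_tsum i

theorem tower_sq_le (u : DyadicInterval → ℝ≥0∞) (x : ℝ) :
    tower (fun I => u I ^ 2) x ≤ tower u x ^ 2 := by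
  refine le_trans (ENNReal.tsum_le_tsum fun I => ?_) (tsum_sq_le_sq_tsum _)
  by_cases hx : x ∈ I.toSet <;> simp [hx]

/-! ### The Calderón–Zygmund decomposition -/

/-- The intervals of `S` are the maximal ones with mean of `|f|` above `t`; on them `g` is the mean
of `f`. The parent of such an interval violates the condition, hence the factor two. Elsewhere `|f|
≤ t` almost everywhere by Lebesgue differentiation. -/
theorem exists_calderonZygmund {f : ℝ → ℂ} (hf : Measurable f) (hfin : ∫⁻ x, ‖f x‖ₑ ≠ ∞)
    {t : ℝ≥0} (ht : 0 < t) : ∃ (S : Set DyadicInterval) (g : ℝ → ℂ),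
      S.PairwiseDisjoint toSet ∧ Measurable g ∧ (∀ᵐ x, ‖g x‖ₑ ≤ 2 * t) ∧
      ∫⁻ x, ‖g x‖ₑ ≤ ∫⁻ x, ‖f x‖ₑ ∧
      t * ∑' Q : S, volume (Q : DyadicInterval).toSet ≤ ∫⁻ x, ‖f x‖ₑ ∧
      (∀ x, x ∉ ⋃ Q ∈ S, Q.toSet → g x = f x) ∧
      ∀ Q ∈ S, ∫ x in Q.toSet, (f x - g x) = 0 := by
  classical
  have hint : Integrable f := ⟨hf.aestronglyMeasurable, hfin.lt_top⟩
  let bad : DyadicInterval → Prop := fun Q =>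
    (t : ℝ≥0∞) * ENNReal.ofReal Q.length < ∫⁻ x in Q.toSet, ‖f x‖ₑ
  let S : Set DyadicInterval := {Q | bad Q ∧ ∀ R : DyadicInterval, Q.toSet ⊆ R.toSet → bad R → R = Q}
  have hdisj : S.PairwiseDisjoint toSet := by
    intro Q hQ R hR hne
    rw [Function.onFun, Set.disjoint_left]
    intro x hxQ hxR
    rcases le_total Q.2 R.2 with h | h
    · exact hne (hQ.2 R (toSet_subset_of_mem hxQ hxR h) hR.1).symm
    · exact hne (hR.2 Q (toSet_subset_of_mem hxR hxQ h) hQ.1)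
  have hcover : ∀ x, ∀ Q : DyadicInterval, x ∈ Q.toSet → bad Q → ∃ R ∈ S, x ∈ R.toSet := by
    intro x Q hx hQ
    -- A bad interval has length less than `‖f‖₁ / t`, so maximal ones exist.
    have hbdd : ∃ b : ℤ, ∀ k : ℤ, bad (around x k) → k ≤ b := by
      obtain ⟨n, hn⟩ := pow_unbounded_of_one_lt ((∫⁻ x, ‖f x‖ₑ).toReal / t) (one_lt_two)
      refine ⟨n, fun k hk => ?_⟩
      by_contra hc
      rw [not_le] at hc
      have h1 : (t : ℝ≥0∞) * ENNReal.ofReal ((2 : ℝ) ^ k) < ∫⁻ x, ‖f x‖ₑ :=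
        lt_of_lt_of_le hk (setLIntegral_le_lintegral _ _)
      rw [← ENNReal.ofReal_coe_nnreal, ← ENNReal.ofReal_mul (NNReal.coe_nonneg t),
        ENNReal.ofReal_lt_iff_lt_toReal (by positivity) hfin] at h1
      have ht' : (0 : ℝ) < t := ht
      rw [div_lt_iff₀ ht'] at hn
      have h2 : (2 : ℝ) ^ n ≤ (2 : ℝ) ^ k := by
        rw [← zpow_natCast]
        exact zpow_le_zpow_right₀ (by norm_num) hc.le
      nlinarith
    obtain ⟨k, hk, hmax⟩ := Int.exists_greatest_of_bdd hbdd
      ⟨Q.2, by rw [← eq_around hx]; exact hQ⟩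
    refine ⟨around x k, ⟨hk, fun R hR hbR => ?_⟩, mem_around x k⟩
    have hxR := hR (mem_around x k)
    have h1 := snd_le_of_subset hR
    have h2 := hmax R.2 (by rw [← eq_around hxR]; exact hbR)
    exact eq_of_mem hxR (mem_around x k) (le_antisymm h2 h1)
  let c : DyadicInterval → ℂ := fun Q => ((Q.length⁻¹ : ℝ) : ℂ) * ∫ x in Q.toSet, f x
  have hc : ∀ Q, ENNReal.ofReal Q.length * ‖c Q‖ₑ ≤ ∫⁻ x in Q.toSet, ‖f x‖ₑ := by
    intro Q
    have hQ := Q.length_pos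
    have e : ‖c Q‖ₑ = (ENNReal.ofReal Q.length)⁻¹ * ‖∫ x in Q.toSet, f x‖ₑ := by
      simp only [c]
      rw [enorm_mul, ← ofReal_norm ((Q.length⁻¹ : ℝ) : ℂ), Complex.norm_real,
        Real.norm_of_nonneg (by positivity), ENNReal.ofReal_inv_of_pos hQ]
    rw [e, ← mul_assoc, ENNReal.mul_inv_cancel (ofReal_length_ne_zero Q) ENNReal.ofReal_ne_top,
      one_mul]
    exact enorm_integral_le_lintegral_enorm _
  set Ω : Set ℝ := ⋃ Q ∈ S, Q.toSet with hΩ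
  have hScount : S.Countable := Set.to_countable S
  have hΩm : MeasurableSet Ω := MeasurableSet.biUnion hScount fun Q _ => measurableSet_toSet Q
  let g : ℝ → ℂ := fun x => Ωᶜ.indicator f x +
    ∑' Q : DyadicInterval, (if Q ∈ S then Q.toSet.indicator (fun _ => c Q) x else 0)
  have hgm : Measurable g := by
    refine (hf.indicator hΩm.compl).add (Measurable.tsum fun Q => ?_)
    by_cases hQ : Q ∈ S
    · simp only [hQ, if_true]
      exact measurable_const.indicator (measurableSet_toSet Q)
    · simp only [hQ, if_false]
      exact measurable_const
  have hgS : ∀ Q ∈ S, ∀ x ∈ Q.toSet, g x = c Q := by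
    intro Q hQ x hx
    have hxΩ : x ∈ Ω := Set.mem_biUnion hQ hx
    simp only [g]
    rw [Set.indicator_of_notMem (by simpa using hxΩ), zero_add, tsum_eq_single Q]
    · rw [if_pos hQ, Set.indicator_of_mem hx]
    · intro R hR
      by_cases hRS : R ∈ S
      · rw [if_pos hRS, Set.indicator_of_notMem]
        intro hxR
        exact Set.disjoint_left.1 (hdisj hQ hRS (Ne.symm hR)) hx hxR
      · rw [if_neg hRS]
  have hgΩ : ∀ x, x ∉ Ω → g x = f x := by
    intro x hx
    simp only [g]
    rw [Set.indicator_of_mem (by simpa using hx)]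
    have : ∀ Q : DyadicInterval, (if Q ∈ S then Q.toSet.indicator (fun _ => c Q) x else 0) = 0 := by
      intro Q
      by_cases hQ : Q ∈ S
      · rw [if_pos hQ, Set.indicator_of_notMem]
        exact fun hxQ => hx (Set.mem_biUnion hQ hxQ)
      · rw [if_neg hQ]
    simp [this]
  have hcS : ∀ Q ∈ S, ‖c Q‖ₑ ≤ 2 * t := by
    intro Q hQ
    -- The dyadic parent of `Q`.
    set R := around Q.center (Q.2 + 1) with hR
    have hQR : Q.toSet ⊆ R.toSet :=
      toSet_subset_of_mem Q.center_mem (mem_around _ _) (by rw [hR]; exact (by simp [around]))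
    have hRl : R.length = 2 * Q.length := by
      rw [length_eq_mul Q R, hR]
      simp [around]
    have hnb : ¬ bad R := by
      intro hb
      have := hQ.2 R hQR hb
      have h2 : R.2 = Q.2 + 1 := rfl
      rw [this] at h2
      omega
    have h1 : ENNReal.ofReal Q.length * ‖c Q‖ₑ ≤ ENNReal.ofReal Q.length * (2 * t) := by
      refine (hc Q).trans ((lintegral_mono_set hQR).trans ((not_lt.1 hnb).trans (le_of_eq ?_)))
      rw [hRl, ENNReal.ofReal_mul (by norm_num), ENNReal.ofReal_ofNat]
      ring
    exact (ENNReal.mul_le_mul_iff_right (ofReal_length_ne_zero Q) ENNReal.ofReal_ne_top).1 h1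
  have hsplit : ∀ h : ℝ → ℝ≥0∞, ∫⁻ x, h x =
      (∑' Q : S, ∫⁻ x in (Q : DyadicInterval).toSet, h x) + ∫⁻ x in Ωᶜ, h x := by
    intro h
    rw [← lintegral_biUnion hScount (fun Q _ => measurableSet_toSet Q) hdisj,
      lintegral_add_compl h hΩm]
  refine ⟨S, g, hdisj, hgm, ?_, ?_, ?_, hgΩ, ?_⟩
  · have hleb := IsUnifLocDoublingMeasure.ae_tendsto_average (volume : Measure ℝ)
      hint.norm.locallyIntegrable 1
    filter_upwards [hleb] with x hx
    by_cases hxΩ : x ∈ Ω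
    · obtain ⟨Q, hQ, hxQ⟩ := Set.mem_iUnion₂.1 hxΩ
      rw [hgS Q hQ x hxQ]
      exact hcS Q hQ
    · rw [hgΩ x hxΩ]
      have hgood : ∀ k, ¬ bad (around x k) := fun k hb => by
        obtain ⟨R, hR, hxR⟩ := hcover x _ (mem_around x k) hb
        exact hxΩ (Set.mem_biUnion hR hxR)
      have hδ : Tendsto (fun n : ℕ => (around x (-(n : ℤ))).length / 2) atTop (𝓝[>] 0) := by
        refine tendsto_nhdsWithin_iff.2 ⟨?_, Eventually.of_forall fun n => ?_⟩
        · have h1 : ∀ n : ℕ, (around x (-(n : ℤ))).length / 2 = (1 / 2) ^ n / 2 := fun n => by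
            simp [around, DyadicInterval.length]
          simp_rw [h1]
          have := (tendsto_pow_atTop_nhds_zero_of_lt_one (r := (1 / 2 : ℝ)) (by norm_num)
            (by norm_num)).div_const 2
          simpa using this
        · exact half_pos (length_pos _)
      -- The dyadic intervals around `x`, up to an endpoint, are balls that contain `x` but need not
      -- be centered there; the differentiation theorem is used in this form.
      have hlim := hx (fun n : ℕ => (around x (-(n : ℤ))).center)
        (fun n : ℕ => (around x (-(n : ℤ))).length / 2) hδ (Eventually.of_forall fun n => by
          rw [one_mul, Metric.mem_closedBall, Real.dist_eq]
          exact abs_sub_center_le (mem_around x _))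
      have hbound : ∀ n : ℕ, (⨍ y in Metric.closedBall (around x (-(n : ℤ))).center
          ((around x (-(n : ℤ))).length / 2), ‖f y‖) ≤ t := by
        intro n
        set I := around x (-(n : ℤ))
        have hI := I.length_pos
        have hset : Metric.closedBall I.center (I.length / 2) =
            Set.Icc ((I.1 : ℝ) * (2 : ℝ) ^ I.2) (((I.1 : ℝ) + 1) * (2 : ℝ) ^ I.2) := by
          rw [Real.closedBall_eq_Icc]
          unfold DyadicInterval.center DyadicInterval.length
          congr 1 <;> ring
        have hae : I.toSet =ᵐ[volume] Metric.closedBall I.center (I.length / 2) := by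
          rw [hset]; exact Ico_ae_eq_Icc
        rw [setAverage_eq, ← setIntegral_congr_set hae]
        have hv : volume.real (Metric.closedBall I.center (I.length / 2)) = I.length := by
          rw [measureReal_def, ← measure_congr hae, volume_toSet, ENNReal.toReal_ofReal hI.le]
        rw [hv, smul_eq_mul, inv_mul_le_iff₀ hI]
        have h1 := not_lt.1 (hgood (-(n : ℤ)))
        rw [integral_norm_eq_lintegral_enorm hf.aestronglyMeasurable]
        refine ENNReal.toReal_le_of_le_ofReal (by positivity) (h1.trans (le_of_eq ?_))
        rw [mul_comm, ENNReal.ofReal_mul hI.le, ENNReal.ofReal_coe_nnreal]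
      have h2 := le_of_tendsto' hlim hbound
      have h3 : ‖f x‖ₑ ≤ t := by
        rw [← ofReal_norm, ← ENNReal.ofReal_coe_nnreal]
        exact ENNReal.ofReal_le_ofReal h2
      refine h3.trans ?_
      rw [two_mul]; exact le_self_add
  · rw [hsplit fun x => ‖g x‖ₑ, hsplit fun x => ‖f x‖ₑ]
    refine add_le_add (ENNReal.tsum_le_tsum fun Q => ?_) (le_of_eq ?_)
    · rw [setLIntegral_congr_fun (measurableSet_toSet _)
        (fun x hx => by simp only [hgS Q Q.2 x hx] : Set.EqOn (fun x => ‖g x‖ₑ) (fun _ => ‖c Q‖ₑ) _),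
        setLIntegral_const, volume_toSet, mul_comm]
      exact hc Q
    · exact setLIntegral_congr_fun hΩm.compl fun x hx => by simp only [hgΩ x hx]
  · rw [← ENNReal.tsum_mul_left]
    refine le_trans (ENNReal.tsum_le_tsum fun Q => ?_) (le_of_le_of_eq le_self_add
      (hsplit fun x => ‖f x‖ₑ).symm)
    rw [volume_toSet]
    exact Q.2.1.le
  · intro Q hQ
    have hQl := Q.length_pos
    rw [setIntegral_congr_fun (measurableSet_toSet Q)
      (fun x hx => by simp only [hgS Q hQ x hx] : Set.EqOn (fun x => f x - g x) (fun x => f x - c Q) _),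
      integral_sub hint.integrableOn, setIntegral_const, measureReal_def, volume_toSet,
      ENNReal.toReal_ofReal hQl.le]
    · simp only [c]
      rw [Complex.real_smul, ← mul_assoc, ← Complex.ofReal_mul, mul_inv_cancel₀ hQl.ne']
      simp
    · refine integrableOn_const ?_
      rw [volume_toSet]; exact ENNReal.ofReal_ne_top

/-! ### The weak type (1,1) bound for the square function -/

/-- An atom `b` on `Q` tested against bumps of intervals not inside the triple. Intervals not longer
than `Q` are then disjoint from the triple, and the decay of the bump gives the geometric factor;
for longer intervals it comes from the mean zero of `b`. The pairings are summable without squares.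
-/
theorem tsum_atom_le {Ψ : DyadicInterval → ℝ → ℂ} (hΨ : ∀ I, Bump 1 5 I (Ψ I))
    {b : ℝ → ℂ} {Q : DyadicInterval} (hb : IntegrableOn b Q.toSet)
    (h0 : ∫ x in Q.toSet, b x = 0) :
    ∑' I : DyadicInterval, {I : DyadicInterval | ¬ I.toSet ⊆ Q.triple}.indicator
      (fun I => ‖∫ x in Q.toSet, b x * conj (Ψ I x)‖ₑ) I ≤
      8 * shiftSum * scaleSum * ∫⁻ x in Q.toSet, ‖b x‖ₑ := by
  have hQ := Q.length_pos
  have hbe := hb.1.enorm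
  have key : ∀ k : ℤ, ∑' j : ℤ, {I : DyadicInterval | ¬ I.toSet ⊆ Q.triple}.indicator
      (fun I => ‖∫ x in Q.toSet, b x * conj (Ψ I x)‖ₑ) (j, k) ≤
      (8 * shiftSum * ∫⁻ x in Q.toSet, ‖b x‖ₑ) * (1 / 2 : ℝ≥0∞) ^ (k - Q.2).natAbs := by
    intro k
    rcases le_or_gt k Q.2 with hk | hk
    · calc _ ≤ ∑' j : ℤ, ∫⁻ x in Q.toSet, ‖b x‖ₑ * ((1 / 2 : ℝ≥0∞) ^ (k - Q.2).natAbs *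
            ENNReal.ofReal ((weight ((j, k) : DyadicInterval) x ^ 2)⁻¹)) := by
            refine ENNReal.tsum_le_tsum fun j => ?_
            set I : DyadicInterval := (j, k) with hI
            by_cases hsub : I.toSet ⊆ Q.triple
            · rw [Set.indicator_of_notMem (by simpa using hsub)]; exact zero_le
            rw [Set.indicator_of_mem (by simpa using hsub)]
            have hd := (toSet_subset_triple_or_disjoint (I := I) (J := Q) hk).resolve_left hsub
            refine (enorm_integral_le_lintegral_enorm _).trans
              (setLIntegral_mono' (measurableSet_toSet Q) fun y hy => ?_)
            rw [enorm_mul, RCLike.enorm_conj]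
            gcongr
            have hIl := I.length_pos
            have h1 := length_le_of_notMem_triple
              (Set.disjoint_left.1 hd I.center_mem) hy
            -- One power of the weight yields the factor `|I| / |Q|`, and two more are kept for the
            -- sum over the positions.
            have h2 : Q.length / I.length ≤ I.weight y := by
              unfold weight
              rw [abs_sub_comm] at h1
              have : Q.length / I.length ≤ |y - I.center| / I.length := by gcongr
              linarith
            rw [show (k - Q.2).natAbs = (Q.2 - I.2).natAbs by rw [hI]; omega,
              ← ofReal_length_div (I := I) (J := Q) hk,
              ← ENNReal.ofReal_mul (by positivity), ← ofReal_norm]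
            refine ENNReal.ofReal_le_ofReal ?_
            have hw := I.weight_pos y
            refine (((hΨ I).mono le_rfl (by norm_num : 3 ≤ 5)).bound y).trans ?_
            rw [one_mul, pow_succ, mul_inv, mul_comm]
            gcongr
            rw [← inv_div]
            gcongr
        _ = (∫⁻ x in Q.toSet, ‖b x‖ₑ * ((1 / 2 : ℝ≥0∞) ^ (k - Q.2).natAbs *
            ∑' j : ℤ, ENNReal.ofReal ((weight ((j, k) : DyadicInterval) x ^ 2)⁻¹))) := by
            have hm : ∀ j : ℤ, AEMeasurable (fun x => ‖b x‖ₑ * ((1 / 2 : ℝ≥0∞) ^ (k - Q.2).natAbs *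
                ENNReal.ofReal ((weight ((j, k) : DyadicInterval) x ^ 2)⁻¹)))
                (volume.restrict Q.toSet) := fun j => hbe.mul
              ((measurable_inv_weight _).const_mul _).aemeasurable
            rw [← lintegral_tsum hm]
            refine lintegral_congr fun x => ?_
            rw [ENNReal.tsum_mul_left, ENNReal.tsum_mul_left]
        _ ≤ (∫⁻ x in Q.toSet, ‖b x‖ₑ * ((1 / 2 : ℝ≥0∞) ^ (k - Q.2).natAbs * (8 * shiftSum))) := by
            gcongr with x
            refine (tsum_inv_weight_sq_le k x).trans ?_
            gcongr; norm_num
        _ = _ := by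
            rw [lintegral_mul_const'' _ hbe]; ring
    · have hsup : ∀ j : ℤ, ‖∫ x in Q.toSet, b x * conj (Ψ (j, k) x)‖ₑ ≤
          2 * (1 / 2 : ℝ≥0∞) ^ (k - Q.2).natAbs * (∫⁻ x in Q.toSet, ‖b x‖ₑ) *
            ENNReal.ofReal ((weight ((j, k) : DyadicInterval) Q.center ^ 2)⁻¹) := by
        intro j
        set I : DyadicInterval := (j, k) with hI
        have hIl := I.length_pos
        have hw := I.weight_pos Q.center
        have hbi : IntegrableOn (fun x => b x * conj (Ψ I x)) Q.toSet :=
          hb.mul_bdd (c := 1) (Complex.continuous_conj.comp (hΨ I).continuous).aestronglyMeasurable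
            (ae_of_all _ fun x => by simpa using (hΨ I).norm_le x)
        have e : ∫ x in Q.toSet, b x * conj (Ψ I x) =
            ∫ x in Q.toSet, b x * (conj (Ψ I x) - conj (Ψ I Q.center)) := by
          simp_rw [mul_sub]
          rw [integral_sub hbi (hb.mul_const _), integral_mul_const, h0, zero_mul, sub_zero]
        rw [e]
        calc _ ≤ ∫⁻ x in Q.toSet, ‖b x * (conj (Ψ I x) - conj (Ψ I Q.center))‖ₑ :=
              enorm_integral_le_lintegral_enorm _
          _ ≤ ∫⁻ x in Q.toSet, ‖b x‖ₑ * ENNReal.ofReal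
              (2 * (Q.length / I.length) * (I.weight Q.center ^ 2)⁻¹) := by
              refine setLIntegral_mono' (measurableSet_toSet Q) fun y hy => ?_
              rw [enorm_mul, ← map_sub, RCLike.enorm_conj]
              gcongr
              rw [← ofReal_norm]
              refine ENNReal.ofReal_le_ofReal
                (((hΨ I).norm_sub_le (I := Q) (by norm_num) hk.le y Q.center).trans ?_)
              have h1 := abs_sub_center_le hy
              have h2 : |y - Q.center| / Q.length ≤ 1 / 2 := by
                rw [div_le_iff₀ hQ]; linarith
              have h3 : (1 + |y - Q.center| / Q.length) ^ 2 ≤ 4 := by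
                have : 0 ≤ |y - Q.center| / Q.length := by positivity
                nlinarith
              calc 1 * I.length⁻¹ * |y - Q.center| * ((I.weight Q.center ^ 2)⁻¹ *
                    (1 + |y - Q.center| / Q.length) ^ 2)
                  ≤ 1 * I.length⁻¹ * (Q.length / 2) * ((I.weight Q.center ^ 2)⁻¹ * 4) := by gcongr
                _ = _ := by field_simp; norm_num
          _ = _ := by
              rw [lintegral_mul_const'' _ hbe, ENNReal.ofReal_mul (by positivity),
                ENNReal.ofReal_mul (by positivity), ofReal_length_div (J := I) hk.le,
                ENNReal.ofReal_ofNat, hI]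
              ring
      calc _ ≤ ∑' j : ℤ, 2 * (1 / 2 : ℝ≥0∞) ^ (k - Q.2).natAbs * (∫⁻ x in Q.toSet, ‖b x‖ₑ) *
            ENNReal.ofReal ((weight ((j, k) : DyadicInterval) Q.center ^ 2)⁻¹) := by
            refine ENNReal.tsum_le_tsum fun j => ?_
            by_cases hsub : ((j, k) : DyadicInterval) ∈ {I : DyadicInterval | ¬ I.toSet ⊆ Q.triple}
            · rw [Set.indicator_of_mem hsub]; exact hsup j
            · rw [Set.indicator_of_notMem hsub]; exact zero_le
        _ ≤ 2 * (1 / 2 : ℝ≥0∞) ^ (k - Q.2).natAbs * (∫⁻ x in Q.toSet, ‖b x‖ₑ) *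
            (4 * shiftSum) := by
            rw [ENNReal.tsum_mul_left]
            gcongr
            exact tsum_inv_weight_sq_le k _
        _ = _ := by ring
  refine (tsum_le_of_scale key).trans (le_of_eq (by ring))

/-- The constant in the weak type bound for square functions. -/
noncomputable def squareConst : ℝ≥0∞ := 8 * besselConst + 3 + 32 * shiftSum * scaleSum

theorem squareConst_ne_top : squareConst ≠ ∞ := by
  unfold squareConst
  refine ENNReal.add_ne_top.2 ⟨ENNReal.add_ne_top.2 ⟨ENNReal.mul_ne_top (by simp)
    besselConst_ne_top, by simp⟩, ?_⟩
  exact ENNReal.mul_ne_top (ENNReal.mul_ne_top (by simp) shiftSum_ne_top) scaleSum_ne_top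

theorem coef_add {I : DyadicInterval} {ψ f g : ℝ → ℂ} (hf : Integrable fun x => f x * conj (ψ x))
    (hg : Integrable fun x => g x * conj (ψ x)) :
    coef I ψ (fun x => f x + g x) = coef I ψ f + coef I ψ g := by
  unfold coef pairing
  simp_rw [add_mul]
  rw [integral_add hf hg, mul_add]

theorem enorm_add_sq_le (a b : ℂ) : ‖a + b‖ₑ ^ 2 ≤ 2 * ‖a‖ₑ ^ 2 + 2 * ‖b‖ₑ ^ 2 := by
  have h : ‖a + b‖ ^ 2 ≤ 2 * ‖a‖ ^ 2 + 2 * ‖b‖ ^ 2 := by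
    have h1 := norm_add_le a b
    have h2 := norm_nonneg (a + b)
    nlinarith [sq_nonneg (‖a‖ - ‖b‖)]
  have h2 := ENNReal.ofReal_le_ofReal h
  rw [ENNReal.ofReal_add (by positivity) (by positivity), ENNReal.ofReal_mul (by norm_num),
    ENNReal.ofReal_mul (by norm_num), ENNReal.ofReal_pow (norm_nonneg _),
    ENNReal.ofReal_pow (norm_nonneg _), ENNReal.ofReal_pow (norm_nonneg _), ENNReal.ofReal_ofNat,
    ofReal_norm, ofReal_norm, ofReal_norm] at h2
  exact h2

/-- The Calderón–Zygmund argument at height `t`. The good part is handled by Chebyshev's inequality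
and the `L²` bound. For the bad part, if `x` lies outside all triples, an interval containing `x` is
contained in no triple, so `tsum_atom_le` controls an `ℓ¹` sum, which dominates the `ℓ²` sum. -/
theorem mul_meas_lt_tower_le_one {Ψ : DyadicInterval → ℝ → ℂ} (hΨ : ∀ I, Bump 1 5 I (Ψ I))
    (h0 : HasMeanZero Ψ) {f : ℝ → ℂ} (hf : Measurable f) (t : ℝ≥0) :
    (t : ℝ≥0∞) * volume {x | (t : ℝ≥0∞) ^ 2 < tower (fun I => ‖coef I (Ψ I) f‖ₑ ^ 2) x} ≤
      squareConst * ∫⁻ x, ‖f x‖ₑ := by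
  rcases eq_or_ne (∫⁻ x, ‖f x‖ₑ) ∞ with htop | hfin
  · rw [htop, ENNReal.mul_top]
    · exact le_top
    · unfold squareConst; simp
  rcases eq_or_lt_of_le (zero_le : 0 ≤ t) with rfl | ht
  · simp
  have ht0 : (t : ℝ≥0∞) ≠ 0 := by exact_mod_cast ht.ne'
  have htt : (t : ℝ≥0∞) ≠ ∞ := ENNReal.coe_ne_top
  obtain ⟨S, g, hdisj, hgm, hgb, hgL1, hvol, hgΩ, hmz⟩ := exists_calderonZygmund hf hfin ht
  set Ω : Set ℝ := ⋃ Q ∈ S, Q.toSet with hΩ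
  have hScount : S.Countable := Set.to_countable S
  have hΩm : MeasurableSet Ω := MeasurableSet.biUnion hScount fun Q _ => measurableSet_toSet Q
  set b : ℝ → ℂ := fun x => f x - g x with hb
  have hfi : Integrable f := ⟨hf.aestronglyMeasurable, hfin.lt_top⟩
  have hgi : Integrable g := ⟨hgm.aestronglyMeasurable, hgL1.trans_lt hfin.lt_top⟩
  have hbi : Integrable b := hfi.sub hgi
  have hmulconj : ∀ {h : ℝ → ℂ}, Integrable h → ∀ I, Integrable fun x => h x * conj (Ψ I x) :=
    fun hh I => hh.mul_bdd (c := 1)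
      (Complex.continuous_conj.comp (hΨ I).continuous).aestronglyMeasurable
      (ae_of_all _ fun x => by simpa using (hΨ I).norm_le x)
  have hfgb : ∀ I, coef I (Ψ I) f = coef I (Ψ I) g + coef I (Ψ I) b := by
    intro I
    rw [← coef_add (hmulconj hgi I) (hmulconj hbi I)]
    congr 1; ext x; simp [hb]
  -- the good part
  have hgood : (t : ℝ≥0∞) * volume {x | (t : ℝ≥0∞) ^ 2 / 4 <
      tower (fun I => ‖coef I (Ψ I) g‖ₑ ^ 2) x} ≤ 8 * besselConst * ∫⁻ x, ‖f x‖ₑ := by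
    have h1 : (t : ℝ≥0∞) ^ 2 / 4 * volume {x | (t : ℝ≥0∞) ^ 2 / 4 <
        tower (fun I => ‖coef I (Ψ I) g‖ₑ ^ 2) x} ≤ besselConst * (2 * t * ∫⁻ x, ‖f x‖ₑ) := by
      calc _ ≤ (t : ℝ≥0∞) ^ 2 / 4 * volume {x | (t : ℝ≥0∞) ^ 2 / 4 ≤
            tower (fun I => ‖coef I (Ψ I) g‖ₑ ^ 2) x} := by
            refine mul_le_mul_right (measure_mono fun x hx => ?_) _
            exact le_of_lt (show (t : ℝ≥0∞) ^ 2 / 4 < _ from hx)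
        _ ≤ ∫⁻ x, tower (fun I => ‖coef I (Ψ I) g‖ₑ ^ 2) x :=
            mul_meas_ge_le_lintegral (measurable_tower _) _
        _ ≤ besselConst * ∫⁻ x, ‖g x‖ₑ ^ 2 := by
            rw [lintegral_tower]
            have := tsum_coef_sq_le hΨ h0 hgm
            simpa using this
        _ ≤ besselConst * ∫⁻ x, 2 * t * ‖g x‖ₑ := by
            refine mul_le_mul_right (lintegral_mono_ae ?_) _
            filter_upwards [hgb] with x hx
            rw [sq]; gcongr
        _ ≤ _ := by
            rw [lintegral_const_mul _ hgm.enorm]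
            gcongr
    have h2 : (t : ℝ≥0∞) * ((t : ℝ≥0∞) * volume {x | (t : ℝ≥0∞) ^ 2 / 4 <
        tower (fun I => ‖coef I (Ψ I) g‖ₑ ^ 2) x}) ≤ t * (8 * besselConst * ∫⁻ x, ‖f x‖ₑ) := by
      calc _ = 4 * ((t : ℝ≥0∞) ^ 2 / 4 * volume {x | (t : ℝ≥0∞) ^ 2 / 4 <
            tower (fun I => ‖coef I (Ψ I) g‖ₑ ^ 2) x}) := by
            rw [← mul_assoc 4, ENNReal.mul_div_cancel (by simp) (by simp)]
            ring
        _ ≤ 4 * (besselConst * (2 * t * ∫⁻ x, ‖f x‖ₑ)) := by gcongr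
        _ = _ := by ring
    exact (ENNReal.mul_le_mul_iff_right ht0 htt).1 h2
  -- the exceptional set
  set A : Set ℝ := ⋃ Q ∈ S, Q.triple with hA
  have hAm : MeasurableSet A := MeasurableSet.biUnion hScount fun Q _ => measurableSet_triple Q
  have hAvol : (t : ℝ≥0∞) * volume A ≤ 3 * ∫⁻ x, ‖f x‖ₑ := by
    calc (t : ℝ≥0∞) * volume A ≤ t * ∑' Q : S, 3 * volume (Q : DyadicInterval).toSet := by
          gcongr
          exact (measure_biUnion_le _ hScount _).trans
            (ENNReal.tsum_le_tsum fun Q => volume_triple_le _)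
      _ = 3 * (t * ∑' Q : S, volume (Q : DyadicInterval).toSet) := by
          rw [ENNReal.tsum_mul_left]; ring
      _ ≤ _ := by gcongr
  -- the bad part
  set v : DyadicInterval → ℝ≥0∞ := fun I => (ENNReal.ofReal I.length)⁻¹ * ∑' Q : S,
    {I : DyadicInterval | ¬ I.toSet ⊆ (Q : DyadicInterval).triple}.indicator
      (fun I => ‖∫ x in (Q : DyadicInterval).toSet, b x * conj (Ψ I x)‖ₑ) I with hv
  have hbadpt : ∀ x, x ∉ A → tower (fun I => ‖coef I (Ψ I) b‖ₑ) x ≤ tower v x := by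
    intro x hx
    refine tower_mono fun I hxI => ?_
    rw [enorm_coef]
    refine mul_le_mul_right ?_ _
    have e1 : pairing b (Ψ I) = ∫ x in Ω, b x * conj (Ψ I x) := by
      unfold pairing
      refine (setIntegral_eq_integral_of_forall_compl_eq_zero fun x hx => ?_).symm
      rw [hb]; simp [hgΩ x hx]
    have e2 : Ω = ⋃ Q : S, (Q : DyadicInterval).toSet := by rw [hΩ, Set.biUnion_eq_iUnion]
    rw [e1, e2, integral_iUnion (fun Q => measurableSet_toSet _)
      (fun (Q R : S) hQR => hdisj Q.2 R.2 (fun h => hQR (Subtype.ext h))) (hmulconj hbi I).integrableOn]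
    refine enorm_tsum_le_tsum_enorm.trans (ENNReal.tsum_le_tsum fun Q => ?_)
    rw [Set.indicator_of_mem]
    intro hsub
    exact hx (Set.mem_biUnion Q.2 (hsub hxI))
  have hvint : ∫⁻ x, tower v x ≤ 16 * shiftSum * scaleSum * ∫⁻ x, ‖f x‖ₑ := by
    rw [lintegral_tower]
    calc ∑' I : DyadicInterval, ENNReal.ofReal I.length * v I
        = ∑' I : DyadicInterval, ∑' Q : S,
          {I : DyadicInterval | ¬ I.toSet ⊆ (Q : DyadicInterval).triple}.indicator
            (fun I => ‖∫ x in (Q : DyadicInterval).toSet, b x * conj (Ψ I x)‖ₑ) I := by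
          refine tsum_congr fun I => ?_
          rw [hv, ← mul_assoc, ENNReal.mul_inv_cancel (ofReal_length_ne_zero I)
            ENNReal.ofReal_ne_top, one_mul]
      _ = ∑' Q : S, ∑' I : DyadicInterval,
          {I : DyadicInterval | ¬ I.toSet ⊆ (Q : DyadicInterval).triple}.indicator
            (fun I => ‖∫ x in (Q : DyadicInterval).toSet, b x * conj (Ψ I x)‖ₑ) I :=
          ENNReal.tsum_comm
      _ ≤ ∑' Q : S, 8 * shiftSum * scaleSum * ∫⁻ x in (Q : DyadicInterval).toSet, ‖b x‖ₑ :=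
          ENNReal.tsum_le_tsum fun Q => tsum_atom_le hΨ hbi.integrableOn (hmz Q Q.2)
      _ = 8 * shiftSum * scaleSum * ∫⁻ x in Ω, ‖b x‖ₑ := by
          rw [ENNReal.tsum_mul_left, hΩ, lintegral_biUnion hScount
            (fun Q _ => measurableSet_toSet Q) hdisj]
      _ ≤ 8 * shiftSum * scaleSum * (2 * ∫⁻ x, ‖f x‖ₑ) := by
          gcongr
          calc ∫⁻ x in Ω, ‖b x‖ₑ ≤ ∫⁻ x, ‖b x‖ₑ := setLIntegral_le_lintegral _ _
            _ ≤ ∫⁻ x, ‖f x‖ₑ + ‖g x‖ₑ := lintegral_mono fun x => enorm_sub_le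
            _ = (∫⁻ x, ‖f x‖ₑ) + ∫⁻ x, ‖g x‖ₑ := lintegral_add_left hf.enorm _
            _ ≤ 2 * ∫⁻ x, ‖f x‖ₑ := by rw [two_mul]; gcongr
      _ = _ := by ring
  have hbadvol : (t : ℝ≥0∞) * volume {x | (t : ℝ≥0∞) / 2 < tower v x} ≤
      32 * shiftSum * scaleSum * ∫⁻ x, ‖f x‖ₑ := by
    calc (t : ℝ≥0∞) * volume {x | (t : ℝ≥0∞) / 2 < tower v x}
        = 2 * ((t : ℝ≥0∞) / 2 * volume {x | (t : ℝ≥0∞) / 2 < tower v x}) := by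
          rw [← mul_assoc 2, ENNReal.mul_div_cancel (by simp) (by simp)]
      _ ≤ 2 * ∫⁻ x, tower v x := by
          gcongr
          refine le_trans ?_ (mul_meas_ge_le_lintegral (measurable_tower v) ((t : ℝ≥0∞) / 2))
          refine mul_le_mul_right (measure_mono fun x hx => ?_) _
          exact le_of_lt (show (t : ℝ≥0∞) / 2 < _ from hx)
      _ ≤ 2 * (16 * shiftSum * scaleSum * ∫⁻ x, ‖f x‖ₑ) := by gcongr
      _ = _ := by ring
  have hsub : {x | (t : ℝ≥0∞) ^ 2 < tower (fun I => ‖coef I (Ψ I) f‖ₑ ^ 2) x} ⊆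
      ({x | (t : ℝ≥0∞) ^ 2 / 4 < tower (fun I => ‖coef I (Ψ I) g‖ₑ ^ 2) x} ∪ A) ∪
        {x | (t : ℝ≥0∞) / 2 < tower v x} := by
    intro x hx
    by_contra hcon
    simp only [Set.mem_union, not_or] at hcon
    obtain ⟨⟨h1, h2⟩, h3⟩ := hcon
    have h1' : tower (fun I => ‖coef I (Ψ I) g‖ₑ ^ 2) x ≤ (t : ℝ≥0∞) ^ 2 / 4 := not_lt.1 h1
    have h3' : tower v x ≤ (t : ℝ≥0∞) / 2 := not_lt.1 h3
    refine absurd (show (t : ℝ≥0∞) ^ 2 < _ from hx) (not_lt.2 ?_)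
    have h4 : tower (fun I => ‖coef I (Ψ I) b‖ₑ ^ 2) x ≤ (t : ℝ≥0∞) ^ 2 / 4 := by
      refine (tower_sq_le _ x).trans ?_
      calc _ ≤ ((t : ℝ≥0∞) / 2) ^ 2 := by gcongr; exact (hbadpt x h2).trans h3'
        _ = _ := by
          rw [div_eq_mul_inv, mul_pow, ← ENNReal.inv_pow, ← div_eq_mul_inv]; norm_num
    calc tower (fun I => ‖coef I (Ψ I) f‖ₑ ^ 2) x
        ≤ tower (fun I => 2 * ‖coef I (Ψ I) g‖ₑ ^ 2 + 2 * ‖coef I (Ψ I) b‖ₑ ^ 2) x :=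
          tower_mono fun I _ => by rw [hfgb I]; exact enorm_add_sq_le _ _
      _ = 2 * tower (fun I => ‖coef I (Ψ I) g‖ₑ ^ 2) x +
          2 * tower (fun I => ‖coef I (Ψ I) b‖ₑ ^ 2) x := by
          rw [tower_add, tower_const_mul, tower_const_mul]
      _ ≤ 2 * ((t : ℝ≥0∞) ^ 2 / 4) + 2 * ((t : ℝ≥0∞) ^ 2 / 4) := by gcongr
      _ = 4 * ((t : ℝ≥0∞) ^ 2 / 4) := by ring
      _ = _ := ENNReal.mul_div_cancel (by simp) (by simp)
  calc _ ≤ (t : ℝ≥0∞) * (volume {x | (t : ℝ≥0∞) ^ 2 / 4 <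
          tower (fun I => ‖coef I (Ψ I) g‖ₑ ^ 2) x} + volume A +
          volume {x | (t : ℝ≥0∞) / 2 < tower v x}) := by
        gcongr
        exact (measure_mono hsub).trans ((measure_union_le _ _).trans
          (add_le_add_left (measure_union_le _ _) _))
    _ ≤ 8 * besselConst * (∫⁻ x, ‖f x‖ₑ) + 3 * (∫⁻ x, ‖f x‖ₑ) +
        32 * shiftSum * scaleSum * ∫⁻ x, ‖f x‖ₑ := by
        rw [mul_add, mul_add]
        gcongr
    _ = _ := by unfold squareConst; ring

theorem Bump.const_mul {K : ℝ} {N : ℕ} {I : DyadicInterval} {ψ : ℝ → ℂ} (h : Bump K N I ψ)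
    (c : ℂ) : Bump (‖c‖ * K) N I (fun x => c * ψ x) := by
  refine ⟨h.differentiable.const_mul c, fun x => ?_, fun x => ?_⟩
  · rw [norm_mul, mul_assoc]
    gcongr
    exact h.bound x
  · rw [deriv_const_mul c (h.differentiable x), norm_mul, mul_assoc, mul_assoc, ← mul_assoc K]
    gcongr
    exact h.deriv_bound x

theorem coef_const_mul (I : DyadicInterval) (c : ℂ) (ψ f : ℝ → ℂ) :
    coef I (fun x => c * ψ x) f = conj c * coef I ψ f := by
  have h : ∀ x, f x * conj (c * ψ x) = conj c * (f x * conj (ψ x)) := fun x => by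
    rw [map_mul]; ring
  unfold coef pairing
  simp_rw [h]
  rw [integral_const_mul]
  ring

/-- The weak type `(1,1)` bound for square functions. -/
theorem mul_meas_lt_tower_le {K : ℝ} (hK : 0 < K) {Ψ : DyadicInterval → ℝ → ℂ}
    (hΨ : ∀ I, Bump K 5 I (Ψ I)) (h0 : HasMeanZero Ψ) {f : ℝ → ℂ} (hf : Measurable f) (t : ℝ≥0) :
    (t : ℝ≥0∞) * volume {x | (t : ℝ≥0∞) ^ 2 < tower (fun I => ‖coef I (Ψ I) f‖ₑ ^ 2) x} ≤
      squareConst * ENNReal.ofReal K * ∫⁻ x, ‖f x‖ₑ := by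
  set κ : ℝ≥0 := K.toNNReal with hκ
  have hκ0 : 0 < κ := Real.toNNReal_pos.2 hK
  have hκK : (κ : ℝ) = K := Real.coe_toNNReal K hK.le
  have hκe : ENNReal.ofReal K = κ := rfl
  have hnorm : ‖((K⁻¹ : ℝ) : ℂ)‖ = K⁻¹ := by
    rw [Complex.norm_real, Real.norm_of_nonneg (by positivity)]
  have hb : ∀ I, Bump 1 5 I (fun x => ((K⁻¹ : ℝ) : ℂ) * Ψ I x) := fun I => by
    have := (hΨ I).const_mul ((K⁻¹ : ℝ) : ℂ)
    rwa [hnorm, inv_mul_cancel₀ hK.ne'] at this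
  have hz : HasMeanZero fun I x => ((K⁻¹ : ℝ) : ℂ) * Ψ I x := fun I => by
    rw [integral_const_mul, h0 I, mul_zero]
  -- Rescaling the bumps by `1 / K` rescales the threshold, so the constant is linear in `K`. This
  -- linearity is needed when translated bumps are summed.
  have h := mul_meas_lt_tower_le_one hb hz hf (t / κ)
  have hκ0' : (κ : ℝ≥0∞) ≠ 0 := by exact_mod_cast hκ0.ne'
  have e : ∀ x, ((t / κ : ℝ≥0) : ℝ≥0∞) ^ 2 <
      tower (fun I => ‖coef I (fun x => ((K⁻¹ : ℝ) : ℂ) * Ψ I x) f‖ₑ ^ 2) x ↔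
      (t : ℝ≥0∞) ^ 2 < tower (fun I => ‖coef I (Ψ I) f‖ₑ ^ 2) x := by
    intro x
    have h1 : ∀ I, ‖coef I (fun x => ((K⁻¹ : ℝ) : ℂ) * Ψ I x) f‖ₑ ^ 2 =
        ((κ : ℝ≥0∞) ^ 2)⁻¹ * ‖coef I (Ψ I) f‖ₑ ^ 2 := by
      intro I
      rw [coef_const_mul, enorm_mul, RCLike.enorm_conj, ← ofReal_norm ((K⁻¹ : ℝ) : ℂ), hnorm,
        ENNReal.ofReal_inv_of_pos hK, hκe, mul_pow, ENNReal.inv_pow]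
    simp_rw [h1]
    rw [tower_const_mul, ENNReal.coe_div hκ0.ne', div_eq_mul_inv, mul_pow, ← ENNReal.inv_pow,
      mul_comm, ENNReal.mul_lt_mul_iff_right (by simp) (by simpa using hκ0.ne')]
  simp_rw [e] at h
  calc (t : ℝ≥0∞) * volume {x | (t : ℝ≥0∞) ^ 2 < tower (fun I => ‖coef I (Ψ I) f‖ₑ ^ 2) x}
      = κ * (((t / κ : ℝ≥0) : ℝ≥0∞) *
        volume {x | (t : ℝ≥0∞) ^ 2 < tower (fun I => ‖coef I (Ψ I) f‖ₑ ^ 2) x}) := by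
        rw [← mul_assoc, ← ENNReal.coe_mul, mul_div_cancel₀ _ hκ0.ne']
    _ ≤ κ * (squareConst * ∫⁻ x, ‖f x‖ₑ) := by gcongr
    _ = _ := by rw [hκe]; ring

end Paraproduct

namespace Paraproduct

open DyadicInterval

/-! ### Finite sums over dyadic intervals and stopping intervals -/

/-- The finite sum `∑_{I ∈ F, I ∋ x} u(I)`. -/
noncomputable def finTower (F : Finset DyadicInterval) (u : DyadicInterval → ℝ≥0∞) (x : ℝ) : ℝ≥0∞ :=
  ∑ I ∈ F, I.toSet.indicator (fun _ => u I) x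

theorem measurable_finTower (F : Finset DyadicInterval) (u : DyadicInterval → ℝ≥0∞) :
    Measurable (finTower F u) :=
  Finset.measurable_fun_sum F fun I _ => measurable_const.indicator (measurableSet_toSet I)

theorem finTower_le_tower (F : Finset DyadicInterval) (u : DyadicInterval → ℝ≥0∞) (x : ℝ) :
    finTower F u x ≤ tower u x := ENNReal.sum_le_tsum F

open Classical in
theorem finTower_eq_sum_filter (F : Finset DyadicInterval) (u : DyadicInterval → ℝ≥0∞) (x : ℝ) :
    finTower F u x = ∑ I ∈ F.filter (fun I => x ∈ I.toSet), u I := by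
  rw [finTower, Finset.sum_filter]
  exact Finset.sum_congr rfl fun I _ => by rw [Set.indicator_apply]

open Classical in
/-- The sum of `u` over the intervals of `F` that contain `I`. -/
noncomputable def above (F : Finset DyadicInterval) (u : DyadicInterval → ℝ≥0∞)
    (I : DyadicInterval) : ℝ≥0∞ :=
  ∑ R ∈ F.filter (fun R => I.toSet ⊆ R.toSet), u R

open Classical in
/-- The maximal intervals of `F` for which `above F u` exceeds `t`. -/
noncomputable def stopping (F : Finset DyadicInterval) (u : DyadicInterval → ℝ≥0∞) (t : ℝ≥0∞) :
    Finset DyadicInterval :=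
  F.filter fun I => t < above F u I ∧
    ∀ R ∈ F, t < above F u R → I.toSet ⊆ R.toSet → R = I

section Stopping

variable {F : Finset DyadicInterval} {u : DyadicInterval → ℝ≥0∞} {t : ℝ≥0∞}

theorem mem_stopping {I : DyadicInterval} : I ∈ stopping F u t ↔ I ∈ F ∧ t < above F u I ∧
    ∀ R ∈ F, t < above F u R → I.toSet ⊆ R.toSet → R = I := by
  classical
  unfold stopping
  rw [Finset.mem_filter]

theorem stopping_pairwiseDisjoint :
    (stopping F u t : Set DyadicInterval).PairwiseDisjoint toSet := by
  intro Q hQ R hR hne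
  rw [Finset.mem_coe, mem_stopping] at hQ hR
  rw [Function.onFun, Set.disjoint_left]
  intro x hxQ hxR
  rcases le_total Q.2 R.2 with h | h
  · exact hne (hQ.2.2 R hR.1 hR.2.1 (toSet_subset_of_mem hxQ hxR h)).symm
  · exact hne (hR.2.2 Q hQ.1 hQ.2.1 (toSet_subset_of_mem hxR hxQ h))

theorem exists_stopping {I : DyadicInterval} (hI : I ∈ F) (h : t < above F u I) :
    ∃ Q ∈ stopping F u t, I.toSet ⊆ Q.toSet := by
  classical
  obtain ⟨Q, hQ, hmax⟩ := Finset.exists_max_image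
    (F.filter fun R => t < above F u R ∧ I.toSet ⊆ R.toSet) (fun R => R.2)
    ⟨I, Finset.mem_filter.2 ⟨hI, h, subset_rfl⟩⟩
  rw [Finset.mem_filter] at hQ
  refine ⟨Q, mem_stopping.2 ⟨hQ.1, hQ.2.1, fun R hR hbR hQR => ?_⟩, hQ.2.2⟩
  have h1 := hmax R (Finset.mem_filter.2 ⟨hR, hbR, hQ.2.2.trans hQR⟩)
  exact eq_of_mem (hQR Q.center_mem) Q.center_mem (le_antisymm h1 (snd_le_of_subset hQR))

theorem above_le_finTower {I : DyadicInterval} {x : ℝ} (hx : x ∈ I.toSet) :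
    above F u I ≤ finTower F u x := by
  classical
  rw [finTower_eq_sum_filter]
  refine Finset.sum_le_sum_of_subset fun R hR => ?_
  rw [Finset.mem_filter] at hR ⊢
  exact ⟨hR.1, hR.2 hx⟩

theorem finTower_eq_zero_or (F : Finset DyadicInterval) (u : DyadicInterval → ℝ≥0∞) (x : ℝ) :
    finTower F u x = 0 ∨ ∃ I ∈ F, x ∈ I.toSet ∧ finTower F u x = above F u I := by
  classical
  rw [finTower_eq_sum_filter]
  rcases Finset.eq_empty_or_nonempty (F.filter fun I => x ∈ I.toSet) with h | h
  · left; rw [h, Finset.sum_empty]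
  · right
    obtain ⟨I, hI, hmin⟩ := Finset.exists_min_image _ (fun R : DyadicInterval => R.2) h
    rw [Finset.mem_filter] at hI
    refine ⟨I, hI.1, hI.2, ?_⟩
    unfold above
    congr 1
    ext R
    simp only [Finset.mem_filter]
    exact ⟨fun hR => ⟨hR.1, toSet_subset_of_mem hI.2 hR.2 (hmin R (Finset.mem_filter.2 hR))⟩,
      fun hR => ⟨hR.1, hR.2 hI.2⟩⟩

theorem exists_mem_stopping_of_lt {x : ℝ} (h : t < finTower F u x) :
    ∃ Q ∈ stopping F u t, x ∈ Q.toSet := by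
  rcases finTower_eq_zero_or F u x with h0 | ⟨I, hI, hxI, e⟩
  · rw [h0] at h; exact absurd h not_lt_zero
  · obtain ⟨Q, hQ, hIQ⟩ := exists_stopping hI (e ▸ h)
    exact ⟨Q, hQ, hIQ hxI⟩

theorem lt_finTower_of_mem_stopping {Q : DyadicInterval} (hQ : Q ∈ stopping F u t) {x : ℝ}
    (hx : x ∈ Q.toSet) : t < finTower F u x :=
  (mem_stopping.1 hQ).2.1.trans_le (above_le_finTower hx)

theorem setOf_lt_finTower (F : Finset DyadicInterval) (u : DyadicInterval → ℝ≥0∞) (t : ℝ≥0∞) :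
    {x | t < finTower F u x} = ⋃ Q ∈ stopping F u t, Q.toSet := by
  ext x
  refine ⟨fun h => ?_, fun h => ?_⟩
  · obtain ⟨Q, hQ, hx⟩ := exists_mem_stopping_of_lt (show t < _ from h)
    exact Set.mem_biUnion hQ hx
  · obtain ⟨Q, hQ, hx⟩ := Set.mem_iUnion₂.1 h
    exact lt_finTower_of_mem_stopping hQ hx

theorem sum_volume_stopping (F : Finset DyadicInterval) (u : DyadicInterval → ℝ≥0∞) (t : ℝ≥0∞) :
    ∑ Q ∈ stopping F u t, volume Q.toSet = volume {x | t < finTower F u x} := by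
  rw [setOf_lt_finTower, measure_biUnion_finset stopping_pairwiseDisjoint
    fun Q _ => measurableSet_toSet Q]

open Classical in
/-- The restriction of `u` to the subintervals of `J`. -/
noncomputable def below (J : DyadicInterval) (u : DyadicInterval → ℝ≥0∞) (I : DyadicInterval) :
    ℝ≥0∞ := if I.toSet ⊆ J.toSet then u I else 0

theorem below_of_subset {I J : DyadicInterval} (h : I.toSet ⊆ J.toSet) : below J u I = u I :=
  if_pos h

theorem below_of_not_subset {I J : DyadicInterval} (h : ¬ I.toSet ⊆ J.toSet) : below J u I = 0 :=
  if_neg h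

theorem tower_below_of_notMem {J : DyadicInterval} {x : ℝ} (hx : x ∉ J.toSet) :
    tower (below J u) x = 0 := by
  unfold tower
  rw [ENNReal.tsum_eq_zero]
  intro I
  by_cases h : I.toSet ⊆ J.toSet
  · exact Set.indicator_of_notMem (fun hI => hx (h hI)) _
  · rw [below_of_not_subset h]; simp

theorem mem_of_lt_tower_below {J : DyadicInterval} {x : ℝ} (h : t < tower (below J u) x) :
    x ∈ J.toSet := by
  by_contra hx
  rw [tower_below_of_notMem hx] at h
  exact not_lt_zero h

/-- The members of `F` through `x` that are not inside `Q` strictly contain `Q`. By maximality of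
`Q` the shortest of them does not pass the threshold, so together they contribute at most `t`. -/
theorem finTower_le_of_mem_stopping {Q : DyadicInterval} (hQ : Q ∈ stopping F u t) {x : ℝ}
    (hx : x ∈ Q.toSet) : finTower F u x ≤ t + tower (below Q u) x := by
  classical
  rw [mem_stopping] at hQ
  rw [finTower_eq_sum_filter,
    ← Finset.sum_filter_add_sum_filter_not _ (fun I : DyadicInterval => ¬ I.toSet ⊆ Q.toSet)]
  refine add_le_add ?_ ?_
  · set G := (F.filter fun I => x ∈ I.toSet).filter fun I : DyadicInterval => ¬ I.toSet ⊆ Q.toSet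
      with hG
    rcases G.eq_empty_or_nonempty with h | h
    · rw [h, Finset.sum_empty]; exact zero_le
    obtain ⟨R, hR, hmin⟩ := Finset.exists_min_image G (fun R : DyadicInterval => R.2) h
    have hmem : ∀ {I}, I ∈ G ↔ (I ∈ F ∧ x ∈ I.toSet) ∧ ¬ I.toSet ⊆ Q.toSet := by
      intro I; rw [hG, Finset.mem_filter, Finset.mem_filter]
    have hR' := hmem.1 hR
    have hQR : Q.toSet ⊆ R.toSet := by
      refine toSet_subset_of_mem hx hR'.1.2 (le_of_not_ge fun hle => ?_)
      exact hR'.2 (toSet_subset_of_mem hR'.1.2 hx hle)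
    have hnot : ¬ t < above F u R := fun hb => by
      have := hQ.2.2 R hR'.1.1 hb hQR
      exact hR'.2 (this ▸ subset_rfl)
    refine le_trans (Finset.sum_le_sum_of_subset fun I hI => ?_) (not_lt.1 hnot)
    rw [Finset.mem_filter]
    exact ⟨(hmem.1 hI).1.1, toSet_subset_of_mem hR'.1.2 (hmem.1 hI).1.2 (hmin I hI)⟩
  · have e : ∀ I ∈ (F.filter fun I => x ∈ I.toSet).filter fun I : DyadicInterval =>
        ¬ ¬ I.toSet ⊆ Q.toSet, u I = I.toSet.indicator (fun _ => below Q u I) x := by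
      intro I hI
      rw [Finset.mem_filter, Finset.mem_filter, not_not] at hI
      rw [Set.indicator_of_mem hI.1.2, below_of_subset hI.2]
    rw [Finset.sum_congr rfl e]
    exact ENNReal.sum_le_tsum _

end Stopping

/-! ### A good-λ inequality -/

/-- The local good-λ condition. -/
def GoodLam (η ε : ℝ≥0) (u : DyadicInterval → ℝ≥0∞) (D : ℝ → ℝ≥0∞) : Prop :=
  ∀ (J : DyadicInterval) (t : ℝ≥0), 0 < t →
    volume {x | (t : ℝ≥0∞) < tower (below J u) x ∧ D x ≤ ((ε * t : ℝ≥0) : ℝ≥0∞)} ≤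
      η * ENNReal.ofReal J.length

section

variable {η ε : ℝ≥0} {u : DyadicInterval → ℝ≥0∞} {D : ℝ → ℝ≥0∞}

/-- A point where the sum exceeds `2t` lies in a stopping interval `Q` of level `t`. The intervals
above `Q` contribute at most `t`, so those inside `Q` contribute more than `t`, and the local
condition applies on `Q`. -/
theorem GoodLam.meas_two_mul_lt_le (h : GoodLam η ε u D) (hD : Measurable D)
    (F : Finset DyadicInterval) {t : ℝ≥0} (ht : 0 < t) :
    volume {x | ((2 * t : ℝ≥0) : ℝ≥0∞) < finTower F u x} ≤
      η * volume {x | (t : ℝ≥0∞) < finTower F u x} +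
        volume {x | ((ε * t : ℝ≥0) : ℝ≥0∞) < D x} := by
  set E : Set ℝ := {x | ((ε * t : ℝ≥0) : ℝ≥0∞) < D x} with hE
  have hEm : MeasurableSet E := measurableSet_lt measurable_const hD
  have hsub : {x | ((2 * t : ℝ≥0) : ℝ≥0∞) < finTower F u x} ⊆
      (⋃ Q ∈ stopping F u t,
        {x | (t : ℝ≥0∞) < tower (below Q u) x ∧ D x ≤ ((ε * t : ℝ≥0) : ℝ≥0∞)}) ∪ E := by
    intro x hx
    have hx' : (t : ℝ≥0∞) + t < finTower F u x := by
      have : ((2 * t : ℝ≥0) : ℝ≥0∞) < finTower F u x := hx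
      rwa [two_mul, ENNReal.coe_add] at this
    by_cases hxE : x ∈ E
    · exact Or.inr hxE
    left
    obtain ⟨Q, hQ, hxQ⟩ := exists_mem_stopping_of_lt (le_self_add.trans_lt hx')
    refine Set.mem_biUnion hQ ⟨?_, not_lt.1 hxE⟩
    exact (ENNReal.add_lt_add_iff_left ENNReal.coe_ne_top).1
      (hx'.trans_le (finTower_le_of_mem_stopping hQ hxQ))
  calc _ ≤ _ := measure_mono hsub
    _ ≤ _ := measure_union_le _ _
    _ ≤ ∑ Q ∈ stopping F u t, η * volume Q.toSet + volume E := by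
      refine add_le_add_left ((measure_biUnion_finset_le _ _).trans
        (Finset.sum_le_sum fun Q _ => ?_)) _
      rw [volume_toSet]
      exact h Q t ht
    _ = _ := by rw [← Finset.mul_sum, sum_volume_stopping]

/-- The good-λ inequality is iterated at the thresholds `t/2, t/4, …`. The remainder is `η^N` times
a measure bounded by the total length of the finite set `F`, so no a priori integrability is
required. -/
theorem GoodLam.meas_lt_finTower_le (h : GoodLam η ε u D) (hη : η < 1) (hD : Measurable D)
    (F : Finset DyadicInterval) {t : ℝ≥0} (ht : 0 < t) :
    volume {x | (t : ℝ≥0∞) < finTower F u x} ≤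
      ∑' n : ℕ, ((η ^ n : ℝ≥0) : ℝ≥0∞) *
        volume {x | ((ε * (1 / 2) ^ (n + 1) * t : ℝ≥0) : ℝ≥0∞) < D x} := by
  have hstep : ∀ N : ℕ, volume {x | (t : ℝ≥0∞) < finTower F u x} ≤
      ∑ n ∈ Finset.range N, ((η ^ n : ℝ≥0) : ℝ≥0∞) *
        volume {x | ((ε * (1 / 2) ^ (n + 1) * t : ℝ≥0) : ℝ≥0∞) < D x} +
      ((η ^ N : ℝ≥0) : ℝ≥0∞) *
        volume {x | (((1 / 2) ^ N * t : ℝ≥0) : ℝ≥0∞) < finTower F u x} := by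
    intro N
    induction N with
    | zero => simp
    | succ N ih =>
      refine ih.trans ?_
      have h1 := h.meas_two_mul_lt_le hD F (t := (1 / 2) ^ (N + 1) * t) (by positivity)
      have e1 : 2 * ((1 / 2 : ℝ≥0) ^ (N + 1) * t) = (1 / 2) ^ N * t := by
        rw [pow_succ]; ring_nf
      rw [e1] at h1
      rw [Finset.sum_range_succ, add_assoc]
      refine add_le_add_right ?_ _
      calc _ ≤ ((η ^ N : ℝ≥0) : ℝ≥0∞) * _ := mul_le_mul_right h1 _
        _ = _ := by
          rw [mul_add, add_comm, mul_assoc ε, pow_succ η, ENNReal.coe_mul (η ^ N),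
            mul_assoc ((η ^ N : ℝ≥0) : ℝ≥0∞)]
  set V : ℝ≥0∞ := ∑ Q ∈ F, volume Q.toSet with hV
  have hVtop : V ≠ ∞ := by
    rw [hV, ENNReal.sum_ne_top]
    intro Q _
    rw [volume_toSet]; exact ENNReal.ofReal_ne_top
  have hfin : ∀ s : ℝ≥0, volume {x | (s : ℝ≥0∞) < finTower F u x} ≤ V := by
    intro s
    rw [← sum_volume_stopping]
    exact Finset.sum_le_sum_of_subset fun Q hQ => (mem_stopping.1 hQ).1
  have hlim : Tendsto (fun N : ℕ => (∑' n : ℕ, ((η ^ n : ℝ≥0) : ℝ≥0∞) *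
        volume {x | ((ε * (1 / 2) ^ (n + 1) * t : ℝ≥0) : ℝ≥0∞) < D x}) + (η : ℝ≥0∞) ^ N * V)
      atTop (𝓝 ((∑' n : ℕ, ((η ^ n : ℝ≥0) : ℝ≥0∞) *
        volume {x | ((ε * (1 / 2) ^ (n + 1) * t : ℝ≥0) : ℝ≥0∞) < D x}) + 0 * V)) :=
    Tendsto.const_add _ (ENNReal.Tendsto.mul_const
      (ENNReal.tendsto_pow_atTop_nhds_zero_of_lt_one (by exact_mod_cast hη)) (Or.inr hVtop))
  rw [zero_mul, add_zero] at hlim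
  refine ge_of_tendsto' hlim fun N => (hstep N).trans (add_le_add (ENNReal.sum_le_tsum _) ?_)
  rw [ENNReal.coe_pow]
  exact mul_le_mul_right (hfin _) _

theorem GoodLam.dom (h : GoodLam η ε u D) (hη : η < 1) (hD : Measurable D) :
    Dom (fun n : ℕ => η ^ n) (fun n => ε * (1 / 2) ^ (n + 1)) D (tower u) := by
  intro t ht
  have e : {x | (t : ℝ≥0∞) < tower u x} =
      ⋃ F : Finset DyadicInterval, {x | (t : ℝ≥0∞) < finTower F u x} := by
    ext x
    simp only [Set.mem_iUnion]
    change (t : ℝ≥0∞) < tower u x ↔ ∃ F, (t : ℝ≥0∞) < finTower F u x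
    unfold tower finTower
    rw [ENNReal.tsum_eq_iSup_sum, lt_iSup_iff]
  rw [e, Directed.measure_iUnion]
  · exact iSup_le fun F => h.meas_lt_finTower_le hη hD F ht
  · refine directed_of_isDirected_le fun F G hFG x hx => ?_
    exact lt_of_lt_of_le (show (t : ℝ≥0∞) < finTower F u x from hx)
      (Finset.sum_le_sum_of_subset hFG)

end

/-- The series of `gauge_le_of_dom` is here geometric with ratio `η * 2^q`. -/
theorem exists_gauge_tower_le {η ε : ℝ≥0} (hε : 0 < ε) (hη : η < 1) {q : ℝ} (hq : 0 < q)
    (hηq : η * 2 ^ q < 1) : ∃ C : ℝ≥0, ∀ (u : DyadicInterval → ℝ≥0∞) (D : ℝ → ℝ≥0∞),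
      Measurable D → GoodLam η ε u D → ∀ w, gauge w q (tower u) ≤ C * gauge w q D := by
  have hsum : ∑' n : ℕ, ((η ^ n * (ε * (1 / 2) ^ (n + 1)) ^ (-q) : ℝ≥0) : ℝ≥0∞) ≠ ∞ := by
    have e : ∀ n : ℕ, η ^ n * (ε * (1 / 2) ^ (n + 1)) ^ (-q) =
        (η * 2 ^ q) ^ n * (ε ^ (-q) * 2 ^ q) := by
      intro n
      have h2 : ((1 / 2 : ℝ≥0) ^ (n + 1)) ^ (-q) = (2 ^ q) ^ (n + 1) := by
        rw [one_div, inv_pow, NNReal.inv_rpow, NNReal.rpow_neg, inv_inv,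
          ← NNReal.rpow_natCast, ← NNReal.rpow_mul, mul_comm, NNReal.rpow_mul, NNReal.rpow_natCast]
      rw [NNReal.mul_rpow, h2]; ring
    simp_rw [e]
    rw [ENNReal.tsum_coe_ne_top_iff_summable]
    exact (NNReal.summable_geometric hηq).mul_right _
  refine ⟨(∑' n : ℕ, ((η ^ n * (ε * (1 / 2) ^ (n + 1)) ^ (-q) : ℝ≥0) : ℝ≥0∞)).toNNReal,
    fun u D hD h w => ?_⟩
  rw [ENNReal.coe_toNNReal hsum]
  exact gauge_le_of_dom (fun n => by positivity) hD (measurable_tower u) (h.dom hη hD) w hq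

/-! ### From local weak type bounds to the good-λ condition -/

/-- If the set in question contains a point `y`, then `y ∈ J` and `g J ≤ D y` is at most a small
multiple of `√t`; the weak type bound at level `√t` then gives the fraction `η`. The `+ 1` in the
denominator avoids a division by zero. -/
theorem goodLam_of_weak {η A : ℝ≥0} {u : DyadicInterval → ℝ≥0∞}
    {g : DyadicInterval → ℝ≥0∞} {D : ℝ → ℝ≥0∞}
    (hw : ∀ (J : DyadicInterval) (t : ℝ≥0), (t : ℝ≥0∞) *
      volume {x | (t : ℝ≥0∞) ^ 2 < tower (below J u) x} ≤ A * (ENNReal.ofReal J.length * g J))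
    (hg : ∀ J : DyadicInterval, ∀ x ∈ J.toSet, g J ≤ D x) :
    GoodLam η ((η / (A + 1)) ^ 2) u (fun x => D x ^ 2) := by
  intro J t ht
  set e : ℝ≥0 := η / (A + 1) with he
  set τ : ℝ≥0 := NNReal.sqrt t with hτ
  have hτt : τ ^ 2 = t := NNReal.sq_sqrt t
  have hτ0 : 0 < τ := NNReal.sqrt_pos.2 ht
  rcases Set.eq_empty_or_nonempty {x | (t : ℝ≥0∞) < tower (below J u) x ∧
    D x ^ 2 ≤ ((e ^ 2 * t : ℝ≥0) : ℝ≥0∞)} with hem | ⟨y, hy1, hy2⟩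
  · rw [hem, measure_empty]; exact zero_le
  have hyJ := mem_of_lt_tower_below hy1
  have hgJ : g J ≤ e * τ := by
    refine (hg J y hyJ).trans ?_
    rw [← hτt, ← mul_pow, ENNReal.coe_pow] at hy2
    have := (ENNReal.pow_le_pow_left_iff two_ne_zero).1 hy2
    exact this.trans_eq (by push_cast; rfl)
  have h1 : (τ : ℝ≥0∞) * volume {x | (t : ℝ≥0∞) < tower (below J u) x ∧
      D x ^ 2 ≤ ((e ^ 2 * t : ℝ≥0) : ℝ≥0∞)} ≤ τ * (η * ENNReal.ofReal J.length) := by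
    calc _ ≤ (τ : ℝ≥0∞) * volume {x | (τ : ℝ≥0∞) ^ 2 < tower (below J u) x} := by
          refine mul_le_mul_right (measure_mono fun x hx => ?_) _
          show (τ : ℝ≥0∞) ^ 2 < _
          rw [← ENNReal.coe_pow, hτt]
          exact hx.1
      _ ≤ A * (ENNReal.ofReal J.length * (e * τ)) := (hw J τ).trans (by gcongr)
      _ = τ * (((A * e : ℝ≥0) : ℝ≥0∞) * ENNReal.ofReal J.length) := by push_cast; ring
      _ ≤ _ := by
        gcongr
        rw [he, mul_div_assoc', div_le_iff₀ (by positivity), mul_comm]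
        gcongr
        exact le_self_add
  exact (ENNReal.mul_le_mul_iff_right (by exact_mod_cast hτ0.ne') ENNReal.coe_ne_top).1 h1

/-- This is the passage from a Carleson condition to the embedding. Where `D` is small, all factors
`d_I²` along the tower are at most `e² t`, so the sum of the `u_I` itself must exceed `e⁻²`, and by
the local weak type bound this happens on a small part of `J`. -/
theorem goodLam_mul_of_weak {η A : ℝ≥0} (hη : 0 < η) {u d : DyadicInterval → ℝ≥0∞}
    {D : ℝ → ℝ≥0∞}
    (hw : ∀ (J : DyadicInterval) (t : ℝ≥0), (t : ℝ≥0∞) *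
      volume {x | (t : ℝ≥0∞) ^ 2 < tower (below J u) x} ≤ A * ENNReal.ofReal J.length)
    (hd : ∀ I : DyadicInterval, ∀ x ∈ I.toSet, d I ≤ D x) :
    GoodLam η ((η / (A + 1)) ^ 2) (fun I => u I * d I ^ 2) (fun x => D x ^ 2) := by
  intro J t ht
  set e : ℝ≥0 := η / (A + 1) with he
  have he0 : 0 < e := by positivity
  have het : (((e ^ 2 * t : ℝ≥0) : ℝ≥0∞)) ≠ 0 := by
    have : 0 < e ^ 2 * t := by positivity
    exact_mod_cast this.ne'
  have hsub : {x | (t : ℝ≥0∞) < tower (below J fun I => u I * d I ^ 2) x ∧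
      D x ^ 2 ≤ ((e ^ 2 * t : ℝ≥0) : ℝ≥0∞)} ⊆
      {x | ((e⁻¹ : ℝ≥0) : ℝ≥0∞) ^ 2 < tower (below J u) x} := by
    rintro x ⟨h1, h2⟩
    show ((e⁻¹ : ℝ≥0) : ℝ≥0∞) ^ 2 < tower (below J u) x
    have h3 : tower (below J fun I => u I * d I ^ 2) x ≤
        ((e ^ 2 * t : ℝ≥0) : ℝ≥0∞) * tower (below J u) x := by
      rw [← tower_const_mul]
      refine tower_mono fun I hI => ?_
      by_cases hIJ : I.toSet ⊆ J.toSet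
      · rw [below_of_subset hIJ, below_of_subset hIJ, mul_comm]
        gcongr
        exact (pow_le_pow_left₀ zero_le (hd I x hI) 2).trans h2
      · rw [below_of_not_subset hIJ]; exact zero_le
    have h4 := h1.trans_le h3
    refine (ENNReal.mul_lt_mul_iff_right het ENNReal.coe_ne_top).1 (lt_of_le_of_lt ?_ h4)
    rw [← ENNReal.coe_pow, ← ENNReal.coe_mul]
    refine ENNReal.coe_le_coe.2 (le_of_eq ?_)
    field_simp
  have h1 := hw J e⁻¹
  have he' : ((e⁻¹ : ℝ≥0) : ℝ≥0∞) ≠ 0 := by simpa using he0.ne'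
  refine (ENNReal.mul_le_mul_iff_right he' ENNReal.coe_ne_top).1 ?_
  calc _ ≤ ((e⁻¹ : ℝ≥0) : ℝ≥0∞) * _ := mul_le_mul_right (measure_mono hsub) _
    _ ≤ A * ENNReal.ofReal J.length := h1
    _ ≤ (((e⁻¹ * η : ℝ≥0)) : ℝ≥0∞) * ENNReal.ofReal J.length := by
      gcongr
      rw [he, inv_div, div_mul_cancel₀ _ hη.ne']
      exact le_self_add
    _ = _ := by rw [ENNReal.coe_mul, mul_assoc]

end Paraproduct

namespace Paraproduct

open DyadicInterval

/-! ### Local weak type bounds for square functions -/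

theorem tower_eq_tsum_scale (u : DyadicInterval → ℝ≥0∞) (x : ℝ) :
    tower u x = ∑' k : ℤ, u (around x k) := by
  unfold tower
  rw [← (Equiv.prodComm ℤ ℤ).tsum_eq, ENNReal.tsum_prod']
  refine tsum_congr fun k => ?_
  rw [tsum_eq_single ⌊x / (2 : ℝ) ^ k⌋]
  · exact Set.indicator_of_mem (mem_around x k) _
  · intro j hj
    refine Set.indicator_of_notMem (fun hx => hj ?_) _
    exact congrArg Prod.fst (eq_of_mem hx (mem_around x k) rfl)

theorem tower_below_scale_le (J : DyadicInterval) (x : ℝ) :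
    tower (below J fun I => (1 / 2 : ℝ≥0∞) ^ (J.2 - I.2).natAbs) x ≤ scaleSum := by
  rw [tower_eq_tsum_scale, scaleSum, ← (Equiv.subLeft J.2).tsum_eq]
  refine ENNReal.tsum_le_tsum fun k => ?_
  have e : J.2 - (around x (Equiv.subLeft J.2 k)).2 = k := sub_sub_cancel J.2 k
  unfold below
  split_ifs
  · beta_reduce; rw [e]
  · exact zero_le

theorem weight_le_mul_weight (I J : DyadicInterval) (x : ℝ) :
    J.weight x ≤ (1 + |I.center - J.center| / J.length + I.length / J.length) * I.weight x := by
  have hI := I.length_pos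
  have hJ := J.length_pos
  unfold weight
  have h1 : |x - J.center| ≤ |x - I.center| + |I.center - J.center| := abs_sub_le _ _ _
  have h2 : |x - J.center| / J.length ≤
      |x - I.center| / J.length + |I.center - J.center| / J.length := by
    rw [← add_div]; gcongr
  have h3 : |x - I.center| / J.length = I.length / J.length * (|x - I.center| / I.length) := by
    field_simp
  have h4 : 0 ≤ |I.center - J.center| / J.length := by positivity
  have h5 : 0 ≤ |x - I.center| / I.length := by positivity
  have h6 : 0 ≤ I.length / J.length := by positivity
  nlinarith [mul_nonneg h4 h5]

/-- The weights of any two intervals are comparable, so finiteness of the average of `h` does not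
depend on the interval. -/
theorem avg_ne_top (I : DyadicInterval) {J : DyadicInterval} {h : ℝ → ℝ≥0∞}
    (hJ : avg J h ≠ ∞) : avg I h ≠ ∞ := by
  set M : ℝ := 1 + |I.center - J.center| / J.length + I.length / J.length
  have hI := I.length_pos
  have hJl := J.length_pos
  have hM : 0 < M := by positivity
  have h1 : ∫⁻ y, h y * ENNReal.ofReal ((I.weight y ^ 2)⁻¹) ≤
      ENNReal.ofReal (M ^ 2) * ∫⁻ y, h y * ENNReal.ofReal ((J.weight y ^ 2)⁻¹) := by
    rw [← lintegral_const_mul' _ _ ENNReal.ofReal_ne_top]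
    refine lintegral_mono fun y => ?_
    rw [mul_left_comm, ← ENNReal.ofReal_mul (by positivity)]
    refine mul_le_mul_right (ENNReal.ofReal_le_ofReal ?_) _
    have hw := I.weight_pos y
    have hw' := J.weight_pos y
    rw [← div_eq_mul_inv, inv_eq_one_div, div_le_div_iff₀ (by positivity) (by positivity), one_mul,
      ← mul_pow]
    gcongr
    exact weight_le_mul_weight I J y
  unfold avg
  refine ENNReal.mul_ne_top (ENNReal.inv_ne_top.2 (ofReal_length_ne_zero I))
    (ne_top_of_le_ne_top (ENNReal.mul_ne_top ENNReal.ofReal_ne_top ?_) h1)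
  rw [← ofReal_mul_avg]
  exact ENNReal.mul_ne_top ENNReal.ofReal_ne_top hJ

theorem Bump.integrable_mul_conj_of_avg {K : ℝ} {N : ℕ} {I J : DyadicInterval} {ψ h : ℝ → ℂ}
    (hψ : Bump K N I ψ) (hN : 2 ≤ N) (hm : Measurable h) (hJ : avg J (fun x => ‖h x‖ₑ) ≠ ∞) :
    Integrable fun x => h x * conj (ψ x) := by
  refine ⟨(hm.mul (Complex.continuous_conj.comp hψ.continuous).measurable).aestronglyMeasurable, ?_⟩
  rw [hasFiniteIntegral_iff_enorm]
  refine lt_of_le_of_lt (lintegral_mono (g := fun x => ENNReal.ofReal K *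
    (‖h x‖ₑ * ENNReal.ofReal ((I.weight x ^ 2)⁻¹))) fun x => ?_) ?_
  · simp only
    rw [enorm_mul, RCLike.enorm_conj, mul_left_comm]
    exact mul_le_mul_right ((hψ.mono le_rfl hN).enorm_le x) _
  · rw [lintegral_const_mul' _ _ ENNReal.ofReal_ne_top, ← ofReal_mul_avg]
    exact (ENNReal.mul_ne_top ENNReal.ofReal_ne_top
      (ENNReal.mul_ne_top ENNReal.ofReal_ne_top (avg_ne_top I hJ))).lt_top

/-- Functions with integral zero do not see constants. -/
theorem coef_sub_const {K : ℝ} {N : ℕ} {I J : DyadicInterval} {ψ f : ℝ → ℂ}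
    (hψ : Bump K N I ψ) (hN : 2 ≤ N) (h0 : ∫ x, ψ x = 0) (hf : Measurable f) {c : ℂ}
    (hJ : avg J (fun x => ‖f x - c‖ₑ) ≠ ∞) : coef I ψ (fun x => f x - c) = coef I ψ f := by
  have h1 := hψ.integrable_mul_conj_of_avg hN (hf.sub_const c) hJ
  have h2 : Integrable fun x => c * conj (ψ x) := by
    have := (hψ.integrable hN)
    exact ((Complex.conjLIE.toContinuousLinearEquiv : ℂ →L[ℝ] ℂ).integrable_comp this).const_mul c
  have h3 : ∫ x, c * conj (ψ x) = 0 := by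
    rw [integral_const_mul, integral_conj, h0]; simp
  unfold coef pairing
  congr 1
  have h4 := integral_add h1 h2
  rw [h3, add_zero] at h4
  rw [← h4]
  refine integral_congr_ae (ae_of_all _ fun x => ?_)
  ring

theorem Bump.enorm_coef_le_sub {K : ℝ} {N : ℕ} {I : DyadicInterval} {ψ f : ℝ → ℂ}
    (hψ : Bump K N I ψ) (hN : 2 ≤ N) (h0 : ∫ x, ψ x = 0) (hf : Measurable f) (c : ℂ) :
    ‖coef I ψ f‖ₑ ≤ ENNReal.ofReal K * avg I (fun x => ‖f x - c‖ₑ) := by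
  rcases eq_or_ne (avg I (fun x => ‖f x - c‖ₑ)) ∞ with h | h
  · rcases eq_or_lt_of_le hψ.nonneg with hK | hK
    · have : ‖coef I ψ f‖ₑ = 0 := le_antisymm ((hψ.enorm_coef_le hN f).trans (by simp [← hK])) zero_le
      rw [this]; exact zero_le
    · rw [h, ENNReal.mul_top (by simpa using hK)]; exact le_top
  · rw [← coef_sub_const hψ hN h0 hf h]
    exact hψ.enorm_coef_le hN _

/-- Off the triple of `J`, the weight of `I` is at least `|J| / (3 |I|)` times that of `J`. Two
powers of decay give `(|I| / |J|)²`, and one factor is lost in passing from the normalization by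
`|I|` to that by `|J|`. -/
theorem Bump.enorm_coef_le_of_support {K : ℝ} {I J : DyadicInterval} {ψ h : ℝ → ℂ}
    (hψ : Bump K 5 I ψ) (hIJ : I.toSet ⊆ J.toSet) (hsupp : ∀ x ∈ J.triple, h x = 0) :
    ‖coef I ψ h‖ₑ ≤ ENNReal.ofReal (27 * K) * avg J (fun x => ‖h x‖ₑ) *
      (1 / 2 : ℝ≥0∞) ^ (J.2 - I.2).natAbs := by
  have hI := I.length_pos
  have hJ := J.length_pos
  have hle := length_mono (snd_le_of_subset hIJ)
  have hK := hψ.nonneg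
  rw [enorm_coef, ← ofReal_length_div (snd_le_of_subset hIJ)]
  have h1 : ‖pairing h ψ‖ₑ ≤ ENNReal.ofReal (27 * K * (I.length / J.length) ^ 2) *
      ∫⁻ x, ‖h x‖ₑ * ENNReal.ofReal ((J.weight x ^ 2)⁻¹) := by
    refine (enorm_pairing_le h ψ).trans ?_
    rw [← lintegral_const_mul' _ _ ENNReal.ofReal_ne_top]
    refine lintegral_mono fun x => ?_
    by_cases hx : x ∈ J.triple
    · simp [hsupp x hx]
    rw [mul_left_comm, ← ENNReal.ofReal_mul (by positivity), ← ofReal_norm (ψ x)]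
    refine mul_le_mul_right (ENNReal.ofReal_le_ofReal ?_) _
    have hw := I.weight_pos x
    have hw1 := J.one_le_weight x
    have hw' := J.weight_pos x
    refine ((hψ.mono le_rfl (by norm_num : 2 ≤ 5)).bound x).trans ?_
    have h2 := mul_weight_le_of_notMem_triple hIJ hx
    have h3 : (J.length / I.length * J.weight x) ^ 2 ≤ (3 * I.weight x) ^ 2 := by gcongr
    have h4 : (I.weight x ^ 2)⁻¹ ≤ 9 * (I.length / J.length) ^ 2 * (J.weight x ^ 2)⁻¹ := by
      rw [inv_le_iff_one_le_mul₀ (by positivity)]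
      calc (1 : ℝ) = (I.length / J.length) ^ 2 * (J.weight x ^ 2)⁻¹ *
            (J.length / I.length * J.weight x) ^ 2 := by field_simp
        _ ≤ (I.length / J.length) ^ 2 * (J.weight x ^ 2)⁻¹ * (3 * I.weight x) ^ 2 := by gcongr
        _ = _ := by ring
    calc K * (I.weight x ^ 2)⁻¹ ≤ K * (9 * (I.length / J.length) ^ 2 * (J.weight x ^ 2)⁻¹) := by
          gcongr
      _ ≤ K * (27 * (I.length / J.length) ^ 2 * (J.weight x ^ 2)⁻¹) := by gcongr; norm_num
      _ = _ := by ring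
  calc _ ≤ (ENNReal.ofReal I.length)⁻¹ * (ENNReal.ofReal (27 * K * (I.length / J.length) ^ 2) *
        (ENNReal.ofReal J.length * avg J (fun x => ‖h x‖ₑ))) := by
        rw [ofReal_mul_avg]; gcongr
    _ = ENNReal.ofReal (I.length⁻¹ * (27 * K * (I.length / J.length) ^ 2) * J.length) *
        avg J (fun x => ‖h x‖ₑ) := by
        rw [← ENNReal.ofReal_inv_of_pos hI, ← mul_assoc, ← mul_assoc,
          ← ENNReal.ofReal_mul (by positivity), ← ENNReal.ofReal_mul (by positivity)]
    _ = ENNReal.ofReal (27 * K * (I.length / J.length)) * avg J (fun x => ‖h x‖ₑ) := by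
        congr 2; field_simp
    _ = _ := by rw [ENNReal.ofReal_mul (by positivity)]; ring

theorem weight_le_four_of_mem_triple {J : DyadicInterval} {x : ℝ} (hx : x ∈ J.triple) :
    J.weight x ≤ 4 := by
  have hJ := J.length_pos
  have key : ∀ n : ℤ, |(n : ℝ)| ≤ 1 → x ∈ (J.shift n).toSet → J.weight x ≤ 4 := by
    intro n hn hx
    have h1 := abs_sub_center_le hx
    rw [length_shift, center_shift] at h1
    unfold weight
    have h2 : |x - J.center| ≤ |x - (J.center + n * J.length)| + |(n : ℝ) * J.length| := by
      have := abs_add_le (x - (J.center + n * J.length)) (n * J.length)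
      rwa [show x - (J.center + n * J.length) + n * J.length = x - J.center by ring] at this
    have h3 : |(n : ℝ) * J.length| ≤ J.length := by
      rw [abs_mul, abs_of_pos hJ]; nlinarith
    have h4 : |x - J.center| / J.length ≤ 3 := by
      rw [div_le_iff₀ hJ]; linarith
    linarith
  rcases hx with (hx | hx) | hx
  · exact key (-1) (by norm_num) hx
  · exact key 0 (by norm_num) (by rwa [shift_zero])
  · exact key 1 (by norm_num) hx

/-- The two terms come from the part of the function off the triple of `J` and the part on it. -/
noncomputable def localConst : ℝ≥0∞ := 54 * scaleSum + 32 * squareConst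

theorem localConst_ne_top : localConst ≠ ∞ := by
  unfold localConst
  exact ENNReal.add_ne_top.2 ⟨ENNReal.mul_ne_top (by simp) scaleSum_ne_top,
    ENNReal.mul_ne_top (by simp) squareConst_ne_top⟩

theorem one_le_scaleSum : 1 ≤ scaleSum := by
  have := ENNReal.le_tsum (f := fun k : ℤ => (1 / 2 : ℝ≥0∞) ^ k.natAbs) 0
  simpa [scaleSum] using this

/-- A constant `c` is invisible to bumps of mean zero. The part of `f - c` off the triple of `J`
has, by geometric decay in the scale, a square function bounded by `R` everywhere; the part on the
triple is handled by the global weak type bound. For `t ≤ 2R` it is enough that the set lies in `J`.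
-/
theorem mul_meas_lt_tower_below_le {K : ℝ} (hK : 0 < K) {Ψ : DyadicInterval → ℝ → ℂ}
    (hΨ : ∀ I, Bump K 5 I (Ψ I)) (h0 : HasMeanZero Ψ) {f : ℝ → ℂ} (hf : Measurable f)
    (J : DyadicInterval) (c : ℂ) (t : ℝ≥0) :
    (t : ℝ≥0∞) * volume {x | (t : ℝ≥0∞) ^ 2 <
        tower (below J fun I => ‖coef I (Ψ I) f‖ₑ ^ 2) x} ≤
      localConst * ENNReal.ofReal K *
        (ENNReal.ofReal J.length * avg J (fun x => ‖f x - c‖ₑ)) := by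
  set α : ℝ≥0∞ := avg J (fun x => ‖f x - c‖ₑ) with hα
  have hKe : ENNReal.ofReal K ≠ 0 := by simpa using hK
  rcases eq_or_ne α ∞ with htop | hfin
  · rw [htop, ENNReal.mul_top (ofReal_length_ne_zero J), ENNReal.mul_top]
    · exact le_top
    · refine mul_ne_zero (fun h => ?_) hKe
      unfold localConst at h
      have h1 := (add_eq_zero.1 h).1
      have h2 := one_le_scaleSum
      rcases mul_eq_zero.1 h1 with h3 | h3
      · norm_num at h3
      · rw [h3] at h2; exact absurd h2 (by simp)
  set h₁ : ℝ → ℂ := J.triple.indicator fun x => f x - c with hh1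
  set h₂ : ℝ → ℂ := J.tripleᶜ.indicator fun x => f x - c with hh2
  have hm1 : Measurable h₁ := (hf.sub_const c).indicator (measurableSet_triple J)
  have hm2 : Measurable h₂ := (hf.sub_const c).indicator (measurableSet_triple J).compl
  have hle1 : ∀ x, ‖h₁ x‖ₑ ≤ ‖f x - c‖ₑ := fun x => by
    rw [hh1, enorm_indicator_eq_indicator_enorm]; exact Set.indicator_le_self _ _ x
  have hle2 : ∀ x, ‖h₂ x‖ₑ ≤ ‖f x - c‖ₑ := fun x => by
    rw [hh2, enorm_indicator_eq_indicator_enorm]; exact Set.indicator_le_self _ _ x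
  have hcoef : ∀ I, coef I (Ψ I) f = coef I (Ψ I) h₁ + coef I (Ψ I) h₂ := by
    intro I
    rw [← coef_sub_const (hΨ I) (by norm_num) (h0 I) hf (hα ▸ hfin), ← coef_add
      ((hΨ I).integrable_mul_conj_of_avg (by norm_num) hm1
        (ne_top_of_le_ne_top hfin (avg_mono J hle1)))
      ((hΨ I).integrable_mul_conj_of_avg (by norm_num) hm2
        (ne_top_of_le_ne_top hfin (avg_mono J hle2)))]
    congr 1
    ext x
    exact (Set.indicator_self_add_compl_apply J.triple (fun x => f x - c) x).symm
  set R : ℝ≥0∞ := ENNReal.ofReal (27 * K) * α * scaleSum with hR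
  have hS2 : ∀ x, tower (below J fun I => ‖coef I (Ψ I) h₂‖ₑ ^ 2) x ≤ R ^ 2 := by
    intro x
    calc _ ≤ tower (fun I => (ENNReal.ofReal (27 * K) * α *
          below J (fun I => (1 / 2 : ℝ≥0∞) ^ (J.2 - I.2).natAbs) I) ^ 2) x := by
          refine tower_mono fun I _ => ?_
          by_cases hIJ : I.toSet ⊆ J.toSet
          · rw [below_of_subset hIJ, below_of_subset hIJ]
            refine pow_le_pow_left₀ zero_le (((hΨ I).enorm_coef_le_of_support hIJ
              fun y hy => Set.indicator_of_notMem (by simpa using hy) _).trans ?_) 2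
            gcongr
            exact avg_mono J hle2
          · rw [below_of_not_subset hIJ]; exact zero_le
      _ ≤ _ := tower_sq_le _ x
      _ ≤ _ := by
        rw [tower_const_mul, hR]
        gcongr
        exact tower_below_scale_le J x
  have hX : (t : ℝ≥0∞) ≤ 2 * R ∨ 2 * R < t := le_or_gt _ _
  rcases hX with ht | ht
  · calc _ ≤ 2 * R * volume J.toSet :=
          mul_le_mul' ht (measure_mono fun x hx =>
            mem_of_lt_tower_below (show (t : ℝ≥0∞) ^ 2 < _ from hx))
      _ = 54 * scaleSum * ENNReal.ofReal K * (ENNReal.ofReal J.length * α) := by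
          rw [volume_toSet, hR, ENNReal.ofReal_mul (by norm_num), ENNReal.ofReal_ofNat]; ring
      _ ≤ _ := by
          unfold localConst
          gcongr
          exact le_self_add
  have hsub : {x | (t : ℝ≥0∞) ^ 2 < tower (below J fun I => ‖coef I (Ψ I) f‖ₑ ^ 2) x} ⊆
      {x | ((t / 2 : ℝ≥0) : ℝ≥0∞) ^ 2 < tower (fun I => ‖coef I (Ψ I) h₁‖ₑ ^ 2) x} := by
    intro x hx
    have hx' : (t : ℝ≥0∞) ^ 2 < tower (below J fun I => ‖coef I (Ψ I) f‖ₑ ^ 2) x := hx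
    show ((t / 2 : ℝ≥0) : ℝ≥0∞) ^ 2 < tower (fun I => ‖coef I (Ψ I) h₁‖ₑ ^ 2) x
    by_contra hcon
    rw [not_lt] at hcon
    refine absurd hx' (not_lt.2 ?_)
    have hRt : R ^ 2 ≤ ((t / 2 : ℝ≥0) : ℝ≥0∞) ^ 2 := by
      gcongr
      rw [ENNReal.coe_div two_ne_zero, ENNReal.coe_ofNat,
        ENNReal.le_div_iff_mul_le (by simp) (by simp), mul_comm]
      exact ht.le
    calc tower (below J fun I => ‖coef I (Ψ I) f‖ₑ ^ 2) x
        ≤ tower (fun I => 2 * ‖coef I (Ψ I) h₁‖ₑ ^ 2 +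
          2 * below J (fun I => ‖coef I (Ψ I) h₂‖ₑ ^ 2) I) x := by
          refine tower_mono fun I _ => ?_
          by_cases hIJ : I.toSet ⊆ J.toSet
          · rw [below_of_subset hIJ, below_of_subset hIJ, hcoef I]
            exact enorm_add_sq_le _ _
          · rw [below_of_not_subset hIJ]; exact zero_le
      _ = 2 * tower (fun I => ‖coef I (Ψ I) h₁‖ₑ ^ 2) x +
          2 * tower (below J fun I => ‖coef I (Ψ I) h₂‖ₑ ^ 2) x := by
          rw [tower_add, tower_const_mul, tower_const_mul]
      _ ≤ 2 * ((t / 2 : ℝ≥0) : ℝ≥0∞) ^ 2 + 2 * ((t / 2 : ℝ≥0) : ℝ≥0∞) ^ 2 := by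
          gcongr
          exact (hS2 x).trans hRt
      _ = (t : ℝ≥0∞) ^ 2 := by
          rw [← ENNReal.coe_pow, ← ENNReal.coe_pow, ← ENNReal.coe_ofNat, ← ENNReal.coe_mul,
            ← ENNReal.coe_add, ENNReal.coe_inj, div_pow]
          ring
  have hint : ∫⁻ x, ‖h₁ x‖ₑ ≤ 16 * (ENNReal.ofReal J.length * α) := by
    rw [hα, ofReal_mul_avg, ← lintegral_const_mul' _ _ (by simp)]
    refine lintegral_mono fun x => ?_
    by_cases hx : x ∈ J.triple
    · rw [mul_left_comm]
      refine (hle1 x).trans (le_mul_of_one_le_right zero_le ?_)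
      rw [← ENNReal.ofReal_ofNat, ← ENNReal.ofReal_mul (by norm_num), ENNReal.one_le_ofReal]
      have hw := J.weight_pos x
      have h4 := weight_le_four_of_mem_triple hx
      rw [← div_eq_mul_inv, le_div_iff₀ (by positivity)]
      nlinarith
    · rw [hh1, Set.indicator_of_notMem hx]; simp
  calc _ ≤ 2 * (((t / 2 : ℝ≥0) : ℝ≥0∞) * volume {x | ((t / 2 : ℝ≥0) : ℝ≥0∞) ^ 2 <
          tower (fun I => ‖coef I (Ψ I) h₁‖ₑ ^ 2) x}) := by
        rw [← mul_assoc]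
        refine mul_le_mul' (le_of_eq ?_) (measure_mono hsub)
        rw [← ENNReal.coe_ofNat, ← ENNReal.coe_mul, mul_div_cancel₀ _ two_ne_zero]
    _ ≤ 2 * (squareConst * ENNReal.ofReal K * (16 * (ENNReal.ofReal J.length * α))) := by
        exact mul_le_mul_right ((mul_meas_lt_tower_le hK hΨ h0 hm1 _).trans
          (mul_le_mul_right hint _)) _
    _ = 32 * squareConst * ENNReal.ofReal K * (ENNReal.ofReal J.length * α) := by ring
    _ ≤ _ := by
        unfold localConst
        gcongr
        exact le_add_self

/-! ### Smoothed square functions -/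

/-- Squared coefficients, averaged over the translates of `I`. -/
noncomputable def smoothSq (Ψ : DyadicInterval → ℝ → ℂ) (f : ℝ → ℂ) (I : DyadicInterval) : ℝ≥0∞ :=
  ∑' k : ℤ, ENNReal.ofReal (((1 + |(k : ℝ)|) ^ 16)⁻¹) *
    ‖coef (I.shift k) (Ψ (I.shift k)) f‖ₑ ^ 2

theorem sq_enorm_coef_le_smoothSq (Ψ : DyadicInterval → ℝ → ℂ) (f : ℝ → ℂ) (I : DyadicInterval) :
    ‖coef I (Ψ I) f‖ₑ ^ 2 ≤ smoothSq Ψ f I := by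
  refine le_trans (le_of_eq ?_) (ENNReal.le_tsum 0)
  simp

/-- A bump of a translate of `I` serves as a bump of `I`, with a constant growing polynomially. Thus
the smoothed square function is a sum of ordinary ones. -/
theorem Bump.of_shift {K : ℝ} {N : ℕ} {I : DyadicInterval} {k : ℤ} {ψ : ℝ → ℂ}
    (h : Bump K N (I.shift k) ψ) : Bump (K * (1 + |(k : ℝ)|) ^ N) N I ψ := by
  have hK := h.nonneg
  have hI := I.length_pos
  have hw : ∀ x, ((I.shift k).weight x ^ N)⁻¹ ≤ (1 + |(k : ℝ)|) ^ N * (I.weight x ^ N)⁻¹ := by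
    intro x
    have h1 := (I.shift k).weight_pos x
    have h2 := I.weight_pos x
    rw [← div_eq_mul_inv, inv_eq_one_div, div_le_div_iff₀ (by positivity) (by positivity), one_mul,
      ← mul_pow]
    gcongr
    exact weight_shift_le I k x
  refine ⟨h.differentiable, fun x => (h.bound x).trans ?_, fun x => (h.deriv_bound x).trans ?_⟩
  · rw [mul_assoc]
    gcongr
    exact hw x
  · rw [length_shift]
    calc _ ≤ K * I.length⁻¹ * ((1 + |(k : ℝ)|) ^ N * (I.weight x ^ N)⁻¹) := by
          gcongr; exact hw x
      _ = _ := by ring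

theorem one_le_shiftSum : 1 ≤ shiftSum := by
  have := ENNReal.le_tsum (f := fun n : ℤ => ENNReal.ofReal (((1 + |(n : ℝ)|) ^ 2)⁻¹)) 0
  simpa [shiftSum] using this

theorem tower_below_tsum (J : DyadicInterval) (w : ℤ → ℝ≥0∞) (u : ℤ → DyadicInterval → ℝ≥0∞)
    (x : ℝ) : tower (below J fun I => ∑' k, w k * u k I) x =
      ∑' k, w k * tower (below J (u k)) x := by
  simp_rw [← tower_const_mul]
  unfold tower
  rw [ENNReal.tsum_comm]
  refine tsum_congr fun I => ?_
  by_cases hx : x ∈ I.toSet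
  · simp only [Set.indicator_of_mem hx]
    by_cases hIJ : I.toSet ⊆ J.toSet
    · simp only [below_of_subset hIJ]
    · simp only [below_of_not_subset hIJ, mul_zero, tsum_zero]
  · simp only [Set.indicator_of_notMem hx, tsum_zero]

/-- With `κ = 1 + |k|`, the level for the `k`-th translate is taken proportional to `κ^7`. If no
translate exceeds its level, the squares sum to at most `t²`, since `κ^(-16) κ^14 = κ^(-2)`. The
exceptional sets are summable since the bump constants are `K κ^5` and `κ^(-7) κ^5 = κ^(-2)`. -/
theorem mul_meas_lt_tower_below_smoothSq_le {K : ℝ} (hK : 0 < K) {Ψ : DyadicInterval → ℝ → ℂ}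
    (hΨ : ∀ I, Bump K 5 I (Ψ I)) (h0 : HasMeanZero Ψ) {f : ℝ → ℂ} (hf : Measurable f)
    (J : DyadicInterval) (c : ℂ) (t : ℝ≥0) :
    (t : ℝ≥0∞) * volume {x | (t : ℝ≥0∞) ^ 2 < tower (below J (smoothSq Ψ f)) x} ≤
      shiftSum ^ 2 * localConst * ENNReal.ofReal K *
        (ENNReal.ofReal J.length * avg J (fun x => ‖f x - c‖ₑ)) := by
  set σ : ℝ≥0 := shiftSum.toNNReal with hσ
  have hσe : (σ : ℝ≥0∞) = shiftSum := ENNReal.coe_toNNReal shiftSum_ne_top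
  have hσ1 : 1 ≤ σ := by
    have := one_le_shiftSum
    rw [← hσe] at this
    exact_mod_cast this
  have hσ0 : 0 < σ := lt_of_lt_of_le one_pos hσ1
  set X : ℝ≥0∞ := ENNReal.ofReal J.length * avg J (fun x => ‖f x - c‖ₑ) with hX
  let κ : ℤ → ℝ≥0 := fun k => Real.toNNReal (1 + |(k : ℝ)|)
  have hκ : ∀ k, (κ k : ℝ) = 1 + |(k : ℝ)| := fun k => Real.coe_toNNReal _ (by positivity)
  have hκ0 : ∀ k, 0 < κ k := fun k => by
    rw [← NNReal.coe_pos, hκ]; positivity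
  have hκe : ∀ (k : ℤ) (n : ℕ), ENNReal.ofReal (((1 + |(k : ℝ)|) ^ n)⁻¹) =
      (((κ k ^ n)⁻¹ : ℝ≥0) : ℝ≥0∞) := fun k n => by
    rw [← hκ, ← NNReal.coe_pow, ← NNReal.coe_inv, ENNReal.ofReal_coe_nnreal]
  let T : ℤ → ℝ → ℝ≥0∞ := fun k => tower (below J fun I =>
    ‖coef I (Ψ (I.shift k)) f‖ₑ ^ 2)
  have hcoef : ∀ (I : DyadicInterval) k, coef (I.shift k) (Ψ (I.shift k)) f =
      coef I (Ψ (I.shift k)) f := fun I k => by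
    unfold coef; rw [length_shift]
  have hsum : ∀ x, tower (below J (smoothSq Ψ f)) x =
      ∑' k, (((κ k ^ 16)⁻¹ : ℝ≥0) : ℝ≥0∞) * T k x := by
    intro x
    unfold smoothSq
    rw [tower_below_tsum]
    simp_rw [hκe, hcoef, T]
  have hsub : {x | (t : ℝ≥0∞) ^ 2 < tower (below J (smoothSq Ψ f)) x} ⊆
      ⋃ k, {x | ((t * κ k ^ 7 / σ : ℝ≥0) : ℝ≥0∞) ^ 2 < T k x} := by
    intro x hx
    have hx' : (t : ℝ≥0∞) ^ 2 < tower (below J (smoothSq Ψ f)) x := hx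
    by_contra hcon
    rw [Set.mem_iUnion, not_exists] at hcon
    have hcon' : ∀ k, T k x ≤ ((t * κ k ^ 7 / σ : ℝ≥0) : ℝ≥0∞) ^ 2 := fun k => not_lt.1 (hcon k)
    refine absurd hx' (not_lt.2 ?_)
    rw [hsum]
    calc _ ≤ ∑' k, (((κ k ^ 16)⁻¹ : ℝ≥0) : ℝ≥0∞) * ((t * κ k ^ 7 / σ : ℝ≥0) : ℝ≥0∞) ^ 2 :=
          ENNReal.tsum_le_tsum fun k => mul_le_mul_right (hcon' k) _
      _ = ∑' k : ℤ, ((t ^ 2 / σ ^ 2 : ℝ≥0) : ℝ≥0∞) * ENNReal.ofReal (((1 + |(k : ℝ)|) ^ 2)⁻¹) := by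
          refine tsum_congr fun k => ?_
          rw [hκe, ← ENNReal.coe_pow, ← ENNReal.coe_mul, ← ENNReal.coe_mul, ENNReal.coe_inj]
          have := (hκ0 k).ne'
          field_simp
      _ = ((t ^ 2 / σ ^ 2 * σ : ℝ≥0) : ℝ≥0∞) := by
          rw [ENNReal.tsum_mul_left, ENNReal.coe_mul, hσe]; rfl
      _ ≤ (t : ℝ≥0∞) ^ 2 := by
          rw [← ENNReal.coe_pow, ENNReal.coe_le_coe, div_mul_eq_mul_div,
            div_le_iff₀ (by positivity)]
          gcongr
          rw [sq]; exact le_mul_of_one_le_left zero_le hσ1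
  have hk : ∀ k : ℤ, (t : ℝ≥0∞) * volume {x | ((t * κ k ^ 7 / σ : ℝ≥0) : ℝ≥0∞) ^ 2 < T k x} ≤
      (shiftSum * localConst * ENNReal.ofReal K * X) *
        ENNReal.ofReal (((1 + |(k : ℝ)|) ^ 2)⁻¹) := by
    intro k
    have hKk : 0 < K * (1 + |(k : ℝ)|) ^ 5 := by positivity
    have h := mul_meas_lt_tower_below_le hKk (Ψ := fun I => Ψ (I.shift k))
      (fun I => (hΨ (I.shift k)).of_shift) (fun I => h0 _) hf J c (t * κ k ^ 7 / σ)
    have e1 : (t : ℝ≥0∞) = ((σ * (κ k ^ 7)⁻¹ : ℝ≥0) : ℝ≥0∞) * ((t * κ k ^ 7 / σ : ℝ≥0) : ℝ≥0∞) := by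
      rw [← ENNReal.coe_mul, ENNReal.coe_inj]
      have := (hκ0 k).ne'
      field_simp
    have e2 : ENNReal.ofReal (K * (1 + |(k : ℝ)|) ^ 5) =
        ENNReal.ofReal K * ((κ k ^ 5 : ℝ≥0) : ℝ≥0∞) := by
      rw [ENNReal.ofReal_mul hK.le, ← hκ, ← NNReal.coe_pow, ENNReal.ofReal_coe_nnreal]
    rw [e2] at h
    rw [e1, mul_assoc]
    refine (mul_le_mul_right h _).trans (le_of_eq ?_)
    rw [hκe, ← hσe]
    have e3 : (((κ k ^ 2)⁻¹ : ℝ≥0) : ℝ≥0∞) =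
        (((κ k ^ 7)⁻¹ : ℝ≥0) : ℝ≥0∞) * ((κ k ^ 5 : ℝ≥0) : ℝ≥0∞) := by
      rw [← ENNReal.coe_mul, ENNReal.coe_inj]
      have := (hκ0 k).ne'
      field_simp
    rw [e3, ENNReal.coe_mul]
    ring
  calc _ ≤ (t : ℝ≥0∞) * ∑' k, volume {x | ((t * κ k ^ 7 / σ : ℝ≥0) : ℝ≥0∞) ^ 2 < T k x} :=
        mul_le_mul_right ((measure_mono hsub).trans (measure_iUnion_le _)) _
    _ ≤ ∑' k : ℤ, (shiftSum * localConst * ENNReal.ofReal K * X) *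
        ENNReal.ofReal (((1 + |(k : ℝ)|) ^ 2)⁻¹) := by
        rw [← ENNReal.tsum_mul_left]
        exact ENNReal.tsum_le_tsum hk
    _ = (shiftSum * localConst * ENNReal.ofReal K * X) * shiftSum := ENNReal.tsum_mul_left
    _ = _ := by ring

theorem exists_pos_mul_rpow_lt_one (q : ℝ) : ∃ η : ℝ≥0, 0 < η ∧ η < 1 ∧ η * 2 ^ q < 1 := by
  refine ⟨(2 * (1 + 2 ^ q))⁻¹, by positivity, ?_, ?_⟩
  · refine inv_lt_one_of_one_lt₀ ?_
    have : (0 : ℝ≥0) < 2 ^ q := by positivity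
    calc (1 : ℝ≥0) < 2 * 1 := by norm_num
      _ ≤ _ := by gcongr; exact le_self_add
  · have h : (0 : ℝ≥0) < 2 ^ q := by positivity
    rw [inv_mul_lt_iff₀ (by positivity), mul_one]
    calc (2 : ℝ≥0) ^ q < 2 * 2 ^ q := by
          exact lt_mul_of_one_lt_left h (by norm_num)
      _ ≤ _ := by gcongr; exact le_add_self

/-- Smoothed square functions are controlled by the maximal function. -/
theorem exists_gauge_smoothSq_le {K : ℝ} (hK : 0 < K) {q : ℝ} (hq : 0 < q) :
    ∃ C : ℝ≥0, ∀ Ψ : DyadicInterval → ℝ → ℂ, (∀ I, Bump K 5 I (Ψ I)) → HasMeanZero Ψ →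
      ∀ f : ℝ → ℂ, Measurable f → ∀ w,
        gauge w q (tower (smoothSq Ψ f)) ≤ C * gauge w q fun x => maxFun (fun y => ‖f y‖ₑ) x ^ 2 := by
  obtain ⟨η, hη0, hη1, hηq⟩ := exists_pos_mul_rpow_lt_one q
  have hA : shiftSum ^ 2 * localConst * ENNReal.ofReal K ≠ ∞ := ENNReal.mul_ne_top
    (ENNReal.mul_ne_top (ENNReal.pow_ne_top shiftSum_ne_top) localConst_ne_top)
    ENNReal.ofReal_ne_top
  obtain ⟨C, hC⟩ := exists_gauge_tower_le
    (ε := (η / ((shiftSum ^ 2 * localConst * ENNReal.ofReal K).toNNReal + 1)) ^ 2)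
    (by positivity) hη1 hq hηq
  refine ⟨C, fun Ψ hΨ h0 f hf w => hC _ _ ((measurable_maxFun _).pow_const 2) ?_ w⟩
  refine goodLam_of_weak (g := fun J => avg J fun x => ‖f x‖ₑ) (fun J t => ?_)
    (fun J x hx => avg_le_maxFun hx _)
  rw [ENNReal.coe_toNNReal hA]
  have := mul_meas_lt_tower_below_smoothSq_le hK hΨ h0 hf J 0 t
  simpa using this

/-- Square functions of functions of bounded mean oscillation act like Carleson measures. -/
theorem exists_gauge_tower_mul_le {K : ℝ} (hK : 0 < K) {q : ℝ} (hq : 0 < q) :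
    ∃ C : ℝ≥0, ∀ Ψ : DyadicInterval → ℝ → ℂ, (∀ I, Bump K 5 I (Ψ I)) → HasMeanZero Ψ →
      ∀ f : ℝ → ℂ, Measurable f → (∀ J : DyadicInterval, ∃ c : ℂ, avg J (fun x => ‖f x - c‖ₑ) ≤ 1) →
      ∀ (d : DyadicInterval → ℝ≥0∞) (D : ℝ → ℝ≥0∞), Measurable D →
      (∀ I : DyadicInterval, ∀ x ∈ I.toSet, d I ≤ D x) → ∀ w,
        gauge w q (tower fun I => ‖coef I (Ψ I) f‖ₑ ^ 2 * d I ^ 2) ≤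
          C * gauge w q fun x => D x ^ 2 := by
  obtain ⟨η, hη0, hη1, hηq⟩ := exists_pos_mul_rpow_lt_one q
  have hA : localConst * ENNReal.ofReal K ≠ ∞ :=
    ENNReal.mul_ne_top localConst_ne_top ENNReal.ofReal_ne_top
  obtain ⟨C, hC⟩ := exists_gauge_tower_le
    (ε := (η / ((localConst * ENNReal.ofReal K).toNNReal + 1)) ^ 2)
    (by positivity) hη1 hq hηq
  refine ⟨C, fun Ψ hΨ h0 f hf hb d D hD hd w => hC _ _ (hD.pow_const 2) ?_ w⟩
  refine goodLam_mul_of_weak hη0 (fun J t => ?_) hd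
  rw [ENNReal.coe_toNNReal hA]
  -- The constant may change with `J`; this is the only form in which bounded mean oscillation
  -- enters.
  obtain ⟨c, hc⟩ := hb J
  refine (mul_meas_lt_tower_below_le hK hΨ h0 hf J c t).trans ?_
  refine mul_le_mul_right ?_ _
  calc _ ≤ ENNReal.ofReal J.length * 1 := by gcongr
    _ = _ := mul_one _

end Paraproduct

namespace Paraproduct

open DyadicInterval

/-! ### From coefficient estimates to synthesis estimates -/

theorem rpow_half_sq (a : ℝ≥0∞) : (a ^ (1 / 2 : ℝ)) ^ 2 = a := by
  rw [← ENNReal.rpow_natCast, ← ENNReal.rpow_mul]; norm_num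

theorem sq_rpow_half (a : ℝ≥0∞) : (a ^ 2) ^ (1 / 2 : ℝ) = a := by
  rw [← ENNReal.rpow_natCast, ← ENNReal.rpow_mul]; norm_num

theorem finTower_mul_le (F : Finset DyadicInterval) (a b : DyadicInterval → ℝ≥0∞) (x : ℝ) :
    finTower F (fun I => a I * b I) x ≤
      finTower F (fun I => a I ^ 2) x ^ (1 / 2 : ℝ) * tower (fun I => b I ^ 2) x ^ (1 / 2 : ℝ) := by
  classical
  have h := ENNReal.inner_le_Lp_mul_Lq (F.filter fun I => x ∈ I.toSet) a b
    (Real.HolderConjugate.two_two)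
  simp only [ENNReal.rpow_two] at h
  rw [← finTower_eq_sum_filter F fun I => a I * b I, ← finTower_eq_sum_filter F fun I => a I ^ 2,
    ← finTower_eq_sum_filter F fun I => b I ^ 2] at h
  exact h.trans (mul_le_mul_right (ENNReal.rpow_le_rpow (finTower_le_tower _ _ _) (by norm_num)) _)

theorem lintegral_finTower (F : Finset DyadicInterval) (u : DyadicInterval → ℝ≥0∞) :
    ∫⁻ x, finTower F u x = ∑ I ∈ F, ENNReal.ofReal I.length * u I := by
  unfold finTower
  rw [lintegral_finsetSum _ fun I _ => measurable_const.indicator (measurableSet_toSet I)]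
  refine Finset.sum_congr rfl fun I _ => ?_
  rw [lintegral_indicator (measurableSet_toSet I), setLIntegral_const, volume_toSet, mul_comm]

/-- Duality: `T = ∑ β_I ψ_I` is tested against `|T|^(P-2) T`, and Cauchy–Schwarz along the towers
separates `β` from the coefficients of the test function. Only a majorant `v` of the coefficients is
required, so that averages may be used when the bumps have no cancellation. -/
theorem lintegral_sum_rpow_le_of_dual {ψ : DyadicInterval → ℝ → ℂ} (hψ : ∀ I, Measurable (ψ I))
    {A : ℝ≥0} (hA : ∀ I x, ‖ψ I x‖ₑ ≤ A * ENNReal.ofReal ((I.weight x ^ 2)⁻¹))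
    {P P' : ℝ} (hP : 2 ≤ P) (hPP : P.HolderConjugate P') {C₀ : ℝ≥0}
    (hdual : ∀ h : ℝ → ℂ, Measurable h → ∃ v : DyadicInterval → ℝ≥0∞,
      (∀ I, ‖pairing h (ψ I)‖ₑ ≤ ENNReal.ofReal I.length * v I) ∧
      ∫⁻ x, (tower (fun I => v I ^ 2) x) ^ (P' / 2) ≤ C₀ * ∫⁻ x, ‖h x‖ₑ ^ P')
    (F : Finset DyadicInterval) (β : DyadicInterval → ℂ) :
    ∫⁻ x, ‖∑ I ∈ F, β I * ψ I x‖ₑ ^ P ≤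
      (C₀ : ℝ≥0∞) ^ (P / P') * ∫⁻ x, (finTower F (fun I => ‖β I‖ₑ ^ 2) x) ^ (P / 2) := by
  have hP0 : 0 < P := by linarith
  have hP'0 : 0 < P' := hPP.symm.pos
  set T : ℝ → ℂ := fun x => ∑ I ∈ F, β I * ψ I x with hT
  have hTm : Measurable T := Finset.measurable_fun_sum F fun I _ => (hψ I).const_mul _
  have hw1 : ∀ (I : DyadicInterval) x, ENNReal.ofReal ((I.weight x ^ 2)⁻¹) ≤ 1 := fun I x => by
    rw [← ENNReal.ofReal_one]
    exact ENNReal.ofReal_le_ofReal (inv_le_one_of_one_le₀ (one_le_pow₀ (I.one_le_weight x)))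
  have hψ1 : ∀ I x, ‖ψ I x‖ₑ ≤ A := fun I x =>
    (hA I x).trans ((mul_le_mul_right (hw1 I x) _).trans_eq (mul_one _))
  have hψint : ∀ I, ∫⁻ x, ‖ψ I x‖ₑ ≠ ∞ := fun I => by
    refine ne_top_of_le_ne_top ?_ (lintegral_mono (hA I))
    rw [lintegral_const_mul' _ _ ENNReal.coe_ne_top]
    refine ENNReal.mul_ne_top ENNReal.coe_ne_top (ne_top_of_le_ne_top ?_ (lintegral_inv_weight_sq_le I))
    exact ENNReal.mul_ne_top (ENNReal.mul_ne_top (by simp) shiftSum_ne_top) ENNReal.ofReal_ne_top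
  set M : ℝ≥0 := ∑ I ∈ F, ‖β I‖₊ * A with hM
  have hTM : ∀ x, ‖T x‖ₑ ≤ M := fun x => by
    refine (enorm_sum_le _ _).trans ?_
    rw [hM]
    push_cast
    refine Finset.sum_le_sum fun I _ => ?_
    rw [enorm_mul]
    exact mul_le_mul_right (hψ1 I x) _
  have hTint : ∫⁻ x, ‖T x‖ₑ ≠ ∞ := by
    refine ne_top_of_le_ne_top ?_ (lintegral_mono fun x => enorm_sum_le F _)
    rw [lintegral_finsetSum _ fun I _ => ((hψ I).const_mul _).enorm]
    refine ENNReal.sum_ne_top.2 fun I _ => ?_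
    simp_rw [enorm_mul]
    rw [lintegral_const_mul' _ _ enorm_ne_top]
    exact ENNReal.mul_ne_top enorm_ne_top (hψint I)
  -- `Z` is finite because `T` is bounded and integrable; the division by a power of `Z` at the end
  -- depends on it.
  set Z : ℝ≥0∞ := ∫⁻ x, ‖T x‖ₑ ^ P with hZ
  have hZtop : Z ≠ ∞ := by
    refine ne_top_of_le_ne_top (b := (M : ℝ≥0∞) ^ (P - 1) * ∫⁻ x, ‖T x‖ₑ)
      (ENNReal.mul_ne_top (ENNReal.rpow_ne_top_of_nonneg (by linarith) ENNReal.coe_ne_top) hTint) ?_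
    rw [← lintegral_const_mul _ hTm.enorm]
    refine lintegral_mono fun x => ?_
    rw [show P = (P - 1) + 1 by ring, ENNReal.rpow_add_of_nonneg _ _ (by linarith) zero_le_one,
      ENNReal.rpow_one, add_sub_cancel_right]
    exact mul_le_mul_left (ENNReal.rpow_le_rpow (hTM x) (by linarith)) _
  set h : ℝ → ℂ := fun x => ((‖T x‖ ^ (P - 2) : ℝ) : ℂ) * T x with hh
  have hhm : Measurable h :=
    (Complex.measurable_ofReal.comp (hTm.norm.pow_const _)).mul hTm
  have hhn : ∀ x, ‖h x‖ₑ = ‖T x‖ₑ ^ (P - 1) := fun x => by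
    have : ‖h x‖ = ‖T x‖ ^ (P - 1) := by
      rw [hh]
      simp only
      rw [norm_mul, Complex.norm_real, Real.norm_of_nonneg (by positivity)]
      rcases eq_or_ne ‖T x‖ 0 with h0 | h0
      · rw [h0, mul_zero, Real.zero_rpow (by linarith)]
      · rw [← Real.rpow_add_one h0]; congr 1; ring
    rw [← ofReal_norm, this, ← ofReal_norm, ENNReal.ofReal_rpow_of_nonneg (norm_nonneg _) (by linarith)]
  have hpair : ∀ x, h x * conj (T x) = ((‖T x‖ ^ P : ℝ) : ℂ) := fun x => by
    rw [hh]
    simp only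
    rw [mul_assoc, Complex.mul_conj', ← Complex.ofReal_pow, ← Complex.ofReal_mul]
    congr 1
    rcases eq_or_ne ‖T x‖ 0 with h0 | h0
    · rw [h0, zero_pow two_ne_zero, mul_zero, Real.zero_rpow hP0.ne']
    · rw [← Real.rpow_natCast, ← Real.rpow_add (by positivity)]; congr 1; push_cast; ring
  have hTP : ∀ x, ENNReal.ofReal (‖T x‖ ^ P) = ‖T x‖ₑ ^ P := fun x => by
    rw [← ofReal_norm, ENNReal.ofReal_rpow_of_nonneg (norm_nonneg _) hP0.le]
  have hTPint : Integrable fun x => ‖T x‖ ^ P := by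
    refine ⟨(hTm.norm.pow_const P).aestronglyMeasurable, ?_⟩
    rw [hasFiniteIntegral_iff_ofReal (ae_of_all _ fun x => by positivity)]
    simp_rw [hTP]
    exact hZtop.lt_top
  have hbd : ∀ x, ‖h x‖ₑ ≤ (M : ℝ≥0∞) ^ (P - 1) := fun x => by
    rw [hhn]; exact ENNReal.rpow_le_rpow (hTM x) (by linarith)
  have hhi : ∀ I, Integrable fun x => h x * conj (ψ I x) := fun I => by
    refine ⟨(hhm.mul (Complex.continuous_conj.measurable.comp (hψ I))).aestronglyMeasurable, ?_⟩
    rw [hasFiniteIntegral_iff_enorm]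
    refine lt_of_le_of_lt (lintegral_mono (g := fun x => (M : ℝ≥0∞) ^ (P - 1) * ‖ψ I x‖ₑ)
      fun x => ?_) ?_
    · simp only
      rw [enorm_mul, RCLike.enorm_conj]
      exact mul_le_mul_left (hbd x) _
    · rw [lintegral_const_mul' _ _ (ENNReal.rpow_ne_top_of_nonneg (by linarith) ENNReal.coe_ne_top)]
      exact (ENNReal.mul_ne_top (ENNReal.rpow_ne_top_of_nonneg (by linarith) ENNReal.coe_ne_top)
        (hψint I)).lt_top
  obtain ⟨v, hv, hvint⟩ := hdual h hhm
  set X : ℝ → ℝ≥0∞ := fun x => finTower F (fun I => ‖β I‖ₑ ^ 2) x ^ (1 / 2 : ℝ) with hX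
  set Y : ℝ → ℝ≥0∞ := fun x => tower (fun I => v I ^ 2) x ^ (1 / 2 : ℝ) with hY
  have hXm : Measurable X := (measurable_finTower _ _).pow_const _
  have hYm : Measurable Y := (measurable_tower _).pow_const _
  have h1 : Z ≤ ∑ I ∈ F, ‖β I‖ₑ * ‖pairing h (ψ I)‖ₑ := by
    have e1 : Z = ‖∫ x, h x * conj (T x)‖ₑ := by
      simp_rw [hpair]
      rw [integral_complex_ofReal, ← ofReal_norm, Complex.norm_real,
        Real.norm_of_nonneg (integral_nonneg fun x => by positivity),
        ofReal_integral_eq_lintegral_ofReal hTPint (ae_of_all _ fun x => by positivity)]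
      simp_rw [hTP]
      rfl
    have e2 : ∫ x, h x * conj (T x) = ∑ I ∈ F, conj (β I) * pairing h (ψ I) := by
      have h1 : ∀ x, h x * conj (T x) = ∑ I ∈ F, conj (β I) * (h x * conj (ψ I x)) := by
        intro x
        rw [hT]
        simp only [map_sum, map_mul]
        rw [Finset.mul_sum]
        exact Finset.sum_congr rfl fun I _ => by ring
      simp_rw [h1]
      rw [integral_finsetSum _ fun I _ => (hhi I).const_mul _]
      refine Finset.sum_congr rfl fun I _ => ?_
      rw [integral_const_mul]; rfl
    rw [e1, e2]
    refine (enorm_sum_le _ _).trans (le_of_eq (Finset.sum_congr rfl fun I _ => ?_))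
    rw [enorm_mul, RCLike.enorm_conj]
  have h2 : Z ≤ ∫⁻ x, (X * Y) x := by
    calc Z ≤ ∑ I ∈ F, ENNReal.ofReal I.length * (‖β I‖ₑ * v I) := by
          refine h1.trans (Finset.sum_le_sum fun I _ => ?_)
          rw [mul_left_comm]
          exact mul_le_mul_right (hv I) _
      _ = ∫⁻ x, finTower F (fun I => ‖β I‖ₑ * v I) x := (lintegral_finTower _ _).symm
      _ ≤ _ := lintegral_mono fun x => finTower_mul_le F _ _ x
  have hYP : ∫⁻ x, Y x ^ P' ≤ C₀ * Z := by
    calc ∫⁻ x, Y x ^ P' = ∫⁻ x, (tower (fun I => v I ^ 2) x) ^ (P' / 2) := by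
          refine lintegral_congr fun x => ?_
          rw [hY]; simp only
          rw [← ENNReal.rpow_mul]; congr 1; ring
      _ ≤ C₀ * ∫⁻ x, ‖h x‖ₑ ^ P' := hvint
      _ = C₀ * Z := by
          congr 1
          refine lintegral_congr fun x => ?_
          rw [hhn, ← ENNReal.rpow_mul, hPP.sub_one_mul_conj]
  have hXP : ∫⁻ x, X x ^ P = ∫⁻ x, (finTower F (fun I => ‖β I‖ₑ ^ 2) x) ^ (P / 2) := by
    refine lintegral_congr fun x => ?_
    rw [hX]; simp only
    rw [← ENNReal.rpow_mul]; congr 1; ring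
  rw [← hXP]
  have h3 : Z ≤ (∫⁻ x, X x ^ P) ^ (1 / P) * (C₀ * Z) ^ (1 / P') := by
    refine h2.trans ((ENNReal.lintegral_mul_le_Lp_mul_Lq volume hPP hXm.aemeasurable
      hYm.aemeasurable).trans ?_)
    exact mul_le_mul_right (ENNReal.rpow_le_rpow hYP (by positivity)) _
  rcases eq_or_ne Z 0 with hZ0 | hZ0
  · rw [hZ0]; exact zero_le
  have hinv : 1 / P + 1 / P' = 1 := by
    rw [one_div, one_div]; exact hPP.inv_add_inv_eq_one
  -- Division by `Z^(1/P')`, using `1/P + 1/P' = 1`.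
  have h4 : Z ^ (1 / P) ≤ (∫⁻ x, X x ^ P) ^ (1 / P) * (C₀ : ℝ≥0∞) ^ (1 / P') := by
    have hZr0 : Z ^ (1 / P') ≠ 0 := by
      simp only [ne_eq, ENNReal.rpow_eq_zero_iff, not_or, not_and]
      exact ⟨fun h => absurd h hZ0, fun h => absurd h hZtop⟩
    have hZrt : Z ^ (1 / P') ≠ ∞ := ENNReal.rpow_ne_top_of_nonneg (by positivity) hZtop
    refine (ENNReal.mul_le_mul_iff_left hZr0 hZrt).1 ?_
    rw [← ENNReal.rpow_add _ _ hZ0 hZtop, hinv, ENNReal.rpow_one, mul_assoc,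
      ← ENNReal.mul_rpow_of_nonneg _ _ (by positivity)]
    exact h3
  calc Z = (Z ^ (1 / P)) ^ P := by
        rw [← ENNReal.rpow_mul, one_div, inv_mul_cancel₀ hP0.ne', ENNReal.rpow_one]
    _ ≤ ((∫⁻ x, X x ^ P) ^ (1 / P) * (C₀ : ℝ≥0∞) ^ (1 / P')) ^ P :=
        ENNReal.rpow_le_rpow h4 hP0.le
    _ = _ := by
        rw [ENNReal.mul_rpow_of_nonneg _ _ hP0.le, ← ENNReal.rpow_mul, ← ENNReal.rpow_mul,
          one_div, inv_mul_cancel₀ hP0.ne', ENNReal.rpow_one, mul_comm]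
        congr 2
        ring

end Paraproduct

namespace Paraproduct

open DyadicInterval

/-! ### Distributional control of synthesis operators -/

theorem lt_rpow_half_iff {t : ℝ≥0} {a : ℝ≥0∞} :
    (t : ℝ≥0∞) < a ^ (1 / 2 : ℝ) ↔ (t : ℝ≥0∞) ^ 2 < a := by
  rw [← ENNReal.pow_lt_pow_left_iff two_ne_zero, rpow_half_sq]

theorem rpow_sum_le_sum_rpow {ι : Type*} (s : Finset ι) (a : ι → ℝ≥0∞) {δ : ℝ} (h0 : 0 < δ)
    (h1 : δ ≤ 1) : (∑ i ∈ s, a i) ^ δ ≤ ∑ i ∈ s, a i ^ δ :=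
  Finset.le_sum_of_subadditive (fun a : ℝ≥0∞ => a ^ δ) (by simp [h0])
    (fun x y => ENNReal.rpow_add_le_add_rpow x y h0.le h1) s a

/-- The coefficients `2^{δ n}` for `n ≥ 0` and `2^{P n}` for `n < 0`. -/
noncomputable def layerCoeff (δ P : ℝ) (n : ℤ) : ℝ≥0 :=
  if 0 ≤ n then ((2 : ℝ≥0) ^ n) ^ δ else ((2 : ℝ≥0) ^ n) ^ P

/-- Two geometric series: the levels above `t` require `δ < q`, the levels below `t` require `q <
P`. -/
theorem tsum_layerCoeff_ne_top {δ P q : ℝ} (hδ : δ < q) (hP : q < P) (C : ℝ≥0) :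
    ∑' n : ℤ, ((C * layerCoeff δ P n * ((2 : ℝ≥0) ^ n) ^ (-q) : ℝ≥0) : ℝ≥0∞) ≠ ∞ := by
  rw [ENNReal.tsum_coe_ne_top_iff_summable]
  simp_rw [mul_assoc]
  refine Summable.mul_left C (Summable.of_nat_of_neg_add_one ?_ ?_)
  · have h : ∀ n : ℕ, layerCoeff δ P n * ((2 : ℝ≥0) ^ (n : ℤ)) ^ (-q) = ((2 : ℝ≥0) ^ (δ - q)) ^ n := by
      intro n
      rw [layerCoeff, if_pos (by positivity), ← NNReal.rpow_add (by positivity), zpow_natCast,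
        ← NNReal.rpow_natCast, ← NNReal.rpow_natCast, ← NNReal.rpow_mul, ← NNReal.rpow_mul]
      congr 1; ring
    simp_rw [h]
    exact NNReal.summable_geometric (NNReal.rpow_lt_one_of_one_lt_of_neg (by norm_num) (by linarith))
  · have h : ∀ n : ℕ, layerCoeff δ P (-((n : ℤ) + 1)) * ((2 : ℝ≥0) ^ (-((n : ℤ) + 1))) ^ (-q) =
        ((2 : ℝ≥0) ^ (q - P)) ^ (n + 1) := by
      intro n
      rw [layerCoeff, if_neg (by omega), ← NNReal.rpow_add (by positivity), zpow_neg,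
        show ((n : ℤ) + 1) = ((n + 1 : ℕ) : ℤ) by push_cast; ring, zpow_natCast,
        NNReal.inv_rpow, ← NNReal.rpow_neg,
        ← NNReal.rpow_natCast, ← NNReal.rpow_natCast, ← NNReal.rpow_mul, ← NNReal.rpow_mul]
      congr 1; ring
    simp_rw [h, pow_succ]
    exact (NNReal.summable_geometric
      (NNReal.rpow_lt_one_of_one_lt_of_neg (by norm_num) (by linarith))).mul_right _

section Layers

variable {X : ℝ → ℝ≥0∞} {δ P : ℝ}

/-- Dyadic layers below `t`; they account for the terms with `n < 0`. -/
theorem lintegral_min_rpow_le (hX : Measurable X) (hP : 0 < P) {t : ℝ≥0} (ht : 0 < t) :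
    ∫⁻ x, (min (X x) t) ^ P ≤ ((2 ^ P * t ^ P : ℝ≥0) : ℝ≥0∞) *
      ∑' n : ℤ, (layerCoeff δ P n : ℝ≥0∞) * volume {x | ((2 ^ n * t : ℝ≥0) : ℝ≥0∞) < X x} := by
  have hpt : ∀ x, (min (X x) t) ^ P ≤ ∑' n : ℕ, (((1 / 2 ^ n * t) ^ P : ℝ≥0) : ℝ≥0∞) *
      {x | ((1 / 2 ^ (n + 1) * t : ℝ≥0) : ℝ≥0∞) < X x}.indicator 1 x := by
    intro x
    classical
    rcases eq_or_ne (X x) 0 with h0 | h0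
    · rw [h0, min_eq_left zero_le, ENNReal.zero_rpow_of_pos hP]; exact zero_le
    have hex : ∃ n : ℕ, ((1 / 2 ^ (n + 1) * t : ℝ≥0) : ℝ≥0∞) < X x := by
      have h1 : Tendsto (fun n : ℕ => ((1 / 2 ^ (n + 1) * t : ℝ≥0) : ℝ≥0∞)) atTop (𝓝 0) := by
        rw [← ENNReal.coe_zero, ENNReal.tendsto_coe]
        have := ((NNReal.tendsto_pow_atTop_nhds_zero_of_lt_one (r := 1 / 2)
          (by norm_num)).comp (tendsto_add_atTop_nat 1)).mul_const t
        simpa [Function.comp_def] using this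
      exact (h1.eventually (gt_mem_nhds (pos_iff_ne_zero.2 h0))).exists
    refine le_trans ?_ (ENNReal.le_tsum (Nat.find hex))
    rw [Set.indicator_of_mem (s := {x | ((1 / 2 ^ (Nat.find hex + 1) * t : ℝ≥0) : ℝ≥0∞) < X x})
      (Nat.find_spec hex), Pi.one_apply, mul_one, ENNReal.coe_rpow_of_nonneg _ hP.le]
    refine ENNReal.rpow_le_rpow ?_ hP.le
    rcases Nat.eq_zero_or_pos (Nat.find hex) with hn | hn
    · rw [hn]; simp
    · have h2 := Nat.find_min hex (m := Nat.find hex - 1) (by omega)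
      rw [Nat.sub_add_cancel hn, not_lt] at h2
      exact (min_le_left _ _).trans h2
  calc _ ≤ ∫⁻ x, ∑' n : ℕ, (((1 / 2 ^ n * t) ^ P : ℝ≥0) : ℝ≥0∞) *
      {x | ((1 / 2 ^ (n + 1) * t : ℝ≥0) : ℝ≥0∞) < X x}.indicator 1 x := lintegral_mono hpt
    _ = ∑' n : ℕ, (((1 / 2 ^ n * t) ^ P : ℝ≥0) : ℝ≥0∞) *
        volume {x | ((1 / 2 ^ (n + 1) * t : ℝ≥0) : ℝ≥0∞) < X x} := by
        have hm : ∀ n : ℕ, MeasurableSet {x | ((1 / 2 ^ (n + 1) * t : ℝ≥0) : ℝ≥0∞) < X x} :=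
          fun n => measurableSet_lt measurable_const hX
        rw [lintegral_tsum fun n => ((measurable_one.indicator (hm n)).const_mul _).aemeasurable]
        refine tsum_congr fun n => ?_
        rw [lintegral_const_mul _ (measurable_one.indicator (hm n)), lintegral_indicator_one (hm n)]
    _ = ((2 ^ P * t ^ P : ℝ≥0) : ℝ≥0∞) * ∑' n : ℕ, (layerCoeff δ P (-((n : ℤ) + 1)) : ℝ≥0∞) *
        volume {x | ((2 ^ (-((n : ℤ) + 1)) * t : ℝ≥0) : ℝ≥0∞) < X x} := by
        rw [← ENNReal.tsum_mul_left]
        refine tsum_congr fun n => ?_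
        have e : (2 : ℝ≥0) ^ (-((n : ℤ) + 1)) = 1 / 2 ^ (n + 1) := by
          rw [zpow_neg, one_div, show ((n : ℤ) + 1) = ((n + 1 : ℕ) : ℤ) by push_cast; ring,
            zpow_natCast]
        rw [layerCoeff, if_neg (by omega), e, ← mul_assoc, ← ENNReal.coe_mul, ← NNReal.mul_rpow,
          ← NNReal.mul_rpow, show 2 * t * (1 / 2 ^ (n + 1)) = 1 / 2 ^ n * t by
            rw [pow_succ]; field_simp]
    _ ≤ _ := by
        refine mul_le_mul_right (ENNReal.tsum_comp_le_tsum_of_injective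
          (f := fun n : ℕ => -((n : ℤ) + 1)) (fun a b h => by simpa using h) (fun n : ℤ =>
          (layerCoeff δ P n : ℝ≥0∞) * volume {x | ((2 ^ n * t : ℝ≥0) : ℝ≥0∞) < X x})) _

/-- Dyadic layers of `X^(1/d)` above `t^(1/d)`. They correspond to the levels `2^(d n) t` of `X`, so
only the indices divisible by `d` among the terms with `n ≥ 0` are used. -/
theorem lintegral_indicator_rpow_le (hX : Measurable X) {d : ℕ} (hd : 0 < d) {t : ℝ≥0}
    (ht : 0 < t) :
    ∫⁻ x in {x | (t : ℝ≥0∞) < X x}, X x ^ (1 / d : ℝ) ≤ ((2 * t ^ (1 / d : ℝ) : ℝ≥0) : ℝ≥0∞) *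
      ∑' n : ℤ, (layerCoeff (1 / d) P n : ℝ≥0∞) *
        volume {x | ((2 ^ n * t : ℝ≥0) : ℝ≥0∞) < X x} := by
  have hd' : (0 : ℝ) < 1 / d := by positivity
  have hiff : ∀ (s : ℝ≥0) x, ((s ^ (1 / d : ℝ) : ℝ≥0) : ℝ≥0∞) < X x ^ (1 / d : ℝ) ↔
      (s : ℝ≥0∞) < X x := fun s x => by
    rw [ENNReal.coe_rpow_of_nonneg _ hd'.le, ENNReal.rpow_lt_rpow_iff hd']
  have h := lintegral_indicator_lt_le (hX.pow_const (1 / d : ℝ)) (s := t ^ (1 / d : ℝ))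
    (NNReal.rpow_pos ht)
  have e1 : ∫⁻ x in {x | (t : ℝ≥0∞) < X x}, X x ^ (1 / d : ℝ) =
      ∫⁻ x, {x | ((t ^ (1 / d : ℝ) : ℝ≥0) : ℝ≥0∞) < X x ^ (1 / d : ℝ)}.indicator
        (fun x => X x ^ (1 / d : ℝ)) x := by
    simp_rw [hiff]
    rw [lintegral_indicator (measurableSet_lt measurable_const hX)]
  rw [e1]
  refine h.trans ?_
  have hpow : ∀ n : ℕ, (2 : ℝ≥0) ^ n = ((2 : ℝ≥0) ^ ((d * n : ℕ) : ℤ)) ^ (1 / d : ℝ) := by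
    intro n
    rw [zpow_natCast, pow_mul, ← NNReal.rpow_natCast ((2 : ℝ≥0) ^ d), ← NNReal.rpow_natCast 2 d,
      ← NNReal.rpow_mul, ← NNReal.rpow_mul, ← NNReal.rpow_natCast]
    congr 1
    field_simp
  calc _ = ((2 * t ^ (1 / d : ℝ) : ℝ≥0) : ℝ≥0∞) * ∑' n : ℕ,
        (layerCoeff (1 / d) P ((d * n : ℕ) : ℤ) : ℝ≥0∞) *
        volume {x | ((2 ^ ((d * n : ℕ) : ℤ) * t : ℝ≥0) : ℝ≥0∞) < X x} := by
        rw [← ENNReal.tsum_mul_left]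
        refine tsum_congr fun n => ?_
        rw [layerCoeff, if_pos (by positivity), ← mul_assoc, ← ENNReal.coe_mul, ← hpow]
        refine congrArg₂ _ ?_ ?_
        · rw [ENNReal.coe_inj, pow_succ]; ring
        · congr 1
          ext x
          change (_ : ℝ≥0∞) < _ ↔ (_ : ℝ≥0∞) < _
          rw [← hiff (2 ^ ((d * n : ℕ) : ℤ) * t) x, NNReal.mul_rpow, ← hpow]
    _ ≤ _ := by
        refine mul_le_mul_right (ENNReal.tsum_comp_le_tsum_of_injective
          (f := fun n : ℕ => ((d * n : ℕ) : ℤ)) (fun a b h => ?_) (fun n : ℤ =>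
          (layerCoeff (1 / d) P n : ℝ≥0∞) * volume {x | ((2 ^ n * t : ℝ≥0) : ℝ≥0∞) < X x})) _
        exact Nat.eq_of_mul_eq_mul_left hd (Int.ofNat_inj.1 h)

end Layers

/-- The tail of the part of the sum that lives on subintervals of `Q`. -/
theorem sum_enorm_mul_inv_weight_le {F : Finset DyadicInterval} {β : DyadicInterval → ℝ≥0∞} {d : ℕ}
    (hd : 0 < d) {Q : DyadicInterval} {x : ℝ} (hx : x ∉ Q.triple) (G : Finset DyadicInterval)
    (hGF : G ⊆ F) (hGQ : ∀ I ∈ G, I.toSet ⊆ Q.toSet) :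
    ∑ I ∈ G, β I * ENNReal.ofReal ((I.weight x ^ (2 * d + 2))⁻¹) ≤
      9 ^ d * 4 * shiftSum * scaleSum *
        (((ENNReal.ofReal Q.length)⁻¹ * ∫⁻ y in Q.toSet,
          (finTower F (fun I => β I ^ 2) y ^ (1 / 2 : ℝ)) ^ (1 / d : ℝ)) ^ d *
        ENNReal.ofReal ((Q.weight x ^ (2 * d))⁻¹)) := by
  have hd' : (0 : ℝ) < 1 / d := by positivity
  set X : ℝ → ℝ≥0∞ := fun y => finTower F (fun I => β I ^ 2) y ^ (1 / 2 : ℝ) with hX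
  set M : ℝ≥0∞ := (ENNReal.ofReal Q.length)⁻¹ * ∫⁻ y in Q.toSet, X y ^ (1 / d : ℝ) with hM
  have hQ := Q.length_pos
  -- On `I` the square function is at least `β I`. Comparing integrals of `1/d`-th powers over `I`
  -- and `Q` loses only `(|Q| / |I|)^d`.
  have hβ : ∀ I ∈ G, β I ≤ ENNReal.ofReal ((Q.length / I.length) ^ d) * M ^ d := by
    intro I hI
    have hIl := I.length_pos
    have h1 : ∀ y ∈ I.toSet, β I ≤ X y := by
      intro y hy
      rw [hX]
      simp only
      rw [← sq_rpow_half (β I)]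
      refine ENNReal.rpow_le_rpow ?_ (by norm_num)
      have := Finset.single_le_sum (f := fun I : DyadicInterval => I.toSet.indicator
        (fun _ => β I ^ 2) y) (fun _ _ => zero_le) (hGF hI)
      simpa only [Set.indicator_of_mem hy, finTower] using this
    have h2 : ENNReal.ofReal I.length * β I ^ (1 / d : ℝ) ≤ ENNReal.ofReal Q.length * M := by
      calc _ = ∫⁻ y in I.toSet, β I ^ (1 / d : ℝ) := by
            rw [setLIntegral_const, volume_toSet, mul_comm]
        _ ≤ ∫⁻ y in I.toSet, X y ^ (1 / d : ℝ) :=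
            setLIntegral_mono' (measurableSet_toSet I) fun y hy =>
              ENNReal.rpow_le_rpow (h1 y hy) hd'.le
        _ ≤ ∫⁻ y in Q.toSet, X y ^ (1 / d : ℝ) := lintegral_mono_set (hGQ I hI)
        _ = _ := by
            rw [hM, ← mul_assoc, ENNReal.mul_inv_cancel (ofReal_length_ne_zero Q)
              ENNReal.ofReal_ne_top, one_mul]
    have h3 : β I ^ (1 / d : ℝ) ≤ ENNReal.ofReal (Q.length / I.length) * M := by
      refine (ENNReal.mul_le_mul_iff_right (ofReal_length_ne_zero I) ENNReal.ofReal_ne_top).1 ?_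
      rw [← mul_assoc, ← ENNReal.ofReal_mul hIl.le, mul_div_cancel₀ _ hIl.ne']
      exact h2
    calc β I = (β I ^ (1 / d : ℝ)) ^ d := by
          rw [← ENNReal.rpow_natCast, ← ENNReal.rpow_mul, one_div,
            inv_mul_cancel₀ (by positivity), ENNReal.rpow_one]
      _ ≤ _ := pow_le_pow_left₀ zero_le h3 d
      _ = _ := by rw [mul_pow, ENNReal.ofReal_pow (by positivity)]
  have hterm : ∀ I ∈ G, β I * ENNReal.ofReal ((I.weight x ^ (2 * d + 2))⁻¹) ≤
      (9 ^ d * M ^ d * ENNReal.ofReal ((Q.weight x ^ (2 * d))⁻¹)) *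
        ((1 / 2 : ℝ≥0∞) ^ (I.2 - Q.2).natAbs * ENNReal.ofReal ((I.weight x ^ 2)⁻¹)) := by
    intro I hI
    have hIl := I.length_pos
    have hsub := hGQ I hI
    have hle := snd_le_of_subset hsub
    have hll := length_mono hle
    have hw := I.weight_pos x
    have hw' := Q.weight_pos x
    rw [show (I.2 - Q.2).natAbs = (Q.2 - I.2).natAbs by omega, ← ofReal_length_div hle]
    refine (mul_le_mul_left (hβ I hI) _).trans ?_
    -- Off the triple of `Q`, `2d` powers of the weight of `I` give `(|I| / |Q|)^(2d)`. Half of it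
    -- absorbs the loss in `hβ`, and the other half makes the sum over the scales converge; two
    -- powers are left for the positions.
    have key : (Q.length / I.length) ^ d * (I.weight x ^ (2 * d + 2))⁻¹ ≤
        9 ^ d * (Q.weight x ^ (2 * d))⁻¹ * (I.length / Q.length) * (I.weight x ^ 2)⁻¹ := by
      have h1 := mul_weight_le_of_notMem_triple hsub hx
      have h2 : (Q.length / I.length * Q.weight x) ^ (2 * d) ≤ (3 * I.weight x) ^ (2 * d) := by
        gcongr
      have h3 : I.length / Q.length ≤ 1 := by rw [div_le_one hQ]; exact hll
      have h4 : (I.length / Q.length) ^ d ≤ I.length / Q.length :=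
        pow_le_of_le_one (by positivity) h3 hd.ne'
      have h5 : (Q.length / I.length) ^ d * (I.weight x ^ (2 * d))⁻¹ ≤
          9 ^ d * (Q.weight x ^ (2 * d))⁻¹ * (I.length / Q.length) ^ d := by
        rw [← div_eq_mul_inv, div_le_iff₀ (by positivity)]
        calc (Q.length / I.length) ^ d = (Q.weight x ^ (2 * d))⁻¹ * (I.length / Q.length) ^ d *
              (Q.length / I.length * Q.weight x) ^ (2 * d) := by
              rw [mul_pow, pow_mul (Q.length / I.length), sq, mul_pow (Q.length / I.length)]
              have e : (I.length / Q.length) ^ d * (Q.length / I.length) ^ d = 1 := by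
                rw [← mul_pow, div_mul_div_cancel₀' hIl.ne', div_self hQ.ne', one_pow]
              calc (Q.length / I.length) ^ d = ((I.length / Q.length) ^ d *
                    (Q.length / I.length) ^ d) * (Q.length / I.length) ^ d *
                    ((Q.weight x ^ (2 * d))⁻¹ * Q.weight x ^ (2 * d)) := by
                    rw [e, inv_mul_cancel₀ (by positivity)]; ring
                _ = _ := by ring
          _ ≤ (Q.weight x ^ (2 * d))⁻¹ * (I.length / Q.length) ^ d *
              (3 * I.weight x) ^ (2 * d) := by gcongr
          _ = _ := by
              rw [mul_pow 3, pow_mul 3]; norm_num; ring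
      calc _ = (Q.length / I.length) ^ d * (I.weight x ^ (2 * d))⁻¹ * (I.weight x ^ 2)⁻¹ := by
            rw [pow_add, mul_inv, mul_assoc]
        _ ≤ 9 ^ d * (Q.weight x ^ (2 * d))⁻¹ * (I.length / Q.length) ^ d *
            (I.weight x ^ 2)⁻¹ := by gcongr
        _ ≤ _ := by gcongr
    calc _ = M ^ d * ENNReal.ofReal ((Q.length / I.length) ^ d *
          (I.weight x ^ (2 * d + 2))⁻¹) := by
          rw [ENNReal.ofReal_mul (by positivity)]; ring
      _ ≤ M ^ d * ENNReal.ofReal (9 ^ d * (Q.weight x ^ (2 * d))⁻¹ * (I.length / Q.length) *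
          (I.weight x ^ 2)⁻¹) := mul_le_mul_right (ENNReal.ofReal_le_ofReal key) _
      _ = _ := by
          rw [ENNReal.ofReal_mul (by positivity), ENNReal.ofReal_mul (by positivity),
            ENNReal.ofReal_mul (by positivity), ENNReal.ofReal_pow (by norm_num),
            ENNReal.ofReal_ofNat]
          ring
  have hall : ∑' I : DyadicInterval, (1 / 2 : ℝ≥0∞) ^ (I.2 - Q.2).natAbs *
      ENNReal.ofReal ((I.weight x ^ 2)⁻¹) ≤ 4 * shiftSum * scaleSum := by
    refine tsum_le_of_scale (k₀ := Q.2) fun k => ?_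
    simp only
    rw [ENNReal.tsum_mul_left, mul_comm]
    exact mul_le_mul_left (tsum_inv_weight_sq_le k x) _
  calc _ ≤ ∑ I ∈ G, (9 ^ d * M ^ d * ENNReal.ofReal ((Q.weight x ^ (2 * d))⁻¹)) *
        ((1 / 2 : ℝ≥0∞) ^ (I.2 - Q.2).natAbs * ENNReal.ofReal ((I.weight x ^ 2)⁻¹)) :=
        Finset.sum_le_sum hterm
    _ ≤ (9 ^ d * M ^ d * ENNReal.ofReal ((Q.weight x ^ (2 * d))⁻¹)) *
        (4 * shiftSum * scaleSum) := by
        rw [← Finset.mul_sum]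
        exact mul_le_mul_right ((ENNReal.sum_le_tsum G).trans hall) _
    _ = _ := by ring

end Paraproduct

namespace Paraproduct

open DyadicInterval

/-- Distributional control of `∑ β_I ψ_I` by the square function of `β`. -/
theorem exists_dom_sum {A C₁ : ℝ≥0} {d : ℕ} (hd : 0 < d) {P : ℝ} (hP : 0 < P) :
    ∃ C : ℝ≥0, ∀ ψ : DyadicInterval → ℝ → ℂ, (∀ I, Measurable (ψ I)) →
      (∀ I x, ‖ψ I x‖ₑ ≤ A * ENNReal.ofReal ((I.weight x ^ (2 * d + 2))⁻¹)) →
      ∀ β : DyadicInterval → ℂ,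
      (∀ F : Finset DyadicInterval, ∫⁻ x, ‖∑ I ∈ F, β I * ψ I x‖ₑ ^ P ≤
        C₁ * ∫⁻ x, (finTower F (fun I => ‖β I‖ₑ ^ 2) x) ^ (P / 2)) →
      ∀ F : Finset DyadicInterval, Dom (fun n : ℤ => C * layerCoeff (1 / d) P n) (fun n => 2 ^ n)
        (fun x => finTower F (fun I => ‖β I‖ₑ ^ 2) x ^ (1 / 2 : ℝ))
        (fun x => ‖∑ I ∈ F, β I * ψ I x‖ₑ) := by
  classical
  have hd' : (0 : ℝ) < 1 / d := by positivity
  have hd1 : (1 / d : ℝ) ≤ 1 := by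
    rw [div_le_one (by positivity)]; exact_mod_cast hd
  set δ : ℝ := 1 / d with hδ
  have htop : 9 ^ d * 4 * shiftSum * scaleSum ≠ ∞ := ENNReal.mul_ne_top
    (ENNReal.mul_ne_top (by simp [ENNReal.mul_eq_top]) shiftSum_ne_top) scaleSum_ne_top
  set B : ℝ≥0 := (9 ^ d * 4 * shiftSum * scaleSum).toNNReal with hB
  have hBe : (B : ℝ≥0∞) = 9 ^ d * 4 * shiftSum * scaleSum := ENNReal.coe_toNNReal htop
  set σ : ℝ≥0 := (4 * shiftSum).toNNReal with hσ
  have hσe : (σ : ℝ≥0∞) = 4 * shiftSum :=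
    ENNReal.coe_toNNReal (ENNReal.mul_ne_top (by simp) shiftSum_ne_top)
  -- The three terms are the contributions of the good intervals, of the union of the tripled
  -- stopping intervals, and of the bad intervals off that union.
  refine ⟨2 ^ P * 2 ^ P * C₁ + 3 + 2 ^ δ * 2 * ((A * B) ^ δ * σ), fun ψ hψ hA β hL F t ht => ?_⟩
  have ht0 : (t : ℝ≥0∞) ≠ 0 := by exact_mod_cast ht.ne'
  set u : DyadicInterval → ℝ≥0∞ := fun I => ‖β I‖ₑ ^ 2 with hu
  set X : ℝ → ℝ≥0∞ := fun x => finTower F u x ^ (1 / 2 : ℝ) with hX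
  have hXm : Measurable X := (measurable_finTower _ _).pow_const _
  set W : ℝ≥0∞ := ∑' n : ℤ, (layerCoeff δ P n : ℝ≥0∞) *
    volume {x | ((2 ^ n * t : ℝ≥0) : ℝ≥0∞) < X x} with hW
  -- An interval is good if the sum of `|β|²` over the members of `F` containing it is at most `t²`.
  -- Every bad interval lies in a stopping interval.
  set Fg : Finset DyadicInterval := F.filter fun I => above F u I ≤ (t : ℝ≥0∞) ^ 2 with hFg
  set Fb : Finset DyadicInterval := F.filter fun I => ¬ above F u I ≤ (t : ℝ≥0∞) ^ 2 with hFb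
  have hsplit : ∀ x, ∑ I ∈ F, β I * ψ I x = ∑ I ∈ Fg, β I * ψ I x + ∑ I ∈ Fb, β I * ψ I x :=
    fun x => (Finset.sum_filter_add_sum_filter_not _ _ _).symm
  -- the good part
  have hgX : ∀ x, finTower Fg u x ≤ (min (X x) t) ^ 2 := by
    intro x
    have h1 : finTower Fg u x ≤ X x ^ 2 := by
      rw [hX]; simp only
      rw [rpow_half_sq]
      exact Finset.sum_le_sum_of_subset (Finset.filter_subset _ _)
    -- The good intervals through `x` all contain the shortest of them, which satisfies the
    -- threshold. Hence the square function of the good part is at most `min (X x) t`.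
    have h2 : finTower Fg u x ≤ (t : ℝ≥0∞) ^ 2 := by
      rcases finTower_eq_zero_or Fg u x with h0 | ⟨I, hI, _, e⟩
      · rw [h0]; exact zero_le
      · rw [e]
        rw [hFg, Finset.mem_filter] at hI
        refine le_trans ?_ hI.2
        exact Finset.sum_le_sum_of_subset
          (Finset.filter_subset_filter _ (Finset.filter_subset _ _))
    rcases min_choice (X x) (t : ℝ≥0∞) with h | h <;> rw [h] <;> assumption
  have hgood : volume {x | ((t / 2 : ℝ≥0) : ℝ≥0∞) < ‖∑ I ∈ Fg, β I * ψ I x‖ₑ} ≤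
      ((2 ^ P * 2 ^ P * C₁ : ℝ≥0) : ℝ≥0∞) * W := by
    have hm : Measurable fun x => ‖∑ I ∈ Fg, β I * ψ I x‖ₑ :=
      (Finset.measurable_fun_sum Fg fun I _ => (hψ I).const_mul _).enorm
    refine (meas_le_gauge false hP hm (half_pos ht)).trans ?_
    rw [gauge_false]
    have h1 : ∫⁻ x, (finTower Fg u x) ^ (P / 2) ≤ ((2 ^ P * t ^ P : ℝ≥0) : ℝ≥0∞) * W := by
      refine le_trans (lintegral_mono fun x => ?_) (lintegral_min_rpow_le (δ := δ) hXm hP ht)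
      refine (ENNReal.rpow_le_rpow (hgX x) (by positivity)).trans (le_of_eq ?_)
      rw [← ENNReal.rpow_natCast, ← ENNReal.rpow_mul]
      congr 1; push_cast; ring
    calc _ ≤ (((t / 2) ^ (-P) : ℝ≥0) : ℝ≥0∞) * (C₁ * (((2 ^ P * t ^ P : ℝ≥0) : ℝ≥0∞) * W)) :=
          mul_le_mul_right ((hL Fg).trans (mul_le_mul_right h1 _)) _
      _ = (((t / 2) ^ (-P) * C₁ * (2 ^ P * t ^ P) : ℝ≥0) : ℝ≥0∞) * W := by
          push_cast; ring
      _ = _ := by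
          congr 2
          have := (NNReal.rpow_pos (p := P) ht).ne'
          rw [NNReal.div_rpow, NNReal.rpow_neg, NNReal.rpow_neg]
          field_simp
  -- the exceptional set
  set S := stopping F u ((t : ℝ≥0∞) ^ 2) with hS
  have hlt : ∀ x, (t : ℝ≥0∞) ^ 2 < finTower F u x ↔ (t : ℝ≥0∞) < X x :=
    fun x => lt_rpow_half_iff.symm
  have hΩ : ⋃ Q ∈ S, Q.toSet = {x | (t : ℝ≥0∞) < X x} := by
    rw [hS, ← setOf_lt_finTower]
    ext x
    exact hlt x
  have hone : volume {x | (t : ℝ≥0∞) < X x} ≤ W := by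
    refine le_trans (le_of_eq ?_) (ENNReal.le_tsum 0)
    simp [layerCoeff]
  have hexc : volume (⋃ Q ∈ S, Q.triple) ≤ 3 * W := by
    calc _ ≤ ∑ Q ∈ S, volume Q.triple := measure_biUnion_finset_le _ _
      _ ≤ ∑ Q ∈ S, 3 * volume Q.toSet := Finset.sum_le_sum fun Q _ => volume_triple_le Q
      _ = 3 * volume {x | (t : ℝ≥0∞) < X x} := by
          rw [← Finset.mul_sum, hS, sum_volume_stopping]
          simp_rw [hlt]
      _ ≤ _ := mul_le_mul_right hone _
  -- the bad part
  let M : DyadicInterval → ℝ≥0∞ := fun Q =>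
    (ENNReal.ofReal Q.length)⁻¹ * ∫⁻ y in Q.toSet, X y ^ δ
  let H : ℝ → ℝ≥0∞ := fun x => ∑ Q ∈ S, ((A * B : ℝ≥0) : ℝ≥0∞) ^ δ *
    (M Q * ENNReal.ofReal ((Q.weight x ^ 2)⁻¹))
  have hHm : Measurable H := Finset.measurable_fun_sum S fun Q _ =>
    ((measurable_inv_weight Q).const_mul _).const_mul _
  -- The power `δ = 1/d ≤ 1` is subadditive and turns the tail of each stopping interval into a mean
  -- of `X^δ` times an integrable weight. Only the integral of `X^δ` over `{X > t}` is then needed.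
  have hbadpt : ∀ x, x ∉ ⋃ Q ∈ S, Q.triple → ‖∑ I ∈ Fb, β I * ψ I x‖ₑ ^ δ ≤ H x := by
    intro x hx
    have hx' : ∀ Q ∈ S, x ∉ Q.triple := fun Q hQ h => hx (Set.mem_biUnion hQ h)
    have h1 : ‖∑ I ∈ Fb, β I * ψ I x‖ₑ ≤ ∑ Q ∈ S, A * ∑ I ∈ Fb.filter
        (fun I => I.toSet ⊆ Q.toSet), ‖β I‖ₑ * ENNReal.ofReal ((I.weight x ^ (2 * d + 2))⁻¹) := by
      have hex : ∀ I ∈ Fb, ∃ Q ∈ S, I.toSet ⊆ Q.toSet := fun I hI => by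
        rw [hFb, Finset.mem_filter, not_le] at hI
        exact exists_stopping hI.1 hI.2
      calc _ ≤ ∑ I ∈ Fb, ‖β I * ψ I x‖ₑ := enorm_sum_le _ _
        _ ≤ ∑ I ∈ Fb, ∑ Q ∈ S, if I.toSet ⊆ Q.toSet then
            A * (‖β I‖ₑ * ENNReal.ofReal ((I.weight x ^ (2 * d + 2))⁻¹)) else 0 := by
            refine Finset.sum_le_sum fun I hI => ?_
            obtain ⟨Q, hQ, hIQ⟩ := hex I hI
            refine le_trans ?_ (Finset.single_le_sum (fun _ _ => zero_le) hQ)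
            rw [if_pos hIQ, enorm_mul, mul_left_comm]
            exact mul_le_mul_right (hA I x) _
        _ = _ := by
            rw [Finset.sum_comm]
            refine Finset.sum_congr rfl fun Q _ => ?_
            rw [Finset.mul_sum]
            exact (Finset.sum_filter _ _).symm
    have h2 : ∀ Q ∈ S, (A : ℝ≥0∞) * ∑ I ∈ Fb.filter (fun I => I.toSet ⊆ Q.toSet),
        ‖β I‖ₑ * ENNReal.ofReal ((I.weight x ^ (2 * d + 2))⁻¹) ≤
        ((A * B : ℝ≥0) : ℝ≥0∞) * (M Q ^ d * ENNReal.ofReal ((Q.weight x ^ (2 * d))⁻¹)) := by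
      intro Q hQ
      rw [ENNReal.coe_mul, mul_assoc, hBe]
      refine mul_le_mul_right ?_ _
      exact sum_enorm_mul_inv_weight_le (β := fun I => ‖β I‖ₑ) hd (hx' Q hQ) _
        ((Finset.filter_subset _ _).trans (Finset.filter_subset _ _))
        fun I hI => (Finset.mem_filter.1 hI).2
    calc _ ≤ (∑ Q ∈ S, ((A * B : ℝ≥0) : ℝ≥0∞) *
          (M Q ^ d * ENNReal.ofReal ((Q.weight x ^ (2 * d))⁻¹))) ^ δ :=
          ENNReal.rpow_le_rpow (h1.trans (Finset.sum_le_sum h2)) hd'.le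
      _ ≤ ∑ Q ∈ S, (((A * B : ℝ≥0) : ℝ≥0∞) *
          (M Q ^ d * ENNReal.ofReal ((Q.weight x ^ (2 * d))⁻¹))) ^ δ :=
          rpow_sum_le_sum_rpow _ _ hd' hd1
      _ = H x := by
          refine Finset.sum_congr rfl fun Q _ => ?_
          have hw := Q.weight_pos x
          rw [ENNReal.mul_rpow_of_nonneg _ _ hd'.le, ENNReal.mul_rpow_of_nonneg _ _ hd'.le,
            pow_mul, ← inv_pow, ENNReal.ofReal_pow (by positivity), ← ENNReal.rpow_natCast (M Q),
            ← ENNReal.rpow_natCast (ENNReal.ofReal _), ← ENNReal.rpow_mul, ← ENNReal.rpow_mul,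
            hδ, mul_one_div_cancel (by positivity), ENNReal.rpow_one, ENNReal.rpow_one]
  have hHint : ∫⁻ x, H x ≤ (((A * B) ^ δ * σ : ℝ≥0) : ℝ≥0∞) *
      (((2 * t ^ δ : ℝ≥0) : ℝ≥0∞) * W) := by
    calc ∫⁻ x, H x = ∑ Q ∈ S, ((A * B : ℝ≥0) : ℝ≥0∞) ^ δ *
          (M Q * ∫⁻ x, ENNReal.ofReal ((Q.weight x ^ 2)⁻¹)) := by
          rw [lintegral_finsetSum _ fun Q _ =>
            ((measurable_inv_weight Q).const_mul _).const_mul _]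
          refine Finset.sum_congr rfl fun Q _ => ?_
          rw [lintegral_const_mul _ ((measurable_inv_weight Q).const_mul _),
            lintegral_const_mul _ (measurable_inv_weight Q)]
      _ ≤ ∑ Q ∈ S, ((A * B : ℝ≥0) : ℝ≥0∞) ^ δ * (σ * ∫⁻ y in Q.toSet, X y ^ δ) := by
          refine Finset.sum_le_sum fun Q _ => mul_le_mul_right ?_ _
          refine (mul_le_mul_right (lintegral_inv_weight_sq_le Q) _).trans (le_of_eq ?_)
          rw [← hσe]
          simp only [M]
          rw [mul_comm, mul_assoc, ← mul_assoc (ENNReal.ofReal _), ENNReal.mul_inv_cancel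
            (ofReal_length_ne_zero Q) ENNReal.ofReal_ne_top, one_mul]
      _ = (((A * B) ^ δ * σ : ℝ≥0) : ℝ≥0∞) * ∫⁻ y in {x | (t : ℝ≥0∞) < X x}, X y ^ δ := by
          rw [← hΩ, lintegral_biUnion_finset stopping_pairwiseDisjoint
            fun Q _ => measurableSet_toSet Q, Finset.mul_sum]
          refine Finset.sum_congr rfl fun Q _ => ?_
          rw [ENNReal.coe_mul ((A * B) ^ δ), ENNReal.coe_rpow_of_nonneg _ hd'.le, mul_assoc]
      _ ≤ _ := mul_le_mul_right (lintegral_indicator_rpow_le hXm hd ht) _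
  have hbad : volume {x | x ∉ ⋃ Q ∈ S, Q.triple ∧
      ((t / 2 : ℝ≥0) : ℝ≥0∞) < ‖∑ I ∈ Fb, β I * ψ I x‖ₑ} ≤
      ((2 ^ δ * 2 * ((A * B) ^ δ * σ) : ℝ≥0) : ℝ≥0∞) * W := by
    calc _ ≤ volume {x | (((t / 2) ^ δ : ℝ≥0) : ℝ≥0∞) < H x} := by
          refine measure_mono fun x hx => ?_
          refine lt_of_lt_of_le ?_ (hbadpt x hx.1)
          rw [ENNReal.coe_rpow_of_nonneg _ hd'.le]
          exact ENNReal.rpow_lt_rpow hx.2 hd'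
      _ ≤ ((((t / 2) ^ δ) ^ (-1 : ℝ) : ℝ≥0) : ℝ≥0∞) * gauge false 1 H :=
          meas_le_gauge false one_pos hHm (NNReal.rpow_pos (half_pos ht))
      _ ≤ ((((t / 2) ^ δ) ^ (-1 : ℝ) : ℝ≥0) : ℝ≥0∞) * ((((A * B) ^ δ * σ : ℝ≥0) : ℝ≥0∞) *
          (((2 * t ^ δ : ℝ≥0) : ℝ≥0∞) * W)) := by
          refine mul_le_mul_right ?_ _
          rw [gauge_false]
          simp_rw [ENNReal.rpow_one]
          exact hHint
      _ = ((((t / 2) ^ δ) ^ (-1 : ℝ) * ((A * B) ^ δ * σ) * (2 * t ^ δ) : ℝ≥0) : ℝ≥0∞) * W := by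
          push_cast; ring
      _ = _ := by
          congr 2
          have := (NNReal.rpow_pos (p := δ) ht).ne'
          rw [NNReal.rpow_neg_one, NNReal.div_rpow, inv_div]
          field_simp
  have hfinal : {x | (t : ℝ≥0∞) < ‖∑ I ∈ F, β I * ψ I x‖ₑ} ⊆
      {x | ((t / 2 : ℝ≥0) : ℝ≥0∞) < ‖∑ I ∈ Fg, β I * ψ I x‖ₑ} ∪ (⋃ Q ∈ S, Q.triple) ∪
        {x | x ∉ ⋃ Q ∈ S, Q.triple ∧
          ((t / 2 : ℝ≥0) : ℝ≥0∞) < ‖∑ I ∈ Fb, β I * ψ I x‖ₑ} := by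
    intro x hx
    have hx' : (t : ℝ≥0∞) < ‖∑ I ∈ F, β I * ψ I x‖ₑ := hx
    by_contra hcon
    simp only [Set.mem_union, not_or] at hcon
    obtain ⟨⟨h1, h2⟩, h3⟩ := hcon
    have h1' : ‖∑ I ∈ Fg, β I * ψ I x‖ₑ ≤ ((t / 2 : ℝ≥0) : ℝ≥0∞) := not_lt.1 h1
    have h3' : ‖∑ I ∈ Fb, β I * ψ I x‖ₑ ≤ ((t / 2 : ℝ≥0) : ℝ≥0∞) :=
      not_lt.1 fun h => h3 ⟨h2, h⟩
    rw [hsplit] at hx'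
    refine absurd hx' (not_lt.2 ((enorm_add_le _ _).trans ((add_le_add h1' h3').trans ?_)))
    rw [← ENNReal.coe_add, add_halves]
  calc _ ≤ _ := measure_mono hfinal
    _ ≤ _ := (measure_union_le _ _).trans (add_le_add_left (measure_union_le _ _) _)
    _ ≤ ((2 ^ P * 2 ^ P * C₁ : ℝ≥0) : ℝ≥0∞) * W + 3 * W +
        ((2 ^ δ * 2 * ((A * B) ^ δ * σ) : ℝ≥0) : ℝ≥0∞) * W :=
        add_le_add (add_le_add hgood hexc) hbad
    _ = ((2 ^ P * 2 ^ P * C₁ + 3 + 2 ^ δ * 2 * ((A * B) ^ δ * σ) : ℝ≥0) : ℝ≥0∞) * W := by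
        push_cast; ring
    _ = _ := by
        rw [hW, ← ENNReal.tsum_mul_left]
        refine tsum_congr fun n => ?_
        rw [← mul_assoc, ← ENNReal.coe_mul]

end Paraproduct

namespace Paraproduct

open DyadicInterval

/-! ### Products of functions and sums over all intervals -/

theorem rpow_sum_eq_prod {ι : Type*} (s : Finset ι) (x : ℝ≥0∞) {a : ι → ℝ}
    (ha : ∀ i ∈ s, 0 ≤ a i) : x ^ (∑ i ∈ s, a i) = ∏ i ∈ s, x ^ a i := by
  classical
  induction s using Finset.induction_on with
  | empty => simp
  | insert i s hi ih =>
    rw [Finset.sum_insert hi, Finset.prod_insert hi, ENNReal.rpow_add_of_nonneg,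
      ih fun j hj => ha j (Finset.mem_insert_of_mem hj)]
    · exact ha i (Finset.mem_insert_self i s)
    · exact Finset.sum_nonneg fun j hj => ha j (Finset.mem_insert_of_mem hj)

theorem gauge_sup_le {ι : Type*} (w : Bool) (s : Finset ι) {E : ι → ℝ → ℝ≥0∞}
    (hE : ∀ i ∈ s, Measurable (E i)) :
    gauge w 1 (fun x => s.sup fun i => E i x) ≤ ∑ i ∈ s, gauge w 1 (E i) := by
  cases w with
  | false =>
    simp only [gauge_false, ENNReal.rpow_one]
    rw [← lintegral_finsetSum' _ fun i hi => (hE i hi).aemeasurable]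
    refine lintegral_mono fun x => Finset.sup_le fun i hi => ?_
    exact Finset.single_le_sum (f := fun i => E i x) (fun _ _ => zero_le) hi
  | true =>
    simp only [gauge_true, ENNReal.rpow_one]
    refine iSup_le fun t => ?_
    have hsub : {x | (t : ℝ≥0∞) < s.sup fun i => E i x} ⊆ ⋃ i ∈ s, {x | (t : ℝ≥0∞) < E i x} := by
      intro x hx
      obtain ⟨i, hi, h⟩ := Finset.lt_sup_iff.1 (show (t : ℝ≥0∞) < s.sup fun i => E i x from hx)
      exact Set.mem_biUnion hi h
    calc _ ≤ (t : ℝ≥0∞) * ∑ i ∈ s, volume {x | (t : ℝ≥0∞) < E i x} :=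
          mul_le_mul_right ((measure_mono hsub).trans (measure_biUnion_finset_le _ _)) _
      _ = ∑ i ∈ s, (t : ℝ≥0∞) * volume {x | (t : ℝ≥0∞) < E i x} := Finset.mul_sum _ _ _
      _ ≤ _ := Finset.sum_le_sum fun i _ =>
          le_iSup (fun t : ℝ≥0 => (t : ℝ≥0∞) * volume {x | (t : ℝ≥0∞) < E i x}) t

/-- Hölder's inequality, for strong and weak spaces alike. -/
theorem gauge_prod_le {ι : Type*} (w : Bool) (s : Finset ι) {E : ι → ℝ → ℝ≥0∞}
    (hE : ∀ i ∈ s, Measurable (E i)) {p : ι → ℝ} (hp : ∀ i ∈ s, 0 < p i) {r : ℝ} (hr : 0 < r)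
    (hpr : r⁻¹ = ∑ i ∈ s, (p i)⁻¹) :
    gauge w r (fun x => ∏ i ∈ s, E i x) ≤ ∑ i ∈ s, gauge w (p i) (E i) := by
  -- Each factor is at most the `1 / p i`-th power of the largest of the `E i ^ p i`. This is lossy,
  -- but enough for normalized data and equally valid for weak spaces; the product form of the bound
  -- is recovered by homogeneity.
  have hpt : ∀ x, ∏ i ∈ s, E i x ≤ (s.sup fun i => E i x ^ p i) ^ (r⁻¹) := by
    intro x
    rw [hpr, rpow_sum_eq_prod _ _ fun i hi => (inv_pos.2 (hp i hi)).le]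
    refine Finset.prod_le_prod' fun i hi => ?_
    rw [ENNReal.le_rpow_inv_iff (hp i hi)]
    exact Finset.le_sup (f := fun i => E i x ^ p i) hi
  calc _ ≤ gauge w r (fun x => (s.sup fun i => E i x ^ p i) ^ (r⁻¹)) := gauge_mono hr hpt
    _ = gauge w 1 (fun x => s.sup fun i => E i x ^ p i) := by
        rw [gauge_rpow w r (inv_pos.2 hr), inv_mul_cancel₀ hr.ne']
    _ ≤ ∑ i ∈ s, gauge w 1 (fun x => E i x ^ p i) :=
        gauge_sup_le w s fun i hi => (hE i hi).pow_const _
    _ = _ := Finset.sum_congr rfl fun i hi => by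
        rw [gauge_rpow w 1 (hp i hi), mul_one]

theorem tsum_mul_le_rpow {ι : Type*} (a b : ι → ℝ≥0∞) :
    ∑' i, a i * b i ≤ (∑' i, a i ^ 2) ^ (1 / 2 : ℝ) * (∑' i, b i ^ 2) ^ (1 / 2 : ℝ) := by
  let _ : MeasurableSpace ι := ⊤
  have h := ENNReal.lintegral_mul_le_Lp_mul_Lq (Measure.count : Measure ι)
    Real.HolderConjugate.two_two (f := a) (g := b) measurable_from_top.aemeasurable
    measurable_from_top.aemeasurable
  simpa only [lintegral_count, ENNReal.rpow_two, Pi.mul_apply] using h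

theorem tsum_eq_tsum_tsum_shift (u : DyadicInterval → ℝ≥0∞) (x : ℝ) :
    ∑' I, u I = ∑' k : ℤ, ∑' n : ℤ, u ((around x k).shift n) := by
  rw [← (Equiv.prodComm ℤ ℤ).tsum_eq, ENNReal.tsum_prod']
  refine tsum_congr fun k => ?_
  exact ((Equiv.addLeft ⌊x / (2 : ℝ) ^ k⌋).tsum_eq fun j => u (j, k)).symm

/-- A sum over all intervals with decay in the distance to `x`. -/
theorem tsum_mul_mul_le_smoothSq {Ψ Ψ' : DyadicInterval → ℝ → ℂ} {f f' : ℝ → ℂ} (x : ℝ)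
    {u : DyadicInterval → ℝ≥0∞} {B : ℝ≥0∞}
    (hu : ∀ (J : DyadicInterval) (n : ℤ), x ∈ J.toSet → u (J.shift n) ≤
      B * (ENNReal.ofReal (((1 + |(n : ℝ)|) ^ 16)⁻¹) *
        (‖coef (J.shift n) (Ψ (J.shift n)) f‖ₑ * ‖coef (J.shift n) (Ψ' (J.shift n)) f'‖ₑ))) :
    ∑' I, u I ≤ B * (tower (smoothSq Ψ f) x ^ (1 / 2 : ℝ) *
      tower (smoothSq Ψ' f') x ^ (1 / 2 : ℝ)) := by
  rw [tsum_eq_tsum_tsum_shift u x, ← ENNReal.tsum_prod]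
  -- The decay is split evenly between the two factors of Cauchy–Schwarz; its square is the weight
  -- of `smoothSq`.
  let c : ℤ → ℝ≥0∞ := fun n => ENNReal.ofReal (((1 + |(n : ℝ)|) ^ 8)⁻¹)
  have hc : ∀ n, c n ^ 2 = ENNReal.ofReal (((1 + |(n : ℝ)|) ^ 16)⁻¹) := fun n => by
    rw [← ENNReal.ofReal_pow (by positivity), inv_pow, ← pow_mul]
  have hsq : ∀ (Θ : DyadicInterval → ℝ → ℂ) (h : ℝ → ℂ), ∑' q : ℤ × ℤ,
      (c q.2 * ‖coef ((around x q.1).shift q.2) (Θ ((around x q.1).shift q.2)) h‖ₑ) ^ 2 =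
      tower (smoothSq Θ h) x := by
    intro Θ h
    rw [ENNReal.tsum_prod', tower_eq_tsum_scale]
    refine tsum_congr fun k => ?_
    unfold smoothSq
    refine tsum_congr fun n => ?_
    rw [mul_pow, hc]
  rw [← hsq Ψ f, ← hsq Ψ' f']
  refine le_trans (ENNReal.tsum_le_tsum fun q => hu (around x q.1) q.2 (mem_around x q.1)) ?_
  rw [ENNReal.tsum_mul_left]
  refine mul_le_mul_right (le_trans (le_of_eq (tsum_congr fun q => ?_)) (tsum_mul_le_rpow _ _)) _
  rw [← hc]
  ring

theorem exists_gauge_tower_smoothSq_le {K : ℝ} (hK : 0 < K) (w : Bool) {p : ℝ} (hp : 0 < p)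
    (A : ℝ≥0) : ∃ C : ℝ≥0, ∀ Ψ : DyadicInterval → ℝ → ℂ, (∀ I, Bump K 5 I (Ψ I)) →
      HasMeanZero Ψ → ∀ f : ℝ → ℂ, Measurable f →
      gauge w p (maxFun fun y => ‖f y‖ₑ) ≤ A →
      gauge w p (fun x => tower (smoothSq Ψ f) x ^ (1 / 2 : ℝ)) ≤ C := by
  obtain ⟨C, hC⟩ := exists_gauge_smoothSq_le hK (q := 1 / 2 * p) (by positivity)
  refine ⟨C * A, fun Ψ hΨ h0 f hf hA => ?_⟩
  rw [gauge_rpow w p (by norm_num), ENNReal.coe_mul]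
  refine (hC Ψ hΨ h0 f hf w).trans (mul_le_mul_right (le_trans (le_of_eq ?_) hA) _)
  have := gauge_rpow w (1 / 2 * p) (a := 2) (by norm_num) (maxFun fun y => ‖f y‖ₑ)
  simp_rw [ENNReal.rpow_two] at this
  rw [this]
  congr 1; ring

end Paraproduct

namespace Paraproduct

open DyadicInterval

/-! ### Paraproducts with normalized data -/

theorem enorm_prod_eq {ι : Type*} (s : Finset ι) (a : ι → ℂ) :
    ‖∏ i ∈ s, a i‖ₑ = ∏ i ∈ s, ‖a i‖ₑ := by
  simp only [enorm_eq_nnnorm]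
  rw [nnnorm_prod, ENNReal.ofNNReal_finsetProd]

/-- Convergence of `∑ β_I ψ_I` from a bound for the square function of `β`. -/
theorem exists_synthesis {w : Bool} {r : ℝ} {d : ℕ} (hd : 0 < d) (hdr : 1 / d < r) {P P' : ℝ}
    (hP : 2 ≤ P) (hrP : r < P) (hPP : P.HolderConjugate P') (A C₀ : ℝ≥0) :
    ∃ C : ℝ≥0, ∀ ψ : DyadicInterval → ℝ → ℂ, (∀ I, Measurable (ψ I)) →
      (∀ I x, ‖ψ I x‖ₑ ≤ A * ENNReal.ofReal ((I.weight x ^ (2 * d + 2))⁻¹)) →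
      (∀ h : ℝ → ℂ, Measurable h → ∃ v : DyadicInterval → ℝ≥0∞,
        (∀ I, ‖pairing h (ψ I)‖ₑ ≤ ENNReal.ofReal I.length * v I) ∧
        ∫⁻ x, (tower (fun I => v I ^ 2) x) ^ (P' / 2) ≤ C₀ * ∫⁻ x, ‖h x‖ₑ ^ P') →
      ∀ β : DyadicInterval → ℂ, gauge w (1 / 2 * r) (tower fun I => ‖β I‖ₑ ^ 2) ≠ ∞ →
      ∃ g : ℝ → ℂ, Measurable g ∧
        TendstoInMeasure volume (fun (F : Finset DyadicInterval) x => ∑ I ∈ F, β I * ψ I x) atTop g ∧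
        gauge w r (fun x => ‖g x‖ₑ) ≤ C * gauge w (1 / 2 * r) (tower fun I => ‖β I‖ₑ ^ 2) := by
  have hP0 : 0 < P := by linarith
  have hd0 : (0 : ℝ) < 1 / d := by positivity
  have hr : 0 < r := hd0.trans hdr
  obtain ⟨C, hC⟩ := exists_dom_sum (A := A) (C₁ := C₀ ^ (P / P')) hd hP0
  have hsum := tsum_layerCoeff_ne_top hdr hrP C
  refine ⟨(∑' n : ℤ, ((C * layerCoeff (1 / d) P n * ((2 : ℝ≥0) ^ n) ^ (-r) : ℝ≥0) : ℝ≥0∞)).toNNReal,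
    fun ψ hψ hA hdual β hβ => ?_⟩
  have hP'0 : 0 < P' := hPP.symm.pos
  have hA2 : ∀ I x, ‖ψ I x‖ₑ ≤ A * ENNReal.ofReal ((I.weight x ^ 2)⁻¹) := fun I x => by
    refine (hA I x).trans (mul_le_mul_right (ENNReal.ofReal_le_ofReal ?_) _)
    have := I.weight_pos x
    exact inv_anti₀ (by positivity) (pow_le_pow_right₀ (I.one_le_weight x) (by omega))
  have hL : ∀ F : Finset DyadicInterval, ∫⁻ x, ‖∑ I ∈ F, β I * ψ I x‖ₑ ^ P ≤
      ((C₀ ^ (P / P') : ℝ≥0) : ℝ≥0∞) *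
        ∫⁻ x, (finTower F (fun I => ‖β I‖ₑ ^ 2) x) ^ (P / 2) := fun F => by
    rw [ENNReal.coe_rpow_of_nonneg _ (by positivity)]
    exact lintegral_sum_rpow_le_of_dual hψ hA2 hP hPP hdual F β
  have hdom := hC ψ hψ hA β hL
  have e : gauge w r (fun x => tower (fun I => ‖β I‖ₑ ^ 2) x ^ (1 / 2 : ℝ)) =
      gauge w (1 / 2 * r) (tower fun I => ‖β I‖ₑ ^ 2) := gauge_rpow w r (by norm_num) _
  rw [ENNReal.coe_toNNReal hsum, ← e]
  exact exists_sum_of_dom (θ := 1 / 2) (by norm_num) (fun n => by positivity) w hr hsum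
    (u := fun I x => β I * ψ I x) (fun I => (hψ I).const_mul _)
    (b := fun I x => I.toSet.indicator (fun _ => ‖β I‖ₑ ^ 2) x)
    (fun I => measurable_const.indicator (measurableSet_toSet I)) hdom (by rw [← e] at hβ; exact hβ)

/-- Bumps and functions whose norms are normalized: the positions in `L` carry functions with
maximal functions in `L^p`, the other positions carry bounded functions or functions of bounded
mean oscillation. -/
structure IsNormalized {m : ℕ} (K : ℝ) (N : ℕ) (w : Bool) (L : Finset (Fin m)) (p : Fin m → ℝ)
    (A : ℝ≥0) (Ψ : Fin (m + 1) → DyadicInterval → ℝ → ℂ) (f : Fin m → ℝ → ℂ) : Prop where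
  bump : ∀ j I, Bump K N I (Ψ j I)
  measurable : ∀ j, Measurable (f j)
  gauge_le : ∀ j ∈ L, gauge w (p j) (maxFun fun y => ‖f j y‖ₑ) ≤ A
  osc_le : ∀ j ∉ L, ∀ J : DyadicInterval, ∃ c : ℂ, avg J (fun x => ‖f j x - c‖ₑ) ≤ 1 ∧
    (c = 0 ∨ HasMeanZero (Ψ j.castSucc))

/-- The normalized coefficient of the function in position `j`. -/
noncomputable def inCoef {m : ℕ} (Ψ : Fin (m + 1) → DyadicInterval → ℝ → ℂ) (f : Fin m → ℝ → ℂ)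
    (j : Fin m) (I : DyadicInterval) : ℂ := coef I (Ψ j.castSucc I) (f j)

open Classical in
/-- A square function in the positions of `s`, a maximal function in the others. -/
noncomputable def sqMax {m : ℕ} (Ψ : Fin (m + 1) → DyadicInterval → ℝ → ℂ) (f : Fin m → ℝ → ℂ)
    (s : Finset (Fin m)) (j : Fin m) (x : ℝ) : ℝ≥0∞ :=
  if j ∈ s then tower (smoothSq (Ψ j.castSucc) (f j)) x ^ (1 / 2 : ℝ)
  else maxFun (fun y => ‖f j y‖ₑ) x

section Normalized

variable {m : ℕ} {K : ℝ} {N : ℕ} {w : Bool} {L : Finset (Fin m)} {p : Fin m → ℝ} {A : ℝ≥0}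
  {Ψ : Fin (m + 1) → DyadicInterval → ℝ → ℂ} {f : Fin m → ℝ → ℂ}

theorem sqMax_of_mem {s : Finset (Fin m)} {j : Fin m} (h : j ∈ s) (x : ℝ) :
    sqMax Ψ f s j x = tower (smoothSq (Ψ j.castSucc) (f j)) x ^ (1 / 2 : ℝ) := if_pos h

theorem sqMax_of_notMem {s : Finset (Fin m)} {j : Fin m} (h : j ∉ s) (x : ℝ) :
    sqMax Ψ f s j x = maxFun (fun y => ‖f j y‖ₑ) x := if_neg h

theorem measurable_sqMax (s : Finset (Fin m)) (j : Fin m) : Measurable (sqMax Ψ f s j) := by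
  unfold sqMax
  split_ifs
  · exact (measurable_tower _).pow_const _
  · exact measurable_maxFun _

/-- In a position of `L` the average over the translate is compared with the average over `J`, which
contains `x`; this costs `(1 + |n|)²`. In the other positions the constant `c` is either zero or not
seen by the bump. -/
theorem IsNormalized.enorm_inCoef_le (h : IsNormalized K N w L p A Ψ f) (hN : 2 ≤ N) (j : Fin m)
    {J : DyadicInterval} (n : ℤ) {x : ℝ} (hx : x ∈ J.toSet) :
    ‖inCoef Ψ f j (J.shift n)‖ₑ ≤ ENNReal.ofReal (K * (1 + |(n : ℝ)|) ^ 2) *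
      (if j ∈ L then maxFun (fun y => ‖f j y‖ₑ) x else 1) := by
  have hb := h.bump j.castSucc (J.shift n)
  have hK := hb.nonneg
  rw [ENNReal.ofReal_mul hK, mul_assoc]
  unfold inCoef
  split_ifs with hj
  · refine (hb.enorm_coef_le hN _).trans (mul_le_mul_right ?_ _)
    refine (avg_le_shift (J.shift n) (-n) _).trans ?_
    rw [shift_shift, add_neg_cancel, shift_zero, Int.cast_neg, abs_neg]
    exact mul_le_mul_right (avg_le_maxFun hx _) _
  · obtain ⟨c, hc, hc'⟩ := h.osc_le j hj (J.shift n)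
    have h1 : ‖coef (J.shift n) (Ψ j.castSucc (J.shift n)) (f j)‖ₑ ≤ ENNReal.ofReal K *
        avg (J.shift n) (fun x => ‖f j x - c‖ₑ) := by
      rcases hc' with h0 | h0
      · subst h0
        simpa using hb.enorm_coef_le hN (f j)
      · exact hb.enorm_coef_le_sub hN (h0 _) (h.measurable j) c
    refine h1.trans (mul_le_mul_right (hc.trans ?_) _)
    rw [mul_one, ENNReal.one_le_ofReal]
    exact one_le_pow₀ (by simp)

theorem IsNormalized.prod_enorm_inCoef_le (h : IsNormalized K N w L p A Ψ f) (hN : 2 ≤ N)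
    (hK : 1 ≤ K) (T : Finset (Fin m)) {J : DyadicInterval} (n : ℤ) {x : ℝ} (hx : x ∈ J.toSet) :
    ∏ j ∈ T, ‖inCoef Ψ f j (J.shift n)‖ₑ ≤ ENNReal.ofReal ((K * (1 + |(n : ℝ)|) ^ 2) ^ m) *
      ∏ j ∈ L ∩ T, maxFun (fun y => ‖f j y‖ₑ) x := by
  have h1 : (1 : ℝ) ≤ K * (1 + |(n : ℝ)|) ^ 2 :=
    one_le_mul_of_one_le_of_one_le hK (one_le_pow₀ (by simp))
  calc _ ≤ ∏ j ∈ T, ENNReal.ofReal (K * (1 + |(n : ℝ)|) ^ 2) *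
        (if j ∈ L then maxFun (fun y => ‖f j y‖ₑ) x else 1) :=
        Finset.prod_le_prod' fun j _ => h.enorm_inCoef_le hN j n hx
    _ = ENNReal.ofReal (K * (1 + |(n : ℝ)|) ^ 2) ^ T.card *
        ∏ j ∈ L ∩ T, maxFun (fun y => ‖f j y‖ₑ) x := by
        rw [Finset.prod_mul_distrib, Finset.prod_const, Finset.prod_ite_mem, Finset.inter_comm]
    _ ≤ _ := by
        refine mul_le_mul_left ?_ _
        rw [ENNReal.ofReal_pow (by positivity)]
        refine pow_le_pow_right₀ (by rwa [ENNReal.one_le_ofReal]) ?_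
        simpa using Finset.card_le_univ T

theorem IsNormalized.prod_enorm_inCoef_le_of_mem (h : IsNormalized K N w L p A Ψ f) (hN : 2 ≤ N)
    (hK : 1 ≤ K) (T : Finset (Fin m)) {J : DyadicInterval} {x : ℝ} (hx : x ∈ J.toSet) :
    ∏ j ∈ T, ‖inCoef Ψ f j J‖ₑ ≤ ENNReal.ofReal (K ^ m) *
      ∏ j ∈ L ∩ T, maxFun (fun y => ‖f j y‖ₑ) x := by
  have := h.prod_enorm_inCoef_le hN hK T 0 hx
  simpa using this

end Normalized

theorem exists_gauge_prod_sqMax_le {m : ℕ} {K : ℝ} (hK : 0 < K) (w : Bool) {L : Finset (Fin m)}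
    {p : Fin m → ℝ} (hp : ∀ j, 0 < p j) {r : ℝ} (hr : 0 < r) (hpr : r⁻¹ = ∑ j ∈ L, (p j)⁻¹)
    (A : ℝ≥0) : ∃ C : ℝ≥0, ∀ (Ψ : Fin (m + 1) → DyadicInterval → ℝ → ℂ) (f : Fin m → ℝ → ℂ),
      IsNormalized K 5 w L p A Ψ f → ∀ s : Finset (Fin m),
      (∀ j ∈ s, HasMeanZero (Ψ j.castSucc)) →
      gauge w r (fun x => ∏ j ∈ L, sqMax Ψ f s j x) ≤ C := by
  choose C hC using fun j => exists_gauge_tower_smoothSq_le hK w (hp j) A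
  refine ⟨∑ j, (C j + A), fun Ψ f h s hs => ?_⟩
  refine (gauge_prod_le w L (fun j _ => measurable_sqMax s j) (fun j _ => hp j) hr hpr).trans ?_
  rw [ENNReal.ofNNReal_finsetSum]
  refine (Finset.sum_le_sum fun j hj => ?_).trans
    (Finset.sum_le_sum_of_subset (Finset.subset_univ L))
  rw [ENNReal.coe_add]
  by_cases hjs : j ∈ s
  · have : sqMax Ψ f s j = fun x => tower (smoothSq (Ψ j.castSucc) (f j)) x ^ (1 / 2 : ℝ) :=
      funext fun x => sqMax_of_mem hjs x
    rw [this]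
    exact (hC j _ (h.bump _) (hs j hjs) _ (h.measurable j) (h.gauge_le j hj)).trans le_self_add
  · have : sqMax Ψ f s j = maxFun fun y => ‖f j y‖ₑ := funext fun x => sqMax_of_notMem hjs x
    rw [this]
    exact (h.gauge_le j hj).trans le_add_self

theorem gauge_sq (w : Bool) (r : ℝ) (X : ℝ → ℝ≥0∞) :
    gauge w (1 / 2 * r) (fun x => X x ^ 2) = gauge w r X := by
  have := gauge_rpow w (1 / 2 * r) (a := 2) (by norm_num) X
  simp_rw [ENNReal.rpow_two] at this
  rw [this]
  congr 1; ring

/-- The square function of the products of the coefficients. -/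
theorem exists_gauge_tower_prod_le {m : ℕ} {K : ℝ} (hK : 1 ≤ K) (w : Bool) {L : Finset (Fin m)}
    {p : Fin m → ℝ} (hp : ∀ j, 0 < p j) {r : ℝ} (hr : 0 < r) (hpr : r⁻¹ = ∑ j ∈ L, (p j)⁻¹)
    (A : ℝ≥0) : ∃ C : ℝ≥0, ∀ (Ψ : Fin (m + 1) → DyadicInterval → ℝ → ℂ) (f : Fin m → ℝ → ℂ),
      IsNormalized K 5 w L p A Ψ f → ∀ (T : Finset (Fin m)), L ⊆ T → ∀ a ∈ T,
      HasMeanZero (Ψ a.castSucc) →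
      gauge w (1 / 2 * r) (tower fun I => ‖∏ j ∈ T, inCoef Ψ f j I‖ₑ ^ 2) ≤ C := by
  classical
  have hK0 : 0 < K := by linarith
  obtain ⟨C₁, hC₁⟩ := exists_gauge_prod_sqMax_le hK0 w hp hr hpr A
  obtain ⟨C₂, hC₂⟩ := exists_gauge_tower_mul_le hK0 (q := 1 / 2 * r) (by positivity)
  set κ : ℝ≥0 := (K ^ m).toNNReal with hκ
  have hκ0 : 0 < κ := Real.toNNReal_pos.2 (by positivity)
  refine ⟨κ ^ r * C₁ + C₂ * (κ ^ r * C₁), fun Ψ f h T hLT a ha h0 => ?_⟩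
  have hprod : ∀ I, ‖∏ j ∈ T, inCoef Ψ f j I‖ₑ =
      ‖inCoef Ψ f a I‖ₑ * ∏ j ∈ T.erase a, ‖inCoef Ψ f j I‖ₑ := fun I => by
    rw [enorm_prod_eq]
    exact (Finset.mul_prod_erase T (fun j => ‖inCoef Ψ f j I‖ₑ) ha).symm
  have hmeas : ∀ s, Measurable fun x => ∏ j ∈ L, sqMax Ψ f s j x := fun s =>
    Finset.measurable_fun_prod L fun j _ => measurable_sqMax s j
  have hbound : ∀ s : Finset (Fin m), (∀ j ∈ s, HasMeanZero (Ψ j.castSucc)) →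
      gauge w r (fun x => κ * ∏ j ∈ L, sqMax Ψ f s j x) ≤ ((κ ^ r * C₁ : ℝ≥0) : ℝ≥0∞) := fun s hs => by
    rw [ENNReal.coe_mul]
    exact (gauge_const_mul w hr (hmeas s) hκ0).trans (mul_le_mul_right (hC₁ Ψ f h s hs) _)
  rw [ENNReal.coe_add]
  -- If `a ∈ L`, the other coefficients are bounded by maximal functions and the square function
  -- falls on `f a`. If not, the squared coefficients of `f a` form a Carleson measure, and the
  -- remaining product is the sequence `d` that it is tested with.
  by_cases haL : a ∈ L
  · refine le_trans ?_ le_self_add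
    refine le_trans ?_ (hbound {a} fun j hj => by rwa [Finset.mem_singleton.1 hj])
    rw [← gauge_sq w r]
    refine gauge_mono (by positivity) fun x => ?_
    have hLT' : L ∩ T.erase a = L.erase a := by
      ext j
      simp only [Finset.mem_inter, Finset.mem_erase]
      exact ⟨fun hj => ⟨hj.2.1, hj.1⟩, fun hj => ⟨hj.2, hj.1, hLT hj.2⟩⟩
    calc tower (fun I => ‖∏ j ∈ T, inCoef Ψ f j I‖ₑ ^ 2) x
        ≤ tower (fun I => (κ * ∏ j ∈ L.erase a, maxFun (fun y => ‖f j y‖ₑ) x) ^ 2 *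
          smoothSq (Ψ a.castSucc) (f a) I) x := by
          refine tower_mono fun I hI => ?_
          rw [hprod, mul_pow, mul_comm]
          refine mul_le_mul' (pow_le_pow_left₀ zero_le ?_ 2) (sq_enorm_coef_le_smoothSq _ _ I)
          have := h.prod_enorm_inCoef_le_of_mem (by norm_num) hK (T.erase a) hI
          rwa [hLT'] at this
      _ = _ := by
          rw [tower_const_mul, ← Finset.mul_prod_erase _ _ haL, sqMax_of_mem
            (Finset.mem_singleton_self a)]
          have : ∏ j ∈ L.erase a, sqMax Ψ f {a} j x =
              ∏ j ∈ L.erase a, maxFun (fun y => ‖f j y‖ₑ) x :=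
            Finset.prod_congr rfl fun j hj => sqMax_of_notMem
              (by rw [Finset.mem_singleton]; exact Finset.ne_of_mem_erase hj) x
          rw [this, mul_pow, mul_pow, mul_pow, rpow_half_sq]
          ring
  · refine le_trans ?_ le_add_self
    rw [ENNReal.coe_mul]
    have hLT' : L ∩ T.erase a = L := by
      ext j
      simp only [Finset.mem_inter, Finset.mem_erase]
      exact ⟨fun hj => hj.1, fun hj => ⟨hj, fun e => haL (e ▸ hj), hLT hj⟩⟩
    have h2 := hC₂ (Ψ a.castSucc) (h.bump _) h0 (f a) (h.measurable a)
      (fun J => by obtain ⟨c, hc, -⟩ := h.osc_le a haL J; exact ⟨c, hc⟩)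
      (fun I => ∏ j ∈ T.erase a, ‖inCoef Ψ f j I‖ₑ)
      (fun x => κ * ∏ j ∈ L, sqMax Ψ f ∅ j x) ((hmeas ∅).const_mul _)
      (fun I x hI => by
        have := h.prod_enorm_inCoef_le_of_mem (by norm_num) hK (T.erase a) hI
        rw [hLT'] at this
        refine this.trans (le_of_eq ?_)
        congr 1
        ) w
    rw [gauge_sq] at h2
    refine le_trans (le_of_eq ?_) (h2.trans (mul_le_mul_right (hbound ∅ fun j hj => by
      simp at hj) _))
    congr 2
    ext I
    rw [hprod, mul_pow]
    rfl

end Paraproduct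

namespace Paraproduct

open DyadicInterval

/-! ### The three distributions of the positions of mean zero. -/

section Core

variable {m : ℕ} {K : ℝ} {w : Bool} {L : Finset (Fin m)} {p : Fin m → ℝ} {r : ℝ} {A : ℝ≥0}

/-- Of the `N` powers of decay of the output bump, `k` compensate the growth of the coefficients in
the distance, and 16 remain for the smoothed square functions. -/
theorem enorm_mul_inv_weight_le_of_mem {N k : ℕ} (hNk : k + 16 ≤ N) {I : DyadicInterval} {n : ℤ}
    {x : ℝ} (hx : x ∈ (I.shift n).toSet) :
    (1 + |(n : ℝ)|) ^ k * (I.weight x ^ N)⁻¹ ≤ 2 ^ N * ((1 + |(n : ℝ)|) ^ 16)⁻¹ := by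
  have h1 := le_weight_of_mem_shift hx
  have h2 : (0 : ℝ) < 1 + |(n : ℝ)| := by positivity
  have h3 := I.weight_pos x
  rw [← div_eq_mul_inv, ← div_eq_mul_inv, div_le_div_iff₀ (by positivity) (by positivity),
    ← pow_add]
  calc (1 + |(n : ℝ)|) ^ (k + 16) ≤ (1 + |(n : ℝ)|) ^ N :=
        pow_le_pow_right₀ (by simp) hNk
    _ = 2 ^ N * ((1 + |(n : ℝ)|) / 2) ^ N := by rw [← mul_pow]; congr 1; ring
    _ ≤ _ := by gcongr

/-- Two positions with mean zero among the positions of `L`. -/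
theorem exists_sum_of_pair (hK : 1 ≤ K) (hp : ∀ j, 0 < p j) (hr : 0 < r)
    (hpr : r⁻¹ = ∑ j ∈ L, (p j)⁻¹) {N : ℕ} (hN : 2 * m + 16 ≤ N) :
    ∃ C : ℝ≥0, ∀ (Ψ : Fin (m + 1) → DyadicInterval → ℝ → ℂ) (f : Fin m → ℝ → ℂ),
      IsNormalized K N w L p A Ψ f → ∀ a ∈ L, ∀ b ∈ L, a ≠ b →
      HasMeanZero (Ψ a.castSucc) → HasMeanZero (Ψ b.castSucc) →
      ∃ g : ℝ → ℂ, Measurable g ∧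
        TendstoInMeasure volume (fun (F : Finset DyadicInterval) x =>
          ∑ I ∈ F, (∏ j, inCoef Ψ f j I) * Ψ (Fin.last m) I x) atTop g ∧
        gauge w r (fun x => ‖g x‖ₑ) ≤ C := by
  have hK0 : 0 < K := by linarith
  obtain ⟨C, hC⟩ := exists_gauge_prod_sqMax_le hK0 w hp hr hpr A
  set κ : ℝ≥0 := (K ^ m * K * 2 ^ N).toNNReal with hκ
  have hκ0 : 0 < κ := Real.toNNReal_pos.2 (by positivity)
  refine ⟨κ ^ r * C, fun Ψ f h a ha b hb hab ha0 hb0 => ?_⟩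
  have h5 : IsNormalized K 5 w L p A Ψ f :=
    ⟨fun j I => (h.bump j I).mono le_rfl (by omega), h.measurable, h.gauge_le, h.osc_le⟩
  have hmean : ∀ j ∈ ({a, b} : Finset (Fin m)), HasMeanZero (Ψ j.castSucc) := by
    intro j hj
    rw [Finset.mem_insert, Finset.mem_singleton] at hj
    rcases hj with rfl | rfl <;> assumption
  have hu : ∀ I, Measurable fun x => (∏ j, inCoef Ψ f j I) * Ψ (Fin.last m) I x :=
    fun I => ((h.bump _ I).continuous.measurable).const_mul _
  have hb' : b ∈ Finset.univ.erase a := Finset.mem_erase.2 ⟨hab.symm, Finset.mem_univ b⟩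
  have hbL : b ∈ L.erase a := Finset.mem_erase.2 ⟨hab.symm, hb⟩
  have hinter : L ∩ ((Finset.univ.erase a).erase b) = (L.erase a).erase b := by
    ext j
    simp only [Finset.mem_inter, Finset.mem_erase, Finset.mem_univ, and_true]
    tauto
  have hpt : ∀ x, ∑' I : DyadicInterval, ‖(∏ j, inCoef Ψ f j I) * Ψ (Fin.last m) I x‖ₑ ≤
      κ * ∏ j ∈ L, sqMax Ψ f {a, b} j x := by
    intro x
    set D : ℝ≥0∞ := ∏ j ∈ (L.erase a).erase b, maxFun (fun y => ‖f j y‖ₑ) x with hD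
    have e : (κ : ℝ≥0∞) * ∏ j ∈ L, sqMax Ψ f {a, b} j x =
        κ * D * (tower (smoothSq (Ψ a.castSucc) (f a)) x ^ (1 / 2 : ℝ) *
          tower (smoothSq (Ψ b.castSucc) (f b)) x ^ (1 / 2 : ℝ)) := by
      rw [← Finset.mul_prod_erase _ _ ha, ← Finset.mul_prod_erase _ _ hbL,
        sqMax_of_mem (by simp), sqMax_of_mem (by simp)]
      have : ∏ j ∈ (L.erase a).erase b, sqMax Ψ f {a, b} j x = D :=
        Finset.prod_congr rfl fun j hj => sqMax_of_notMem (by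
          rw [Finset.mem_erase, Finset.mem_erase] at hj
          simp [hj.1, hj.2.1]) x
      rw [this]
      ring
    rw [e]
    -- All intervals contribute at `x`, since the output bump has tails: an interval is written as
    -- the `n`-th translate of the interval of its scale around `x`.
    refine tsum_mul_mul_le_smoothSq x fun J n hx => ?_
    rw [enorm_mul, enorm_prod_eq, ← Finset.mul_prod_erase _ _ (Finset.mem_univ a),
      ← Finset.mul_prod_erase _ _ hb']
    have h1 := h5.prod_enorm_inCoef_le (by norm_num) hK ((Finset.univ.erase a).erase b) n hx
    rw [hinter] at h1
    have h2 := (h.bump (Fin.last m) (J.shift n)).enorm_le x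
    have hx' : x ∈ ((J.shift n).shift (-n)).toSet := by
      rwa [shift_shift, add_neg_cancel, shift_zero]
    have h3 := enorm_mul_inv_weight_le_of_mem hN hx'
    rw [Int.cast_neg, abs_neg] at h3
    have hw := (J.shift n).weight_pos x
    have h4 : ENNReal.ofReal ((K * (1 + |(n : ℝ)|) ^ 2) ^ m) *
        (ENNReal.ofReal K * ENNReal.ofReal (((J.shift n).weight x ^ N)⁻¹)) ≤
        κ * ENNReal.ofReal (((1 + |(n : ℝ)|) ^ 16)⁻¹) := by
      rw [← ENNReal.ofReal_mul hK0.le, ← ENNReal.ofReal_mul (by positivity), hκ]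
      change _ ≤ ENNReal.ofReal _ * _
      rw [← ENNReal.ofReal_mul (by positivity)]
      refine ENNReal.ofReal_le_ofReal ?_
      calc _ = K ^ m * K * ((1 + |(n : ℝ)|) ^ (2 * m) * ((J.shift n).weight x ^ N)⁻¹) := by
            rw [mul_pow, ← pow_mul]; ring
        _ ≤ K ^ m * K * (2 ^ N * ((1 + |(n : ℝ)|) ^ 16)⁻¹) := by gcongr
        _ = _ := by ring
    calc _ ≤ ‖inCoef Ψ f a (J.shift n)‖ₑ * (‖inCoef Ψ f b (J.shift n)‖ₑ *
          (ENNReal.ofReal ((K * (1 + |(n : ℝ)|) ^ 2) ^ m) * D)) *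
          (ENNReal.ofReal K * ENNReal.ofReal (((J.shift n).weight x ^ N)⁻¹)) :=
          mul_le_mul' (mul_le_mul_right (mul_le_mul_right h1 _) _) h2
      _ = (ENNReal.ofReal ((K * (1 + |(n : ℝ)|) ^ 2) ^ m) *
          (ENNReal.ofReal K * ENNReal.ofReal (((J.shift n).weight x ^ N)⁻¹))) * D *
          (‖inCoef Ψ f a (J.shift n)‖ₑ * ‖inCoef Ψ f b (J.shift n)‖ₑ) := by ring
      _ ≤ κ * ENNReal.ofReal (((1 + |(n : ℝ)|) ^ 16)⁻¹) * D *
          (‖inCoef Ψ f a (J.shift n)‖ₑ * ‖inCoef Ψ f b (J.shift n)‖ₑ) :=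
          mul_le_mul_left (mul_le_mul_left h4 _) _
      _ = _ := by unfold inCoef; ring
  have hgauge : gauge w r (fun x => (∑' I : DyadicInterval,
      ‖(∏ j, inCoef Ψ f j I) * Ψ (Fin.last m) I x‖ₑ) ^ (1 : ℝ)) ≤ ((κ ^ r * C : ℝ≥0) : ℝ≥0∞) := by
    simp_rw [ENNReal.rpow_one]
    rw [ENNReal.coe_mul]
    refine (gauge_mono hr hpt).trans ((gauge_const_mul w hr
      (Finset.measurable_fun_prod L fun j _ => measurable_sqMax _ j) hκ0).trans
      (mul_le_mul_right (hC Ψ f h5 {a, b} hmean) _))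
  -- The series converges absolutely, so the domination is just the triangle inequality, with one
  -- dilate and `θ = 1`.
  obtain ⟨g, hg, hgt, hgb⟩ := exists_sum_of_dom (ι := Unit) (c := fun _ => 1) (s := fun _ => 1)
    (θ := 1) one_pos (fun _ => one_pos) w hr (by simp) hu
    (b := fun I x => ‖(∏ j, inCoef Ψ f j I) * Ψ (Fin.last m) I x‖ₑ) (fun I => (hu I).enorm)
    (fun F t ht => by
      rw [tsum_fintype]
      simp only [Finset.univ_unique, Finset.sum_const, Finset.card_singleton, one_smul, one_mul,
        ENNReal.rpow_one, ENNReal.coe_one]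
      refine measure_mono fun x hx => ?_
      exact lt_of_lt_of_le (show (t : ℝ≥0∞) < ‖_‖ₑ from hx) (enorm_sum_le _ _))
    (ne_top_of_le_ne_top ENNReal.coe_ne_top hgauge)
  refine ⟨g, hg, hgt, hgb.trans (le_trans (le_of_eq ?_) hgauge)⟩
  simp

/-- One of the positions with mean zero is the output position. -/
theorem exists_sum_of_last (hK : 1 ≤ K) (hp : ∀ j, 0 < p j) (hr : 0 < r)
    (hpr : r⁻¹ = ∑ j ∈ L, (p j)⁻¹) {d N : ℕ} (hd : 0 < d) (hdr : 1 / d < r) (hN : 2 * d + 2 ≤ N)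
    (hN5 : 5 ≤ N) :
    ∃ C : ℝ≥0, ∀ (Ψ : Fin (m + 1) → DyadicInterval → ℝ → ℂ) (f : Fin m → ℝ → ℂ),
      IsNormalized K N w L p A Ψ f → ∀ a : Fin m,
      HasMeanZero (Ψ a.castSucc) → HasMeanZero (Ψ (Fin.last m)) →
      ∃ g : ℝ → ℂ, Measurable g ∧
        TendstoInMeasure volume (fun (F : Finset DyadicInterval) x =>
          ∑ I ∈ F, (∏ j, inCoef Ψ f j I) * Ψ (Fin.last m) I x) atTop g ∧
        gauge w r (fun x => ‖g x‖ₑ) ≤ C := by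
  have hK0 : 0 < K := by linarith
  -- `P ≥ 2` serves the duality argument, `P > r` the convergence of the layer series.
  set P : ℝ := max 2 (r + 1) with hP
  have hP2 : 2 ≤ P := le_max_left _ _
  have hrP : r < P := lt_of_lt_of_le (lt_add_one r) (le_max_right _ _)
  have hPP := Real.HolderConjugate.conjExponent (show 1 < P by linarith)
  set P' := P.conjExponent
  have hP'1 : 1 < P' := hPP.symm.lt
  obtain ⟨C₁, hC₁⟩ := exists_gauge_smoothSq_le hK0 (q := 1 / 2 * P') (by positivity)
  obtain ⟨C₂, hC₂⟩ := exists_gauge_maxFun_le hP'1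
  obtain ⟨C₃, hC₃⟩ := exists_synthesis (w := w) hd hdr hP2 hrP hPP K.toNNReal (C₁ * C₂)
  obtain ⟨C₄, hC₄⟩ := exists_gauge_tower_prod_le hK w hp hr hpr A
  refine ⟨C₃ * C₄, fun Ψ f h a ha0 hl0 => ?_⟩
  have h5 : IsNormalized K 5 w L p A Ψ f :=
    ⟨fun j I => (h.bump j I).mono le_rfl hN5, h.measurable, h.gauge_le, h.osc_le⟩
  have hG := hC₄ Ψ f h5 Finset.univ (Finset.subset_univ L) a (Finset.mem_univ a) ha0
  obtain ⟨g, hg, hgt, hgb⟩ := hC₃ (Ψ (Fin.last m)) (fun I => (h.bump _ I).continuous.measurable)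
    (fun I x => ((h.bump _ I).mono le_rfl hN).enorm_le x)
    -- The dual estimate is the square function bound for the output bumps, followed by the maximal
    -- theorem in `L^(P')`.
    (fun u hu => ⟨fun I => ‖coef I (Ψ (Fin.last m) I) u‖ₑ,
      fun I => (ofReal_length_mul_enorm_coef _ _ _).ge, by
      calc ∫⁻ x, tower (fun I => ‖coef I (Ψ (Fin.last m) I) u‖ₑ ^ 2) x ^ (P' / 2)
          ≤ gauge false (1 / 2 * P') (tower (smoothSq (Ψ (Fin.last m)) u)) := by
            rw [gauge_false, one_div_mul_eq_div]
            exact lintegral_mono fun x => ENNReal.rpow_le_rpow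
              (tower_mono fun I _ => sq_enorm_coef_le_smoothSq _ _ I) (by positivity)
        _ ≤ C₁ * gauge false P' (maxFun fun y => ‖u y‖ₑ) := by
            rw [← gauge_sq false P']
            exact hC₁ _ (h5.bump _) hl0 u hu false
        _ ≤ C₁ * (C₂ * gauge false P' fun y => ‖u y‖ₑ) :=
            mul_le_mul_right (hC₂ _ hu.enorm) _
        _ = _ := by rw [gauge_false, ENNReal.coe_mul, mul_assoc]⟩)
    (fun I => ∏ j, inCoef Ψ f j I) (ne_top_of_le_ne_top ENNReal.coe_ne_top hG)
  refine ⟨g, hg, hgt, hgb.trans ?_⟩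
  rw [ENNReal.coe_mul]
  exact mul_le_mul_right hG _

/-- One of the positions with mean zero is not in `L`. -/
theorem exists_sum_of_notMem (hK : 1 ≤ K) (hp : ∀ j, 0 < p j) (hr : 0 < r)
    (hpr : r⁻¹ = ∑ j ∈ L, (p j)⁻¹) {d N : ℕ} (hd : 0 < d) (hdr : 1 / d < r) (hN : 2 * d + 2 ≤ N)
    (hN5 : 5 ≤ N) :
    ∃ C : ℝ≥0, ∀ (Ψ : Fin (m + 1) → DyadicInterval → ℝ → ℂ) (f : Fin m → ℝ → ℂ),
      IsNormalized K N w L p A Ψ f → ∀ a b : Fin m, a ≠ b → b ∉ L →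
      HasMeanZero (Ψ a.castSucc) → HasMeanZero (Ψ b.castSucc) →
      ∃ g : ℝ → ℂ, Measurable g ∧
        TendstoInMeasure volume (fun (F : Finset DyadicInterval) x =>
          ∑ I ∈ F, (∏ j, inCoef Ψ f j I) * Ψ (Fin.last m) I x) atTop g ∧
        gauge w r (fun x => ‖g x‖ₑ) ≤ C := by
  have hK0 : 0 < K := by linarith
  set P : ℝ := max 2 (r + 1) with hP
  have hP2 : 2 ≤ P := le_max_left _ _
  have hrP : r < P := lt_of_lt_of_le (lt_add_one r) (le_max_right _ _)
  have hPP := Real.HolderConjugate.conjExponent (show 1 < P by linarith)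
  set P' := P.conjExponent
  have hP'1 : 1 < P' := hPP.symm.lt
  have hP'0 : 0 < P' := by linarith
  set κ : ℝ≥0 := K.toNNReal with hκ
  have hκ0 : 0 < κ := Real.toNNReal_pos.2 hK0
  obtain ⟨C₁, hC₁⟩ := exists_gauge_tower_mul_le hK0 (q := 1 / 2 * P') (by positivity)
  obtain ⟨C₂, hC₂⟩ := exists_gauge_maxFun_le hP'1
  obtain ⟨C₃, hC₃⟩ := exists_synthesis (w := w) hd hdr hP2 hrP hPP (κ * κ) (C₁ * (κ ^ P' * C₂))
  obtain ⟨C₄, hC₄⟩ := exists_gauge_tower_prod_le hK w hp hr hpr A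
  refine ⟨C₃ * C₄, fun Ψ f h a b hab hbL ha0 hb0 => ?_⟩
  have h5 : IsNormalized K 5 w L p A Ψ f :=
    ⟨fun j I => (h.bump j I).mono le_rfl hN5, h.measurable, h.gauge_le, h.osc_le⟩
  have hG := hC₄ Ψ f h5 (Finset.univ.erase b)
    (fun j hj => Finset.mem_erase.2 ⟨fun e => hbL (e ▸ hj), Finset.mem_univ j⟩) a
    (Finset.mem_erase.2 ⟨hab, Finset.mem_univ a⟩) ha0
  have hcb : ∀ I, ‖inCoef Ψ f b I‖ₑ ≤ κ := fun I => by
    have := h5.enorm_inCoef_le (by norm_num) b 0 I.center_mem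
    rw [if_neg hbL, mul_one, shift_zero, Int.cast_zero, abs_zero, add_zero, one_pow,
      mul_one] at this
    exact this
  -- The bounded coefficient of `f b` is moved from the coefficient sequence into the synthesizing
  -- functions.
  obtain ⟨g, hg, hgt, hgb⟩ := hC₃ (fun I x => inCoef Ψ f b I * Ψ (Fin.last m) I x)
    (fun I => (h.bump _ I).continuous.measurable.const_mul _)
    (fun I x => by
      rw [enorm_mul, ENNReal.coe_mul, mul_assoc]
      exact mul_le_mul' (hcb I) (((h.bump _ I).mono le_rfl hN).enorm_le x))
    -- The output bumps need have no cancellation, so the pairing with `u` is bounded by an average.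
    -- Square summability comes from the coefficients of `f b` through the Carleson embedding.
    (fun u hu => ⟨fun I => ‖inCoef Ψ f b I‖ₑ * (κ * avg I fun y => ‖u y‖ₑ), fun I => by
      have e : pairing u (fun x => inCoef Ψ f b I * Ψ (Fin.last m) I x) =
          conj (inCoef Ψ f b I) * pairing u (Ψ (Fin.last m) I) := by
        have h1 : ∀ x, u x * conj (inCoef Ψ f b I * Ψ (Fin.last m) I x) =
            conj (inCoef Ψ f b I) * (u x * conj (Ψ (Fin.last m) I x)) := fun x => by
          rw [map_mul]; ring
        unfold pairing
        simp_rw [h1]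
        rw [integral_const_mul]
      rw [e, enorm_mul, RCLike.enorm_conj, ← ofReal_length_mul_enorm_coef, mul_left_comm]
      exact mul_le_mul_right (mul_le_mul_right
        ((h5.bump (Fin.last m) I).enorm_coef_le (by norm_num) u) _) _, by
      simp_rw [mul_pow (‖inCoef Ψ f b _‖ₑ)]
      calc _ = gauge false (1 / 2 * P') (tower fun I => ‖inCoef Ψ f b I‖ₑ ^ 2 *
            (κ * avg I fun y => ‖u y‖ₑ) ^ 2) := by
            rw [gauge_false, one_div_mul_eq_div]
        _ ≤ C₁ * gauge false P' (fun x => κ * maxFun (fun y => ‖u y‖ₑ) x) := by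
            rw [← gauge_sq false P']
            exact hC₁ _ (h5.bump _) hb0 (f b) (h.measurable b)
              (fun J => by obtain ⟨c, hc, -⟩ := h.osc_le b hbL J; exact ⟨c, hc⟩) _ _
              ((measurable_maxFun _).const_mul _)
              (fun I x hI => mul_le_mul_right (avg_le_maxFun hI _) _) false
        _ ≤ C₁ * (((κ ^ P' : ℝ≥0) : ℝ≥0∞) * (C₂ * gauge false P' fun y => ‖u y‖ₑ)) :=
            mul_le_mul_right ((gauge_const_mul false hP'0 (measurable_maxFun _) hκ0).trans
              (mul_le_mul_right (hC₂ _ hu.enorm) _)) _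
        _ = _ := by
            rw [gauge_false, ENNReal.coe_mul, ENNReal.coe_mul (κ ^ P'), mul_assoc, mul_assoc]⟩)
    (fun I => ∏ j ∈ Finset.univ.erase b, inCoef Ψ f j I)
    (ne_top_of_le_ne_top ENNReal.coe_ne_top hG)
  refine ⟨g, hg, ?_, hgb.trans ?_⟩
  · have e : ∀ I x, (∏ j ∈ Finset.univ.erase b, inCoef Ψ f j I) *
        (inCoef Ψ f b I * Ψ (Fin.last m) I x) = (∏ j, inCoef Ψ f j I) * Ψ (Fin.last m) I x :=
      fun I x => by
        rw [← mul_assoc, Finset.prod_erase_mul Finset.univ (fun j => inCoef Ψ f j I)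
          (Finset.mem_univ b)]
    simp_rw [e] at hgt
    exact hgt
  · rw [ENNReal.coe_mul]
    exact mul_le_mul_right hG _

end Core

/-- The bound for normalized data. -/
theorem exists_sum_of_isNormalized {m : ℕ} (w : Bool) {L : Finset (Fin m)} {p : Fin m → ℝ}
    (hp : ∀ j, 0 < p j) {r : ℝ} (hr : 0 < r) (hpr : r⁻¹ = ∑ j ∈ L, (p j)⁻¹) :
    ∃ N : ℕ, ∀ K : ℝ, 1 ≤ K → ∀ A : ℝ≥0, ∃ C : ℝ≥0,
      ∀ (Ψ : Fin (m + 1) → DyadicInterval → ℝ → ℂ) (f : Fin m → ℝ → ℂ),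
      IsNormalized K N w L p A Ψ f →
      (∃ a b : Fin (m + 1), a ≠ b ∧ HasMeanZero (Ψ a) ∧ HasMeanZero (Ψ b)) →
      ∃ g : ℝ → ℂ, Measurable g ∧
        TendstoInMeasure volume (fun (F : Finset DyadicInterval) x =>
          ∑ I ∈ F, (∏ j, inCoef Ψ f j I) * Ψ (Fin.last m) I x) atTop g ∧
        gauge w r (fun x => ‖g x‖ₑ) ≤ C := by
  -- `1/d < r` is the lower condition for the layer series. The exponent `N` chosen from `d` depends
  -- on `r` and the number of functions only.
  obtain ⟨d₀, hd₀⟩ := exists_nat_one_div_lt hr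
  set d : ℕ := d₀ + 1 with hd
  have hdr : (1 : ℝ) / (d : ℕ) < r := by rw [hd]; push_cast; exact hd₀
  refine ⟨2 * m + 2 * d + 16, fun K hK A => ?_⟩
  obtain ⟨C₁, hC₁⟩ := exists_sum_of_pair (w := w) (A := A) hK hp hr hpr
    (N := 2 * m + 2 * d + 16) (by omega)
  obtain ⟨C₂, hC₂⟩ := exists_sum_of_last (w := w) (A := A) hK hp hr hpr (d := d)
    (N := 2 * m + 2 * d + 16) (by omega) hdr (by omega) (by omega)
  obtain ⟨C₃, hC₃⟩ := exists_sum_of_notMem (w := w) (A := A) hK hp hr hpr (d := d)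
    (N := 2 * m + 2 * d + 16) (by omega) hdr (by omega) (by omega)
  refine ⟨C₁ + C₂ + C₃, fun Ψ f h ⟨a, b, hab, ha, hb⟩ => ?_⟩
  have hle1 : (C₁ : ℝ≥0∞) ≤ ((C₁ + C₂ + C₃ : ℝ≥0) : ℝ≥0∞) := by
    rw [ENNReal.coe_le_coe, add_assoc]; exact le_self_add
  have hle2 : (C₂ : ℝ≥0∞) ≤ ((C₁ + C₂ + C₃ : ℝ≥0) : ℝ≥0∞) := by
    rw [ENNReal.coe_le_coe]; exact le_add_self.trans le_self_add
  have hle3 : (C₃ : ℝ≥0∞) ≤ ((C₁ + C₂ + C₃ : ℝ≥0) : ℝ≥0∞) := by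
    rw [ENNReal.coe_le_coe]; exact le_add_self
  rcases a.eq_castSucc_or_eq_last with ⟨a, rfl⟩ | rfl <;>
    rcases b.eq_castSucc_or_eq_last with ⟨b, rfl⟩ | rfl
  · have hab' : a ≠ b := fun e => hab (e ▸ rfl)
    -- With two input positions, one of them outside `L` takes the role of the absorbed position;
    -- otherwise both are in `L`.
    by_cases haL : a ∈ L
    · by_cases hbL : b ∈ L
      · obtain ⟨g, h1, h2, h3⟩ := hC₁ Ψ f h a haL b hbL hab' ha hb
        exact ⟨g, h1, h2, h3.trans hle1⟩
      · obtain ⟨g, h1, h2, h3⟩ := hC₃ Ψ f h a b hab' hbL ha hb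
        exact ⟨g, h1, h2, h3.trans hle3⟩
    · obtain ⟨g, h1, h2, h3⟩ := hC₃ Ψ f h b a hab'.symm haL hb ha
      exact ⟨g, h1, h2, h3.trans hle3⟩
  · obtain ⟨g, h1, h2, h3⟩ := hC₂ Ψ f h a ha hb
    exact ⟨g, h1, h2, h3.trans hle2⟩
  · obtain ⟨g, h1, h2, h3⟩ := hC₂ Ψ f h b hb ha
    exact ⟨g, h1, h2, h3.trans hle2⟩
  · exact absurd rfl hab

end Paraproduct

namespace Paraproduct

open DyadicInterval

/-! ### Homogeneity -/

theorem avg_congr (I : DyadicInterval) {h₁ h₂ : ℝ → ℝ≥0∞} (h : h₁ =ᵐ[volume] h₂) :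
    avg I h₁ = avg I h₂ := by
  unfold avg
  congr 1
  exact lintegral_congr_ae (h.mono fun x hx => by simp only [hx])

theorem maxFun_congr {h₁ h₂ : ℝ → ℝ≥0∞} (h : h₁ =ᵐ[volume] h₂) : maxFun h₁ = maxFun h₂ := by
  funext x
  unfold maxFun
  simp only [avg_congr _ h]

theorem avg_const_mul (I : DyadicInterval) {c : ℝ≥0∞} (hc : c ≠ ∞) (h : ℝ → ℝ≥0∞) :
    avg I (fun x => c * h x) = c * avg I h := by
  unfold avg
  rw [mul_left_comm, ← lintegral_const_mul' _ _ hc]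
  simp only [mul_assoc]

theorem maxFun_const_mul_le {c : ℝ≥0∞} (hc : c ≠ ∞) (h : ℝ → ℝ≥0∞) (x : ℝ) :
    maxFun (fun y => c * h y) x ≤ c * maxFun h x := by
  refine le_of_forall_lt fun t ht => ?_
  obtain ⟨I, hI, hlt⟩ := lt_maxFun_iff.1 ht
  rw [avg_const_mul I hc] at hlt
  exact hlt.trans_le (mul_le_mul_right (avg_le_maxFun hI h) c)

theorem gauge_congr (w : Bool) (q : ℝ) {X Y : ℝ → ℝ≥0∞} (h : X =ᵐ[volume] Y) :
    gauge w q X = gauge w q Y := by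
  cases w
  · rw [gauge_false, gauge_false]
    exact lintegral_congr_ae (h.mono fun x hx => by simp only [hx])
  · rw [gauge_true, gauge_true]
    refine iSup_congr fun t => ?_
    congr 1
    refine measure_congr (h.mono fun x hx => ?_)
    show (_ < X x) = (_ < Y x)
    rw [hx]

theorem pairing_congr {f f' : ℝ → ℂ} (h : f =ᵐ[volume] f') (ψ : ℝ → ℂ) :
    pairing f ψ = pairing f' ψ :=
  integral_congr_ae (h.mono fun x hx => by simp only [hx])

theorem coef_mul_right (I : DyadicInterval) (c : ℂ) (ψ f : ℝ → ℂ) :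
    coef I ψ (fun x => c * f x) = c * coef I ψ f := by
  unfold coef pairing
  simp only [mul_assoc]
  rw [integral_const_mul]
  ring

/-- Bumps and functions of given sizes: `a j` bounds the norm of the function in position `j`. -/
structure IsSized {m : ℕ} (K : ℝ) (N : ℕ) (w : Bool) (L : Finset (Fin m)) (p : Fin m → ℝ)
    (A : ℝ≥0) (Ψ : Fin (m + 1) → DyadicInterval → ℝ → ℂ) (f : Fin m → ℝ → ℂ) (a : Fin m → ℝ≥0) :
    Prop where
  bump : ∀ j I, Bump K N I (Ψ j I)
  aestronglyMeasurable : ∀ j, AEStronglyMeasurable (f j) volume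
  gauge_le : ∀ j ∈ L, gauge w (p j) (maxFun fun y => ‖f j y‖ₑ) ≤ A * ((a j ^ p j : ℝ≥0) : ℝ≥0∞)
  osc_le : ∀ j ∉ L, ∀ J : DyadicInterval, ∃ c : ℂ, avg J (fun x => ‖f j x - c‖ₑ) ≤ a j ∧
    (c = 0 ∨ HasMeanZero (Ψ j.castSucc))

section Sized

variable {m : ℕ} {K : ℝ} {N : ℕ} {w : Bool} {L : Finset (Fin m)} {p : Fin m → ℝ} {A : ℝ≥0}
  {Ψ : Fin (m + 1) → DyadicInterval → ℝ → ℂ} {f : Fin m → ℝ → ℂ} {a : Fin m → ℝ≥0}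

theorem enorm_ofReal_coe (t : ℝ≥0) : ‖((t : ℝ) : ℂ)‖ₑ = t := by
  rw [← ofReal_norm, Complex.norm_real, NNReal.norm_eq, ENNReal.ofReal_coe_nnreal]

theorem IsSized.mono (h : IsSized K N w L p A Ψ f a) (hp : ∀ j, 0 < p j) {b : Fin m → ℝ≥0}
    (hab : ∀ j, a j ≤ b j) : IsSized K N w L p A Ψ f b where
  bump := h.bump
  aestronglyMeasurable := h.aestronglyMeasurable
  gauge_le j hj := (h.gauge_le j hj).trans (mul_le_mul_right
    (ENNReal.coe_le_coe.2 (NNReal.rpow_le_rpow (hab j) (hp j).le)) _)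
  osc_le j hj J := by
    obtain ⟨c, hc, h'⟩ := h.osc_le j hj J
    exact ⟨c, hc.trans (ENNReal.coe_le_coe.2 (hab j)), h'⟩

/-- Division by the sizes, after passing to measurable representatives, which changes neither
coefficients nor averages. -/
theorem IsSized.isNormalized (h : IsSized K N w L p A Ψ f a) (hp : ∀ j, 0 < p j)
    (ha : ∀ j, 0 < a j) : IsNormalized K N w L p A Ψ
      (fun j x => (((a j)⁻¹ : ℝ≥0) : ℝ) * (h.aestronglyMeasurable j).mk (f j) x) := by
  have hmul : ∀ j (z : ℂ), ‖((((a j)⁻¹ : ℝ≥0) : ℝ) : ℂ) * z‖ₑ = ((a j)⁻¹ : ℝ≥0) * ‖z‖ₑ :=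
    fun j z => by rw [enorm_mul, enorm_ofReal_coe]
  refine ⟨h.bump, fun j => ((h.aestronglyMeasurable j).stronglyMeasurable_mk.measurable).const_mul _,
    fun j hj => ?_, fun j hj J => ?_⟩
  · have e : maxFun (fun y => ‖(h.aestronglyMeasurable j).mk (f j) y‖ₑ) =
        maxFun fun y => ‖f j y‖ₑ :=
      maxFun_congr ((h.aestronglyMeasurable j).ae_eq_mk.mono fun x hx => by simp only [← hx])
    simp only [hmul]
    refine (gauge_mono (hp j) (maxFun_const_mul_le ENNReal.coe_ne_top _)).trans ?_
    refine (gauge_const_mul w (hp j) (measurable_maxFun _) (inv_pos.2 (ha j))).trans ?_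
    rw [e]
    refine (mul_le_mul_right (h.gauge_le j hj) _).trans (le_of_eq ?_)
    rw [mul_left_comm, ← ENNReal.coe_mul, ← NNReal.mul_rpow, inv_mul_cancel₀ (ha j).ne',
      NNReal.one_rpow, ENNReal.coe_one, mul_one]
  · obtain ⟨c, hc, h'⟩ := h.osc_le j hj J
    refine ⟨(((a j)⁻¹ : ℝ≥0) : ℝ) * c, ?_, h'.imp (fun e => by rw [e, mul_zero]) id⟩
    simp only [← mul_sub, hmul]
    have e : avg J (fun x => ‖(h.aestronglyMeasurable j).mk (f j) x - c‖ₑ) =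
        avg J fun x => ‖f j x - c‖ₑ :=
      avg_congr J ((h.aestronglyMeasurable j).ae_eq_mk.mono fun x hx => by simp only [← hx])
    rw [avg_const_mul J ENNReal.coe_ne_top, e]
    refine (mul_le_mul_right hc _).trans (le_of_eq ?_)
    rw [← ENNReal.coe_mul, inv_mul_cancel₀ (ha j).ne', ENNReal.coe_one]

theorem tendstoInMeasure_const_mul {ι : Type*} {l : Filter ι} {u : ι → ℝ → ℂ} {g : ℝ → ℂ}
    (h : TendstoInMeasure volume u l g) {c : ℂ} (hc : c ≠ 0) :
    TendstoInMeasure volume (fun i x => c * u i x) l fun x => c * g x := by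
  rw [tendstoInMeasure_iff_norm] at h ⊢
  intro ε hε
  have hc' : 0 < ‖c‖ := norm_pos_iff.2 hc
  have e : ∀ i, {x | ε ≤ ‖c * u i x - c * g x‖} = {x | ε / ‖c‖ ≤ ‖u i x - g x‖} := fun i => by
    ext x
    show ε ≤ _ ↔ ε / ‖c‖ ≤ _
    rw [← mul_sub, norm_mul, div_le_iff₀' hc']
  simp only [e]
  exact h _ (div_pos hε hc')

end Sized

/-- The bound for data of given sizes. -/
theorem exists_sum_of_isSized {m : ℕ} (w : Bool) {L : Finset (Fin m)} {p : Fin m → ℝ}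
    (hp : ∀ j, 0 < p j) {r : ℝ} (hr : 0 < r) (hpr : r⁻¹ = ∑ j ∈ L, (p j)⁻¹) :
    ∃ N : ℕ, ∀ K : ℝ, 1 ≤ K → ∀ A : ℝ≥0, ∃ C : ℝ≥0,
      ∀ (Ψ : Fin (m + 1) → DyadicInterval → ℝ → ℂ) (f : Fin m → ℝ → ℂ) (a : Fin m → ℝ≥0),
      IsSized K N w L p A Ψ f a →
      (∃ a b : Fin (m + 1), a ≠ b ∧ HasMeanZero (Ψ a) ∧ HasMeanZero (Ψ b)) →
      ∃ g : ℝ → ℂ, Measurable g ∧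
        TendstoInMeasure volume (fun (F : Finset DyadicInterval) x =>
          ∑ I ∈ F, (∏ j, inCoef Ψ f j I) * Ψ (Fin.last m) I x) atTop g ∧
        gauge w r (fun x => ‖g x‖ₑ) ≤ C * (((∏ j, a j) ^ r : ℝ≥0) : ℝ≥0∞) := by
  obtain ⟨N, hN⟩ := exists_sum_of_isNormalized w hp hr hpr
  refine ⟨N, fun K hK A => ?_⟩
  obtain ⟨C, hC⟩ := hN K hK A
  refine ⟨C, fun Ψ f a h hz => ?_⟩
  -- Sizes may vanish, so they are enlarged by `ε` before dividing by them.
  have key : ∀ ε : ℝ≥0, 0 < ε → ∃ g : ℝ → ℂ, Measurable g ∧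
        TendstoInMeasure volume (fun (F : Finset DyadicInterval) x =>
          ∑ I ∈ F, (∏ j, inCoef Ψ f j I) * Ψ (Fin.last m) I x) atTop g ∧
        gauge w r (fun x => ‖g x‖ₑ) ≤ C * (((∏ j, (a j + ε)) ^ r : ℝ≥0) : ℝ≥0∞) := by
    intro ε hε
    have ha : ∀ j, 0 < a j + ε := fun j => by positivity
    have h' := h.mono hp (b := fun j => a j + ε) fun j => le_self_add
    obtain ⟨g, hg, hlim, hb⟩ := hC Ψ _ (h'.isNormalized hp ha) hz
    set c : ℝ≥0 := ∏ j, (a j + ε) with hcdef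
    have hc : 0 < c := Finset.prod_pos fun j _ => ha j
    have hc' : ((c : ℝ) : ℂ) ≠ 0 := by exact_mod_cast hc.ne'
    refine ⟨fun x => (c : ℝ) * g x, hg.const_mul _, ?_, ?_⟩
    · have := tendstoInMeasure_const_mul hlim hc'
      refine this.congr (fun F => Eventually.of_forall fun x => ?_) (Eventually.of_forall fun x => rfl)
      beta_reduce
      rw [Finset.mul_sum]
      refine Finset.sum_congr rfl fun I _ => ?_
      rw [← mul_assoc]
      congr 1
      unfold inCoef
      simp only [coef_mul_right]
      rw [Finset.prod_mul_distrib, ← mul_assoc]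
      have e : ((c : ℝ) : ℂ) * ∏ j, ((((a j + ε)⁻¹ : ℝ≥0) : ℝ) : ℂ) = 1 := by
        have : c * ∏ j, (a j + ε)⁻¹ = 1 := by
          rw [Finset.prod_inv_distrib]
          exact mul_inv_cancel₀ hc.ne'
        exact_mod_cast congrArg (fun t : ℝ≥0 => ((t : ℝ) : ℂ)) this
      rw [e, one_mul]
      refine Finset.prod_congr rfl fun j _ => ?_
      unfold coef
      rw [pairing_congr (h.aestronglyMeasurable j).ae_eq_mk.symm]
    · simp only [enorm_mul, enorm_ofReal_coe]
      refine (gauge_const_mul w hr hg.enorm hc).trans ?_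
      rw [mul_comm]
      exact mul_le_mul_left hb _
  obtain ⟨g, hg, hlim, -⟩ := key 1 one_pos
  refine ⟨g, hg, hlim, ?_⟩
  -- Limits in measure are unique almost everywhere, so the same `g` satisfies the bound for every
  -- `ε`.
  have hle : ∀ ε : ℝ≥0, 0 < ε →
      gauge w r (fun x => ‖g x‖ₑ) ≤ C * (((∏ j, (a j + ε)) ^ r : ℝ≥0) : ℝ≥0∞) := fun ε hε => by
    obtain ⟨g', -, hlim', hb⟩ := key ε hε
    have hae := tendstoInMeasure_ae_unique hlim hlim'
    rw [gauge_congr w r (hae.mono fun x hx => by simp only [hx] : (fun x => ‖g x‖ₑ) =ᵐ[volume]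
      fun x => ‖g' x‖ₑ)]
    exact hb
  have hcont : Continuous fun ε : ℝ≥0 => C * (∏ j, (a j + ε)) ^ r := by
    have := NNReal.continuous_rpow_const hr.le
    fun_prop
  have ht : Tendsto (fun ε : ℝ≥0 => ((C * (∏ j, (a j + ε)) ^ r : ℝ≥0) : ℝ≥0∞)) (𝓝[>] 0)
      (𝓝 ((C * (∏ j, (a j + 0)) ^ r : ℝ≥0) : ℝ≥0∞)) :=
    ENNReal.tendsto_coe.2 ((hcont.tendsto 0).mono_left nhdsWithin_le_nhds)
  have := ge_of_tendsto ht (eventually_mem_nhdsWithin.mono fun ε hε => by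
    rw [ENNReal.coe_mul]; exact hle ε hε)
  simpa only [add_zero, ENNReal.coe_mul] using this

/-! ### Adapted functions as bumps -/

/-- The adapted functions in the normalization of `L^∞`. -/
noncomputable def rescale {m : ℕ} (φ : Fin (m + 1) → DyadicInterval → ℝ → ℂ) (j : Fin (m + 1))
    (I : DyadicInterval) (x : ℝ) : ℂ := ((I.length ^ (1 / 2 : ℝ) : ℝ) : ℂ) * φ j I x

theorem IsAdapted.bump {K : ℝ} {N : ℕ} {I : DyadicInterval} {φ : ℝ → ℂ} (h : IsAdapted K N I φ) :
    Bump K N I (fun x => ((I.length ^ (1 / 2 : ℝ) : ℝ) : ℂ) * φ x) := by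
  have hl := I.length_pos
  have hs : 0 < I.length ^ (1 / 2 : ℝ) := Real.rpow_pos_of_pos hl _
  have h1 : I.length ^ (1 / 2 : ℝ) * I.length ^ (-(1 / 2) : ℝ) = 1 := by
    rw [← Real.rpow_add hl]; norm_num
  have h2 : I.length ^ (1 / 2 : ℝ) * I.length ^ (-(3 / 2) : ℝ) = I.length⁻¹ := by
    rw [← Real.rpow_add hl, ← Real.rpow_neg_one]; norm_num
  refine ⟨h.differentiable.const_mul _, fun x => ?_, fun x => ?_⟩
  · rw [norm_mul, Complex.norm_real, Real.norm_of_nonneg hs.le]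
    refine (mul_le_mul_of_nonneg_left (h.bound x) hs.le).trans (le_of_eq ?_)
    unfold weight
    linear_combination (K * ((1 + |x - I.center| / I.length) ^ N)⁻¹) * h1
  · rw [deriv_const_mul _ (h.differentiable x), norm_mul, Complex.norm_real,
      Real.norm_of_nonneg hs.le]
    refine (mul_le_mul_of_nonneg_left (h.deriv_bound x) hs.le).trans (le_of_eq ?_)
    unfold weight
    linear_combination (K * ((1 + |x - I.center| / I.length) ^ N)⁻¹) * h2

theorem HasMeanZero.rescale {m : ℕ} {φ : Fin (m + 1) → DyadicInterval → ℝ → ℂ} {j : Fin (m + 1)}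
    (h : HasMeanZero (φ j)) : HasMeanZero (rescale φ j) := fun I => by
  unfold Paraproduct.rescale
  rw [integral_const_mul, h I, mul_zero]

/-- Each of the `m` coefficients contributes `|I|^(-1/2)` and the output bump `|I|^(1/2)`, in total
`|I|^(-(m-1)/2)`. -/
theorem prod_inCoef_rescale {m : ℕ} (φ : Fin (m + 1) → DyadicInterval → ℝ → ℂ)
    (f : Fin m → ℝ → ℂ) (I : DyadicInterval) (x : ℝ) :
    (∏ j, inCoef (rescale φ) f j I) * rescale φ (Fin.last m) I x = summand φ f I x := by
  have hl := I.length_pos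
  have e : ∀ j, inCoef (rescale φ) f j I =
      ((I.length ^ (-(1 / 2) : ℝ) : ℝ) : ℂ) * pairing (f j) (φ j.castSucc I) := fun j => by
    have : coef I (rescale φ j.castSucc I) (f j) = _ :=
      coef_const_mul I ((I.length ^ (1 / 2 : ℝ) : ℝ) : ℂ) (φ j.castSucc I) (f j)
    unfold inCoef
    rw [this, Complex.conj_ofReal]
    unfold coef
    rw [← mul_assoc, ← Complex.ofReal_mul]
    congr 3
    rw [← Real.rpow_neg_one, ← Real.rpow_add hl]
    norm_num
  simp only [e]
  rw [Finset.prod_mul_distrib, Finset.prod_const, Finset.card_univ, Fintype.card_fin]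
  unfold summand rescale
  have e2 : I.length ^ (-((m : ℝ) - 1) / 2) =
      (I.length ^ (-(1 / 2) : ℝ)) ^ m * I.length ^ (1 / 2 : ℝ) := by
    rw [← Real.rpow_natCast, ← Real.rpow_mul hl.le, ← Real.rpow_add hl]
    congr 1
    ring
  rw [e2]
  push_cast
  ring

/-- The bound for paraproducts in terms of sizes of the functions. -/
theorem exists_isParaproduct {m : ℕ} (w : Bool) {L : Finset (Fin m)} {p : Fin m → ℝ}
    (hp : ∀ j, 0 < p j) {r : ℝ} (hr : 0 < r) (hpr : r⁻¹ = ∑ j ∈ L, (p j)⁻¹) :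
    ∃ N : ℕ, ∀ (K : ℝ) (A : ℝ≥0), ∃ C : ℝ≥0,
      ∀ φ : Fin (m + 1) → DyadicInterval → ℝ → ℂ, IsParaproductFamily K N φ →
      ∀ (f : Fin m → ℝ → ℂ) (a : Fin m → ℝ≥0), (∀ j, AEStronglyMeasurable (f j) volume) →
      (∀ j ∈ L, gauge w (p j) (maxFun fun y => ‖f j y‖ₑ) ≤
        A * ((a j ^ p j : ℝ≥0) : ℝ≥0∞)) →
      (∀ j ∉ L, ∀ J : DyadicInterval, ∃ c : ℂ, avg J (fun x => ‖f j x - c‖ₑ) ≤ a j ∧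
        (c = 0 ∨ HasMeanZero (φ j.castSucc))) →
      ∃ g : ℝ → ℂ, IsParaproduct φ f g ∧
        gauge w r (fun x => ‖g x‖ₑ) ≤ C * (((∏ j, a j) ^ r : ℝ≥0) : ℝ≥0∞) := by
  obtain ⟨N, hN⟩ := exists_sum_of_isSized w hp hr hpr
  refine ⟨N, fun K A => ?_⟩
  -- The estimates for bumps assume `1 ≤ K`; enlarging `K` is harmless.
  obtain ⟨C, hC⟩ := hN (max K 1) (le_max_right _ _) A
  refine ⟨C, fun φ hφ f a hm hg ho => ?_⟩
  have hs : IsSized (max K 1) N w L p A (rescale φ) f a := by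
    refine ⟨fun j I => (hφ.adapted j I).bump.mono (le_max_left _ _) le_rfl, hm, hg,
      fun j hj J => ?_⟩
    obtain ⟨c, h1, h2⟩ := ho j hj J
    exact ⟨c, h1, h2.imp id fun h => h.rescale⟩
  obtain ⟨x, y, hxy, hx, hy⟩ := hφ.two_mean_zero
  obtain ⟨g, h1, h2, h3⟩ := hC _ f a hs ⟨x, y, hxy, hx.rescale, hy.rescale⟩
  simp only [prod_inCoef_rescale] at h2
  exact ⟨g, ⟨h1.aestronglyMeasurable, h2⟩, h3⟩

end Paraproduct

namespace Paraproduct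

open DyadicInterval

/-! ### Sizes from norms -/

theorem exists_gauge_maxFun_le_eLpNorm {p : ℝ≥0∞} (h1 : 1 < p) (hp : p ≠ ∞) :
    ∃ C : ℝ≥0, ∀ f : ℝ → ℂ, AEStronglyMeasurable f volume →
      gauge false p.toReal (maxFun fun y => ‖f y‖ₑ) ≤ C * eLpNorm f p volume ^ p.toReal := by
  have hq : 1 < p.toReal := by
    rw [← ENNReal.toReal_one]
    exact (ENNReal.toReal_lt_toReal ENNReal.one_ne_top hp).2 h1
  obtain ⟨C, hC⟩ := exists_gauge_maxFun_le hq
  refine ⟨C, fun f hf => ?_⟩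
  have e : (fun y => ‖f y‖ₑ) =ᵐ[volume] fun y => ‖hf.mk f y‖ₑ :=
    hf.ae_eq_mk.mono fun x hx => by simp only [← hx]
  rw [maxFun_congr e, eLpNorm_congr_ae hf.ae_eq_mk,
    eLpNorm_eq_lintegral_rpow_enorm_toReal (by positivity) hp, ← ENNReal.rpow_mul,
    one_div_mul_cancel (by positivity), ENNReal.rpow_one]
  exact hC _ hf.stronglyMeasurable_mk.measurable.enorm

theorem gauge_maxFun_le_eLpNorm_one {f : ℝ → ℂ} (hf : AEStronglyMeasurable f volume) :
    gauge true 1 (maxFun fun y => ‖f y‖ₑ) ≤ 80 * eLpNorm f 1 volume := by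
  have e : (fun y => ‖f y‖ₑ) =ᵐ[volume] fun y => ‖hf.mk f y‖ₑ :=
    hf.ae_eq_mk.mono fun x hx => by simp only [← hx]
  rw [maxFun_congr e, eLpNorm_congr_ae hf.ae_eq_mk, eLpNorm_one_eq_lintegral_enorm]
  exact gauge_maxFun_weak hf.stronglyMeasurable_mk.measurable.enorm

theorem avg_le_eLpNorm_top (f : ℝ → ℂ) (J : DyadicInterval) :
    avg J (fun x => ‖f x‖ₑ) ≤ maxConst * eLpNorm f ∞ volume := by
  refine le_trans ?_ ((avg_const_le J _).trans (mul_le_mul_left four_mul_shiftSum_le _))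
  unfold avg
  refine mul_le_mul_right (lintegral_mono_ae ?_) _
  rw [eLpNorm_exponent_top]
  exact (enorm_ae_le_eLpNormEssSup f volume).mono fun x hx => mul_le_mul_left hx _

theorem lintegral_enorm_sub_setAverage_le (f : ℝ → ℂ) {a b : ℝ} (h : a < b) :
    ∫⁻ x in Set.Ioc a b, ‖f x - ⨍ y in Set.Ioc a b, f y‖ₑ ≤
      bmoNorm f * ENNReal.ofReal (b - a) := by
  rw [← ENNReal.div_le_iff (by simpa using h) ENNReal.ofReal_ne_top]
  unfold bmoNorm
  exact le_iSup_of_le a (le_iSup_of_le b (le_iSup_of_le h le_rfl))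

theorem enorm_setAverage_sub_le {f : ℝ → ℂ} (hf : LocallyIntegrable f volume) {a b : ℝ}
    (h : a < b) (c : ℂ) :
    ENNReal.ofReal (b - a) * ‖(⨍ y in Set.Ioc a b, f y) - c‖ₑ ≤
      ∫⁻ x in Set.Ioc a b, ‖f x - c‖ₑ := by
  have hi : IntegrableOn f (Set.Ioc a b) volume :=
    (hf.integrableOn_isCompact isCompact_Icc).mono_set Set.Ioc_subset_Icc_self
  have hv : volume.real (Set.Ioc a b) = b - a := by
    rw [Measure.real, Real.volume_Ioc, ENNReal.toReal_ofReal (by linarith)]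
  have hc : IntegrableOn (fun _ : ℝ => c) (Set.Ioc a b) volume :=
    integrableOn_const (by simp)
  have hba : ((b - a : ℝ) : ℂ) ≠ 0 := by exact_mod_cast (sub_pos.2 h).ne'
  have e : ((b - a : ℝ) : ℂ) * ((⨍ y in Set.Ioc a b, f y) - c) =
      ∫ x in Set.Ioc a b, (f x - c) := by
    rw [integral_sub hi hc, setAverage_eq, setIntegral_const, hv, Complex.real_smul,
      Complex.real_smul, Complex.ofReal_inv, mul_sub, ← mul_assoc, mul_inv_cancel₀ hba, one_mul]
  have e' : ENNReal.ofReal (b - a) = ‖((b - a : ℝ) : ℂ)‖ₑ := by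
    rw [← ofReal_norm, Complex.norm_real, Real.norm_of_nonneg (by linarith)]
  rw [e', ← enorm_mul, e]
  exact enorm_integral_le_lintegral_enorm _

/-- The means over two successive doublings differ by at most twice the `BMO` norm, so after `n`
doublings the mean has moved by at most `2n` norms. -/
theorem lintegral_enorm_sub_le_of_doubling {f : ℝ → ℂ} (hf : LocallyIntegrable f volume)
    (x₀ : ℝ) {ℓ : ℝ} (hℓ : 0 < ℓ) (n : ℕ) :
    ∫⁻ x in Set.Ioc (x₀ - 2 ^ n * ℓ) (x₀ + 2 ^ n * ℓ),
        ‖f x - ⨍ y in Set.Ioc (x₀ - ℓ) (x₀ + ℓ), f y‖ₑ ≤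
      (1 + 2 * n) * bmoNorm f * ENNReal.ofReal (2 * (2 ^ n * ℓ)) := by
  have hs : ∀ n : ℕ, x₀ - 2 ^ n * ℓ < x₀ + 2 ^ n * ℓ := fun n => by
    have : 0 < 2 ^ n * ℓ := by positivity
    linarith
  have hl : ∀ n : ℕ, x₀ + 2 ^ n * ℓ - (x₀ - 2 ^ n * ℓ) = 2 * (2 ^ n * ℓ) := fun n => by ring
  set c : ℕ → ℂ := fun n => ⨍ y in Set.Ioc (x₀ - 2 ^ n * ℓ) (x₀ + 2 ^ n * ℓ), f y with hc
  have hc0 : (⨍ y in Set.Ioc (x₀ - ℓ) (x₀ + ℓ), f y) = c 0 := by simp [hc]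
  have hstep : ∀ n, ‖c (n + 1) - c n‖ₑ ≤ 2 * bmoNorm f := fun n => by
    have h1 := enorm_setAverage_sub_le hf (hs n) (c (n + 1))
    have h2 : ∫⁻ x in Set.Ioc (x₀ - 2 ^ n * ℓ) (x₀ + 2 ^ n * ℓ), ‖f x - c (n + 1)‖ₑ ≤
        ∫⁻ x in Set.Ioc (x₀ - 2 ^ (n + 1) * ℓ) (x₀ + 2 ^ (n + 1) * ℓ), ‖f x - c (n + 1)‖ₑ := by
      refine lintegral_mono_set (Set.Ioc_subset_Ioc ?_ ?_) <;>
      · have : 0 < 2 ^ n * ℓ := by positivity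
        rw [pow_succ]; linarith
    have h3 := h1.trans (h2.trans (lintegral_enorm_sub_setAverage_le f (hs (n + 1))))
    rw [hl, hl] at h3
    have e : ENNReal.ofReal (2 * (2 ^ (n + 1) * ℓ)) = ENNReal.ofReal (2 * (2 ^ n * ℓ)) * 2 := by
      rw [← ENNReal.ofReal_ofNat 2, ← ENNReal.ofReal_mul (by positivity)]
      congr 1
      ring
    have hpos : 0 < 2 * (2 ^ n * ℓ) := by positivity
    rw [enorm_sub_rev]
    refine (ENNReal.mul_le_mul_iff_right (ENNReal.ofReal_pos.2 hpos).ne' ENNReal.ofReal_ne_top).1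
      (h3.trans (le_of_eq ?_))
    rw [e]
    ring
  have hdist : ∀ n : ℕ, ‖c n - c 0‖ₑ ≤ 2 * n * bmoNorm f := by
    intro n
    induction n with
    | zero => simp
    | succ n ih =>
      calc ‖c (n + 1) - c 0‖ₑ = ‖(c (n + 1) - c n) + (c n - c 0)‖ₑ := by rw [sub_add_sub_cancel]
        _ ≤ 2 * bmoNorm f + 2 * n * bmoNorm f :=
          (enorm_add_le _ _).trans (add_le_add (hstep n) ih)
        _ = 2 * ((n + 1 : ℕ) : ℝ≥0∞) * bmoNorm f := by push_cast; ring
  rw [hc0]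
  calc ∫⁻ x in Set.Ioc (x₀ - 2 ^ n * ℓ) (x₀ + 2 ^ n * ℓ), ‖f x - c 0‖ₑ
      ≤ ∫⁻ x in Set.Ioc (x₀ - 2 ^ n * ℓ) (x₀ + 2 ^ n * ℓ), (‖f x - c n‖ₑ + 2 * n * bmoNorm f) :=
        lintegral_mono fun x => by
          rw [← sub_add_sub_cancel (f x) (c n) (c 0)]
          exact (enorm_add_le _ _).trans (add_le_add le_rfl (hdist n))
    _ = (∫⁻ x in Set.Ioc (x₀ - 2 ^ n * ℓ) (x₀ + 2 ^ n * ℓ), ‖f x - c n‖ₑ) +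
          2 * n * bmoNorm f * ENNReal.ofReal (2 * (2 ^ n * ℓ)) := by
        rw [lintegral_add_right _ measurable_const, setLIntegral_const, Real.volume_Ioc, hl]
    _ ≤ bmoNorm f * ENNReal.ofReal (2 * (2 ^ n * ℓ)) +
          2 * n * bmoNorm f * ENNReal.ofReal (2 * (2 ^ n * ℓ)) := by
        refine add_le_add ?_ le_rfl
        have := lintegral_enorm_sub_setAverage_le f (hs n)
        rwa [hl] at this
    _ = _ := by ring

/-- The constant in `exists_avg_le_bmoNorm`. -/
noncomputable def bmoConst : ℝ≥0∞ := ∑' n : ℕ, 32 * (3 / 4 : ℝ≥0∞) ^ n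

theorem bmoConst_ne_top : bmoConst ≠ ∞ := by
  unfold bmoConst
  rw [ENNReal.tsum_mul_left, ENNReal.tsum_geometric]
  refine ENNReal.mul_ne_top (by norm_num) (ENNReal.inv_ne_top.2 ?_)
  rw [ne_eq, tsub_eq_zero_iff_le, not_le]
  exact ENNReal.div_lt_of_lt_mul (by norm_num)

/-- The constant is the mean over the ball of radius `|J|` around the center. The logarithmic drift
of the means is summable against the quadratic decay of the weight. -/
theorem exists_avg_le_bmoNorm {f : ℝ → ℂ} (hf : LocallyIntegrable f volume) (J : DyadicInterval) :
    ∃ c : ℂ, avg J (fun x => ‖f x - c‖ₑ) ≤ bmoConst * bmoNorm f := by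
  have hℓ := J.length_pos
  refine ⟨⨍ y in Set.Ioc (J.center - J.length) (J.center + J.length), f y, ?_⟩
  refine (avg_le_tsum_closedBall J (hf.aestronglyMeasurable.sub
    aestronglyMeasurable_const).enorm).trans ?_
  unfold bmoConst
  rw [← ENNReal.tsum_mul_left, ← ENNReal.tsum_mul_right]
  refine ENNReal.tsum_le_tsum fun n => ?_
  rw [Real.closedBall_eq_Icc, ← setLIntegral_congr Ioc_ae_eq_Icc]
  refine (mul_le_mul_right (mul_le_mul_right
    (lintegral_enorm_sub_le_of_doubling hf J.center hℓ n) _) _).trans ?_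
  -- Bernoulli's inequality replaces the linear growth by a geometric one; `4 · 4^(-n) · 2 · 2^n · 4
  -- (3/2)^n = 32 (3/4)^n`.
  have hn : (1 + 2 * (n : ℝ)) ≤ 4 * (3 / 2) ^ n := by
    have := one_add_mul_le_pow (a := (1 / 2 : ℝ)) (by norm_num) n
    norm_num at this
    linarith
  have e1 : (1 + 2 * (n : ℝ≥0∞)) = ENNReal.ofReal (1 + 2 * n) := by
    rw [ENNReal.ofReal_add (by norm_num) (by positivity), ENNReal.ofReal_mul (by norm_num)]
    simp
  have e2 : (1 / 4 : ℝ≥0∞) = ENNReal.ofReal (1 / 4) := by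
    rw [ENNReal.ofReal_div_of_pos (by norm_num)]; simp
  have e3 : (3 / 4 : ℝ≥0∞) = ENNReal.ofReal (3 / 4) := by
    rw [ENNReal.ofReal_div_of_pos (by norm_num)]; simp
  have e4 : (4 : ℝ≥0∞) = ENNReal.ofReal 4 := by simp
  have e5 : (32 : ℝ≥0∞) = ENNReal.ofReal 32 := by simp
  rw [e1, e2, e3, e5, ← ENNReal.ofReal_inv_of_pos hℓ, ← ENNReal.ofReal_pow (by norm_num),
    ← ENNReal.ofReal_pow (by norm_num)]
  calc ENNReal.ofReal J.length⁻¹ * (4 * ENNReal.ofReal ((1 / 4) ^ n) *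
        (ENNReal.ofReal (1 + 2 * n) * bmoNorm f * ENNReal.ofReal (2 * (2 ^ n * J.length))))
      = ENNReal.ofReal (J.length⁻¹ * (4 * (1 / 4) ^ n * ((1 + 2 * n) *
          (2 * (2 ^ n * J.length))))) * bmoNorm f := by
        rw [ENNReal.ofReal_mul (p := J.length⁻¹) (by positivity),
          ENNReal.ofReal_mul (p := 4 * (1 / 4) ^ n) (by positivity),
          ENNReal.ofReal_mul (p := 4) (by norm_num),
          ENNReal.ofReal_mul (p := 1 + 2 * (n : ℝ)) (by positivity), ← e4]
        ring
    _ ≤ ENNReal.ofReal (32 * (3 / 4) ^ n) * bmoNorm f := by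
        refine mul_le_mul_left (ENNReal.ofReal_le_ofReal ?_) _
        have e : J.length⁻¹ * (4 * (1 / 4) ^ n * ((1 + 2 * n) * (2 * (2 ^ n * J.length)))) =
            8 * (1 / 4 * 2) ^ n * (1 + 2 * (n : ℝ)) := by
          rw [mul_pow]
          field_simp
          ring
        have e' : (32 * (3 / 4) ^ n : ℝ) = 8 * (1 / 4 * 2) ^ n * (4 * (3 / 2) ^ n) := by
          rw [show (3 / 4 : ℝ) = (1 / 4 * 2) * (3 / 2) by norm_num, mul_pow]
          ring
        rw [e, e']
        exact mul_le_mul_of_nonneg_left hn (by positivity)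
    _ = _ := by rw [ENNReal.ofReal_mul (by norm_num)]

/-! ### Quasi-norms of the paraproduct -/

theorem weakNorm_le_gauge (g : ℝ → ℂ) {q : ℝ} (hq : 0 < q) :
    weakNorm g q ≤ gauge true q (fun x => ‖g x‖ₑ) ^ q⁻¹ := by
  refine iSup_le fun t => ?_
  have e : (t : ℝ≥0∞) * volume {x | (t : ℝ≥0∞) < ‖g x‖ₑ} ^ q⁻¹ =
      ((t : ℝ≥0∞) ^ q * volume {x | (t : ℝ≥0∞) < ‖g x‖ₑ}) ^ q⁻¹ := by
    rw [ENNReal.mul_rpow_of_nonneg _ _ (inv_pos.2 hq).le, ← ENNReal.rpow_mul,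
      mul_inv_cancel₀ hq.ne', ENNReal.rpow_one]
  rw [e, gauge_true]
  exact ENNReal.rpow_le_rpow
    (le_iSup (fun t : ℝ≥0 => (t : ℝ≥0∞) ^ q * volume {x | (t : ℝ≥0∞) < ‖g x‖ₑ}) t)
    (inv_pos.2 hq).le

/-- The bound for paraproducts in terms of (quasi-)norms of the functions. -/
theorem exists_isParaproduct_of_norms {m : ℕ} (w : Bool) {L : Finset (Fin m)} {p : Fin m → ℝ}
    (hp : ∀ j, 0 < p j) {r : ℝ} (hr : 0 < r) (hpr : r⁻¹ = ∑ j ∈ L, (p j)⁻¹) :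
    ∃ N : ℕ, ∀ (K : ℝ) (A B : ℝ≥0), ∃ C : ℝ≥0,
      ∀ φ : Fin (m + 1) → DyadicInterval → ℝ → ℂ, IsParaproductFamily K N φ →
      ∀ (f : Fin m → ℝ → ℂ) (a : Fin m → ℝ≥0∞), (∀ j, AEStronglyMeasurable (f j) volume) →
      (∀ j, a j ≠ ∞) →
      (∀ j ∈ L, gauge w (p j) (maxFun fun y => ‖f j y‖ₑ) ≤ A * a j ^ p j) →
      (∀ j ∉ L, ∀ J : DyadicInterval, ∃ c : ℂ, avg J (fun x => ‖f j x - c‖ₑ) ≤ B * a j ∧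
        (c = 0 ∨ HasMeanZero (φ j.castSucc))) →
      ∃ g : ℝ → ℂ, IsParaproduct φ f g ∧
        gauge w r (fun x => ‖g x‖ₑ) ^ r⁻¹ ≤ C * ∏ j, a j := by
  obtain ⟨N, hN⟩ := exists_isParaproduct w hp hr hpr
  refine ⟨N, fun K A B => ?_⟩
  obtain ⟨C, hC⟩ := hN K A
  refine ⟨C ^ r⁻¹ * (B + 1) ^ m, fun φ hφ f a hm hfin hg ho => ?_⟩
  have ha : ∀ j, (((a j).toNNReal : ℝ≥0) : ℝ≥0∞) = a j := fun j => ENNReal.coe_toNNReal (hfin j)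
  -- One size must serve both hypotheses: the factor has to be at least `B` outside `L` and at least
  -- one in `L`.
  obtain ⟨g, h1, h2⟩ := hC φ hφ f (fun j => (B + 1) * (a j).toNNReal) hm
    (fun j hj => (hg j hj).trans (mul_le_mul_right (by
      rw [ENNReal.coe_rpow_of_nonneg _ (hp j).le, ENNReal.coe_mul, ha]
      refine ENNReal.rpow_le_rpow (le_mul_of_one_le_left zero_le ?_) (hp j).le
      exact_mod_cast le_add_self) _))
    (fun j hj J => by
      obtain ⟨c, h, h'⟩ := ho j hj J
      refine ⟨c, h.trans ?_, h'⟩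
      rw [ENNReal.coe_mul, ha]
      refine mul_le_mul_left ?_ _
      exact_mod_cast le_self_add)
  refine ⟨g, h1, (ENNReal.rpow_le_rpow h2 (inv_pos.2 hr).le).trans (le_of_eq ?_)⟩
  rw [← ENNReal.coe_mul, ← ENNReal.coe_rpow_of_nonneg _ (inv_pos.2 hr).le, NNReal.mul_rpow,
    ← NNReal.rpow_mul, mul_inv_cancel₀ hr.ne', NNReal.rpow_one, Finset.prod_mul_distrib,
    Finset.prod_const, Finset.card_univ, Fintype.card_fin, ← mul_assoc, ENNReal.coe_mul,
    ENNReal.ofNNReal_finsetProd]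
  simp only [ha]

end Paraproduct

/-! ### The three bounds. -/

open Paraproduct in
/-- The number of input functions is `m = n - 1`, so that `n ≥ 3` reads `2 ≤ m`.  The three
conjuncts are the strong type bound, the `L¹ × ⋯ × L¹` endpoint and the endpoint with `L¹` in the
positions of the nonempty set `S` and `BMO` in the others. -/
theorem theorem2p1 (m : ℕ) (hm : 2 ≤ m) :
    (∀ p : Fin m → ℝ≥0∞, (∀ j, 1 < p j) → (∃ j, p j ≠ ∞) →
      ∃ N : ℕ, ∀ K : ℝ, ∃ C : ℝ≥0,
        ∀ φ : Fin (m + 1) → DyadicInterval → ℝ → ℂ, IsParaproductFamily K N φ →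
        ∀ f : Fin m → ℝ → ℂ, (∀ j, MemLp (f j) (p j) volume) →
          ∃ g : ℝ → ℂ, IsParaproduct φ f g ∧
            eLpNorm g (∑ j, (p j)⁻¹)⁻¹ volume ≤ C * ∏ j, eLpNorm (f j) (p j) volume) ∧
    (∃ N : ℕ, ∀ K : ℝ, ∃ C : ℝ≥0,
        ∀ φ : Fin (m + 1) → DyadicInterval → ℝ → ℂ, IsParaproductFamily K N φ →
        ∀ f : Fin m → ℝ → ℂ, (∀ j, MemLp (f j) 1 volume) →
          ∃ g : ℝ → ℂ, IsParaproduct φ f g ∧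
            weakNorm g (1 / (m : ℝ)) ≤ C * ∏ j, eLpNorm (f j) 1 volume) ∧
    (∀ S : Finset (Fin m), S.Nonempty →
      ∃ N : ℕ, ∀ K : ℝ, ∃ C : ℝ≥0,
        ∀ φ : Fin (m + 1) → DyadicInterval → ℝ → ℂ, IsParaproductFamily K N φ →
        (∀ j ∉ S, HasMeanZero (φ j.castSucc)) →
        ∀ f : Fin m → ℝ → ℂ, (∀ j ∈ S, MemLp (f j) 1 volume) → (∀ j ∉ S, MemBMO (f j)) →
          ∃ g : ℝ → ℂ, IsParaproduct φ f g ∧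
            weakNorm g (1 / (S.card : ℝ)) ≤
              C * ((∏ j ∈ S, eLpNorm (f j) 1 volume) * ∏ j ∈ Sᶜ, bmoNorm (f j))) := by
  refine ⟨fun p h1 hex => ?_, ?_, fun S hS => ?_⟩
  · set L : Finset (Fin m) := Finset.univ.filter fun j => p j ≠ ∞ with hL
    have hmem : ∀ j, j ∈ L ↔ p j ≠ ∞ := fun j => by simp [hL]
    have hsum0 : ∑ j, (p j)⁻¹ ≠ 0 := by
      obtain ⟨j, hj⟩ := hex
      exact fun h => ENNReal.inv_ne_zero.2 hj ((Finset.sum_eq_zero_iff.1 h) j (Finset.mem_univ j))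
    have hinv : ∀ j, (p j)⁻¹ ≠ ∞ := fun j => ENNReal.inv_ne_top.2 (zero_lt_one.trans (h1 j)).ne'
    have hsumt : ∑ j, (p j)⁻¹ ≠ ∞ := ENNReal.sum_ne_top.2 fun j _ => hinv j
    set P : ℝ≥0∞ := (∑ j, (p j)⁻¹)⁻¹ with hP
    have hP0 : P ≠ 0 := ENNReal.inv_ne_zero.2 hsumt
    have hPt : P ≠ ∞ := ENNReal.inv_ne_top.2 hsum0
    set q : Fin m → ℝ := fun j => if p j = ∞ then 1 else (p j).toReal with hq
    have hqL : ∀ j ∈ L, q j = (p j).toReal := fun j hj => if_neg ((hmem j).1 hj)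
    have hq0 : ∀ j, 0 < q j := fun j => by
      by_cases h : p j = ∞
      · simp [hq, h]
      · rw [hqL j ((hmem j).2 h)]
        exact ENNReal.toReal_pos (zero_lt_one.trans (h1 j)).ne' h
    have hpr : P.toReal⁻¹ = ∑ j ∈ L, (q j)⁻¹ := by
      rw [← ENNReal.toReal_inv, hP, inv_inv, ENNReal.toReal_sum fun j _ => hinv j]
      rw [← Finset.sum_subset (Finset.subset_univ L) fun j _ hj => by
        rw [not_not.1 fun h => hj ((hmem j).2 h)]; simp]
      exact Finset.sum_congr rfl fun j hj => by rw [hqL j hj, ENNReal.toReal_inv]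
    obtain ⟨N, hN⟩ := exists_isParaproduct_of_norms false hq0
      (ENNReal.toReal_pos hP0 hPt) hpr
    have hA : ∀ j, ∃ C : ℝ≥0, j ∈ L → ∀ f : ℝ → ℂ, AEStronglyMeasurable f volume →
        gauge false (q j) (maxFun fun y => ‖f y‖ₑ) ≤ C * eLpNorm f (p j) volume ^ q j := fun j => by
      by_cases hj : j ∈ L
      · obtain ⟨C, hC⟩ := exists_gauge_maxFun_le_eLpNorm (h1 j) ((hmem j).1 hj)
        exact ⟨C, fun _ => by rw [hqL j hj]; exact hC⟩
      · exact ⟨0, fun h => absurd h hj⟩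
    choose A hA using hA
    refine ⟨N, fun K => ?_⟩
    obtain ⟨C, hC⟩ := hN K (∑ j, A j) maxConst
    refine ⟨C, fun φ hφ f hf => ?_⟩
    obtain ⟨g, hg, hb⟩ := hC φ hφ f (fun j => eLpNorm (f j) (p j) volume)
      (fun j => (hf j).1) (fun j => (hf j).2.ne)
      (fun j hj => (hA j hj (f j) (hf j).1).trans (mul_le_mul_left (ENNReal.coe_le_coe.2
        (Finset.single_le_sum (fun _ _ => zero_le) (Finset.mem_univ j))) _))
      -- For bounded functions no constant has to be subtracted, so no cancellation is needed in
      -- these positions.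
      (fun j hj J => ⟨0, by
        rw [not_not.1 fun h => hj ((hmem j).2 h)]
        simp only [sub_zero]
        exact avg_le_eLpNorm_top (f j) J, Or.inl rfl⟩)
    refine ⟨g, hg, ?_⟩
    rw [eLpNorm_eq_lintegral_rpow_enorm_toReal hP0 hPt, one_div]
    exact hb
  · have hm0 : (0 : ℝ) < m := by exact_mod_cast (by omega : 0 < m)
    obtain ⟨N, hN⟩ := exists_isParaproduct_of_norms true (L := (Finset.univ : Finset (Fin m)))
      (p := fun _ => 1) (fun _ => one_pos) (r := 1 / m) (by positivity) (by simp)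
    refine ⟨N, fun K => ?_⟩
    -- 80 is the weak type constant of the maximal function; no position is outside `L` here, so the
    -- second constant is irrelevant.
    obtain ⟨C, hC⟩ := hN K 80 0
    refine ⟨C, fun φ hφ f hf => ?_⟩
    obtain ⟨g, hg, hb⟩ := hC φ hφ f (fun j => eLpNorm (f j) 1 volume)
      (fun j => (hf j).1) (fun j => (hf j).2.ne)
      (fun j _ => by rw [ENNReal.rpow_one]; exact gauge_maxFun_le_eLpNorm_one (hf j).1)
      (fun j hj => absurd (Finset.mem_univ j) hj)
    exact ⟨g, hg, (weakNorm_le_gauge g (by positivity)).trans hb⟩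
  · have hs0 : (0 : ℝ) < S.card := by exact_mod_cast hS.card_pos
    obtain ⟨N, hN⟩ := exists_isParaproduct_of_norms true (L := S)
      (p := fun _ => 1) (fun _ => one_pos) (r := 1 / S.card) (by positivity) (by simp)
    refine ⟨N, fun K => ?_⟩
    obtain ⟨C, hC⟩ := hN K 80 bmoConst.toNNReal
    refine ⟨C, fun φ hφ hz f hf hbmo => ?_⟩
    set a : Fin m → ℝ≥0∞ := fun j => if j ∈ S then eLpNorm (f j) 1 volume else bmoNorm (f j)
      with ha
    have haS : ∀ j ∈ S, a j = eLpNorm (f j) 1 volume := fun j hj => if_pos hj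
    have haN : ∀ j ∉ S, a j = bmoNorm (f j) := fun j hj => if_neg hj
    obtain ⟨g, hg, hb⟩ := hC φ hφ f a
      (fun j => by
        by_cases hj : j ∈ S
        · exact (hf j hj).1
        · exact (hbmo j hj).locallyIntegrable.aestronglyMeasurable)
      (fun j => by
        by_cases hj : j ∈ S
        · rw [haS j hj]; exact (hf j hj).2.ne
        · rw [haN j hj]; exact (hbmo j hj).bmoNorm_lt_top.ne)
      (fun j hj => by
        rw [ENNReal.rpow_one, haS j hj]; exact gauge_maxFun_le_eLpNorm_one (hf j hj).1)
      (fun j hj J => by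
        -- The constant `c` depends on `J`; this is admissible because the bumps in the `BMO`
        -- positions have mean zero.
        obtain ⟨c, hc⟩ := exists_avg_le_bmoNorm (hbmo j hj).locallyIntegrable J
        refine ⟨c, ?_, Or.inr (hz j hj)⟩
        rwa [ENNReal.coe_toNNReal bmoConst_ne_top, haN j hj])
    refine ⟨g, hg, ((weakNorm_le_gauge g (by positivity)).trans hb).trans (le_of_eq ?_)⟩
    rw [← Finset.prod_mul_prod_compl S a, Finset.prod_congr rfl haS,
      Finset.prod_congr rfl fun j hj => haN j (Finset.mem_compl.1 hj)]
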